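/- Let either $N=2$ and $l\ge 1$ be any integer, or $N=3$ and $l=1$. For $\tau$ in the upper half plane put $p=e^{2\pi i\tau}$ and $$H^{\tau}=-\frac12\sum_{i=1}^N\frac{\partial^2}{\partial x_i^2}+l(l+1)\sum_{1\le i<j\le N}\bigl(\wp(x_i-x_j)+2\eta\bigr),\qquad \eta=\pi^2\Bigl(\frac16-4\sum_{n\ge1}\frac{p^n}{1-p^n}\Bigr),$$ where $\wp$ is the Weierstrass function with periods $1,\tau$. Let $P^+$ be the set of dominant weights of type $A_{N-1}$, i.e. of $\lambda=(\lambda_1,\dots,\lambda_N)\in\mathbb R^N$ with $\sum_i\lambda_i=0$ and $\lambda_i-\lambda_{j}\in\mathbb Z_{\ge0}$ for $i\le j$. Put $X_i=e^{2\pi i x_i}$, $\Delta(X)=(X_1\cdots X_N)^{(1-N)/2}\prod_{i<j}(X_i-X_j)$, where for real $a$ the power $X_i^{a}$ means $e^{2\pi i a x_i}$. For $\mu\in P^+$ let $m_\mu$ be the sum of the distinct monomials $X_1^{\nu_1}\cdots X_N^{\nu_N}$ with $\nu\in S_N\mu$. For $\mu,\lambda\in P^+$ write $\mu\prec\lambda$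 if $\mu\ne\lambda$, $\lambda-\mu\in\mathbb Z^N$ and $\sum_{i\le k}\mu_i\le\sum_{i\le k}\lambda_i$ for all $k$. The Jack polynomial $J_\lambda=J_\lambda^{(1/(l+1))}$ is the function $m_\lambda+\sum_{\mu\prec\lambda}c_\mu m_\mu$ that is orthogonal to all $m_\mu$ with $\mu\prec\lambda$ for the inner product $\langle f,g\rangle=\frac1{N!}\int_{[0,1]^N}\overline{\Delta^{l+1}f}\,\Delta^{l+1}g\,dx$. Finally put $e_0=\frac16\pi^2(l+1)^2N(N^2-1)$ and $E_\lambda=\sum_i\lambda_i^2+(l+1)\sum_i(N+1-2i)\lambda_i$. Then for every $\lambda\in P^+$ there are $\epsilon>0$ and, for every $p$ with $0<|p|<\epsilon$, a number $E_\lambda^{(p)}\in\mathbb C$ and a function $F_\lambda^{(p)}:\mathbb R^N\to\mathbb C$ such that, for every $\tau$ with $e^{2\pi i\tau}=p$: 1. $F_\lambda^{(p)}$ is a square-integrable eigenstate of $H^\tau$ with eigenvalue $E_\lambda^{(p)}$: on the set where $x_i-x_j\notin\mathbb Z$ for all $i\ne j$ it is $C^2$, not identically zero, and satisfies $H^\tau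 F_\lambda^{(p)}=E_\lambda^{(p)}F_\lambda^{(p)}$, and $\int_{[0,1]^N}|F_\lambda^{(p)}|^2dx<\infty$; 2. $F_\lambda^{(p)}$ has the exchange symmetry and the quasi-periodicity of $\Delta^{l+1}J_\lambda$: $F_\lambda^{(p)}(x_{\sigma(1)},\dots,x_{\sigma(N)})=\operatorname{sgn}(\sigma)^{l+1}F_\lambda^{(p)}(x)$ for $\sigma\in S_N$, and replacing $x_i$ by $x_i+1$ multiplies $F_\lambda^{(p)}$ by $(-1)^{(N-1)(l+1)}e^{2\pi i\lambda_i}$; 3. as $p\to0$, $E_\lambda^{(p)}\to 2\pi^2E_\lambda+e_0$ and $F_\lambda^{(p)}(x)\to\Delta(X)^{l+1}J_\lambda(X)$ uniformly in $x\in\mathbb R^N$. -/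

import Mathlib

noncomputable section

namespace CalogeroMoser

/-- The nome-squared parameter `p = exp (2πiτ)`. -/
def pParam (τ : UpperHalfPlane) : ℂ := Complex.exp (2 * Real.pi * Complex.I * (τ : ℂ))

/-- The period pair `(1, τ)`, generating the lattice `ℤ + ℤτ`. -/
def periods (τ : UpperHalfPlane) : PeriodPair where
  ω₁ := 1
  ω₂ := (τ : ℂ)
  indep := by
    rw [LinearIndependent.pair_iff]
    intro s t h
    have hi := congrArg Complex.im h
    have hr := congrArg Complex.re h
    have ht : t = 0 := by
      have hτ : (τ : ℂ).im ≠ 0 := τ.im_pos.ne'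
      simp at hi
      rcases hi with hi | hi
      · exact hi
      · exact absurd hi hτ
    subst ht
    simp at hr
    exact ⟨hr, rfl⟩

/-- The constant `η = π² (1/6 - 4 ∑_{n ≥ 1} pⁿ / (1 - pⁿ))`, with `p = exp (2πiτ)`. -/
def etaConst (τ : UpperHalfPlane) : ℂ :=
  (Real.pi : ℂ) ^ 2 *
    (1 / 6 - 4 * ∑' n : ℕ, pParam τ ^ (n + 1) / (1 - pParam τ ^ (n + 1)))

/-- The configurations at which no two particles collide modulo `1`: the complement in `ℝᴺ` of
the singular set of the potential. -/
def regularSet (N : ℕ) : Set (Fin N → ℝ) :=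
  {x | ∀ i j : Fin N, i ≠ j → ∀ n : ℤ, x i - x j ≠ n}

/-- The Laplacian `∑ᵢ ∂²/∂xᵢ²` on functions of `N` real variables. -/
def laplacian {N : ℕ} (f : (Fin N → ℝ) → ℂ) (x : Fin N → ℝ) : ℂ :=
  ∑ i, iteratedDeriv 2 (fun t : ℝ => f (Function.update x i t)) (x i)

/-- The elliptic Calogero-Moser Hamiltonian
`H = -(1/2) ∑ᵢ ∂²/∂xᵢ² + l (l + 1) ∑_{i < j} (℘(xᵢ - xⱼ) + 2 η)`,
where `℘` is the Weierstrass function with periods `1` and `τ`. -/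
def ellipticH {N : ℕ} (l : ℕ) (τ : UpperHalfPlane) (f : (Fin N → ℝ) → ℂ) (x : Fin N → ℝ) : ℂ :=
  -(1 / 2) * laplacian f x +
    (l : ℂ) * (l + 1) *
      (∑ i, ∑ j ∈ Finset.Ioi i,
        ((periods τ).weierstrassP ((x i - x j : ℝ) : ℂ) + 2 * etaConst τ)) * f x

/-- Dominant weights of type `A_{N-1}`, written in the orthonormal basis `ε₁, …, ε_N`: vectors
with coordinate sum zero whose coordinates decrease weakly with integer differences. -/
def IsDominantWeight {N : ℕ} (lam : Fin N → ℝ) : Prop :=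
  ∑ i, lam i = 0 ∧ ∀ i j : Fin N, i ≤ j → ∃ n : ℕ, lam i - lam j = n

/-- The strict dominance order `μ ≺ λ` on dominant weights: `μ ≠ λ`, the difference `λ - μ` is an
integral vector, and the partial sums of `μ` are at most those of `λ`. (The total sums agree, both
being zero.) -/
def DominanceLT {N : ℕ} (mu lam : Fin N → ℝ) : Prop :=
  IsDominantWeight mu ∧ IsDominantWeight lam ∧ mu ≠ lam ∧
    (∀ i, ∃ n : ℤ, lam i - mu i = n) ∧
    ∀ k : Fin N, ∑ i ∈ Finset.Iic k, mu i ≤ ∑ i ∈ Finset.Iic k, lam i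

/-- The exponential monomial `∏ᵢ Xᵢ^{μᵢ} = exp (2πi ∑ᵢ μᵢ xᵢ)`, where `Xᵢ = exp (2πi xᵢ)`, as a
function of `x`. -/
def expMonomial {N : ℕ} (mu : Fin N → ℝ) (x : Fin N → ℝ) : ℂ :=
  Complex.exp (2 * Real.pi * Complex.I * ((∑ i, mu i * x i : ℝ) : ℂ))

open Classical in
/-- The monomial symmetric function `m_μ`: the sum of the exponential monomials over the orbit of
`μ` under permutations, each element of the orbit being counted once. -/
def monomialSymm {N : ℕ} (mu : Fin N → ℝ) (x : Fin N → ℝ) : ℂ :=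
  ∑ nu ∈ Finset.univ.image (fun s : Equiv.Perm (Fin N) => fun i => mu (s i)), expMonomial nu x

/-- `Δ(X) = (X₁ ⋯ X_N)^{(1-N)/2} ∏_{i<j} (Xᵢ - Xⱼ)` with `Xᵢ = exp (2πi xᵢ)`, as a function
of `x`. -/
def delta {N : ℕ} (x : Fin N → ℝ) : ℂ :=
  Complex.exp (Real.pi * Complex.I * (1 - N) * ((∑ i, x i : ℝ) : ℂ)) *
    ∏ i, ∏ j ∈ Finset.Ioi i,
      (Complex.exp (2 * Real.pi * Complex.I * (x i : ℂ)) -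
        Complex.exp (2 * Real.pi * Complex.I * (x j : ℂ)))

/-- The inner product `⟨f, g⟩ = (1/N!) ∫_{[0,1]^N} conj (Δ^k f) · (Δ^k g) dx`, conjugate-linear in
the first variable. -/
def jackInner {N : ℕ} (k : ℕ) (f g : (Fin N → ℝ) → ℂ) : ℂ :=
  (1 / (N.factorial : ℂ)) *
    ∫ x in Set.Icc (0 : Fin N → ℝ) 1,
      (starRingEnd ℂ) (delta x ^ k * f x) * (delta x ^ k * g x)

/-- `J` is the Jack polynomial `J_λ^{(1/k)}` attached to the dominant weight `λ`, as a function of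
`x`: it is `m_λ` plus a linear combination of the `m_μ` with `μ ≺ λ`, and it is orthogonal to all
of these `m_μ`. Since the inner product is positive definite on the span of the exponential
monomials of a fixed class modulo integral vectors, this determines `J`. -/
def IsJackPolynomial {N : ℕ} (k : ℕ) (lam : Fin N → ℝ) (J : (Fin N → ℝ) → ℂ) : Prop :=
  J - monomialSymm lam ∈ Submodule.span ℂ (monomialSymm '' {mu | DominanceLT mu lam}) ∧
    ∀ mu, DominanceLT mu lam → jackInner k (monomialSymm mu) J = 0

/-- `E_λ^{[1/k]} = ∑ᵢ λᵢ² + ∑ᵢ (N + 1 - 2 i) k λᵢ`, with `i` running from `1` to `N`. -/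
def jackEnergy {N : ℕ} (k : ℕ) (lam : Fin N → ℝ) : ℝ :=
  ∑ i, lam i ^ 2 + ∑ i : Fin N, ((N : ℝ) + 1 - 2 * ((i : ℕ) + 1)) * k * lam i

/-- The ground state energy `e₀ = (1/6) π² (l + 1)² N (N² - 1)` of the trigonometric model. -/
def groundEnergy (N l : ℕ) : ℝ :=
  1 / 6 * Real.pi ^ 2 * ((l : ℝ) + 1) ^ 2 * N * ((N : ℝ) ^ 2 - 1)

/-- `F` is a square-integrable eigenstate of the elliptic Hamiltonian with eigenvalue `E`: it is
twice continuously differentiable and satisfies `H F = E F` away from collisions, is not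
identically zero there, and is square-integrable on `[0,1]^N`. -/
structure IsEigenstate {N : ℕ} (l : ℕ) (τ : UpperHalfPlane) (E : ℂ)
    (F : (Fin N → ℝ) → ℂ) : Prop where
  contDiffOn : ContDiffOn ℝ 2 F (regularSet N)
  eigen : ∀ x ∈ regularSet N, ellipticH l τ F x = E * F x
  ne_zero : ∃ x ∈ regularSet N, F x ≠ 0
  sq_integrable :
    MeasureTheory.MemLp F 2 (MeasureTheory.volume.restrict (Set.Icc (0 : Fin N → ℝ) 1))

/-- `F` transforms under permutations of the particles and under the translations `xᵢ ↦ xᵢ + 1`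
in the same way as `Δ(X)^{l+1} J_λ(X)`. -/
structure InSector {N : ℕ} (l : ℕ) (lam : Fin N → ℝ) (F : (Fin N → ℝ) → ℂ) : Prop where
  perm : ∀ (s : Equiv.Perm (Fin N)) (x : Fin N → ℝ),
    F (fun i => x (s i)) = ((Equiv.Perm.sign s : ℤ) : ℂ) ^ (l + 1) * F x
  translate : ∀ (i : Fin N) (x : Fin N → ℝ),
    F (x + Pi.single i 1) =
      (-1) ^ ((N - 1) * (l + 1)) * Complex.exp (2 * Real.pi * Complex.I * (lam i : ℂ)) * F x

end CalogeroMoser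

end

/-! ### Laurent polynomials: monomials, derivations, permutations, evaluation on the torus. -/

noncomputable section

namespace CalogeroMoser

/-! Put `k = l + 1`. Writing `℘ + 2η` as a series in `p` (`weierstrassP_add_eta`) turns `H / (2π²)`,
up to a scalar `potConst` that tends to `0`, into a power series of operators. Its coefficients act
on an algebraic space: symmetric homogeneous Laurent polynomials times `vdm ^ k`, all exponents
shifted by one real number. At `p = 0` it is the trigonometric Hamiltonian, and for `n ≥ 1` the
coefficient of `p ^ n` is multiplication by a Laurent polynomial. The theorem is perturbation theory
for this series with a proof of convergence.

Unperturbed problem. The trigonometric operator is triangular for the dominance order and symmetric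
for the inner product in which monomials are orthonormal (`hamOp_triangular`, `hamOp_isSymmetric`),
so its eigenvectors are the Gram-Schmidt vectors (`gramVec_eigen`). These are exactly `Δ ^ k` times
the Jack polynomials, and the eigenvalue is the sum of squares of shifted exponents.

Degeneracy. For two particles the energy is simple in each degree. For three it need not be, so a
third-order integral `I` is added. It commutes with `H` to all orders in `p` (`hamR_cubR_comm`)
because of the functional equation of the Weierstrass function, proved formally by summing
trigonometric identities over the rows of the lattice (`ell_functional_eq`). Energy and cubic
eigenvalue together determine the state (`energies_separate_three`), so `H + iI` has simple
unperturbed spectrum. A formal eigenvector of `H + iI` is then one of `H`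
(`formal_eigenvector_of_commute`).

Convergence. The coefficients of `I` cost one derivative, and the reduced resolvent of `H + iI` at
`p = 0` gains one (`exists_inverse`), so the recursion for the formal eigenvector has a quadratic
majorant with positive radius of convergence (`exists_summable_of_quadratic_recursion`). A
filtration by the largest exponent keeps every order a finite sum and makes exponents grow at most
linearly in the order. Hence norms of coefficients control uniform norms of the function and its
first two derivatives up to polynomial factors (`exists_majorant`), and the formal identity sums to
a genuine eigenvalue equation (`ConvergentFamily.ellipticH_genFun`). -/

/-- Laurent polynomials in `N` variables. -/
abbrev Laurent (N : ℕ) := AddMonoidAlgebra ℂ (Fin N → ℤ)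

variable {N : ℕ}

/-- The Laurent monomial with exponent `nu`. -/
def mono (nu : Fin N → ℤ) : Laurent N := AddMonoidAlgebra.single nu 1

lemma mono_mul (a b : Fin N → ℤ) : (mono a : Laurent N) * mono b = mono (a + b) := by
  simp [mono, AddMonoidAlgebra.single_mul_single]

lemma mono_zero : (mono 0 : Laurent N) = 1 := rfl

lemma single_eq_smul_mono (a : Fin N → ℤ) (r : ℂ) :
    (AddMonoidAlgebra.single a r : Laurent N) = r • mono a := by
  simp [mono, AddMonoidAlgebra.smul_single]

lemma coeff_mono (a b : Fin N → ℤ) : (mono a : Laurent N).coeff b = if a = b then 1 else 0 := by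
  classical
  simp [mono, Finsupp.single_apply]

lemma coeff_mono_mul (a b : Fin N → ℤ) (f : Laurent N) :
    (mono a * f).coeff b = f.coeff (b - a) := by
  simp [mono, sub_eq_neg_add]

/-- Induction on Laurent polynomials from monomials. -/
lemma laurent_induction {P : Laurent N → Prop} (f : Laurent N) (hm : ∀ nu, P (mono nu))
    (hadd : ∀ f g, P f → P g → P (f + g)) (hsmul : ∀ (r : ℂ) f, P f → P (r • f)) : P f := by
  induction f using AddMonoidAlgebra.induction_linear with
  | zero => simpa using hsmul 0 _ (hm 0)
  | add f g hf hg => exact hadd f g hf hg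
  | single a r => rw [single_eq_smul_mono]; exact hsmul r _ (hm a)

/-- The variable `X i`. -/
def X (i : Fin N) : Laurent N := mono (Pi.single i 1)

/-- The inverse variable. -/
def Xinv (i : Fin N) : Laurent N := mono (-Pi.single i 1)

lemma X_mul_Xinv (i : Fin N) : X i * Xinv i = (1 : Laurent N) := by
  simp [X, Xinv, mono_mul, mono_zero]

/-- Multiplication of the coefficient at `nu` by `nu i`, i.e. `X i ∂/∂(X i)`, as a linear map. -/
def delLin (i : Fin N) : Laurent N →ₗ[ℂ] Laurent N :=
  (Finsupp.lsum ℂ fun nu : Fin N → ℤ =>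
    LinearMap.toSpanSingleton ℂ (Laurent N) ((nu i : ℂ) • mono nu)) ∘ₗ
    (AddMonoidAlgebra.coeffLinearEquiv ℂ).toLinearMap

lemma delLin_mono (i : Fin N) (nu : Fin N → ℤ) :
    delLin i (mono nu) = (nu i : ℂ) • mono nu := by
  simp [delLin, mono]

/-- The derivation `X i ∂/∂(X i)`. -/
def del (i : Fin N) : Derivation ℂ (Laurent N) (Laurent N) :=
  Derivation.mk' (delLin i) (by
    intro a b
    induction a using laurent_induction with
    | hadd f g hf hg => rw [add_mul, map_add, hf, hg, map_add]; simp only [smul_eq_mul]; ring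
    | hsmul r f hf =>
      rw [smul_mul_assoc, map_smul, hf, map_smul]
      simp only [smul_eq_mul, smul_add, mul_smul_comm, smul_mul_assoc]
    | hm nu =>
      induction b using laurent_induction with
      | hadd f g hf hg => rw [mul_add, map_add, hf, hg, map_add]; simp only [smul_eq_mul]; ring
      | hsmul r f hf =>
        rw [mul_smul_comm, map_smul, hf, map_smul]
        simp only [smul_eq_mul, smul_add, mul_smul_comm, smul_mul_assoc]
      | hm mu =>
        simp only [mono_mul, delLin_mono, smul_eq_mul, mul_smul_comm, add_comm mu nu, Pi.add_apply,
          Int.cast_add, add_smul]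
        rw [add_comm])

@[simp] lemma del_mono (i : Fin N) (nu : Fin N → ℤ) :
    del i (mono nu) = (nu i : ℂ) • mono nu := delLin_mono i nu

lemma del_X (i j : Fin N) : del i (X j) = if i = j then X j else 0 := by
  rw [X, del_mono, Pi.single_apply]; split_ifs <;> simp

lemma coeff_del (i : Fin N) (f : Laurent N) (nu : Fin N → ℤ) :
    (del i f).coeff nu = nu i * f.coeff nu := by
  induction f using laurent_induction with
  | hadd f g hf hg => simp [hf, hg, mul_add]
  | hsmul r f hf => simp [hf]; ring
  | hm mu =>
    rw [del_mono, AddMonoidAlgebra.coeff_smul_apply, coeff_mono]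
    split_ifs with h <;> simp [h]

lemma del_comm (i j : Fin N) (f : Laurent N) : del i (del j f) = del j (del i f) := by
  ext nu; simp only [coeff_del]; ring

/-- The shifted derivation `X i ∂/∂(X i) + c`. -/
def shiftDel (c : ℂ) (i : Fin N) : Laurent N →ₗ[ℂ] Laurent N := (del i).toLinearMap + c • .id

lemma shiftDel_apply (c : ℂ) (i : Fin N) (f : Laurent N) : shiftDel c i f = del i f + c • f := rfl

lemma coeff_shiftDel (c : ℂ) (i : Fin N) (f : Laurent N) (nu : Fin N → ℤ) :
    (shiftDel c i f).coeff nu = (nu i + c) * f.coeff nu := by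
  rw [shiftDel_apply, AddMonoidAlgebra.coeff_add, Finsupp.add_apply, coeff_del,
    AddMonoidAlgebra.coeff_smul_apply, smul_eq_mul]; ring

/-- The action of a permutation of the variables: `X i ↦ X (s i)`. -/
def permAct (s : Equiv.Perm (Fin N)) : Laurent N ≃ₐ[ℂ] Laurent N :=
  AddMonoidAlgebra.domCongr ℂ ℂ
    { toFun := fun nu => nu ∘ s.symm, invFun := fun nu => nu ∘ s, left_inv := fun nu => by ext; simp,
      right_inv := fun nu => by ext; simp, map_add' := fun _ _ => rfl }

@[simp] lemma permAct_mono (s : Equiv.Perm (Fin N)) (nu : Fin N → ℤ) :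
    permAct s (mono nu) = mono (nu ∘ s.symm) := by
  simp [permAct, mono]

lemma permAct_X (s : Equiv.Perm (Fin N)) (i : Fin N) : permAct s (X i) = X (s i) := by
  rw [X, permAct_mono, X]
  congr 1
  ext j
  simp [Pi.single_apply, Equiv.symm_apply_eq]

lemma coeff_permAct (s : Equiv.Perm (Fin N)) (f : Laurent N) (nu : Fin N → ℤ) :
    (permAct s f).coeff nu = f.coeff (nu ∘ s) := by
  induction f using laurent_induction with
  | hadd f g hf hg => simp [hf, hg]
  | hsmul r f hf => simp [hf]
  | hm mu =>
    rw [permAct_mono, coeff_mono, coeff_mono]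
    congr 1
    rw [eq_iff_iff]
    constructor
    · rintro rfl; ext; simp
    · rintro rfl; ext; simp

lemma permAct_mul_apply (s t : Equiv.Perm (Fin N)) (f : Laurent N) :
    permAct (s * t) f = permAct s (permAct t f) := by
  ext nu; simp only [coeff_permAct]; rfl

lemma permAct_del (s : Equiv.Perm (Fin N)) (i : Fin N) (f : Laurent N) :
    permAct s (del i f) = del (s i) (permAct s f) := by
  ext nu; simp [coeff_permAct, coeff_del]

/-- Evaluation of a Laurent polynomial at `X i = exp (2πi x i)`. -/
def evalAt (x : Fin N → ℝ) : Laurent N →ₐ[ℂ] ℂ :=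
  AddMonoidAlgebra.lift ℂ ℂ (Fin N → ℤ)
    { toFun := fun nu => Complex.exp (2 * Real.pi * Complex.I *
        ((∑ i, (nu.toAdd i : ℝ) * x i : ℝ) : ℂ))
      map_one' := by simp
      map_mul' := fun a b => by
        rw [← Complex.exp_add, ← mul_add]
        simp [add_mul, Finset.sum_add_distrib] }

lemma evalAt_mono (x : Fin N → ℝ) (nu : Fin N → ℤ) :
    evalAt x (mono nu) = Complex.exp (2 * Real.pi * Complex.I *
      ((∑ i, (nu i : ℝ) * x i : ℝ) : ℂ)) := by
  simp [evalAt, mono]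

lemma evalAt_X (x : Fin N → ℝ) (i : Fin N) :
    evalAt x (X i) = Complex.exp (2 * Real.pi * Complex.I * (x i : ℂ)) := by
  rw [X, evalAt_mono]; simp [Pi.single_apply]

lemma evalAt_permAct (x : Fin N → ℝ) (s : Equiv.Perm (Fin N)) (f : Laurent N) :
    evalAt x (permAct s f) = evalAt (fun i => x (s i)) f := by
  induction f using laurent_induction with
  | hadd f g hf hg => simp [hf, hg]
  | hsmul r f hf => simp [hf]
  | hm mu =>
    rw [permAct_mono, evalAt_mono, evalAt_mono]
    congr 3
    rw [← Equiv.sum_comp s]; simp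

instance : IsDomain (Laurent N) := NoZeroDivisors.to_isDomain _

/-! ### The coefficient inner product -/

/-- The Hermitian form for which the monomials are orthonormal. -/
def coeffInner (f g : Laurent N) : ℂ := g.coeff.sum fun nu b => starRingEnd ℂ (f.coeff nu) * b

lemma coeffInner_eq_sum {s : Finset (Fin N → ℤ)} (f g : Laurent N) (h : g.coeff.support ⊆ s) :
    coeffInner f g = ∑ nu ∈ s, starRingEnd ℂ (f.coeff nu) * g.coeff nu :=
  Finsupp.sum_of_support_subset _ h _ (by simp)

lemma coeffInner_conj (f g : Laurent N) : starRingEnd ℂ (coeffInner g f) = coeffInner f g := by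
  classical
  rw [coeffInner_eq_sum (s := f.coeff.support ∪ g.coeff.support) g f Finset.subset_union_left,
    coeffInner_eq_sum (s := f.coeff.support ∪ g.coeff.support) f g Finset.subset_union_right]
  simp [mul_comm]

/-- The inner product space structure on Laurent polynomials. -/
@[reducible] def laurentCore : InnerProductSpace.Core ℂ (Laurent N) where
  inner := coeffInner
  conj_inner_symm f g := coeffInner_conj f g
  re_inner_nonneg f := by
    rw [coeffInner_eq_sum f f subset_rfl, map_sum]
    refine Finset.sum_nonneg fun nu _ => ?_
    rw [← Complex.normSq_eq_conj_mul_self]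
    simpa using Complex.normSq_nonneg _
  add_left f g h := by
    change coeffInner _ _ = coeffInner _ _ + coeffInner _ _
    simp [coeffInner, Finsupp.sum, add_mul, Finset.sum_add_distrib]
  smul_left f g r := by
    change coeffInner _ _ = _ * coeffInner _ _
    simp [coeffInner, Finsupp.sum, Finset.mul_sum, mul_assoc]
  definite f h := by
    change coeffInner f f = 0 at h
    rw [coeffInner_eq_sum f f subset_rfl] at h
    have h' : ∑ nu ∈ f.coeff.support, Complex.normSq (f.coeff nu) = 0 := by
      have := congrArg Complex.re h
      simpa [← Complex.normSq_eq_conj_mul_self] using this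
    ext nu
    by_cases hn : nu ∈ f.coeff.support
    · simpa using (Finset.sum_eq_zero_iff_of_nonneg (fun _ _ => Complex.normSq_nonneg _)).1 h' nu hn
    · simpa using hn

instance : NormedAddCommGroup (Laurent N) := laurentCore.toNormedAddCommGroup

instance : InnerProductSpace ℂ (Laurent N) := InnerProductSpace.ofCore laurentCore.toCore

lemma inner_eq (f g : Laurent N) : inner ℂ f g = coeffInner f g := rfl

lemma inner_mono (a b : Fin N → ℤ) :
    inner ℂ (mono a : Laurent N) (mono b) = if a = b then 1 else 0 := by
  rw [inner_eq, coeffInner, mono, mono, AddMonoidAlgebra.coeff_single,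
    AddMonoidAlgebra.coeff_single, Finsupp.sum_single_index (by simp)]
  rw [Finsupp.single_apply]
  split_ifs <;> simp

lemma inner_mono_left (a : Fin N → ℤ) (g : Laurent N) :
    inner ℂ (mono a : Laurent N) g = g.coeff a := by
  induction g using laurent_induction with
  | hadd f g hf hg => simp [hf, hg]
  | hsmul r f hf => simp [hf]
  | hm mu => rw [inner_mono, coeff_mono]; simp only [eq_comm]

lemma inner_mono_mul (a : Fin N → ℤ) (f g : Laurent N) :
    inner ℂ (mono a * f) g = inner ℂ f (mono (-a) * g) := by
  induction f using laurent_induction with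
  | hadd f g hf hg => simp only [mul_add, inner_add_left, hf, hg]
  | hsmul r f hf => simp only [mul_smul_comm, inner_smul_left, hf]
  | hm mu =>
    rw [mono_mul, inner_mono_left, inner_mono_left, coeff_mono_mul]; congr 1; abel

lemma norm_mono_mul (a : Fin N → ℤ) (f : Laurent N) : ‖mono a * f‖ = ‖f‖ := by
  rw [@norm_eq_sqrt_re_inner ℂ, @norm_eq_sqrt_re_inner ℂ, inner_mono_mul, ← mul_assoc, mono_mul]
  simp [mono_zero]

/-- The operator is diagonal in the orthonormal monomials with entries `nu i + c`, which are real
because `c` is. -/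
lemma inner_shiftDel (c : ℝ) (i : Fin N) (f g : Laurent N) :
    inner ℂ (shiftDel c i f) g = inner ℂ f (shiftDel c i g) := by
  induction f using laurent_induction with
  | hadd f g hf hg => simp only [map_add, inner_add_left, hf, hg]
  | hsmul r f hf => simp only [map_smul, inner_smul_left, hf]
  | hm mu =>
    rw [inner_mono_left, coeff_shiftDel, shiftDel_apply, del_mono, ← add_smul, inner_smul_left,
      inner_mono_left]
    simp

lemma norm_coeff_le (f : Laurent N) (nu : Fin N → ℤ) : ‖f.coeff nu‖ ≤ ‖f‖ := by
  rw [← inner_mono_left]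
  refine (norm_inner_le_norm _ _).trans ?_
  have : ‖(mono nu : Laurent N)‖ = 1 := by
    rw [@norm_eq_sqrt_re_inner ℂ, inner_mono]; simp
  rw [this, one_mul]

/-! ### The fraction field -/

/-- The field of rational functions in `N` variables. -/
abbrev Ratl (N : ℕ) := FractionRing (Laurent N)

/-- The inclusion of Laurent polynomials into rational functions. -/
def toRatl : Laurent N →ₐ[ℂ] Ratl N := Algebra.ofId (Laurent N) (Ratl N) |>.restrictScalars ℂ

lemma toRatl_injective : Function.Injective (toRatl : Laurent N → Ratl N) :=
  IsFractionRing.injective (Laurent N) (Ratl N)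

/-- The ring homomorphism `f ↦ f + ε δ f` into dual numbers of rational functions. -/
def dualHom (i : Fin N) : Laurent N →+* TrivSqZeroExt (Ratl N) (Ratl N) where
  toFun f := TrivSqZeroExt.inl (toRatl f) + TrivSqZeroExt.inr (toRatl (del i f))
  map_one' := by ext <;> simp
  map_mul' f g := by
    ext
    · simp
    · simp only [TrivSqZeroExt.snd_add, TrivSqZeroExt.snd_inl, TrivSqZeroExt.snd_inr, zero_add,
        TrivSqZeroExt.snd_mul, TrivSqZeroExt.fst_add, TrivSqZeroExt.fst_inl, TrivSqZeroExt.fst_inr,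
        add_zero, Derivation.leibniz, map_add, smul_eq_mul, map_mul, MulOpposite.smul_eq_mul_unop,
        MulOpposite.unop_op]
      ring
  map_zero' := by ext <;> simp
  map_add' f g := by ext <;> simp

/-- A dual number is invertible as soon as its first component is. The universal property of the
localization therefore extends `dualHom`, and with it the derivation, to rational functions. -/
lemma isUnit_dualHom (i : Fin N) (y : nonZeroDivisors (Laurent N)) : IsUnit (dualHom i y) := by
  rw [TrivSqZeroExt.isUnit_iff_isUnit_fst]
  have : toRatl (y : Laurent N) ≠ 0 := by
    rw [Ne, ← map_zero toRatl, toRatl_injective.eq_iff]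
    exact nonZeroDivisors.ne_zero y.2
  simpa [dualHom] using this

/-- The extension of `dualHom` to rational functions. -/
def dualHomExt (i : Fin N) : Ratl N →+* TrivSqZeroExt (Ratl N) (Ratl N) :=
  IsLocalization.lift (isUnit_dualHom i)

lemma dualHomExt_toRatl (i : Fin N) (f : Laurent N) : dualHomExt i (toRatl f) = dualHom i f :=
  IsLocalization.lift_eq _ _

lemma toRatl_div_surjective (f : Ratl N) : ∃ a b : Laurent N, toRatl b ≠ 0 ∧
    f * toRatl b = toRatl a := by
  obtain ⟨⟨a, b⟩, h⟩ := IsLocalization.surj (nonZeroDivisors (Laurent N)) f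
  refine ⟨a, b, ?_, h⟩
  rw [Ne, ← map_zero toRatl, toRatl_injective.eq_iff]
  exact nonZeroDivisors.ne_zero b.2

lemma fst_dualHomExt (i : Fin N) (f : Ratl N) : (dualHomExt i f).fst = f := by
  obtain ⟨a, b, hb, h⟩ := toRatl_div_surjective f
  have := congrArg (fun u => (dualHomExt i u).fst) h
  simp only [map_mul, dualHomExt_toRatl, TrivSqZeroExt.fst_mul] at this
  simp only [dualHom, RingHom.coe_mk, MonoidHom.coe_mk, OneHom.coe_mk, TrivSqZeroExt.fst_add,
    TrivSqZeroExt.fst_inl, TrivSqZeroExt.fst_inr, add_zero, ← h] at this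
  exact mul_right_cancel₀ hb this

/-- The derivation `X i ∂/∂(X i)` of rational functions. -/
def delR (i : Fin N) : Derivation ℂ (Ratl N) (Ratl N) :=
  Derivation.mk'
    { toFun := fun f => (dualHomExt i f).snd
      map_add' := by simp
      map_smul' := fun r f => by
        have h : algebraMap ℂ (Ratl N) r = toRatl (algebraMap ℂ (Laurent N) r) :=
          (toRatl.commutes r).symm
        rw [Algebra.smul_def, h, map_mul, dualHomExt_toRatl, TrivSqZeroExt.snd_mul, fst_dualHomExt]
        have h2 : dualHom i (algebraMap ℂ (Laurent N) r)
            = TrivSqZeroExt.inl (algebraMap ℂ (Ratl N) r) := by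
          ext
          · rw [h]
            change (TrivSqZeroExt.inl (toRatl _) + TrivSqZeroExt.inr _ :
              TrivSqZeroExt (Ratl N) (Ratl N)).fst = _
            rw [TrivSqZeroExt.fst_add, TrivSqZeroExt.fst_inl, TrivSqZeroExt.fst_inr, add_zero]
          · change (TrivSqZeroExt.inl _ + TrivSqZeroExt.inr (toRatl (del i (algebraMap ℂ _ r))) :
              TrivSqZeroExt (Ratl N) (Ratl N)).snd = _
            rw [Derivation.map_algebraMap, map_zero, TrivSqZeroExt.snd_add, TrivSqZeroExt.snd_inl,
              TrivSqZeroExt.snd_inr, TrivSqZeroExt.snd_inl, zero_add]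
        rw [h2, TrivSqZeroExt.fst_inl, TrivSqZeroExt.snd_inl, smul_zero, add_zero]
        simp [Algebra.smul_def] } (by
    intro a b
    simp [TrivSqZeroExt.snd_mul, fst_dualHomExt, mul_comm])

lemma delR_toRatl (i : Fin N) (f : Laurent N) : delR i (toRatl f) = toRatl (del i f) := by
  change (dualHomExt i (toRatl f)).snd = _
  rw [dualHomExt_toRatl]; simp [dualHom]

/-- The commutator of two derivations is a derivation. It vanishes on Laurent polynomials, hence on
their quotients, as one sees by applying it to `f * b = a`. -/
lemma delR_comm (i j : Fin N) (f : Ratl N) : delR i (delR j f) = delR j (delR i f) := by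
  obtain ⟨a, b, hb, h⟩ := toRatl_div_surjective f
  have h1 := congrArg (fun u => delR i (delR j u)) h
  have h2 := congrArg (fun u => delR j (delR i u)) h
  simp only [Derivation.leibniz, map_add, smul_eq_mul, delR_toRatl] at h1 h2
  rw [del_comm i j a, ← h2, del_comm i j b] at h1
  refine mul_right_cancel₀ hb ?_
  linear_combination h1

end CalogeroMoser

end

noncomputable section

namespace CalogeroMoser

variable {N : ℕ}

/-! ### Supports and leading coefficients -/

/-- The functional `L` is at most `b` on the support of `f`. -/
def BddBy (L : (Fin N → ℤ) →+ ℤ) (f : Laurent N) (b : ℤ) : Prop :=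
  ∀ nu, f.coeff nu ≠ 0 → L nu ≤ b

lemma coeff_mul_eq (f g : Laurent N) (kap : Fin N → ℤ) :
    (f * g).coeff kap = f.coeff.sum fun nu a => a * g.coeff (kap - nu) := by
  rw [AddMonoidAlgebra.coeff_mul_apply_left]
  simp only [sub_eq_neg_add]

lemma exists_of_coeff_mul_ne_zero {f g : Laurent N} {kap : Fin N → ℤ}
    (h : (f * g).coeff kap ≠ 0) : ∃ a b, f.coeff a ≠ 0 ∧ g.coeff b ≠ 0 ∧ a + b = kap := by
  rw [coeff_mul_eq] at h
  obtain ⟨a, ha, h⟩ := Finset.exists_ne_zero_of_sum_ne_zero h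
  exact ⟨a, kap - a, left_ne_zero_of_mul h, right_ne_zero_of_mul h, by abel⟩

lemma BddBy.add {L : (Fin N → ℤ) →+ ℤ} {f g : Laurent N} {b : ℤ} (hf : BddBy L f b)
    (hg : BddBy L g b) : BddBy L (f + g) b := by
  intro nu h
  by_cases h1 : f.coeff nu = 0
  · exact hg nu (by simpa [h1] using h)
  · exact hf nu h1

lemma BddBy.smul {L : (Fin N → ℤ) →+ ℤ} {f : Laurent N} {b : ℤ} (hf : BddBy L f b) (r : ℂ) :
    BddBy L (r • f) b := fun nu h => hf nu (by
      rw [AddMonoidAlgebra.coeff_smul_apply] at h; exact right_ne_zero_of_mul h)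

lemma BddBy.zero (L : (Fin N → ℤ) →+ ℤ) (b : ℤ) : BddBy L 0 b := fun _ h => absurd rfl h

lemma BddBy.mono_le {L : (Fin N → ℤ) →+ ℤ} {f : Laurent N} {a b : ℤ} (hf : BddBy L f a)
    (h : a ≤ b) : BddBy L f b := fun nu hn => (hf nu hn).trans h

lemma BddBy.mul {L : (Fin N → ℤ) →+ ℤ} {f g : Laurent N} {a b : ℤ} (hf : BddBy L f a)
    (hg : BddBy L g b) : BddBy L (f * g) (a + b) := by
  intro nu h
  obtain ⟨u, w, hu, hw, rfl⟩ := exists_of_coeff_mul_ne_zero h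
  rw [map_add]
  exact add_le_add (hf u hu) (hg w hw)

lemma BddBy.shiftDel {L : (Fin N → ℤ) →+ ℤ} {f : Laurent N} {a : ℤ} (hf : BddBy L f a) (c : ℂ)
    (i : Fin N) : BddBy L (shiftDel c i f) a := fun nu h => hf nu (by
      rw [coeff_shiftDel] at h; exact right_ne_zero_of_mul h)

lemma bddBy_mono (L : (Fin N → ℤ) →+ ℤ) (nu : Fin N → ℤ) : BddBy L (mono nu) (L nu) := by
  intro mu h
  rw [coeff_mono] at h
  split_ifs at h with h1
  · rw [h1]
  · exact absurd rfl h

lemma BddBy.sum {ι : Type*} {L : (Fin N → ℤ) →+ ℤ} {b : ℤ} (s : Finset ι) {f : ι → Laurent N}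
    (h : ∀ i ∈ s, BddBy L (f i) b) : BddBy L (∑ i ∈ s, f i) b := by
  classical
  induction s using Finset.induction_on with
  | empty => simpa using BddBy.zero L b
  | insert a s ha ih =>
    rw [Finset.sum_insert ha]
    exact (h a (by simp)).add (ih fun i hi => h i (by simp [hi]))

/-- The partial sums of an exponent. -/
def psum (k : Fin N) : (Fin N → ℤ) →+ ℤ where
  toFun nu := ∑ i ∈ Finset.Iic k, nu i
  map_zero' := by simp
  map_add' _ _ := by simp [Finset.sum_add_distrib]

lemma psum_apply (k : Fin N) (nu : Fin N → ℤ) : psum k nu = ∑ i ∈ Finset.Iic k, nu i := rfl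

lemma psum_zero_apply [NeZero N] (nu : Fin N → ℤ) : psum 0 nu = nu 0 := by
  rw [psum_apply]
  have : (Finset.Iic 0 : Finset (Fin N)) = {0} := by ext; simp
  simp [this]

lemma psum_injective {a b : Fin N → ℤ} (h : ∀ k, psum k a = psum k b) : a = b := by
  funext k
  induction k using WellFoundedLT.induction with
  | ind k ih =>
    have hk := h k
    simp only [psum_apply] at hk
    rw [← Finset.Iio_insert, Finset.sum_insert (by simp), Finset.sum_insert (by simp),
      Finset.sum_congr rfl fun i hi => ih i (Finset.mem_Iio.1 hi)] at hk
    exact add_right_cancel hk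

/-- The functional `L` is dominant: it is nonnegative on differences of ordered coordinates. -/
def DomFun (L : (Fin N → ℤ) →+ ℤ) : Prop :=
  ∀ i j : Fin N, i < j → L (Pi.single j 1) ≤ L (Pi.single i 1)

lemma psum_single_le {i j : Fin N} (h : i ≤ j) (k : Fin N) :
    psum k (Pi.single j 1) ≤ psum k (Pi.single i 1) := by
  simp only [psum_apply, Pi.single_apply, Finset.sum_ite_eq', Finset.mem_Iic]
  split_ifs with h1 h2 <;> simp
  exact absurd (h.trans h1) h2

lemma domFun_psum (k : Fin N) : DomFun (psum k) := fun _ _ h => psum_single_le h.le k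

/-- All exponents of `f` are below `u` in the dominance order, and the coefficient at `u`
is `a`. -/
def HasTop (f : Laurent N) (u : Fin N → ℤ) (a : ℂ) : Prop :=
  (∀ L, DomFun L → BddBy L f (L u)) ∧ f.coeff u = a

lemma HasTop.add {f g : Laurent N} {u : Fin N → ℤ} {a b : ℂ} (hf : HasTop f u a)
    (hg : HasTop g u b) : HasTop (f + g) u (a + b) :=
  ⟨fun L hL => (hf.1 L hL).add (hg.1 L hL), by simp [hf.2, hg.2]⟩

lemma HasTop.smul {f : Laurent N} {u : Fin N → ℤ} {a : ℂ} (hf : HasTop f u a) (r : ℂ) :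
    HasTop (r • f) u (r * a) := ⟨fun L hL => (hf.1 L hL).smul r, by simp [hf.2]⟩

lemma HasTop.neg {f : Laurent N} {u : Fin N → ℤ} {a : ℂ} (hf : HasTop f u a) :
    HasTop (-f) u (-a) := by simpa using hf.smul (-1)

lemma HasTop.sub {f g : Laurent N} {u : Fin N → ℤ} {a b : ℂ} (hf : HasTop f u a)
    (hg : HasTop g u b) : HasTop (f - g) u (a - b) := by
  simpa [sub_eq_add_neg] using hf.add hg.neg

lemma HasTop.shiftDel {f : Laurent N} {u : Fin N → ℤ} {a : ℂ} (hf : HasTop f u a) (c : ℂ)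
    (i : Fin N) : HasTop (shiftDel c i f) u ((u i + c) * a) :=
  ⟨fun L hL => (hf.1 L hL).shiftDel c i, by simp [coeff_shiftDel, hf.2]⟩

/-- Only one pair of exponents can contribute to the coefficient at `u + w`: both have partial sums
at most those of `u` and `w`, and equality of the total forces equality of each. -/
lemma HasTop.mul {f g : Laurent N} {u w : Fin N → ℤ} {a b : ℂ} (hf : HasTop f u a)
    (hg : HasTop g w b) : HasTop (f * g) (u + w) (a * b) := by
  refine ⟨fun L hL => by rw [map_add]; exact (hf.1 L hL).mul (hg.1 L hL), ?_⟩
  rw [coeff_mul_eq, Finsupp.sum, Finset.sum_eq_single u]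
  · rw [add_sub_cancel_left, hf.2, hg.2]
  · intro nu _ hne
    by_contra h
    refine hne (psum_injective fun k => ?_)
    have h1 := hf.1 _ (domFun_psum k) nu (left_ne_zero_of_mul h)
    have h2 := hg.1 _ (domFun_psum k) _ (right_ne_zero_of_mul h)
    rw [map_sub, map_add] at h2
    linarith
  · intro h
    rw [Finsupp.notMem_support_iff.1 h, zero_mul]

lemma HasTop.congr {f : Laurent N} {u w : Fin N → ℤ} {a b : ℂ} (hf : HasTop f u a)
    (h : u = w) (h' : a = b) : HasTop f w b := by subst h; subst h'; exact hf

lemma hasTop_one : HasTop (1 : Laurent N) 0 1 := by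
  refine ⟨fun L _ => bddBy_mono L 0, ?_⟩
  rw [← mono_zero, coeff_mono, if_pos rfl]

lemma HasTop.pow {f : Laurent N} {u : Fin N → ℤ} {a : ℂ} (hf : HasTop f u a) (n : ℕ) :
    HasTop (f ^ n) (n • u) (a ^ n) := by
  induction n with
  | zero => simpa using! hasTop_one
  | succ n ih =>
    rw [pow_succ]
    exact (ih.mul hf).congr (succ_nsmul u n).symm (pow_succ a n).symm

lemma HasTop.prod {ι : Type*} (s : Finset ι) {f : ι → Laurent N} {u : ι → Fin N → ℤ}
    (h : ∀ i ∈ s, HasTop (f i) (u i) 1) : HasTop (∏ i ∈ s, f i) (∑ i ∈ s, u i) 1 := by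
  classical
  induction s using Finset.induction_on with
  | empty => simpa using hasTop_one
  | insert a s ha ih =>
    rw [Finset.prod_insert ha, Finset.sum_insert ha]
    simpa using (h a (by simp)).mul (ih fun i hi => h i (by simp [hi]))

lemma hasTop_X (i : Fin N) : HasTop (X i) (Pi.single i 1) 1 :=
  ⟨fun L _ => bddBy_mono L _, by rw [X, coeff_mono, if_pos rfl]⟩

lemma hasTop_X_of_lt {i j : Fin N} (h : i < j) : HasTop (X j) (Pi.single i 1) 0 := by
  refine ⟨fun L hL => (bddBy_mono L _).mono_le (hL i j h), ?_⟩
  rw [X, coeff_mono, if_neg]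
  intro he
  have := congrFun he i
  simp [h.ne] at this

lemma hasTop_X_sub {i j : Fin N} (h : i < j) : HasTop (X i - X j) (Pi.single i 1) 1 := by
  simpa using (hasTop_X i).sub (hasTop_X_of_lt h)

lemma hasTop_X_add {i j : Fin N} (h : i < j) : HasTop (X i + X j) (Pi.single i 1) 1 := by
  simpa using (hasTop_X i).add (hasTop_X_of_lt h)

/-! ### Division by `X i - X j` -/

/-- An exponent `nu` of `q` above the bound cannot be seen in the product, so the coefficient of `q`
must repeat at `nu + e_i - e_j`, which is again above the bound. Iterating would give `q` infinite
support. -/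
lemma bddBy_of_X_sub_mul {L : (Fin N → ℤ) →+ ℤ} {i j : Fin N} (hij : i ≠ j)
    (hL : L (Pi.single j 1) ≤ L (Pi.single i 1)) {q : Laurent N} {b : ℤ}
    (h : BddBy L ((X i - X j) * q) (L (Pi.single i 1) + b)) : BddBy L q b := by
  intro nu hnu
  by_contra hb
  push Not at hb
  set al : Fin N → ℤ := Pi.single i 1 - Pi.single j 1 with hal
  have hLal : 0 ≤ L al := by rw [hal, map_sub]; linarith
  have key : ∀ n : ℕ, q.coeff (nu + n • al) ≠ 0 := by
    intro n
    induction n with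
    | zero => simpa using hnu
    | succ n ih =>
      intro h0
      have h1 : ((X i - X j) * q).coeff (Pi.single i 1 + (nu + n • al)) =
          q.coeff (nu + n • al) := by
        rw [sub_mul, AddMonoidAlgebra.coeff_sub, Finsupp.sub_apply, X, X, coeff_mono_mul,
          coeff_mono_mul, add_sub_cancel_left]
        have : Pi.single i 1 + (nu + n • al) - Pi.single j 1 = nu + (n + 1) • al := by
          rw [succ_nsmul, hal]; abel
        rw [this, h0, sub_zero]
      have h2 := h _ (h1.symm ▸ ih)
      rw [map_add, map_add, map_nsmul] at h2
      have : 0 ≤ n • L al := nsmul_nonneg hLal n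
      linarith
  have hinj : Function.Injective fun n : ℕ => nu + n • al := by
    intro a b hab
    have := congrFun (add_left_cancel hab) i
    simpa [hal, Pi.single_apply, hij] using this
  refine Set.infinite_univ (α := ℕ) ?_
  refine Set.Finite.of_injOn (f := fun n : ℕ => nu + n • al) (t := q.coeff.support)
    (fun n _ => by simpa using key n) hinj.injOn (Finset.finite_toSet _)

/-- Ordered pairs of indices. -/
def pairs (N : ℕ) : Finset (Σ _ : Fin N, Fin N) := Finset.univ.sigma fun i => Finset.Ioi i

lemma mem_pairs {p : Σ _ : Fin N, Fin N} : p ∈ pairs N ↔ p.1 < p.2 := by simp [pairs]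

/-- The Vandermonde product `∏_{i<j} (X i - X j)`. -/
def vdm : Laurent N := ∏ p ∈ pairs N, (X p.1 - X p.2)

lemma vdm_eq : (vdm : Laurent N) = ∏ i, ∏ j ∈ Finset.Ioi i, (X i - X j) :=
  (Finset.prod_sigma' Finset.univ (fun i : Fin N => Finset.Ioi i)
    fun i j => (X i - X j : Laurent N)).symm

/-- The leading exponent of the Vandermonde product. -/
def rho : Fin N → ℤ := ∑ p ∈ pairs N, Pi.single p.1 1

lemma rho_eq : (rho : Fin N → ℤ) = fun i : Fin N => (N : ℤ) - 1 - i := by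
  funext i
  simp only [rho, pairs, Finset.sum_sigma, Finset.sum_apply, Pi.single_apply]
  have : ∀ x : Fin N, (∑ j ∈ Finset.Ioi x, if i = x then (1 : ℤ) else 0) =
      if i = x then ((N : ℤ) - 1 - x) else 0 := by
    intro x
    split_ifs
    · simp only [Finset.sum_const, Fin.card_Ioi]
      have := x.2
      simp only [nsmul_eq_mul, mul_one]
      omega
    · simp
  simp only [this]
  simp

lemma hasTop_vdm : HasTop (vdm : Laurent N) rho 1 :=
  HasTop.prod _ fun _ hp => hasTop_X_sub (mem_pairs.1 hp)

lemma hasTop_vdm_pow (k : ℕ) : HasTop (vdm ^ k : Laurent N) (k • rho) 1 := by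
  simpa using hasTop_vdm.pow k

lemma X_sub_ne_zero {i j : Fin N} (h : i ≠ j) : (X i - X j : Laurent N) ≠ 0 := by
  intro h0
  have := congrArg (fun f : Laurent N => f.coeff (Pi.single i 1)) h0
  simp only [AddMonoidAlgebra.coeff_sub, Finsupp.sub_apply, X, coeff_mono, if_true] at this
  rw [if_neg] at this
  · simp at this
  · intro he
    have := congrFun he i
    simp [h] at this

lemma vdm_ne_zero : (vdm : Laurent N) ≠ 0 :=
  Finset.prod_ne_zero_iff.2 fun _ hp => X_sub_ne_zero (mem_pairs.1 hp).ne

lemma bddBy_of_vdm_mul {L : (Fin N → ℤ) →+ ℤ}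
    (hL : DomFun L) {q : Laurent N} {b : ℤ}
    (h : BddBy L (vdm * q) (L rho + b)) : BddBy L q b := by
  have : ∀ s ⊆ pairs N, ∀ b, BddBy L ((∏ p ∈ s, (X p.1 - X p.2)) * q)
      (L (∑ p ∈ s, Pi.single p.1 1) + b) → BddBy L q b := by
    intro s
    induction s using Finset.induction_on with
    | empty => intro _ b h; simpa using h
    | insert a s ha ih =>
      intro hs b h
      have hlt := mem_pairs.1 (hs (Finset.mem_insert_self a s))
      rw [Finset.prod_insert ha, Finset.sum_insert ha, mul_assoc, map_add, add_assoc] at h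
      exact ih (fun x hx => hs (Finset.mem_insert_of_mem hx)) b
        (bddBy_of_X_sub_mul hlt.ne (hL _ _ hlt) h)
  exact this _ subset_rfl b h

lemma bddBy_of_vdm_pow_mul {L : (Fin N → ℤ) →+ ℤ}
    (hL : DomFun L) (k : ℕ) {q : Laurent N}
    {b : ℤ} (h : BddBy L (vdm ^ k * q) (L (k • rho) + b)) : BddBy L q b := by
  induction k with
  | zero => simpa using h
  | succ k ih =>
    refine ih (bddBy_of_vdm_mul hL ?_)
    rw [← mul_assoc, ← pow_succ']
    convert h using 1
    rw [succ_nsmul, map_add]; ring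

lemma HasTop.of_vdm_mul {q : Laurent N} {u : Fin N → ℤ} {a : ℂ}
    (h : HasTop (vdm * q) (rho + u) a) : HasTop q u a := by
  have h1 : ∀ L, DomFun L → BddBy L q (L u) := fun L hL =>
    bddBy_of_vdm_mul hL (by rw [← map_add]; exact h.1 L hL)
  refine ⟨h1, ?_⟩
  have h2 := (hasTop_vdm.mul (⟨h1, rfl⟩ : HasTop q u _)).2
  rw [one_mul] at h2
  rw [← h2, h.2]

/-! ### Divisibility -/

lemma dvd_smul_right' {f g : Laurent N} (h : f ∣ g) (r : ℂ) : f ∣ r • g := by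
  rw [Algebra.smul_def]; exact h.mul_left _

lemma X_sub_dvd_mono_sub_nat (i j : Fin N) (nu : Fin N → ℤ) (n : ℕ) :
    (X i - X j : Laurent N) ∣ mono (nu + n • (Pi.single i 1 - Pi.single j 1)) - mono nu := by
  induction n with
  | zero => simp
  | succ n ih =>
    set al : Fin N → ℤ := Pi.single i 1 - Pi.single j 1 with hal
    have h : (X i - X j : Laurent N) * mono (nu + n • al - Pi.single j 1) =
        mono (nu + (n + 1) • al) - mono (nu + n • al) := by
      rw [sub_mul, X, X, mono_mul, mono_mul]
      congr 2
      · rw [succ_nsmul, hal]; abel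
      · abel
    have := dvd_add (Dvd.intro _ h) ih
    simpa using this

lemma X_sub_dvd_mono_sub (i j : Fin N) (nu : Fin N → ℤ) (n : ℤ) :
    (X i - X j : Laurent N) ∣ mono (nu + n • (Pi.single i 1 - Pi.single j 1)) - mono nu := by
  obtain ⟨n, rfl | rfl⟩ := n.eq_nat_or_neg
  · simpa using X_sub_dvd_mono_sub_nat i j nu n
  · have := X_sub_dvd_mono_sub_nat i j (nu + (-(n : ℤ)) • (Pi.single i 1 - Pi.single j 1)) n
    rw [← dvd_neg, neg_sub] at this
    convert this using 3
    simp

lemma X_sub_dvd_sub_permAct {i j : Fin N} (f : Laurent N) :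
    X i - X j ∣ f - permAct (Equiv.swap i j) f := by
  induction f using laurent_induction with
  | hadd f g hf hg => rw [map_add, add_sub_add_comm]; exact dvd_add hf hg
  | hsmul r f hf => rw [map_smul, ← smul_sub]; exact dvd_smul_right' hf r
  | hm nu =>
    rw [permAct_mono, ← dvd_neg, neg_sub]
    -- Transposing the entries `i` and `j` moves `nu` by a multiple of `e_i - e_j`, and `X i = X j`
    -- modulo `X i - X j`.
    convert X_sub_dvd_mono_sub i j nu (nu j - nu i) using 3
    funext k
    simp only [Function.comp, Equiv.symm_swap, Pi.add_apply, Pi.smul_apply, Pi.sub_apply,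
      Pi.single_apply, smul_eq_mul, Equiv.swap_apply_def]
    split_ifs <;> simp_all

/-- The homomorphism merging the variable `X i` into `X j`. -/
def merge (i j : Fin N) : Laurent N →ₐ[ℂ] Laurent N :=
  AddMonoidAlgebra.mapDomainAlgHom ℂ ℂ
    { toFun := fun nu => nu - nu i • (Pi.single i 1 - Pi.single j 1)
      map_zero' := by simp
      map_add' := fun a b => by simp only [Pi.add_apply, add_smul]; abel }

lemma merge_mono (i j : Fin N) (nu : Fin N → ℤ) :
    merge i j (mono nu) = mono (nu - nu i • (Pi.single i 1 - Pi.single j 1)) := by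
  simp [merge, mono]

lemma merge_X (i j : Fin N) (l : Fin N) : merge i j (X l) = if l = i then X j else X l := by
  rw [X, merge_mono]
  split_ifs with h
  · subst h; simp [X]
  · simp [Ne.symm h]

/-- Merging is the evaluation `X i = X j`, and `f` always agrees with its merged form modulo `X i -
X j`. Being the kernel of a homomorphism into a domain, the ideal is prime. -/
lemma X_sub_dvd_iff (i j : Fin N) (f : Laurent N) : X i - X j ∣ f ↔ merge i j f = 0 := by
  constructor
  · rintro ⟨g, rfl⟩
    rw [map_mul, map_sub, merge_X, merge_X, if_pos rfl]
    split_ifs <;> simp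
  · intro h
    have : X i - X j ∣ f - merge i j f := by
      clear h
      induction f using laurent_induction with
      | hadd f g hf hg => rw [map_add, add_sub_add_comm]; exact dvd_add hf hg
      | hsmul r f hf => rw [map_smul, ← smul_sub]; exact dvd_smul_right' hf r
      | hm nu =>
        rw [merge_mono, ← dvd_neg, neg_sub]
        convert X_sub_dvd_mono_sub i j nu (-nu i) using 3
        rw [neg_smul, sub_eq_add_neg]
    rwa [h, sub_zero] at this

lemma X_sub_prime {i j : Fin N} (h : i ≠ j) : Prime (X i - X j : Laurent N) := by
  refine ⟨X_sub_ne_zero h, ?_, ?_⟩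
  · rw [isUnit_iff_dvd_one, X_sub_dvd_iff, map_one]; exact one_ne_zero
  · intro a b
    simp only [X_sub_dvd_iff, map_mul, mul_eq_zero, imp_self]

lemma X_sub_not_dvd {p q : Σ _ : Fin N, Fin N} (hp : p ∈ pairs N) (hq : q ∈ pairs N)
    (h : p ≠ q) : ¬ (X p.1 - X p.2 : Laurent N) ∣ X q.1 - X q.2 := by
  obtain ⟨i, j⟩ := p
  obtain ⟨a, b⟩ := q
  rw [mem_pairs] at hp hq
  simp only at hp hq
  rw [X_sub_dvd_iff, map_sub, merge_X, merge_X]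
  have h' : a = i → b ≠ j := by rintro rfl rfl; exact h rfl
  dsimp only
  split_ifs with h1 h2 h2
  · exact absurd hq (by rw [h1, h2]; exact lt_irrefl _)
  · exact X_sub_ne_zero (h' h1).symm
  · refine X_sub_ne_zero fun h3 => ?_
    rw [h2] at hq; rw [h3] at hq; exact lt_asymm hp hq
  · exact X_sub_ne_zero hq.ne

lemma prod_dvd_of_primes {ι R : Type*} [CommMonoidWithZero R] [IsCancelMulZero R]
    (s : Finset ι) (f : ι → R)
    (hp : ∀ a ∈ s, Prime (f a)) (hn : ∀ a ∈ s, ∀ b ∈ s, a ≠ b → ¬ f a ∣ f b) {n : R}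
    (h : ∀ a ∈ s, f a ∣ n) : ∏ a ∈ s, f a ∣ n := by
  classical
  induction s using Finset.induction_on with
  | empty => simp
  | insert a s ha ih =>
    obtain ⟨m, rfl⟩ := ih (fun b hb => hp b (by simp [hb]))
      (fun b hb c hc => hn b (by simp [hb]) c (by simp [hc])) (fun b hb => h b (by simp [hb]))
    rcases (hp a (by simp)).dvd_or_dvd (h a (by simp)) with h1 | h1
    · obtain ⟨b, hb, h2⟩ := ((hp a (by simp)).dvd_finsetProd_iff f).1 h1
      exact absurd h2 (hn a (by simp) b (by simp [hb]) (by rintro rfl; exact ha hb))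
    · rw [Finset.prod_insert ha, mul_comm]
      exact mul_dvd_mul_left _ h1

lemma permAct_vdm (s : Equiv.Perm (Fin N)) :
    permAct s (vdm : Laurent N) = ((Equiv.Perm.sign s : ℤ) : Laurent N) * vdm := by
  -- The minus sign matches the order of the differences in `Matrix.det_vandermonde`; the sign of
  -- the permutation then comes from permuting the rows of a determinant.
  have h : ∀ t : Equiv.Perm (Fin N), permAct t (vdm : Laurent N) =
      (Matrix.vandermonde fun i => -(X (t i) : Laurent N)).det := by
    intro t
    rw [Matrix.det_vandermonde, vdm_eq, map_prod]
    simp only [map_prod, map_sub, permAct_X, neg_sub_neg]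
  have h1 := h 1
  have h2 : permAct 1 (vdm : Laurent N) = vdm := by
    ext nu; rw [coeff_permAct]; rfl
  rw [h2] at h1
  rw [h s, h1, ← Matrix.det_permute]
  rfl

lemma vdm_dvd_of_antisymm {f : Laurent N}
    (h : ∀ s : Equiv.Perm (Fin N), permAct s f = ((Equiv.Perm.sign s : ℤ) : Laurent N) * f) :
    vdm ∣ f := by
  refine prod_dvd_of_primes _ _ (fun p hp => X_sub_prime (mem_pairs.1 hp).ne)
    (fun p hp q hq => X_sub_not_dvd hp hq) fun p hp => ?_
  have h1 := X_sub_dvd_sub_permAct (i := p.1) (j := p.2) f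
  rw [h, Equiv.Perm.sign_swap (mem_pairs.1 hp).ne] at h1
  -- For a transposition antisymmetry makes `f` minus its image equal to `2 f`, so each prime factor
  -- of the Vandermonde product divides `f`.
  have h2 : f - ((-1 : ℤˣ) : ℤ) * f = (2 : ℂ) • f := by
    rw [two_smul]; simp
  rw [h2] at h1
  simpa using dvd_smul_right' h1 (2⁻¹ : ℂ)

end CalogeroMoser

end

noncomputable section

namespace CalogeroMoser

/-! ### Triangular symmetric operators -/

section GramSchmidt

variable {E ι : Type*} [NormedAddCommGroup E] [InnerProductSpace ℂ E]

/-- The span of the vectors strictly below `z`. -/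
def lowerSpan (b : ι → E) (r : ι → ι → Prop) (z : ι) : Submodule ℂ E :=
  Submodule.span ℂ (b '' {w | r w z})

lemma lowerSpan_hasOrthogonalProjection (b : ι → E) (r : ι → ι → Prop)
    (hfin : ∀ z, {w | r w z}.Finite) (z : ι) : (lowerSpan b r z).HasOrthogonalProjection := by
  have : FiniteDimensional ℂ (lowerSpan b r z) :=
    FiniteDimensional.span_of_finite ℂ ((hfin z).image b)
  infer_instance

lemma exists_gramSchmidt (b : ι → E) (r : ι → ι → Prop) (hfin : ∀ z, {w | r w z}.Finite) (z : ι) :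
    ∃ v : E, v - b z ∈ lowerSpan b r z ∧ ∀ u ∈ lowerSpan b r z, inner ℂ u v = 0 := by
  have := lowerSpan_hasOrthogonalProjection b r hfin z
  refine ⟨b z - (lowerSpan b r z).starProjection (b z), ?_, fun u hu => ?_⟩
  · rw [sub_sub_cancel_left]
    exact neg_mem (Submodule.starProjection_apply_mem _ _)
  · exact (Submodule.mem_orthogonal _ _).1 (Submodule.sub_starProjection_mem_orthogonal (b z)) u hu

/-- The Gram-Schmidt vector: `b z` minus its projection to the span of the lower vectors. -/
def gramVec (b : ι → E) (r : ι → ι → Prop) (hfin : ∀ z, {w | r w z}.Finite) (z : ι) : E :=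
  (exists_gramSchmidt b r hfin z).choose

variable {b : ι → E} {r : ι → ι → Prop} (hfin : ∀ z, {w | r w z}.Finite)

lemma gramVec_sub_mem (z : ι) : gramVec b r hfin z - b z ∈ lowerSpan b r z :=
  (exists_gramSchmidt b r hfin z).choose_spec.1

lemma inner_gramVec {z : ι} {u : E} (hu : u ∈ lowerSpan b r z) :
    inner ℂ u (gramVec b r hfin z) = 0 :=
  (exists_gramSchmidt b r hfin z).choose_spec.2 u hu

/-- Triangularity puts `T v - e v` in the span of the lower vectors. This span is stable under `T`,
so symmetry of `T` makes `T v - e v` orthogonal to it as well; hence it is zero. -/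
lemma gramVec_eigen (htrans : ∀ x y z, r x y → r y z → r x z) {T : E →ₗ[ℂ] E}
    (hT : T.IsSymmetric) {e : ι → ℂ} (htri : ∀ z, T (b z) - e z • b z ∈ lowerSpan b r z) (z : ι) :
    T (gramVec b r hfin z) = e z • gramVec b r hfin z := by
  have hinv : ∀ u ∈ lowerSpan b r z, T u ∈ lowerSpan b r z := by
    intro u hu
    induction hu using Submodule.span_induction with
    | zero => simp
    | add u v _ _ hu hv => rw [map_add]; exact add_mem hu hv
    | smul c u _ hu => rw [map_smul]; exact Submodule.smul_mem _ c hu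
    | mem u hu =>
      obtain ⟨w, hw, rfl⟩ := hu
      have h1 : lowerSpan b r w ≤ lowerSpan b r z :=
        Submodule.span_mono (Set.image_mono fun x hx => htrans x w z hx hw)
      have h2 : b w ∈ lowerSpan b r z := Submodule.subset_span ⟨w, hw, rfl⟩
      have := add_mem (h1 (htri w)) (Submodule.smul_mem _ (e w) h2)
      simpa using this
  set v := gramVec b r hfin z with hv
  have hd := gramVec_sub_mem (b := b) hfin z
  rw [← hv] at hd
  have h1 : T v - e z • v ∈ lowerSpan b r z := by
    have : T v - e z • v = T (v - b z) - e z • (v - b z) + (T (b z) - e z • b z) := by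
      rw [map_sub, smul_sub]; abel
    rw [this]
    exact add_mem (sub_mem (hinv _ hd) (Submodule.smul_mem _ _ hd)) (htri z)
  have h2 : ∀ u ∈ lowerSpan b r z, inner ℂ u (T v - e z • v) = 0 := by
    intro u hu
    rw [inner_sub_right, inner_smul_right, ← hT, inner_gramVec hfin (hinv u hu),
      inner_gramVec hfin hu]
    simp
  exact sub_eq_zero.1 (inner_self_eq_zero.1 (h2 _ h1))

lemma mem_span_gramVec (hwf : WellFounded r) {D : Set ι}
    (hD : ∀ x ∈ D, ∀ y, r y x → y ∈ D) {z : ι} (hz : z ∈ D) :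
    b z ∈ Submodule.span ℂ (gramVec b r hfin '' D) := by
  induction z using hwf.induction with
  | h z ih =>
    have h1 : lowerSpan b r z ≤ Submodule.span ℂ (gramVec b r hfin '' D) :=
      Submodule.span_le.2 (by
        rintro _ ⟨w, hw, rfl⟩
        exact ih w hw (hD z hz w hw))
    have h2 : gramVec b r hfin z ∈ Submodule.span ℂ (gramVec b r hfin '' D) :=
      Submodule.subset_span ⟨z, hz, rfl⟩
    have := sub_mem h2 (h1 (gramVec_sub_mem (b := b) hfin z))
    simpa using this

end GramSchmidt

lemma wellFounded_of_finite_lower {ι : Type*} {r : ι → ι → Prop}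
    (hfin : ∀ z, {w | r w z}.Finite) (htrans : ∀ x y z, r x y → r y z → r x z)
    (hirr : ∀ x, ¬ r x x) : WellFounded r := by
  refine Subrelation.wf (r := InvImage (· < ·) fun z => {w | r w z}.ncard) ?_
    (InvImage.wf _ wellFounded_lt)
  intro x y hxy
  refine Set.ncard_lt_ncard ?_ (hfin y)
  refine ⟨fun w hw => htrans w x y hw hxy, fun h => hirr x (h hxy)⟩

/-! ### Symmetric Laurent polynomials -/

variable {N : ℕ}

/-- Symmetric Laurent polynomials, homogeneous of degree `m`. -/
def symmSub (N : ℕ) (m : ℤ) : Submodule ℂ (Laurent N) where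
  carrier := {f | (∀ s, permAct s f = f) ∧ ∀ nu, f.coeff nu ≠ 0 → ∑ i, nu i = m}
  add_mem' {f g} hf hg := by
    refine ⟨fun s => by rw [map_add, hf.1, hg.1], fun nu h => ?_⟩
    by_cases h1 : f.coeff nu = 0
    · exact hg.2 nu (by simpa [h1] using h)
    · exact hf.2 nu h1
  zero_mem' := ⟨fun s => map_zero _, fun nu h => absurd rfl h⟩
  smul_mem' r f hf := by
    refine ⟨fun s => by rw [map_smul, hf.1], fun nu h => hf.2 nu ?_⟩
    rw [AddMonoidAlgebra.coeff_smul_apply] at h; exact right_ne_zero_of_mul h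

/-- Dominant integral exponents of degree `m`. -/
@[ext] structure Dom (N : ℕ) (m : ℤ) where
  /-- The exponent. -/
  val : Fin N → ℤ
  anti : Antitone val
  sum_eq : ∑ i, val i = m

lemma Dom.val_injective {m : ℤ} : Function.Injective (Dom.val : Dom N m → Fin N → ℤ) :=
  fun _ _ h => Dom.ext h

lemma coeff_comp_perm {m : ℤ} {G : Laurent N} (hG : G ∈ symmSub N m) (s : Equiv.Perm (Fin N))
    (nu : Fin N → ℤ) : G.coeff (nu ∘ s) = G.coeff nu := by
  conv_rhs => rw [← hG.1 s, coeff_permAct]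

/-- The strict dominance order. -/
def Dom.lt {m : ℤ} (w z : Dom N m) : Prop := w.1 ≠ z.1 ∧ ∀ k, psum k w.1 ≤ psum k z.1

lemma Dom.lt_trans {m : ℤ} (x y z : Dom N m) (h1 : x.lt y) (h2 : y.lt z) : x.lt z := by
  refine ⟨fun h => h1.1 (psum_injective fun k => le_antisymm (h1.2 k) ?_),
    fun k => (h1.2 k).trans (h2.2 k)⟩
  rw [h]; exact h2.2 k

lemma finite_dom_of_le (m B : ℤ) : {z : Dom N m | ∀ i, z.1 i ≤ B}.Finite := by
  -- The defects `B - u i` are nonnegative with sum `N * B - m`, so each is at most that sum.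
  have : {u : Fin N → ℤ | ∀ i, u i ∈ Set.Icc (B - (N * B - m)) B}.Finite :=
    Set.Finite.pi' fun _ => Set.finite_Icc _ _
  refine Set.Finite.of_injOn (f := fun z : Dom N m => z.1) ?_ Dom.val_injective.injOn this
  intro z hz i
  refine ⟨?_, hz i⟩
  have h1 : ∑ j, (B - z.1 j) = N * B - m := by simp [Finset.sum_sub_distrib, z.sum_eq]
  have h2 := Finset.single_le_sum (f := fun j => B - z.1 j) (fun j _ => sub_nonneg.2 (hz j))
    (Finset.mem_univ i)
  rw [h1] at h2
  linarith

lemma Dom.le_zero [NeZero N] {m : ℤ} (z : Dom N m) (i : Fin N) : z.1 i ≤ z.1 0 := z.anti (Fin.zero_le i)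

lemma finite_dom_zero_le [NeZero N] (m B : ℤ) : {z : Dom N m | z.1 0 ≤ B}.Finite :=
  (finite_dom_of_le m B).subset fun z hz i => (z.le_zero i).trans hz

lemma Dom.lt_zero_le [NeZero N] {m : ℤ} {w z : Dom N m} (h : w.lt z) : w.1 0 ≤ z.1 0 := by
  simpa [psum_zero_apply] using h.2 0

lemma Dom.finite_lt [NeZero N] {m : ℤ} (z : Dom N m) : {w : Dom N m | w.lt z}.Finite :=
  (finite_dom_zero_le m (z.1 0)).subset fun _ h => Dom.lt_zero_le h

lemma Dom.lt_wf [NeZero N] (m : ℤ) : WellFounded (Dom.lt : Dom N m → Dom N m → Prop) :=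
  wellFounded_of_finite_lower Dom.finite_lt Dom.lt_trans fun _ h => h.1 rfl

open Classical in
/-- The monomial symmetric polynomial. -/
def msymm (z : Fin N → ℤ) : Laurent N :=
  ∑ nu ∈ Finset.univ.image (fun s : Equiv.Perm (Fin N) => z ∘ s), mono nu

open Classical in
lemma coeff_msymm (z nu : Fin N → ℤ) :
    (msymm z).coeff nu = if ∃ s : Equiv.Perm (Fin N), z ∘ s = nu then 1 else 0 := by
  rw [msymm, AddMonoidAlgebra.coeff_sum, Finset.sum_apply']
  simp [coeff_mono]

lemma msymm_mem {m : ℤ} (z : Dom N m) : msymm z.1 ∈ symmSub N m := by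
  classical
  refine ⟨fun s => ?_, fun nu h => ?_⟩
  · ext nu
    rw [coeff_permAct, coeff_msymm, coeff_msymm]
    congr 1
    rw [eq_iff_iff]
    constructor
    · rintro ⟨t, h⟩
      refine ⟨t * s⁻¹, funext fun i => ?_⟩
      have := congrFun h (s⁻¹ i)
      simpa using this
    · rintro ⟨t, rfl⟩
      exact ⟨t * s, rfl⟩
  · rw [coeff_msymm] at h
    split_ifs at h with h1
    · obtain ⟨s, rfl⟩ := h1
      exact (Equiv.sum_comp s z.1).trans z.sum_eq
    · exact absurd rfl h

lemma exists_sort (nu : Fin N → ℤ) : ∃ s : Equiv.Perm (Fin N), Antitone (nu ∘ s) := by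
  refine ⟨Tuple.sort (fun i => -nu i), fun i j h => ?_⟩
  have := Tuple.monotone_sort (fun i => -nu i) h
  simpa using this

lemma antitone_eq_of_comp_perm {a b : Fin N → ℤ} (ha : Antitone a) (hb : Antitone b)
    (s : Equiv.Perm (Fin N)) (h : a ∘ s = b) : a = b := by
  have h1 : Monotone ((fun i => -a i) ∘ (1 : Equiv.Perm (Fin N))) := fun i j h => neg_le_neg (ha h)
  have h2 : Monotone ((fun i => -a i) ∘ s) := by
    intro i j hij
    have := neg_le_neg (hb hij)
    rw [← h] at this
    exact this
  have := Tuple.unique_monotone h1 h2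
  rw [← h]
  funext i
  simpa using congrFun this i

lemma addHom_apply_eq_sum (L : (Fin N → ℤ) →+ ℤ) (u : Fin N → ℤ) :
    L u = ∑ i, L (Pi.single i 1) • u i := by
  conv_lhs => rw [← Finset.univ_sum_single u]
  rw [map_sum]
  refine Finset.sum_congr rfl fun i _ => ?_
  rw [smul_eq_mul, mul_comm, ← smul_eq_mul, ← map_zsmul, ← Pi.single_smul, smul_eq_mul, mul_one]

/-- This is the rearrangement inequality: a dominant functional has decreasing weights, which pair
best with a decreasing exponent. -/
lemma domFun_comp_perm_le {L : (Fin N → ℤ) →+ ℤ} (hL : DomFun L) {z : Fin N → ℤ}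
    (hz : Antitone z) (s : Equiv.Perm (Fin N)) : L (z ∘ s) ≤ L z := by
  have hm : Monovary (fun i : Fin N => L (Pi.single i 1)) z := by
    intro i j h
    have hji : j < i := by
      by_contra h'
      exact absurd (hz (not_lt.1 h')) (not_le.2 h)
    exact hL j i hji
  rw [addHom_apply_eq_sum L, addHom_apply_eq_sum L z]
  exact hm.sum_smul_comp_perm_le_sum_smul (σ := s)

lemma hasTop_msymm {m : ℤ} (z : Dom N m) : HasTop (msymm z.1) z.1 1 := by
  classical
  refine ⟨fun L hL nu h => ?_, ?_⟩
  · rw [coeff_msymm] at h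
    split_ifs at h with h1
    · obtain ⟨s, rfl⟩ := h1
      exact domFun_comp_perm_le hL z.anti s
    · exact absurd rfl h
  · rw [coeff_msymm, if_pos ⟨1, rfl⟩]

lemma mem_span_msymm {m : ℤ} {G : Laurent N} (hG : G ∈ symmSub N m) :
    G ∈ Submodule.span ℂ ((fun z : Dom N m => msymm z.1) '' {z | G.coeff z.1 ≠ 0}) := by
  classical
  have hfin : {z : Dom N m | G.coeff z.1 ≠ 0}.Finite :=
    Set.Finite.of_injOn (f := fun z : Dom N m => z.1) (t := G.coeff.support)
      (fun z hz => by simpa using hz) Dom.val_injective.injOn (Finset.finite_toSet _)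
  have key : G = ∑ z ∈ hfin.toFinset, G.coeff z.1 • msymm z.1 := by
    ext nu
    rw [AddMonoidAlgebra.coeff_sum, Finset.sum_apply']
    simp only [AddMonoidAlgebra.coeff_smul_apply, coeff_msymm]
    obtain ⟨s, hs⟩ := exists_sort nu
    have hcoe : G.coeff nu = G.coeff (nu ∘ s) := (coeff_comp_perm hG s nu).symm
    by_cases h0 : G.coeff nu = 0
    · rw [h0, Finset.sum_eq_zero]
      intro z hz
      rw [if_neg, smul_zero]
      rintro ⟨t, rfl⟩
      exact (hfin.mem_toFinset.1 hz) ((coeff_comp_perm hG t z.1).symm.trans h0)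
    · have hsum : ∑ i, (nu ∘ s) i = m := by
        rw [← hG.2 nu h0]; exact Equiv.sum_comp s nu
      refine Eq.trans ?_ (Finset.sum_eq_single (⟨nu ∘ s, hs, hsum⟩ : Dom N m) ?_ ?_).symm
      · rw [if_pos, ← hcoe, smul_eq_mul, mul_one]
        exact ⟨s⁻¹, funext fun i => by simp⟩
      · intro z _ hne
        rw [if_neg, smul_zero]
        rintro ⟨t, ht⟩
        refine hne (Dom.ext (antitone_eq_of_comp_perm z.anti hs (t * s) ?_))
        exact congrArg (· ∘ s) ht
      · intro h
        rw [hfin.mem_toFinset, Set.mem_ofPred_eq, not_not, ← hcoe] at h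
        exact absurd h h0
  have hmem : ∑ z ∈ hfin.toFinset, G.coeff z.1 • msymm z.1 ∈
      Submodule.span ℂ ((fun z : Dom N m => msymm z.1) '' {z | G.coeff z.1 ≠ 0}) :=
    sum_mem fun z hz => Submodule.smul_mem _ _
      (Submodule.subset_span ⟨z, hfin.mem_toFinset.1 hz, rfl⟩)
  rwa [← key] at hmem

/-- After the top coefficient is removed, every dominant exponent that remains is strictly below
`z`, and the coefficients at dominant exponents give the expansion in monomial symmetric
polynomials. -/
lemma sub_smul_msymm_mem {m : ℤ} {G : Laurent N} (hG : G ∈ symmSub N m) (z : Dom N m) {a : ℂ}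
    (h : HasTop G z.1 a) :
    G - a • msymm z.1 ∈ Submodule.span ℂ ((fun z : Dom N m => msymm z.1) '' {w | w.lt z}) := by
  have h1 := h.sub ((hasTop_msymm z).smul a)
  refine Submodule.span_mono (Set.image_mono ?_)
    (mem_span_msymm (sub_mem hG (Submodule.smul_mem _ a (msymm_mem z))))
  intro w hw
  refine ⟨fun he => hw ?_, fun k => h1.1 _ (domFun_psum k) _ hw⟩
  rw [he, h1.2]; ring

end CalogeroMoser

end

noncomputable section

namespace CalogeroMoser

variable {N : ℕ}

/-! ### Homogeneity -/

/-- All exponents of `f` have total degree `m`. -/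
def IsHomog (f : Laurent N) (m : ℤ) : Prop := ∀ nu, f.coeff nu ≠ 0 → ∑ i, nu i = m

lemma isHomog_mono (nu : Fin N → ℤ) : IsHomog (mono nu) (∑ i, nu i) := by
  intro mu h
  rw [coeff_mono] at h
  split_ifs at h with h1
  · rw [h1]
  · exact absurd rfl h

lemma IsHomog.add {f g : Laurent N} {m : ℤ} (hf : IsHomog f m) (hg : IsHomog g m) :
    IsHomog (f + g) m := by
  intro nu h
  by_cases h1 : f.coeff nu = 0
  · exact hg nu (by simpa [h1] using h)
  · exact hf nu h1

lemma IsHomog.smul {f : Laurent N} {m : ℤ} (hf : IsHomog f m) (r : ℂ) : IsHomog (r • f) m :=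
  fun nu h => hf nu (by
    rw [AddMonoidAlgebra.coeff_smul_apply] at h; exact right_ne_zero_of_mul h)

lemma IsHomog.neg {f : Laurent N} {m : ℤ} (hf : IsHomog f m) : IsHomog (-f) m := by
  simpa using hf.smul (-1)

lemma IsHomog.sub {f g : Laurent N} {m : ℤ} (hf : IsHomog f m) (hg : IsHomog g m) :
    IsHomog (f - g) m := by simpa [sub_eq_add_neg] using hf.add hg.neg

lemma IsHomog.mul {f g : Laurent N} {m n : ℤ} (hf : IsHomog f m) (hg : IsHomog g n) :
    IsHomog (f * g) (m + n) := by
  intro nu h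
  obtain ⟨u, w, hu, hw, rfl⟩ := exists_of_coeff_mul_ne_zero h
  simp [Finset.sum_add_distrib, hf u hu, hg w hw]

lemma IsHomog.shiftDel {f : Laurent N} {m : ℤ} (hf : IsHomog f m) (c : ℂ) (i : Fin N) :
    IsHomog (shiftDel c i f) m := fun nu h => hf nu (by
      rw [coeff_shiftDel] at h; exact right_ne_zero_of_mul h)

lemma isHomog_X (i : Fin N) : IsHomog (X i) 1 := by
  simpa using! isHomog_mono (Pi.single i 1 : Fin N → ℤ)

lemma IsHomog.sum {ι : Type*} (s : Finset ι) {f : ι → Laurent N} {m : ℤ}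
    (h : ∀ i ∈ s, IsHomog (f i) m) : IsHomog (∑ i ∈ s, f i) m := by
  classical
  induction s using Finset.induction_on with
  | empty => intro nu h; exact absurd rfl h
  | insert a s ha ih =>
    rw [Finset.sum_insert ha]
    exact (h a (by simp)).add (ih fun i hi => h i (by simp [hi]))

/-- The total degree as a functional. -/
def totDeg : (Fin N → ℤ) →+ ℤ where
  toFun nu := ∑ i, nu i
  map_zero' := by simp
  map_add' _ _ := by simp [Finset.sum_add_distrib]

lemma totDeg_apply (nu : Fin N → ℤ) : totDeg nu = ∑ i, nu i := rfl

/-- Both `totDeg` and its negative are dominant functionals, so this form lets homogeneity pass to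
quotients by the Vandermonde product through the one-sided bounds. -/
lemma isHomog_iff (f : Laurent N) (m : ℤ) :
    IsHomog f m ↔ BddBy totDeg f m ∧ BddBy (-totDeg) f (-m) := by
  constructor
  · intro h
    exact ⟨fun nu hn => (h nu hn).le, fun nu hn => by simp [totDeg_apply, h nu hn]⟩
  · intro h nu hn
    refine le_antisymm (h.1 nu hn) ?_
    have := h.2 nu hn
    simp only [AddMonoidHom.neg_apply, neg_le_neg_iff] at this
    exact this

lemma domFun_totDeg : DomFun (totDeg : (Fin N → ℤ) →+ ℤ) := fun i j _ => by simp [totDeg_apply]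

lemma domFun_neg_totDeg : DomFun (-totDeg : (Fin N → ℤ) →+ ℤ) :=
  fun i j _ => by simp [totDeg_apply]

lemma isHomog_vdm : IsHomog (vdm : Laurent N) (totDeg (rho : Fin N → ℤ)) := by
  rw [isHomog_iff]
  refine ⟨hasTop_vdm.1 _ domFun_totDeg, ?_⟩
  simpa using hasTop_vdm.1 _ domFun_neg_totDeg

lemma isHomog_of_vdm_mul {Q : Laurent N} {m : ℤ} (h : IsHomog (vdm * Q) (totDeg (rho : Fin N → ℤ) + m)) :
    IsHomog Q m := by
  rw [isHomog_iff] at h ⊢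
  refine ⟨bddBy_of_vdm_mul domFun_totDeg h.1, bddBy_of_vdm_mul domFun_neg_totDeg ?_⟩
  convert h.2 using 1
  rw [AddMonoidHom.neg_apply]; ring

lemma exists_vdm_mul_eq {m : ℤ} {n : Laurent N}
    (hanti : ∀ s : Equiv.Perm (Fin N), permAct s n = ((Equiv.Perm.sign s : ℤ) : Laurent N) * n)
    (hh : IsHomog n (totDeg (rho : Fin N → ℤ) + m)) : ∃ Q ∈ symmSub N m, vdm * Q = n := by
  obtain ⟨Q, rfl⟩ := vdm_dvd_of_antisymm hanti
  refine ⟨Q, ⟨fun s => ?_, isHomog_of_vdm_mul hh⟩, rfl⟩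
  have h := hanti s
  rw [map_mul, permAct_vdm, mul_assoc] at h
  have h1 : ((Equiv.Perm.sign s : ℤ) : Laurent N) ≠ 0 := by
    rcases Int.units_eq_one_or (Equiv.Perm.sign s) with h | h <;> simp [h]
  exact mul_left_cancel₀ vdm_ne_zero (mul_left_cancel₀ h1 h)

/-! ### The space of states -/

/-- Symmetric homogeneous Laurent polynomials multiplied by the `k`-th power of the Vandermonde
product. -/
def vSpace (N k : ℕ) (m : ℤ) : Submodule ℂ (Laurent N) :=
  (symmSub N m).map (LinearMap.mulLeft ℂ (vdm ^ k))

/-- The operator on states induced by an operator on rational functions preserving them. -/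
def opOfRatl {k : ℕ} {m : ℤ} (T : Ratl N →ₗ[ℂ] Ratl N)
    (h : ∀ f ∈ vSpace N k m, ∃ g ∈ vSpace N k m, toRatl g = T (toRatl f)) :
    vSpace N k m →ₗ[ℂ] vSpace N k m where
  toFun f := ⟨(h f.1 f.2).choose, (h f.1 f.2).choose_spec.1⟩
  map_add' f g := by
    refine Subtype.ext (toRatl_injective ?_)
    have key := fun f : vSpace N k m => (h f.1 f.2).choose_spec.2
    refine (key (f + g)).trans (Eq.trans ?_ (map_add toRatl (h f.1 f.2).choose _).symm)
    refine (congrArg T (map_add toRatl f.1 g.1)).trans ((map_add T _ _).trans ?_)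
    exact congrArg₂ _ (key f).symm (key g).symm
  map_smul' r f := by
    refine Subtype.ext (toRatl_injective ?_)
    have key := fun f : vSpace N k m => (h f.1 f.2).choose_spec.2
    refine (key (r • f)).trans (Eq.trans ?_ (map_smul toRatl r (h f.1 f.2).choose).symm)
    refine (congrArg T (map_smul toRatl r f.1)).trans ((map_smul T _ _).trans ?_)
    exact congrArg _ (key f).symm

lemma toRatl_opOfRatl {k : ℕ} {m : ℤ} (T : Ratl N →ₗ[ℂ] Ratl N)
    (h : ∀ f ∈ vSpace N k m, ∃ g ∈ vSpace N k m, toRatl g = T (toRatl f)) (f : vSpace N k m) :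
    toRatl (opOfRatl T h f : Laurent N) = T (toRatl (f : Laurent N)) :=
  (h f.1 f.2).choose_spec.2

/-! ### Operators on rational functions -/

/-- The shifted derivation of rational functions. -/
def shiftR (c : ℂ) (i : Fin N) : Ratl N →ₗ[ℂ] Ratl N := (delR i).toLinearMap + c • .id

lemma shiftR_apply (c : ℂ) (i : Fin N) (f : Ratl N) :
    shiftR c i f = delR i f + algebraMap ℂ (Ratl N) c * f := by
  rw [← Algebra.smul_def]; rfl

lemma toRatl_shiftDel (c : ℂ) (i : Fin N) (f : Laurent N) :
    toRatl (shiftDel c i f) = shiftR c i (toRatl f) := by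
  rw [shiftDel_apply, map_add, ← delR_toRatl, map_smul]; rfl

/-- The coefficient of `p ^ n`, `n ≥ 1`, of the pair potential: `∑_{d ∣ n} d (x^d + x^{-d})` with
`x = X i / X j`. -/
def lambertCoeff (i j : Fin N) (n : ℕ) : Laurent N :=
  ∑ d ∈ n.divisors, (d : ℂ) • (mono ((d : ℤ) • (Pi.single i 1 - Pi.single j 1)) +
    mono ((d : ℤ) • (Pi.single j 1 - Pi.single i 1)))

lemma lambertCoeff_symm (i j : Fin N) (n : ℕ) :
    lambertCoeff i j n = (lambertCoeff j i n : Laurent N) := by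
  rw [lambertCoeff, lambertCoeff]
  exact Finset.sum_congr rfl fun d _ => by rw [add_comm]

lemma permAct_lambertCoeff (s : Equiv.Perm (Fin N)) (i j : Fin N) (n : ℕ) :
    permAct s (lambertCoeff i j n) = lambertCoeff (s i) (s j) n := by
  have h : ∀ a b : Fin N, ∀ d : ℤ, (d • (Pi.single a 1 - Pi.single b 1) : Fin N → ℤ) ∘ s.symm =
      d • (Pi.single (s a) 1 - Pi.single (s b) 1) := by
    intro a b d
    funext l
    simp [Pi.single_apply, Equiv.symm_apply_eq]
  simp only [lambertCoeff, map_sum, map_smul, map_add, permAct_mono, h]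

lemma isHomog_lambertCoeff (i j : Fin N) (n : ℕ) : IsHomog (lambertCoeff i j n) 0 := by
  refine IsHomog.sum _ fun d _ => IsHomog.smul (IsHomog.add ?_ ?_) _
  · convert isHomog_mono _ using 1; simp [Finset.sum_sub_distrib, ← Finset.mul_sum]
  · convert isHomog_mono _ using 1; simp [Finset.sum_sub_distrib, ← Finset.mul_sum]

/-- The coefficient of `p ^ n` of the pair potential as a rational function. -/
def potR (i j : Fin N) (n : ℕ) : Ratl N :=
  if n = 0 then toRatl (X i * X j) / toRatl (X i - X j) ^ 2 else toRatl (lambertCoeff i j n)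

/-- The coefficient of `p ^ n` of the Hamiltonian, divided by `2π²`. -/
def hamR (c : ℂ) (k : ℕ) (n : ℕ) : Ratl N →ₗ[ℂ] Ratl N :=
  (if n = 0 then ∑ i, shiftR c i ∘ₗ shiftR c i else 0) -
    (2 * k * (k - 1) : ℂ) • LinearMap.mulLeft ℂ (∑ p ∈ pairs N, potR p.1 p.2 n)

/-- The coefficient of `p ^ n` of the third-order integral for three particles. -/
def cubR (c : ℂ) (k : ℕ) (n : ℕ) : Ratl 3 →ₗ[ℂ] Ratl 3 :=
  (if n = 0 then shiftR c 0 ∘ₗ shiftR c 1 ∘ₗ shiftR c 2 else 0) +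
    (k * (k - 1) : ℂ) • (LinearMap.mulLeft ℂ (potR 0 1 n) ∘ₗ shiftR c 2 +
      LinearMap.mulLeft ℂ (potR 0 2 n) ∘ₗ shiftR c 1 +
      LinearMap.mulLeft ℂ (potR 1 2 n) ∘ₗ shiftR c 0)

/-- The ratio `X i / (X i - X j)`. -/
def fracR (i j : Fin N) : Ratl N := toRatl (X i) / toRatl (X i - X j)

lemma toRatl_X_sub_ne_zero {i j : Fin N} (h : i ≠ j) : (toRatl (X i - X j) : Ratl N) ≠ 0 := by
  rw [Ne, ← map_zero toRatl, toRatl_injective.eq_iff]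
  exact X_sub_ne_zero h

lemma toRatl_X_sub_ne_zero' {i j : Fin N} (h : i ≠ j) :
    (toRatl (X i) - toRatl (X j) : Ratl N) ≠ 0 := by
  rw [← map_sub]; exact toRatl_X_sub_ne_zero h

lemma delR_X (i j : Fin N) : delR i (toRatl (X j)) = if i = j then toRatl (X j) else 0 := by
  rw [delR_toRatl, del_X]; split_ifs <;> simp

lemma fracR_mul {i j : Fin N} (h : i ≠ j) :
    fracR i j * (toRatl (X i) - toRatl (X j)) = toRatl (X i) := by
  rw [fracR, map_sub, div_mul_cancel₀ _ (toRatl_X_sub_ne_zero' h)]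

/-- Derivatives of the fractions are again polynomials in the fractions. This reduces the
conjugation of differential operators by `vdm ^ k` to polynomial identities. The values come from
differentiating `fracR i j * (X i - X j) = X i`. -/
lemma delR_fracR (l : Fin N) {i j : Fin N} (h : i ≠ j) :
    delR l (fracR i j) = if l = i then fracR i j - fracR i j ^ 2 else
      if l = j then fracR i j ^ 2 - fracR i j else 0 := by
  have h0 := toRatl_X_sub_ne_zero' h
  have h1 := fracR_mul h
  have h2 := congrArg (delR l) h1
  simp only [Derivation.leibniz, map_sub, delR_X, smul_eq_mul] at h2
  refine mul_right_cancel₀ h0 ?_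
  by_cases hli : l = i
  · subst hli
    rw [if_pos rfl, if_neg h] at h2
    rw [if_pos rfl]
    linear_combination h2 - (1 - fracR l j) * h1
  · by_cases hlj : l = j
    · subst hlj
      rw [if_neg hli, if_pos rfl] at h2
      rw [if_neg hli, if_pos rfl]
      linear_combination h2 - fracR i l * h1
    · rw [if_neg hli, if_neg hlj] at h2
      rw [if_neg hli, if_neg hlj]
      linear_combination h2

lemma potR_zero_eq {i j : Fin N} (h : i ≠ j) : potR i j 0 = fracR i j ^ 2 - fracR i j := by
  have h0 := toRatl_X_sub_ne_zero' h
  rw [potR, if_pos rfl, fracR, map_sub, map_mul]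
  field_simp
  ring

lemma two_fracR_sub_one {i j : Fin N} (h : i ≠ j) :
    (2 * fracR i j - 1) * (toRatl (X i) - toRatl (X j)) = toRatl (X i) + toRatl (X j) := by
  linear_combination 2 * fracR_mul h

lemma delR_X_sub (l : Fin N) {i j : Fin N} (h : i ≠ j) :
    delR l (toRatl (X i) - toRatl (X j)) = (if l = i then fracR i j else
      if l = j then 1 - fracR i j else 0) * (toRatl (X i) - toRatl (X j)) := by
  have h1 := fracR_mul h
  rw [map_sub, delR_X, delR_X]
  by_cases hli : l = i
  · subst hli
    rw [if_pos rfl, if_neg h, if_pos rfl, h1, sub_zero]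
  · by_cases hlj : l = j
    · subst hlj
      rw [if_neg hli, if_pos rfl, if_neg hli, if_pos rfl]
      linear_combination h1
    · rw [if_neg hli, if_neg hlj, if_neg hli, if_neg hlj]; ring

lemma delR_pow_of_eq {i : Fin N} {P t : Ratl N} (h : delR i P = t * P) (k : ℕ) :
    delR i (P ^ k) = k * t * P ^ k := by
  induction k with
  | zero => simp
  | succ k ih =>
    rw [pow_succ, Derivation.leibniz, ih, h, smul_eq_mul, smul_eq_mul]
    push_cast
    ring

lemma delR_algebraMap (i : Fin N) (c : ℂ) : delR i (algebraMap ℂ (Ratl N) c) = 0 :=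
  Derivation.map_algebraMap _ _

end CalogeroMoser

end

noncomputable section

namespace CalogeroMoser

/-! ### Two and three particles: the operators preserve the space of states -/

lemma sum_pairs_three {M : Type*} [AddCommMonoid M] (f : (Σ _ : Fin 3, Fin 3) → M) :
    ∑ p ∈ pairs 3, f p = f ⟨0, 1⟩ + f ⟨0, 2⟩ + f ⟨1, 2⟩ := by
  have h0 : Finset.Ioi (0 : Fin 3) = {1, 2} := by decide
  have h1 : Finset.Ioi (1 : Fin 3) = {2} := by decide
  have h2 : Finset.Ioi (2 : Fin 3) = ∅ := by decide
  rw [pairs, Finset.sum_sigma, Fin.sum_univ_three, h0, h1, h2, Finset.sum_pair (by decide)]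
  simp

lemma sum_pairs_two {M : Type*} [AddCommMonoid M] (f : (Σ _ : Fin 2, Fin 2) → M) :
    ∑ p ∈ pairs 2, f p = f ⟨0, 1⟩ := by
  have h0 : Finset.Ioi (0 : Fin 2) = {1} := by decide
  have h1 : Finset.Ioi (1 : Fin 2) = ∅ := by decide
  rw [pairs, Finset.sum_sigma, Fin.sum_univ_two, h0, h1]
  simp

lemma vdm_three : (vdm : Laurent 3) = (X 0 - X 1) * (X 0 - X 2) * (X 1 - X 2) := by
  have h0 : Finset.Ioi (0 : Fin 3) = {1, 2} := by decide
  have h1 : Finset.Ioi (1 : Fin 3) = {2} := by decide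
  have h2 : Finset.Ioi (2 : Fin 3) = ∅ := by decide
  rw [vdm_eq, Fin.prod_univ_three, h0, h1, h2, Finset.prod_pair (by decide)]
  simp

lemma vdm_two : (vdm : Laurent 2) = X 0 - X 1 := by
  have h0 : Finset.Ioi (0 : Fin 2) = {1} := by decide
  have h1 : Finset.Ioi (1 : Fin 2) = ∅ := by decide
  rw [vdm_eq, Fin.prod_univ_two, h0, h1]
  simp

lemma rho_three : (rho : Fin 3 → ℤ) = ![2, 1, 0] := by
  rw [rho_eq]; ext i; fin_cases i <;> simp

lemma rho_two : (rho : Fin 2 → ℤ) = ![1, 0] := by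
  rw [rho_eq]; ext i; fin_cases i <;> simp

section Field

variable {K : Type*} [Field K] [Algebra ℂ K]

/-- Here `a`, `b`, `e` stand for the three fractions, `P` for `vdm ^ k` and `g` for the symmetric
factor. The logarithmic derivatives of `P` are `k` plus `k / 2` times signed sums of `2a - 1`, `2b -
1`, `2e - 1`, which explains the shift `c + k`. The potential cancels, and the partial fraction
relation `hab` removes the three-body products. -/
lemma conj_ham_three (D : Fin 3 → Derivation ℂ K K)
    {a b e P g c k : K} (hab : a * e = a * b + b * e - b)
    (hc : ∀ i, D i c = 0) (hk : ∀ i, D i k = 0)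
    (h0a : D 0 a = a - a ^ 2) (h1a : D 1 a = a ^ 2 - a)
    (h0b : D 0 b = b - b ^ 2) (h2b : D 2 b = b ^ 2 - b)
    (h1e : D 1 e = e - e ^ 2) (h2e : D 2 e = e ^ 2 - e)
    (h0 : D 0 P = k * (a + b) * P) (h1 : D 1 P = k * (1 - a + e) * P)
    (h2 : D 2 P = k * (2 - b - e) * P) (E : Fin 3 → K → K)
    (hE : ∀ i f, E i f = D i f + (c + k) * f) :
    D 0 (D 0 (P * g) + c * (P * g)) + c * (D 0 (P * g) + c * (P * g)) +
    (D 1 (D 1 (P * g) + c * (P * g)) + c * (D 1 (P * g) + c * (P * g))) +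
    (D 2 (D 2 (P * g) + c * (P * g)) + c * (D 2 (P * g) + c * (P * g))) -
    2 * k * (k - 1) * (((a ^ 2 - a) + (b ^ 2 - b) + (e ^ 2 - e)) * (P * g)) =
    P * (E 0 (E 0 g) + E 1 (E 1 g) + E 2 (E 2 g) + 2 * k ^ 2 * g +
      k * ((2 * a - 1) * (E 0 g - E 1 g) + (2 * b - 1) * (E 0 g - E 2 g) +
        (2 * e - 1) * (E 1 g - E 2 g))) := by
  have D1 : ∀ i, D i (1 : K) = 0 := fun i => (D i).map_one_eq_zero
  have D2 : ∀ i, D i (2 : K) = 0 := fun i => by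
    have := (D i).map_natCast 2; simpa using this
  simp only [hE, Derivation.leibniz, map_add, map_sub, smul_eq_mul, h0, h1, h2, hc, hk, h0a, h1a,
    h0b, h2b, h1e, h2e, D1, D2]
  linear_combination (-2 * k ^ 2 * P * g) * hab

/-- With two particles the logarithmic derivatives of `P` are `k / 2` plus or minus `k / 2` times
`2a - 1`, hence the shift `c + k / 2`. -/
lemma conj_ham_two (D : Fin 2 → Derivation ℂ K K) {a P g c k : K}
    (hc : ∀ i, D i c = 0) (hk : ∀ i, D i k = 0)
    (h0a : D 0 a = a - a ^ 2) (h1a : D 1 a = a ^ 2 - a)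
    (h0 : D 0 P = k * a * P) (h1 : D 1 P = k * (1 - a) * P) (E : Fin 2 → K → K)
    (hE : ∀ i f, E i f = D i f + (c + k / 2) * f) :
    D 0 (D 0 (P * g) + c * (P * g)) + c * (D 0 (P * g) + c * (P * g)) +
    (D 1 (D 1 (P * g) + c * (P * g)) + c * (D 1 (P * g) + c * (P * g))) -
    2 * k * (k - 1) * ((a ^ 2 - a) * (P * g)) =
    P * (E 0 (E 0 g) + E 1 (E 1 g) + k ^ 2 / 2 * g +
      k * ((2 * a - 1) * (E 0 g - E 1 g))) := by
  have D1 : ∀ i, D i (1 : K) = 0 := fun i => (D i).map_one_eq_zero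
  have D2 : ∀ i, D i (2 : K) = 0 := fun i => by
    have := (D i).map_natCast 2; simpa using this
  have hz : (2 : K) ≠ 0 := by
    have h := (map_ne_zero (algebraMap ℂ K)).2 (two_ne_zero (α := ℂ))
    rwa [map_ofNat] at h
  have D3 : ∀ i, D i (k / 2) = 0 := fun i => by rw [Derivation.leibniz_div, hk, D2]; simp
  simp only [hE, Derivation.leibniz, map_add, map_sub, smul_eq_mul, h0, h1, hc, hk, h0a, h1a,
    D1, D3]
  field_simp
  ring

/-- The same conjugation for the cubic integral: the double poles cancel and only products of the
`2a - 1`, `2b - 1`, `2e - 1` survive, each with at most simple poles. -/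
lemma conj_cub_three (D : Fin 3 → Derivation ℂ K K)
    {a b e P g c k : K} (hab : a * e = a * b + b * e - b)
    (hc : ∀ i, D i c = 0) (hk : ∀ i, D i k = 0)
    (h0a : D 0 a = a - a ^ 2) (h0b : D 0 b = b - b ^ 2) (h1b : D 1 b = 0)
    (h0e : D 0 e = 0) (h1e : D 1 e = e - e ^ 2)
    (h0 : D 0 P = k * (a + b) * P) (h1 : D 1 P = k * (1 - a + e) * P)
    (h2 : D 2 P = k * (2 - b - e) * P)
    (hDc : ∀ i j (f : K), D i (D j f) = D j (D i f)) (E : Fin 3 → K → K)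
    (hE : ∀ i f, E i f = D i f + (c + k) * f) :
    D 0 (D 1 (D 2 (P * g) + c * (P * g)) + c * (D 2 (P * g) + c * (P * g))) +
    c * (D 1 (D 2 (P * g) + c * (P * g)) + c * (D 2 (P * g) + c * (P * g))) +
    k * (k - 1) * ((a ^ 2 - a) * (D 2 (P * g) + c * (P * g)) +
      (b ^ 2 - b) * (D 1 (P * g) + c * (P * g)) + (e ^ 2 - e) * (D 0 (P * g) + c * (P * g))) =
    P * (E 0 (E 1 (E 2 g)) - k / 2 * ((2 * a - 1) * E 2 (E 0 g - E 1 g) +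
      (2 * b - 1) * E 1 (E 0 g - E 2 g) + (2 * e - 1) * E 0 (E 1 g - E 2 g)) +
      k ^ 2 / 2 * (((2 * a - 1) * (2 * b - 1) - 1) * E 0 g + (-(2 * a - 1) * (2 * e - 1) - 1) * E 1 g
        + ((2 * b - 1) * (2 * e - 1) - 1) * E 2 g)) := by
  have D1 : ∀ i, D i (1 : K) = 0 := fun i => (D i).map_one_eq_zero
  have D2 : ∀ i, D i (2 : K) = 0 := fun i => by
    have := (D i).map_natCast 2; simpa using this
  have hz : (2 : K) ≠ 0 := by
    have h := (map_ne_zero (algebraMap ℂ K)).2 (two_ne_zero (α := ℂ))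
    rwa [map_ofNat] at h
  simp only [pow_two] at h0a h0b h1e ⊢
  simp only [hE, Derivation.leibniz, map_add, map_sub, map_zero, smul_eq_mul, h0, h1, h2, hc, hk,
    h0a, h0b, h1b, h0e, h1e, D1, D2, hDc 1 0, hDc 2 0, hDc 2 1]
  field_simp
  linear_combination (P * k ^ 2 * (2 * (D 0 g + D 1 g + D 2 g) + 6 * c * g + 6 * k * g)) * hab

end Field

/-- Conjugation of the trigonometric Hamiltonian by a power of the Vandermonde product, times the
Vandermonde product, for three particles. -/
def hamNum3 (c : ℂ) (k : ℕ) (G : Laurent 3) : Laurent 3 :=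
  vdm * (shiftDel (c + k) 0 (shiftDel (c + k) 0 G) + shiftDel (c + k) 1 (shiftDel (c + k) 1 G) +
    shiftDel (c + k) 2 (shiftDel (c + k) 2 G) + (2 * k ^ 2 : ℂ) • G) +
  (k : ℂ) • ((X 0 + X 1) * ((X 0 - X 2) * (X 1 - X 2)) *
      (shiftDel (c + k) 0 G - shiftDel (c + k) 1 G) +
    (X 0 + X 2) * ((X 0 - X 1) * (X 1 - X 2)) * (shiftDel (c + k) 0 G - shiftDel (c + k) 2 G) +
    (X 1 + X 2) * ((X 0 - X 1) * (X 0 - X 2)) * (shiftDel (c + k) 1 G - shiftDel (c + k) 2 G))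

/-- Conjugation of the trigonometric Hamiltonian by a power of the Vandermonde product, times the
Vandermonde product, for two particles. -/
def hamNum2 (c : ℂ) (k : ℕ) (G : Laurent 2) : Laurent 2 :=
  vdm * (shiftDel (c + k / 2) 0 (shiftDel (c + k / 2) 0 G) +
    shiftDel (c + k / 2) 1 (shiftDel (c + k / 2) 1 G) + (k ^ 2 / 2 : ℂ) • G) +
  (k : ℂ) • ((X 0 + X 1) * (shiftDel (c + k / 2) 0 G - shiftDel (c + k / 2) 1 G))

/-- Conjugation of the trigonometric cubic integral by a power of the Vandermonde product, times
the Vandermonde product. -/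
def cubNum3 (c : ℂ) (k : ℕ) (G : Laurent 3) : Laurent 3 :=
  vdm * (shiftDel (c + k) 0 (shiftDel (c + k) 1 (shiftDel (c + k) 2 G))) -
  (k / 2 : ℂ) • ((X 0 + X 1) * ((X 0 - X 2) * (X 1 - X 2)) *
      shiftDel (c + k) 2 (shiftDel (c + k) 0 G - shiftDel (c + k) 1 G) +
    (X 0 + X 2) * ((X 0 - X 1) * (X 1 - X 2)) *
      shiftDel (c + k) 1 (shiftDel (c + k) 0 G - shiftDel (c + k) 2 G) +
    (X 1 + X 2) * ((X 0 - X 1) * (X 0 - X 2)) *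
      shiftDel (c + k) 0 (shiftDel (c + k) 1 G - shiftDel (c + k) 2 G)) +
  (k ^ 2 / 2 : ℂ) • (((X 0 + X 1) * ((X 0 + X 2) * (X 1 - X 2)) - vdm) * shiftDel (c + k) 0 G +
    (-((X 0 + X 1) * ((X 1 + X 2) * (X 0 - X 2))) - vdm) * shiftDel (c + k) 1 G +
    ((X 0 + X 2) * ((X 1 + X 2) * (X 0 - X 1)) - vdm) * shiftDel (c + k) 2 G)

lemma fracR_rel_three : (fracR 0 1 * fracR 1 2 : Ratl 3) =
    fracR 0 1 * fracR 0 2 + fracR 0 2 * fracR 1 2 - fracR 0 2 := by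
  have h1 := toRatl_X_sub_ne_zero' (show (0 : Fin 3) ≠ 1 by decide)
  have h2 := toRatl_X_sub_ne_zero' (show (0 : Fin 3) ≠ 2 by decide)
  have h3 := toRatl_X_sub_ne_zero' (show (1 : Fin 3) ≠ 2 by decide)
  simp only [fracR, map_sub]
  field_simp
  ring

lemma delR_vdm_pow_three (k : ℕ) (i : Fin 3) : delR i (toRatl (vdm ^ k) : Ratl 3) =
    (k : Ratl 3) * (![fracR 0 1 + fracR 0 2, 1 - fracR 0 1 + fracR 1 2, 2 - fracR 0 2 - fracR 1 2] i) *
      toRatl (vdm ^ k) := by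
  rw [map_pow]
  refine delR_pow_of_eq ?_ k
  rw [vdm_three, map_mul toRatl, map_mul toRatl]
  have e1 := delR_X_sub i (show (0 : Fin 3) ≠ 1 by decide)
  have e2 := delR_X_sub i (show (0 : Fin 3) ≠ 2 by decide)
  have e3 := delR_X_sub i (show (1 : Fin 3) ≠ 2 by decide)
  rw [← map_sub] at e1 e2 e3
  rw [Derivation.leibniz, Derivation.leibniz, e1, e2, e3]
  fin_cases i <;> simp only [smul_eq_mul] <;> simp <;> ring

lemma delR_vdm_pow_two (k : ℕ) (i : Fin 2) : delR i (toRatl (vdm ^ k) : Ratl 2) =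
    (k : Ratl 2) * (![fracR 0 1, 1 - fracR 0 1] i) * toRatl (vdm ^ k) := by
  rw [map_pow]
  refine delR_pow_of_eq ?_ k
  rw [vdm_two, map_sub, delR_X_sub _ (show (0 : Fin 2) ≠ 1 by decide)]
  fin_cases i <;> simp

lemma hamR_zero_three (c : ℂ) (k : ℕ) (G : Laurent 3) :
    toRatl vdm * hamR c k 0 (toRatl (vdm ^ k * G)) = toRatl (vdm ^ k * hamNum3 c k G) := by
  have h01 : (0 : Fin 3) ≠ 1 := by decide
  have h02 : (0 : Fin 3) ≠ 2 := by decide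
  have h12 : (1 : Fin 3) ≠ 2 := by decide
  have key := conj_ham_three (fun i : Fin 3 => delR i) (a := fracR 0 1) (b := fracR 0 2)
    (e := fracR 1 2) (P := toRatl (vdm ^ k)) (g := toRatl G) (c := algebraMap ℂ _ c)
    (k := (k : Ratl 3)) fracR_rel_three (fun i => delR_algebraMap i c)
    (fun i => (delR i).map_natCast k) (by simp [delR_fracR _ h01]) (by simp [delR_fracR _ h01])
    (by simp [delR_fracR _ h02]) (by simp [delR_fracR _ h02]) (by simp [delR_fracR _ h12])
    (by simp [delR_fracR _ h12]) (by simpa using delR_vdm_pow_three k 0)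
    (by simpa using delR_vdm_pow_three k 1) (by simpa using delR_vdm_pow_three k 2)
    (fun i f => shiftR (c + k) i f) (fun i f => by simp [shiftR_apply])
  have hL : hamR c k 0 (toRatl (vdm ^ k * G)) = _ := Eq.trans (by
    simp only [hamR, if_true, LinearMap.sub_apply, LinearMap.smul_apply, Fin.sum_univ_three,
      LinearMap.add_apply, LinearMap.comp_apply, LinearMap.mulLeft_apply, sum_pairs_three,
      potR_zero_eq h01, potR_zero_eq h02, potR_zero_eq h12, shiftR_apply]
    simp only [Algebra.smul_def, map_mul, map_sub, map_natCast, map_ofNat, map_one]) key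
  rw [hL, hamNum3, vdm_three]
  simp only [map_add, map_mul, map_sub, toRatl_shiftDel, map_smul]
  simp only [Algebra.smul_def, map_mul, map_natCast, map_ofNat, map_pow]
  have e1 := two_fracR_sub_one h01
  have e2 := two_fracR_sub_one h02
  have e3 := two_fracR_sub_one h12
  -- Replacing each `X i + X j` by `(2 * fracR i j - 1) * (X i - X j)` makes both sides polynomials
  -- in the same generators.
  rw [← e1, ← e2, ← e3]
  ring

lemma hamR_zero_two (c : ℂ) (k : ℕ) (G : Laurent 2) :
    toRatl vdm * hamR c k 0 (toRatl (vdm ^ k * G)) = toRatl (vdm ^ k * hamNum2 c k G) := by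
  have h01 : (0 : Fin 2) ≠ 1 := by decide
  have key := conj_ham_two (fun i : Fin 2 => delR i) (a := fracR 0 1)
    (P := toRatl (vdm ^ k)) (g := toRatl G) (c := algebraMap ℂ _ c)
    (k := (k : Ratl 2)) (fun i => delR_algebraMap i c)
    (fun i => (delR i).map_natCast k) (by simp [delR_fracR _ h01]) (by simp [delR_fracR _ h01])
    (by simpa using delR_vdm_pow_two k 0) (by simpa using delR_vdm_pow_two k 1)
    (fun i f => shiftR (c + k / 2) i f) (fun i f => by
      rw [shiftR_apply, map_add, map_div₀, map_natCast, map_ofNat])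
  have hL : hamR c k 0 (toRatl (vdm ^ k * G)) = _ := Eq.trans (by
    simp only [hamR, if_true, LinearMap.sub_apply, LinearMap.smul_apply, Fin.sum_univ_two,
      LinearMap.add_apply, LinearMap.comp_apply, LinearMap.mulLeft_apply, sum_pairs_two,
      potR_zero_eq h01, shiftR_apply]
    simp only [Algebra.smul_def, map_mul, map_sub, map_natCast, map_ofNat, map_one]) key
  rw [hL, hamNum2, vdm_two]
  simp only [map_add, map_mul, map_sub, toRatl_shiftDel, map_smul]
  simp only [Algebra.smul_def, map_mul, map_natCast, map_ofNat, map_pow, map_div₀]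
  rw [← two_fracR_sub_one h01]
  ring

lemma cubR_zero_three (c : ℂ) (k : ℕ) (G : Laurent 3) :
    toRatl vdm * cubR c k 0 (toRatl (vdm ^ k * G)) = toRatl (vdm ^ k * cubNum3 c k G) := by
  have h01 : (0 : Fin 3) ≠ 1 := by decide
  have h02 : (0 : Fin 3) ≠ 2 := by decide
  have h12 : (1 : Fin 3) ≠ 2 := by decide
  have key := conj_cub_three (fun i : Fin 3 => delR i) (a := fracR 0 1) (b := fracR 0 2)
    (e := fracR 1 2) (P := toRatl (vdm ^ k)) (g := toRatl G) (c := algebraMap ℂ _ c)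
    (k := (k : Ratl 3)) fracR_rel_three (fun i => delR_algebraMap i c)
    (fun i => (delR i).map_natCast k) (by simp [delR_fracR _ h01]) (by simp [delR_fracR _ h02])
    (by simp [delR_fracR _ h02]) (by simp [delR_fracR _ h12]) (by simp [delR_fracR _ h12])
    (by simpa using delR_vdm_pow_three k 0)
    (by simpa using delR_vdm_pow_three k 1) (by simpa using delR_vdm_pow_three k 2)
    (fun i j f => delR_comm i j f)
    (fun i f => shiftR (c + k) i f) (fun i f => by simp [shiftR_apply])
  have hL : cubR c k 0 (toRatl (vdm ^ k * G)) = _ := Eq.trans (by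
    simp only [cubR, if_true, LinearMap.add_apply, LinearMap.smul_apply,
      LinearMap.comp_apply, LinearMap.mulLeft_apply,
      potR_zero_eq h01, potR_zero_eq h02, potR_zero_eq h12, shiftR_apply]
    simp only [Algebra.smul_def, map_mul, map_sub, map_natCast, map_one]) key
  rw [hL, cubNum3, vdm_three]
  simp only [map_add, map_mul, map_sub, map_neg, toRatl_shiftDel, map_smul]
  simp only [Algebra.smul_def, map_mul, map_natCast, map_ofNat, map_pow, map_div₀]
  have e1 := two_fracR_sub_one h01
  have e2 := two_fracR_sub_one h02
  have e3 := two_fracR_sub_one h12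
  rw [← e1, ← e2, ← e3]
  ring

end CalogeroMoser

end

/-! ### Antisymmetry, degree and leading coefficient of the conjugated operators. -/

noncomputable section

namespace CalogeroMoser

variable {N : ℕ}

lemma antisymm_of_adjacent_swaps {n : ℕ} {f : Laurent (n + 1)}
    (h : ∀ i : Fin n, permAct (Equiv.swap i.castSucc i.succ) f = -f) (s : Equiv.Perm (Fin (n + 1))) :
    permAct s f = ((Equiv.Perm.sign s : ℤ) : Laurent (n + 1)) * f := by
  have hs : s ∈ Submonoid.closure
      (Set.range fun i : Fin n => Equiv.swap i.castSucc i.succ) := by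
    rw [Equiv.Perm.mclosure_swap_castSucc_succ]; trivial
  induction hs using Submonoid.closure_induction with
  | mem x hx =>
    obtain ⟨i, rfl⟩ := hx
    rw [h i, Equiv.Perm.sign_swap Fin.castSucc_lt_succ.ne]
    simp
  | one =>
    ext nu
    simp [coeff_permAct]
  | mul x y _ _ hx hy =>
    rw [permAct_mul_apply, hy, map_mul, hx, map_intCast, Equiv.Perm.sign_mul]
    push_cast
    ring

lemma permAct_shiftDel (s : Equiv.Perm (Fin N)) (c : ℂ) (i : Fin N) (f : Laurent N) :
    permAct s (shiftDel c i f) = shiftDel c (s i) (permAct s f) := by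
  simp only [shiftDel_apply, map_add, permAct_del, map_smul]

lemma shiftDel_comm (c : ℂ) (i j : Fin N) (f : Laurent N) :
    shiftDel c i (shiftDel c j f) = shiftDel c j (shiftDel c i f) := by
  ext nu; simp only [coeff_shiftDel]; ring

/-- After conjugation by `vdm ^ k` the operator has at most simple poles along the diagonals. Its
numerator over `vdm` is antisymmetric, so `vdm` divides it and the poles disappear on symmetric
polynomials. -/
lemma exists_of_num {k : ℕ} {m : ℤ} {T : Ratl N →ₗ[ℂ] Ratl N} {G n : Laurent N}
    (hT : toRatl vdm * T (toRatl (vdm ^ k * G)) = toRatl (vdm ^ k * n))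
    (hanti : ∀ s : Equiv.Perm (Fin N), permAct s n = ((Equiv.Perm.sign s : ℤ) : Laurent N) * n)
    (hh : IsHomog n (totDeg (rho : Fin N → ℤ) + m)) :
    ∃ Q ∈ symmSub N m, vdm * Q = n ∧ toRatl (vdm ^ k * Q) = T (toRatl (vdm ^ k * G)) := by
  obtain ⟨Q, hQ, rfl⟩ := exists_vdm_mul_eq hanti hh
  refine ⟨Q, hQ, rfl, ?_⟩
  have h0 : (toRatl vdm : Ratl N) ≠ 0 := by
    rw [Ne, ← map_zero toRatl, toRatl_injective.eq_iff]; exact vdm_ne_zero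
  refine mul_left_cancel₀ h0 ?_
  rw [hT, ← map_mul]
  congr 1
  ring

lemma preserves_of_num {k : ℕ} {m : ℤ} {T : Ratl N →ₗ[ℂ] Ratl N} {num : Laurent N → Laurent N}
    (hT : ∀ G, toRatl vdm * T (toRatl (vdm ^ k * G)) = toRatl (vdm ^ k * num G))
    (hanti : ∀ G ∈ symmSub N m, ∀ s : Equiv.Perm (Fin N),
      permAct s (num G) = ((Equiv.Perm.sign s : ℤ) : Laurent N) * num G)
    (hh : ∀ G ∈ symmSub N m, IsHomog (num G) (totDeg (rho : Fin N → ℤ) + m)) :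
    ∀ f ∈ vSpace N k m, ∃ g ∈ vSpace N k m, toRatl g = T (toRatl f) := by
  rintro f ⟨G, hG, rfl⟩
  obtain ⟨Q, hQ, -, h⟩ := exists_of_num (hT G) (hanti G hG) (hh G hG)
  exact ⟨vdm ^ k * Q, ⟨Q, hQ, rfl⟩, h⟩

/-- The state with dominant exponent `z`. -/
def stateVec (k : ℕ) {m : ℤ} (z : Dom N m) : vSpace N k m :=
  ⟨vdm ^ k * msymm z.1, msymm z.1, msymm_mem z, rfl⟩

lemma triangular_of_num {k : ℕ} {m : ℤ} {T : Ratl N →ₗ[ℂ] Ratl N} {num : Laurent N → Laurent N}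
    (hT : ∀ G, toRatl vdm * T (toRatl (vdm ^ k * G)) = toRatl (vdm ^ k * num G))
    (hanti : ∀ G ∈ symmSub N m, ∀ s : Equiv.Perm (Fin N),
      permAct s (num G) = ((Equiv.Perm.sign s : ℤ) : Laurent N) * num G)
    (hh : ∀ G ∈ symmSub N m, IsHomog (num G) (totDeg (rho : Fin N → ℤ) + m))
    (S : vSpace N k m →ₗ[ℂ] vSpace N k m)
    (hS : ∀ f : vSpace N k m, toRatl (S f : Laurent N) = T (toRatl (f : Laurent N)))
    (z : Dom N m) {e : ℂ} (he : HasTop (num (msymm z.1)) (rho + z.1) e) :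
    S (stateVec k z) - e • stateVec k z ∈ lowerSpan (stateVec k) Dom.lt z := by
  obtain ⟨Q, hQ, hn, h⟩ := exists_of_num (hT _) (hanti _ (msymm_mem z)) (hh _ (msymm_mem z))
  rw [← hn] at he
  have h1 : S (stateVec k z) = ⟨vdm ^ k * Q, Q, hQ, rfl⟩ :=
    Subtype.ext (toRatl_injective ((hS _).trans h.symm))
  have h2 := sub_smul_msymm_mem hQ z he.of_vdm_mul
  have h3 := Submodule.mem_map_of_mem (f := LinearMap.mulLeft ℂ (vdm ^ k : Laurent N)) h2
  rw [Submodule.map_span, Set.image_image] at h3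
  have h4 : (S (stateVec k z) - e • stateVec k z : vSpace N k m).1 ∈
      (lowerSpan (stateVec k) Dom.lt z).map (vSpace N k m).subtype := by
    rw [lowerSpan, Submodule.map_span, Set.image_image, h1]
    rw [LinearMap.mulLeft_apply, mul_sub, mul_smul_comm] at h3
    exact h3
  obtain ⟨u, hu, h5⟩ := h4
  rwa [← Subtype.ext h5]

lemma preserves_mul {k : ℕ} {m : ℤ} {w : Laurent N} (hs : ∀ s, permAct s w = w)
    (hw : IsHomog w 0) : ∀ f ∈ vSpace N k m, w * f ∈ vSpace N k m := by
  rintro f ⟨G, hG, rfl⟩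
  refine ⟨w * G, ⟨fun s => by rw [map_mul, hs, hG.1], ?_⟩, ?_⟩
  · have := hw.mul (show IsHomog G m from hG.2)
    rwa [zero_add] at this
  · simp only [LinearMap.mulLeft_apply]; ring

lemma isHomog_vdm_two : IsHomog (vdm : Laurent 2) 1 := by
  have := isHomog_vdm (N := 2)
  rwa [totDeg_apply, rho_two, Fin.sum_univ_two] at this

lemma isHomog_vdm_three : IsHomog (vdm : Laurent 3) 3 := by
  have := isHomog_vdm (N := 3)
  rwa [totDeg_apply, rho_three, Fin.sum_univ_three] at this

lemma totDeg_rho_two : totDeg (rho : Fin 2 → ℤ) = 1 := by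
  rw [totDeg_apply, rho_two, Fin.sum_univ_two]; rfl

lemma totDeg_rho_three : totDeg (rho : Fin 3 → ℤ) = 3 := by
  rw [totDeg_apply, rho_three, Fin.sum_univ_three]; rfl

section Two

variable {c : ℂ} {k : ℕ} {m : ℤ} {G : Laurent 2}

lemma hamNum2_anti (hG : G ∈ symmSub 2 m) (s : Equiv.Perm (Fin 2)) :
    permAct s (hamNum2 c k G) = ((Equiv.Perm.sign s : ℤ) : Laurent 2) * hamNum2 c k G := by
  refine antisymm_of_adjacent_swaps (n := 1) (fun i => ?_) s
  obtain rfl : i = 0 := Subsingleton.elim _ _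
  have e0 : Equiv.swap (0 : Fin 2) 1 0 = 1 := by decide
  have e1 : Equiv.swap (0 : Fin 2) 1 1 = 0 := by decide
  simp only [Fin.castSucc_zero, Fin.succ_zero_eq_one, hamNum2, vdm_two, map_add, map_mul, map_sub,
    map_smul, permAct_X, permAct_shiftDel, hG.1, e0, e1]
  simp only [Algebra.smul_def]
  ring

lemma hamNum2_homog (hG : G ∈ symmSub 2 m) :
    IsHomog (hamNum2 c k G) (totDeg (rho : Fin 2 → ℤ) + m) := by
  have hG' : IsHomog G m := hG.2
  rw [totDeg_rho_two]
  exact (isHomog_vdm_two.mul ((((hG'.shiftDel _ _).shiftDel _ _).add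
    ((hG'.shiftDel _ _).shiftDel _ _)).add (hG'.smul _))).add
    ((((isHomog_X 0).add (isHomog_X 1)).mul ((hG'.shiftDel _ _).sub (hG'.shiftDel _ _))).smul _)

/-- Each quotient `(X i + X j) / (X i - X j)` has leading coefficient `1`. With `x_i` the shifted
entries the value is `x_0² + x_1² + k² / 2 + k (x_0 - x_1)`, and completing squares gives the
shifted exponents. -/
lemma hamNum2_top (z : Dom 2 m) : HasTop (hamNum2 c k (msymm z.1)) (rho + z.1)
    (∑ i, (z.1 i + c + k * (2 - 1 - (i : ℕ))) ^ 2) := by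
  have ht := hasTop_msymm z
  have h01 : (0 : Fin 2) < 1 := by decide
  have hr : (Pi.single 0 1 : Fin 2 → ℤ) = rho := by
    rw [rho_two]; ext i; fin_cases i <;> simp
  have hX := hasTop_X_add h01
  rw [hr] at hX
  refine ((hasTop_vdm.mul ((((ht.shiftDel _ _).shiftDel _ _).add
    ((ht.shiftDel _ _).shiftDel _ _)).add (ht.smul _))).add
    ((hX.mul ((ht.shiftDel _ _).sub (ht.shiftDel _ _))).smul _)).congr rfl ?_
  rw [Fin.sum_univ_two]
  simp
  ring

end Two

section Three

variable {c : ℂ} {k : ℕ} {m : ℤ} {G : Laurent 3}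

lemma antisymm_three {f : Laurent 3} (h0 : permAct (Equiv.swap (0 : Fin 3) 1) f = -f)
    (h1 : permAct (Equiv.swap (1 : Fin 3) 2) f = -f) (s : Equiv.Perm (Fin 3)) :
    permAct s f = ((Equiv.Perm.sign s : ℤ) : Laurent 3) * f := by
  refine antisymm_of_adjacent_swaps (n := 2) (fun i => ?_) s
  fin_cases i
  · exact h0
  · exact h1

lemma swap_three_values : (Equiv.swap (0 : Fin 3) 1 0 = 1 ∧ Equiv.swap (0 : Fin 3) 1 1 = 0 ∧
    Equiv.swap (0 : Fin 3) 1 2 = 2) ∧ (Equiv.swap (1 : Fin 3) 2 0 = 0 ∧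
    Equiv.swap (1 : Fin 3) 2 1 = 2 ∧ Equiv.swap (1 : Fin 3) 2 2 = 1) := by decide

lemma hamNum3_anti (hG : G ∈ symmSub 3 m) (s : Equiv.Perm (Fin 3)) :
    permAct s (hamNum3 c k G) = ((Equiv.Perm.sign s : ℤ) : Laurent 3) * hamNum3 c k G := by
  obtain ⟨⟨a0, a1, a2⟩, b0, b1, b2⟩ := swap_three_values
  refine antisymm_three ?_ ?_ s
  all_goals
    simp only [hamNum3, vdm_three, map_add, map_mul, map_sub, map_smul, permAct_X,
      permAct_shiftDel, hG.1, a0, a1, a2, b0, b1, b2]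
    simp only [Algebra.smul_def]
    ring

lemma cubNum3_anti (hG : G ∈ symmSub 3 m) (s : Equiv.Perm (Fin 3)) :
    permAct s (cubNum3 c k G) = ((Equiv.Perm.sign s : ℤ) : Laurent 3) * cubNum3 c k G := by
  obtain ⟨⟨a0, a1, a2⟩, b0, b1, b2⟩ := swap_three_values
  refine antisymm_three ?_ ?_ s
  all_goals
    simp only [cubNum3, vdm_three, map_add, map_mul, map_sub, map_smul, permAct_X, map_neg,
      permAct_shiftDel, hG.1, a0, a1, a2, b0, b1, b2, shiftDel_comm _ 1 0, shiftDel_comm _ 2 0,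
      shiftDel_comm _ 2 1]
    simp only [Algebra.smul_def]
    ring

lemma isHomog_X_add_three (i j : Fin 3) : IsHomog (X i + X j : Laurent 3) 1 :=
  (isHomog_X i).add (isHomog_X j)

lemma isHomog_X_sub_three (i j : Fin 3) : IsHomog (X i - X j : Laurent 3) 1 :=
  (isHomog_X i).sub (isHomog_X j)

lemma hamNum3_homog (hG : G ∈ symmSub 3 m) :
    IsHomog (hamNum3 c k G) (totDeg (rho : Fin 3 → ℤ) + m) := by
  have hG' : IsHomog G m := hG.2
  have hE : ∀ i, IsHomog (shiftDel (c + k) i G) m := fun i => hG'.shiftDel _ _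
  have hB : ∀ i j a b u v p q : Fin 3, IsHomog ((X i + X j) * ((X a - X b) * (X u - X v)) *
      (shiftDel (c + k) p G - shiftDel (c + k) q G)) (1 + (1 + 1) + m) := fun i j a b u v p q =>
    ((isHomog_X_add_three _ _).mul ((isHomog_X_sub_three _ _).mul (isHomog_X_sub_three _ _))).mul
      ((hE _).sub (hE _))
  rw [totDeg_rho_three]
  exact (isHomog_vdm_three.mul (((((hE _).shiftDel _ _).add ((hE _).shiftDel _ _)).add
    ((hE _).shiftDel _ _)).add (hG'.smul _))).add
    ((((hB _ _ _ _ _ _ _ _).add (hB _ _ _ _ _ _ _ _)).add (hB _ _ _ _ _ _ _ _)).smul _)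

lemma cubNum3_homog (hG : G ∈ symmSub 3 m) :
    IsHomog (cubNum3 c k G) (totDeg (rho : Fin 3 → ℤ) + m) := by
  have hG' : IsHomog G m := hG.2
  have hE : ∀ i, IsHomog (shiftDel (c + k) i G) m := fun i => hG'.shiftDel _ _
  have hB : ∀ i j a b u v p q r : Fin 3, IsHomog ((X i + X j) * ((X a - X b) * (X u - X v)) *
      shiftDel (c + k) r (shiftDel (c + k) p G - shiftDel (c + k) q G)) (1 + (1 + 1) + m) :=
    fun i j a b u v p q r => ((isHomog_X_add_three _ _).mul
      ((isHomog_X_sub_three _ _).mul (isHomog_X_sub_three _ _))).mul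
      (((hE _).sub (hE _)).shiftDel _ _)
  have hT : ∀ i j a b u v : Fin 3, IsHomog ((X i + X j) * ((X a + X b) * (X u - X v)) : Laurent 3)
      (1 + (1 + 1)) :=
    fun i j a b u v => (isHomog_X_add_three _ _).mul
      ((isHomog_X_add_three _ _).mul (isHomog_X_sub_three _ _))
  rw [totDeg_rho_three]
  exact ((isHomog_vdm_three.mul (((hE _).shiftDel _ _).shiftDel _ _)).sub
    ((((hB _ _ _ _ _ _ _ _ _).add (hB _ _ _ _ _ _ _ _ _)).add (hB _ _ _ _ _ _ _ _ _)).smul _)).add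
    (((((((hT _ _ _ _ _ _).sub isHomog_vdm_three).mul (hE _)).add
      (((hT _ _ _ _ _ _).neg.sub isHomog_vdm_three).mul (hE _))).add
      (((hT _ _ _ _ _ _).sub isHomog_vdm_three).mul (hE _)))).smul _)

lemma single_sum_three {u : Fin 3 → ℤ} (h0 : u 0 = 2) (h1 : u 1 = 1) (h2 : u 2 = 0) : u = rho := by
  rw [rho_three]; ext i; fin_cases i <;> simp [h0, h1, h2]

lemma hasTop_factors_three :
    HasTop ((X 0 + X 1) * ((X 0 - X 2) * (X 1 - X 2)) : Laurent 3) rho 1 ∧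
    HasTop ((X 0 + X 2) * ((X 0 - X 1) * (X 1 - X 2)) : Laurent 3) rho 1 ∧
    HasTop ((X 1 + X 2) * ((X 0 - X 1) * (X 0 - X 2)) : Laurent 3) rho 1 ∧
    HasTop ((X 0 + X 1) * ((X 0 + X 2) * (X 1 - X 2)) : Laurent 3) rho 1 ∧
    HasTop ((X 0 + X 1) * ((X 1 + X 2) * (X 0 - X 2)) : Laurent 3) rho 1 ∧
    HasTop ((X 0 + X 2) * ((X 1 + X 2) * (X 0 - X 1)) : Laurent 3) rho 1 := by
  have h01 : (0 : Fin 3) < 1 := by decide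
  have h02 : (0 : Fin 3) < 2 := by decide
  have h12 : (1 : Fin 3) < 2 := by decide
  have p1 := hasTop_X_add h01
  have p2 := hasTop_X_add h02
  have p3 := hasTop_X_add h12
  have q1 := hasTop_X_sub h01
  have q2 := hasTop_X_sub h02
  have q3 := hasTop_X_sub h12
  refine ⟨(p1.mul (q2.mul q3)).congr ?_ (by norm_num), (p2.mul (q1.mul q3)).congr ?_ (by norm_num),
    (p3.mul (q1.mul q2)).congr ?_ (by norm_num), (p1.mul (p2.mul q3)).congr ?_ (by norm_num),
    (p1.mul (p3.mul q2)).congr ?_ (by norm_num), (p2.mul (p3.mul q1)).congr ?_ (by norm_num)⟩ <;>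
  exact single_sum_three (by simp) (by simp) (by simp)

lemma hamNum3_top (z : Dom 3 m) : HasTop (hamNum3 c k (msymm z.1)) (rho + z.1)
    (∑ i, (z.1 i + c + k * (3 - 1 - (i : ℕ))) ^ 2) := by
  have ht := hasTop_msymm z
  obtain ⟨r1, r2, r3, -, -, -⟩ := hasTop_factors_three
  refine ((hasTop_vdm.mul (((((ht.shiftDel _ _).shiftDel _ _).add
    ((ht.shiftDel _ _).shiftDel _ _)).add ((ht.shiftDel _ _).shiftDel _ _)).add (ht.smul _))).add
    ((((r1.mul ((ht.shiftDel _ _).sub (ht.shiftDel _ _))).add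
    (r2.mul ((ht.shiftDel _ _).sub (ht.shiftDel _ _)))).add
    (r3.mul ((ht.shiftDel _ _).sub (ht.shiftDel _ _)))).smul _)).congr rfl ?_
  rw [Fin.sum_univ_three]
  simp
  ring

/-- Replacing every `(X i + X j) / (X i - X j)` by its leading coefficient `1` turns the conjugated
cubic operator into the product of the three shifted exponents. -/
lemma cubNum3_top (z : Dom 3 m) : HasTop (cubNum3 c k (msymm z.1)) (rho + z.1)
    (∏ i, (z.1 i + c + k * (3 - 1 - (i : ℕ)))) := by
  have ht := hasTop_msymm z
  obtain ⟨r1, r2, r3, s1, s2, s3⟩ := hasTop_factors_three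
  refine (((hasTop_vdm.mul (((ht.shiftDel _ _).shiftDel _ _).shiftDel _ _)).sub
    ((((r1.mul (((ht.shiftDel _ _).sub (ht.shiftDel _ _)).shiftDel _ _)).add
    (r2.mul (((ht.shiftDel _ _).sub (ht.shiftDel _ _)).shiftDel _ _))).add
    (r3.mul (((ht.shiftDel _ _).sub (ht.shiftDel _ _)).shiftDel _ _))).smul _)).add
    (((((s1.sub hasTop_vdm).mul (ht.shiftDel _ _)).add
    ((s2.neg.sub hasTop_vdm).mul (ht.shiftDel _ _))).add
    ((s3.sub hasTop_vdm).mul (ht.shiftDel _ _))).smul _)).congr rfl ?_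
  rw [Fin.prod_univ_three]
  simp
  ring

/-- Conjugation of a coefficient of the cubic integral by a power of the Vandermonde product,
times the Vandermonde product. -/
def cubNumPos (c : ℂ) (k n : ℕ) (G : Laurent 3) : Laurent 3 :=
  (k * (k - 1) : ℂ) • (vdm * (lambertCoeff 0 1 n * shiftDel (c + k) 2 G +
    lambertCoeff 0 2 n * shiftDel (c + k) 1 G + lambertCoeff 1 2 n * shiftDel (c + k) 0 G) +
  (k / 2 : ℂ) • ((lambertCoeff 0 1 n * (-((X 0 + X 2) * ((X 0 - X 1) * (X 1 - X 2))) -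
      (X 1 + X 2) * ((X 0 - X 1) * (X 0 - X 2))) +
    lambertCoeff 0 2 n * (-((X 0 + X 1) * ((X 0 - X 2) * (X 1 - X 2))) +
      (X 1 + X 2) * ((X 0 - X 1) * (X 0 - X 2))) +
    lambertCoeff 1 2 n * ((X 0 + X 1) * ((X 0 - X 2) * (X 1 - X 2)) +
      (X 0 + X 2) * ((X 0 - X 1) * (X 1 - X 2)))) * G))

lemma cubNumPos_anti {n : ℕ} (hG : G ∈ symmSub 3 m) (s : Equiv.Perm (Fin 3)) :
    permAct s (cubNumPos c k n G) = ((Equiv.Perm.sign s : ℤ) : Laurent 3) * cubNumPos c k n G := by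
  obtain ⟨⟨a0, a1, a2⟩, b0, b1, b2⟩ := swap_three_values
  have l1 := lambertCoeff_symm (1 : Fin 3) 0 n
  have l3 := lambertCoeff_symm (2 : Fin 3) 1 n
  refine antisymm_three ?_ ?_ s
  all_goals
    simp only [cubNumPos, vdm_three, map_add, map_mul, map_sub, map_smul, permAct_X, map_neg,
      permAct_shiftDel, hG.1, a0, a1, a2, b0, b1, b2, permAct_lambertCoeff, l1, l3]
    simp only [Algebra.smul_def]
    ring

lemma cubNumPos_homog {n : ℕ} (hG : G ∈ symmSub 3 m) :
    IsHomog (cubNumPos c k n G) (totDeg (rho : Fin 3 → ℤ) + m) := by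
  have hG' : IsHomog G m := hG.2
  have hE : ∀ i j l, IsHomog (lambertCoeff i j n * shiftDel (c + k) l G) (0 + m) :=
    fun i j l => (isHomog_lambertCoeff i j n).mul (hG'.shiftDel _ _)
  have hB : ∀ i j a b u v : Fin 3, IsHomog ((X i + X j) * ((X a - X b) * (X u - X v)) : Laurent 3)
      (1 + (1 + 1)) := fun i j a b u v =>
    (isHomog_X_add_three _ _).mul ((isHomog_X_sub_three _ _).mul (isHomog_X_sub_three _ _))
  have hl := fun i j : Fin 3 => isHomog_lambertCoeff i j n
  rw [totDeg_rho_three]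
  refine IsHomog.smul (IsHomog.add ?_ (IsHomog.smul ?_ _)) _
  · have := isHomog_vdm_three.mul (((hE 0 1 2).add (hE 0 2 1)).add (hE 1 2 0))
    rwa [zero_add] at this
  · have := (((((hl 0 1).mul ((hB 0 2 0 1 1 2).neg.sub (hB 1 2 0 1 0 2))).add
      ((hl 0 2).mul ((hB 0 1 0 2 1 2).neg.add (hB 1 2 0 1 0 2)))).add
      ((hl 1 2).mul ((hB 0 1 0 2 1 2).add (hB 0 2 0 1 1 2))))).mul hG'
    exact this

/-- For `n ≥ 1` the operator has order one, so the only denominators created by conjugation are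
those of the logarithmic derivative of `vdm ^ k`. -/
lemma cubR_pos {n : ℕ} (hn : n ≠ 0) (G : Laurent 3) :
    toRatl vdm * cubR c k n (toRatl (vdm ^ k * G)) = toRatl (vdm ^ k * cubNumPos c k n G) := by
  have h01 : (0 : Fin 3) ≠ 1 := by decide
  have h02 : (0 : Fin 3) ≠ 2 := by decide
  have h12 : (1 : Fin 3) ≠ 2 := by decide
  have hE : ∀ i, shiftR c i (toRatl (vdm ^ k * G)) = toRatl (vdm ^ k) *
      (shiftR (c + k) i (toRatl G) + (k : Ratl 3) *
        (![fracR 0 1 + fracR 0 2, 1 - fracR 0 1 + fracR 1 2, 2 - fracR 0 2 - fracR 1 2] i - 1) *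
        toRatl G) := by
    intro i
    rw [shiftR_apply, shiftR_apply, map_mul, Derivation.leibniz, delR_vdm_pow_three, smul_eq_mul,
      smul_eq_mul, map_add, map_natCast]
    ring
  simp only [cubR, hn, if_false, zero_add, potR, LinearMap.smul_apply, LinearMap.add_apply,
    LinearMap.comp_apply, LinearMap.mulLeft_apply, hE]
  rw [cubNumPos, vdm_three]
  simp only [map_add, map_mul, map_sub, map_neg, toRatl_shiftDel, map_smul]
  simp only [Algebra.smul_def, map_mul, map_sub, map_one, map_natCast, map_ofNat, map_pow, map_div₀]
  have e1 := two_fracR_sub_one h01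
  have e2 := two_fracR_sub_one h02
  have e3 := two_fracR_sub_one h12
  generalize ((toRatl (X 0) - toRatl (X 1)) * (toRatl (X 0) - toRatl (X 2)) *
    (toRatl (X 1) - toRatl (X 2)) : Ratl 3) ^ k = P
  rw [← e1, ← e2, ← e3]
  simp only [Matrix.cons_val_zero, Matrix.cons_val_one, Matrix.cons_val]
  -- Characteristic zero is needed to cancel the coefficient `k / 2`.
  have : CharZero (Ratl 3) := charZero_of_injective_algebraMap (algebraMap ℂ (Ratl 3)).injective
  ring

end Three

end CalogeroMoser

end

noncomputable section

namespace CalogeroMoser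

variable {N : ℕ}

/-! ### The operators on the space of states -/

lemma permAct_sum_lambertCoeff (s : Equiv.Perm (Fin N)) (hN : N = 2 ∨ N = 3) (n : ℕ) :
    permAct s (∑ p ∈ pairs N, lambertCoeff p.1 p.2 n) = ∑ p ∈ pairs N, lambertCoeff p.1 p.2 n := by
  rcases hN with rfl | rfl
  · rw [sum_pairs_two, permAct_lambertCoeff]
    rcases (by decide +revert : (s 0 = 0 ∧ s 1 = 1) ∨ (s 0 = 1 ∧ s 1 = 0)) with ⟨h0, h1⟩ | ⟨h0, h1⟩
    · rw [h0, h1]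
    · rw [h0, h1, lambertCoeff_symm]
  · rw [sum_pairs_three, map_add, map_add, permAct_lambertCoeff, permAct_lambertCoeff,
      permAct_lambertCoeff]
    have l1 := lambertCoeff_symm (1 : Fin 3) 0 n
    have l2 := lambertCoeff_symm (2 : Fin 3) 0 n
    have l3 := lambertCoeff_symm (2 : Fin 3) 1 n
    rcases (by decide +revert : (s 0 = 0 ∧ s 1 = 1 ∧ s 2 = 2) ∨ (s 0 = 0 ∧ s 1 = 2 ∧ s 2 = 1) ∨
      (s 0 = 1 ∧ s 1 = 0 ∧ s 2 = 2) ∨ (s 0 = 1 ∧ s 1 = 2 ∧ s 2 = 0) ∨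
      (s 0 = 2 ∧ s 1 = 0 ∧ s 2 = 1) ∨ (s 0 = 2 ∧ s 1 = 1 ∧ s 2 = 0)) with
      ⟨h0, h1, h2⟩ | ⟨h0, h1, h2⟩ | ⟨h0, h1, h2⟩ | ⟨h0, h1, h2⟩ | ⟨h0, h1, h2⟩ | ⟨h0, h1, h2⟩ <;>
    · simp only [h0, h1, h2, l1, l2, l3]
      try abel

lemma hamR_pos {c : ℂ} {k n : ℕ} (hn : n ≠ 0) (f : Laurent N) : hamR c k n (toRatl f) =
    toRatl ((-(2 * k * (k - 1)) : ℂ) • ((∑ p ∈ pairs N, lambertCoeff p.1 p.2 n) * f)) := by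
  simp only [hamR, hn, if_false, zero_sub, potR, LinearMap.neg_apply, LinearMap.smul_apply,
    LinearMap.mulLeft_apply, map_smul, neg_smul, map_mul, map_sum, map_neg]

lemma hamR_preserves (hN : N = 2 ∨ N = 3) (c : ℂ) (k : ℕ) (m : ℤ) (n : ℕ) :
    ∀ f ∈ vSpace N k m, ∃ g ∈ vSpace N k m, toRatl g = hamR c k n (toRatl f) := by
  by_cases hn : n = 0
  · subst hn
    rcases hN with rfl | rfl
    · exact preserves_of_num (hamR_zero_two c k) (fun G hG => hamNum2_anti hG)
        fun G hG => hamNum2_homog hG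
    · exact preserves_of_num (hamR_zero_three c k) (fun G hG => hamNum3_anti hG)
        fun G hG => hamNum3_homog hG
  · intro f hf
    exact ⟨_, Submodule.smul_mem _ _ (preserves_mul (fun s => permAct_sum_lambertCoeff s hN n)
      (IsHomog.sum _ fun p _ => isHomog_lambertCoeff p.1 p.2 n) f hf), (hamR_pos hn f).symm⟩

lemma cubR_preserves (c : ℂ) (k : ℕ) (m : ℤ) (n : ℕ) :
    ∀ f ∈ vSpace 3 k m, ∃ g ∈ vSpace 3 k m, toRatl g = cubR c k n (toRatl f) := by
  by_cases hn : n = 0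
  · subst hn
    exact preserves_of_num (cubR_zero_three c k) (fun G hG => cubNum3_anti hG)
      fun G hG => cubNum3_homog hG
  · exact preserves_of_num (cubR_pos hn) (fun G hG => cubNumPos_anti hG)
      fun G hG => cubNumPos_homog hG

/-- The coefficient of `p ^ n` of the Hamiltonian on states. -/
def hamOp (hN : N = 2 ∨ N = 3) (c : ℂ) (k : ℕ) (m : ℤ) (n : ℕ) :
    vSpace N k m →ₗ[ℂ] vSpace N k m := opOfRatl (hamR c k n) (hamR_preserves hN c k m n)

/-- The coefficient of `p ^ n` of the cubic integral on states. -/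
def cubOp (c : ℂ) (k : ℕ) (m : ℤ) (n : ℕ) : vSpace 3 k m →ₗ[ℂ] vSpace 3 k m :=
  opOfRatl (cubR c k n) (cubR_preserves c k m n)

/-- The shifted exponents attached to a dominant exponent. -/
def quasiMom (c : ℝ) (k : ℕ) {m : ℤ} (z : Dom N m) (i : Fin N) : ℝ :=
  z.1 i + c + k * (N - 1 - (i : ℕ))

lemma hamOp_triangular (hN : N = 2 ∨ N = 3) (c : ℝ) (k : ℕ) {m : ℤ} (z : Dom N m) :
    hamOp hN c k m 0 (stateVec k z) - ((∑ i, quasiMom c k z i ^ 2 : ℝ) : ℂ) • stateVec k z ∈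
      lowerSpan (stateVec k) Dom.lt z := by
  rcases hN with rfl | rfl
  · refine triangular_of_num (hamR_zero_two c k) (fun G hG => hamNum2_anti hG)
      (fun G hG => hamNum2_homog hG) _ (toRatl_opOfRatl _ _) z ((hamNum2_top z).congr rfl ?_)
    simp [quasiMom]
  · refine triangular_of_num (hamR_zero_three c k) (fun G hG => hamNum3_anti hG)
      (fun G hG => hamNum3_homog hG) _ (toRatl_opOfRatl _ _) z ((hamNum3_top z).congr rfl ?_)
    simp [quasiMom]

lemma cubOp_triangular (c : ℝ) (k : ℕ) {m : ℤ} (z : Dom 3 m) :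
    cubOp c k m 0 (stateVec k z) - ((∏ i, quasiMom c k z i : ℝ) : ℂ) • stateVec k z ∈
      lowerSpan (stateVec k) Dom.lt z := by
  refine triangular_of_num (cubR_zero_three c k) (fun G hG => cubNum3_anti hG)
      (fun G hG => cubNum3_homog hG) _ (toRatl_opOfRatl _ _) z ((cubNum3_top z).congr rfl ?_)
  simp [quasiMom]

/-! ### Symmetry -/

/-- Since `k ≥ 2`, states vanish to second order on the diagonals, which absorbs the double pole of
the potential. The quotient is given for all index pairs, with the default `0` off `pairs N`, so
that it can be chosen as a function. -/
lemma exists_quot_sq {k : ℕ} (hk : 2 ≤ k) {m : ℤ} {f : Laurent N} (hf : f ∈ vSpace N k m)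
    (p : Σ _ : Fin N, Fin N) : ∃ g, p ∈ pairs N → f = (X p.1 - X p.2) ^ 2 * g := by
  obtain ⟨G, -, rfl⟩ := hf
  by_cases hp : p ∈ pairs N
  · have h1 : (X p.1 - X p.2 : Laurent N) ∣ vdm := Finset.dvd_prod_of_mem _ hp
    have h2 : (X p.1 - X p.2 : Laurent N) ^ 2 ∣ vdm ^ k * G :=
      ((pow_dvd_pow_of_dvd h1 2).trans (pow_dvd_pow _ hk)).trans (dvd_mul_right _ _)
    obtain ⟨g, hg⟩ := h2
    exact ⟨g, fun _ => hg⟩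
  · exact ⟨0, fun h => absurd h hp⟩

/-- On the torus the conjugate of `X i - X j` times `X i * X j` equals `-(X i - X j)`. -/
lemma inner_X_sub_mul (i j : Fin N) (f g : Laurent N) :
    inner ℂ ((X i - X j) * f) (X i * X j * g) = -inner ℂ f ((X i - X j) * g) := by
  have hi : mono (-Pi.single i 1) * X i = (1 : Laurent N) := by
    rw [mul_comm]; exact X_mul_Xinv i
  have hj : mono (-Pi.single j 1) * X j = (1 : Laurent N) := by
    rw [mul_comm]; exact X_mul_Xinv j
  rw [sub_mul, inner_sub_left, X, X, inner_mono_mul, inner_mono_mul, ← inner_sub_right,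
    ← inner_neg_right]
  congr 1
  change mono (-Pi.single i 1) * (X i * X j * g) - mono (-Pi.single j 1) * (X i * X j * g) =
    -((X i - X j) * g)
  linear_combination (X j * g) * hi - (X i * g) * hj

lemma inner_sq_mul_pot (i j : Fin N) (f g : Laurent N) :
    inner ℂ ((X i - X j) ^ 2 * f) (X i * X j * g) =
      -inner ℂ ((X i - X j) * f) ((X i - X j) * g) := by
  rw [pow_two, mul_assoc, inner_X_sub_mul]

lemma inner_pot_sq_mul (i j : Fin N) (f g : Laurent N) :
    inner ℂ (X i * X j * g) ((X i - X j) ^ 2 * f) =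
      -inner ℂ ((X i - X j) * g) ((X i - X j) * f) := by
  rw [← inner_conj_symm, inner_sq_mul_pot, map_neg, inner_conj_symm]

lemma toRatl_pot_mul {i j : Fin N} (h : i ≠ j) (g : Laurent N) :
    toRatl (X i * X j * g) = potR i j 0 * toRatl ((X i - X j) ^ 2 * g) := by
  have h0 := toRatl_X_sub_ne_zero h
  rw [potR, if_pos rfl, map_mul, map_mul _ _ g, map_pow]
  field_simp

lemma hamOp_zero_coe (hN : N = 2 ∨ N = 3) (c : ℂ) {k : ℕ} {m : ℤ}
    (f : vSpace N k m) {g : (Σ _ : Fin N, Fin N) → Laurent N}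
    (hg : ∀ p ∈ pairs N, (f : Laurent N) = (X p.1 - X p.2) ^ 2 * g p) :
    (hamOp hN c k m 0 f : Laurent N) = ∑ i, shiftDel c i (shiftDel c i f) -
      (2 * k * (k - 1) : ℂ) • ∑ p ∈ pairs N, X p.1 * X p.2 * g p := by
  apply toRatl_injective
  rw [hamOp, toRatl_opOfRatl]
  simp only [hamR, if_true, LinearMap.sub_apply, LinearMap.smul_apply, LinearMap.sum_apply,
    LinearMap.comp_apply, LinearMap.mulLeft_apply, map_sub, map_sum, map_smul, toRatl_shiftDel,
    Finset.sum_mul]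
  congr 2
  exact Finset.sum_congr rfl fun p hp => by
    rw [toRatl_pot_mul (mem_pairs.1 hp).ne, ← hg p hp]

lemma cubOp_zero_coe (c : ℂ) {k : ℕ} {m : ℤ} (f : vSpace 3 k m) {g : (Σ _ : Fin 3, Fin 3) → Laurent 3}
    (hg : ∀ p ∈ pairs 3, (f : Laurent 3) = (X p.1 - X p.2) ^ 2 * g p) :
    (cubOp c k m 0 f : Laurent 3) = shiftDel c 0 (shiftDel c 1 (shiftDel c 2 f)) +
      (k * (k - 1) : ℂ) • (X 0 * X 1 * shiftDel c 2 (g ⟨0, 1⟩) + X 0 * X 2 * shiftDel c 1 (g ⟨0, 2⟩) +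
        X 1 * X 2 * shiftDel c 0 (g ⟨1, 2⟩)) := by
  have key : ∀ i j l : Fin 3, i < j → l ≠ i → l ≠ j →
      toRatl (X i * X j * shiftDel c l (g ⟨i, j⟩)) = potR i j 0 * shiftR c l (toRatl (f : Laurent 3)) := by
    intro i j l hij hi hj
    rw [toRatl_pot_mul hij.ne, ← toRatl_shiftDel, hg ⟨i, j⟩ (mem_pairs.2 hij)]
    congr 2
    simp only [shiftDel_apply, Derivation.leibniz, pow_two, map_sub, del_X, if_neg hi, if_neg hj,
      smul_eq_mul, Algebra.smul_def]
    ring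
  apply toRatl_injective
  rw [cubOp, toRatl_opOfRatl]
  simp only [cubR, if_true, LinearMap.add_apply, LinearMap.smul_apply,
    LinearMap.comp_apply, LinearMap.mulLeft_apply, map_add, map_smul, toRatl_shiftDel,
    key 0 1 2 (by decide) (by decide) (by decide), key 0 2 1 (by decide) (by decide) (by decide),
    key 1 2 0 (by decide) (by decide) (by decide)]

/-- The kinetic part is a sum of squares of symmetric operators. For the singular potential write `f
= (X i - X j)² u` and `g = (X i - X j)² w`: both orders of the pairing become `-⟨(X i - X j) u, (X i
- X j) w⟩`. -/
lemma hamOp_isSymmetric (hN : N = 2 ∨ N = 3) (c : ℝ) {k : ℕ} (hk : 2 ≤ k) (m : ℤ) :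
    (hamOp hN c k m 0).IsSymmetric := by
  intro f g
  choose u hu using fun p => exists_quot_sq hk f.2 p
  choose w hw using fun p => exists_quot_sq hk g.2 p
  rw [Submodule.coe_inner, Submodule.coe_inner, hamOp_zero_coe hN c f (g := u) hu,
    hamOp_zero_coe hN c g (g := w) hw, inner_sub_left, inner_sub_right, sum_inner, inner_sum,
    inner_smul_left, inner_smul_right, sum_inner, inner_sum]
  congr 1
  · refine Finset.sum_congr rfl fun i _ => ?_
    rw [inner_shiftDel, inner_shiftDel]
  · congr 1
    · simp [map_ofNat]
    · refine Finset.sum_congr rfl fun p hp => ?_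
      nth_rewrite 1 [hw p hp]
      nth_rewrite 1 [hu p hp]
      rw [inner_sq_mul_pot, inner_pot_sq_mul]

lemma cubOp_isSymmetric (c : ℝ) {k : ℕ} (hk : 2 ≤ k) (m : ℤ) :
    (cubOp c k m 0).IsSymmetric := by
  intro f g
  choose u hu using fun p => exists_quot_sq hk f.2 p
  choose w hw using fun p => exists_quot_sq hk g.2 p
  -- The derivation in the third variable commutes with `X i - X j`, so it moves across the pairing
  -- together with the potential.
  have key : ∀ i j l : Fin 3, i < j → l ≠ i → l ≠ j →
      inner ℂ (X i * X j * shiftDel c l (u ⟨i, j⟩)) (g : Laurent 3) =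
        inner ℂ (f : Laurent 3) (X i * X j * shiftDel c l (w ⟨i, j⟩)) := by
    intro i j l hij hi hj
    have h1 : ∀ a : Laurent 3, (X i - X j) * shiftDel c l a = shiftDel c l ((X i - X j) * a) := by
      intro a
      simp only [shiftDel_apply, Derivation.leibniz, map_sub, del_X, if_neg hi, if_neg hj,
        smul_eq_mul, Algebra.smul_def]
      ring
    rw [hw ⟨i, j⟩ (mem_pairs.2 hij), hu ⟨i, j⟩ (mem_pairs.2 hij), inner_sq_mul_pot,
      inner_pot_sq_mul, h1, h1, inner_shiftDel]
  rw [Submodule.coe_inner, Submodule.coe_inner, cubOp_zero_coe c f (g := u) hu,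
    cubOp_zero_coe c g (g := w) hw, inner_add_left, inner_add_right, inner_smul_left,
    inner_smul_right]
  simp only [inner_add_left, inner_add_right, key 0 1 2 (by decide) (by decide) (by decide),
    key 0 2 1 (by decide) (by decide) (by decide), key 1 2 0 (by decide) (by decide) (by decide)]
  congr 1
  · rw [inner_shiftDel, inner_shiftDel, inner_shiftDel, shiftDel_comm _ 2 1, shiftDel_comm _ 2 0,
      shiftDel_comm _ 1 0]
  · simp

/-- The potential is repulsive: its contribution to the energy is `2k(k-1)` times a sum of squared
norms. Dropping it shows that the energy controls first derivatives. -/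
lemma sum_norm_shiftDel_sq_le (hN : N = 2 ∨ N = 3) (c : ℝ) {k : ℕ} (hk : 2 ≤ k) {m : ℤ}
    (f : vSpace N k m) : ∑ i, ‖shiftDel c i (f : Laurent N)‖ ^ 2 ≤
      (inner ℂ f (hamOp hN c k m 0 f)).re := by
  choose u hu using fun p => exists_quot_sq hk f.2 p
  rw [Submodule.coe_inner, hamOp_zero_coe hN c f (g := u) hu, inner_sub_right, inner_sum,
    inner_smul_right, inner_sum, Complex.sub_re, Complex.re_sum]
  have h1 : ∀ i, (inner ℂ (f : Laurent N) (shiftDel c i (shiftDel c i (f : Laurent N)))).re =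
      ‖shiftDel c i (f : Laurent N)‖ ^ 2 := by
    intro i
    rw [← inner_shiftDel, @norm_sq_eq_re_inner ℂ]; rfl
  have h2 : ∑ p ∈ pairs N, inner ℂ (f : Laurent N) (X p.1 * X p.2 * u p) =
      -((∑ p ∈ pairs N, ‖(X p.1 - X p.2) * u p‖ ^ 2 : ℝ) : ℂ) := by
    rw [Complex.ofReal_sum, ← Finset.sum_neg_distrib]
    refine Finset.sum_congr rfl fun p hp => ?_
    nth_rewrite 1 [hu p hp]
    rw [inner_sq_mul_pot, inner_self_eq_norm_sq_to_K]
    simp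
  have h3 : (0 : ℝ) ≤ 2 * k * (k - 1) := by
    have : (2 : ℝ) ≤ k := by exact_mod_cast hk
    have : (0 : ℝ) ≤ k - 1 := by linarith
    positivity
  have h4 : (0 : ℝ) ≤ ∑ p ∈ pairs N, ‖(X p.1 - X p.2) * u p‖ ^ 2 :=
    Finset.sum_nonneg fun _ _ => sq_nonneg _
  simp only [h1, h2]
  have h5 : ((2 * k * (k - 1) : ℂ) * -((∑ p ∈ pairs N, ‖(X p.1 - X p.2) * u p‖ ^ 2 : ℝ) : ℂ)).re =
      -((2 * k * (k - 1)) * ∑ p ∈ pairs N, ‖(X p.1 - X p.2) * u p‖ ^ 2) := by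
    rw [show (2 * k * (k - 1) : ℂ) = ((2 * k * (k - 1) : ℝ) : ℂ) by push_cast; ring,
      ← Complex.ofReal_neg, ← Complex.ofReal_mul, Complex.ofReal_re]
    ring
  rw [h5]
  have := mul_nonneg h3 h4
  linarith

/-! ### Bounds for the perturbation -/

/-- Multiplication by a monomial is an isometry, and `n` has at most `n` divisors, each at most `n`.
-/
lemma norm_lambertCoeff_mul_le (i j : Fin N) (n : ℕ) (f : Laurent N) :
    ‖lambertCoeff i j n * f‖ ≤ 2 * n ^ 2 * ‖f‖ := by
  rw [lambertCoeff, Finset.sum_mul]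
  refine (norm_sum_le_of_le (f := fun d : ℕ => ((d : ℂ) •
    (mono ((d : ℤ) • (Pi.single i 1 - Pi.single j 1)) +
    mono ((d : ℤ) • (Pi.single j 1 - Pi.single i 1))) * f : Laurent N)) n.divisors
    (n := fun _ => n * (2 * ‖f‖)) ?_).trans ?_
  · intro d hd
    rw [smul_mul_assoc, norm_smul, add_mul, Complex.norm_natCast]
    refine mul_le_mul (Nat.cast_le.2 (Nat.divisor_le hd)) ?_ (norm_nonneg _) (Nat.cast_nonneg _)
    refine (norm_add_le _ _).trans ?_
    rw [norm_mono_mul, norm_mono_mul]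
    linarith
  · rw [Finset.sum_const, nsmul_eq_mul]
    have : (n.divisors.card : ℝ) ≤ n := Nat.cast_le.2 (Nat.card_divisors_le_self n)
    calc (n.divisors.card : ℝ) * (n * (2 * ‖f‖)) ≤ n * (n * (2 * ‖f‖)) := by gcongr
      _ = 2 * n ^ 2 * ‖f‖ := by ring

lemma hamOp_pos_coe (hN : N = 2 ∨ N = 3) (c : ℂ) {k : ℕ} {m : ℤ} {n : ℕ} (hn : n ≠ 0)
    (f : vSpace N k m) : (hamOp hN c k m n f : Laurent N) =
      (-(2 * k * (k - 1)) : ℂ) • ((∑ p ∈ pairs N, lambertCoeff p.1 p.2 n) * f) := by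
  apply toRatl_injective
  rw [hamOp, toRatl_opOfRatl, hamR_pos hn]

lemma cubOp_pos_coe (c : ℂ) {k : ℕ} {m : ℤ} {n : ℕ} (hn : n ≠ 0)
    (f : vSpace 3 k m) : (cubOp c k m n f : Laurent 3) =
      (k * (k - 1) : ℂ) • (lambertCoeff 0 1 n * shiftDel c 2 f + lambertCoeff 0 2 n * shiftDel c 1 f +
        lambertCoeff 1 2 n * shiftDel c 0 f) := by
  apply toRatl_injective
  rw [cubOp, toRatl_opOfRatl]
  simp only [cubR, hn, if_false, zero_add, potR, LinearMap.smul_apply, LinearMap.add_apply,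
    LinearMap.comp_apply, LinearMap.mulLeft_apply, map_add, map_smul, map_mul, toRatl_shiftDel]

/-- The first-order Sobolev seminorm of a state. -/
def gradNorm (c : ℝ) {k : ℕ} {m : ℤ} (f : vSpace N k m) : ℝ := ∑ i, ‖shiftDel c i (f : Laurent N)‖

lemma norm_two_mul_le (k : ℕ) : ‖(-(2 * k * (k - 1)) : ℂ)‖ ≤ 2 * k ^ 2 := by
  rcases k with _ | k
  · simp
  · have : (-(2 * (k + 1 : ℕ) * ((k + 1 : ℕ) - 1)) : ℂ) = -((2 * (k + 1) * k : ℕ) : ℂ) := by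
      push_cast; ring
    rw [this, norm_neg, Complex.norm_natCast]
    push_cast
    nlinarith [(Nat.cast_nonneg k : (0 : ℝ) ≤ k)]

/-- The constant `12` is `2 * 3 * 2`: the coupling is at most `2k²`, there are at most three pairs,
and each pair costs `2n²`. -/
lemma norm_hamOp_pos_le (hN : N = 2 ∨ N = 3) (c : ℝ) {k : ℕ} {m : ℤ} {n : ℕ} (hn : n ≠ 0)
    (f : vSpace N k m) : ‖hamOp hN c k m n f‖ ≤ 12 * k ^ 2 * n ^ 2 * ‖f‖ := by
  rw [Submodule.coe_norm, hamOp_pos_coe hN c hn, norm_smul]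
  have hc : ((pairs N).card : ℝ) ≤ 3 := by
    rcases hN with rfl | rfl
    · rw [show (pairs 2).card = 1 by decide]; norm_num
    · rw [show (pairs 3).card = 3 by decide]; norm_num
  have h1 : ‖(∑ p ∈ pairs N, lambertCoeff p.1 p.2 n) * (f : Laurent N)‖ ≤
      3 * (2 * n ^ 2 * ‖f‖) := by
    rw [Finset.sum_mul]
    refine (norm_sum_le_of_le _ fun p _ => norm_lambertCoeff_mul_le p.1 p.2 n f).trans ?_
    rw [Finset.sum_const, nsmul_eq_mul]
    exact mul_le_mul_of_nonneg_right hc (by positivity)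
  calc _ ≤ (2 * k ^ 2 : ℝ) * (3 * (2 * n ^ 2 * ‖f‖)) :=
        mul_le_mul (norm_two_mul_le k) h1 (norm_nonneg _) (by positivity)
    _ = _ := by ring

lemma norm_cubOp_pos_le (c : ℝ) {k : ℕ} {m : ℤ} {n : ℕ} (hn : n ≠ 0)
    (f : vSpace 3 k m) : ‖cubOp c k m n f‖ ≤ 4 * k ^ 2 * n ^ 2 * gradNorm c f := by
  rw [Submodule.coe_norm, cubOp_pos_coe c hn, norm_smul, gradNorm, Fin.sum_univ_three]
  have h0 : ‖(k * (k - 1) : ℂ)‖ ≤ 2 * k ^ 2 := by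
    refine le_trans ?_ (norm_two_mul_le k)
    rw [norm_neg, mul_assoc 2, norm_mul 2]
    have := norm_nonneg (k * (k - 1) : ℂ)
    have h2 : ‖(2 : ℂ)‖ = 2 := by simp
    rw [h2]
    linarith
  have h1 := norm_lambertCoeff_mul_le (0 : Fin 3) 1 n (shiftDel c 2 f)
  have h2 := norm_lambertCoeff_mul_le (0 : Fin 3) 2 n (shiftDel c 1 f)
  have h3 := norm_lambertCoeff_mul_le (1 : Fin 3) 2 n (shiftDel c 0 f)
  have h4 := norm_add₃_le (a := lambertCoeff 0 1 n * shiftDel c 2 (f : Laurent 3))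
    (b := lambertCoeff 0 2 n * shiftDel c 1 (f : Laurent 3))
    (c := lambertCoeff 1 2 n * shiftDel c 0 (f : Laurent 3))
  calc _ ≤ (2 * k ^ 2 : ℝ) * (2 * n ^ 2 * (‖shiftDel c 0 (f : Laurent 3)‖ +
          ‖shiftDel c 1 (f : Laurent 3)‖ + ‖shiftDel c 2 (f : Laurent 3)‖)) :=
        mul_le_mul h0 (by linarith) (norm_nonneg _) (by positivity)
    _ = _ := by ring

end CalogeroMoser

end

noncomputable section

namespace CalogeroMoser

variable {N : ℕ}

/-! ### The filtration by the largest exponent -/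

/-- Dividing by `(X i - X j)²` lowers the bound by `2 L(e_i)`, while multiplying by `X i * X j`
raises it by at most that much. Hence the singular potential respects the filtration. -/
lemma bddBy_X_mul_X_mul {L : (Fin N → ℤ) →+ ℤ} (hL : DomFun L) {i j : Fin N} (h : i < j)
    {g : Laurent N} {b : ℤ} (hg : BddBy L ((X i - X j) ^ 2 * g) b) :
    ∃ b', BddBy L g b' ∧ ∀ g' : Laurent N, BddBy L g' b' → BddBy L (X i * X j * g') b := by
  have h1 := hL i j h
  refine ⟨b - 2 * L (Pi.single i 1), ?_, fun g' hg' => ?_⟩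
  · refine bddBy_of_X_sub_mul h.ne h1 (bddBy_of_X_sub_mul h.ne h1 ?_)
    rw [← mul_assoc, ← pow_two]
    exact hg.mono_le (by linarith)
  · exact (((bddBy_mono L _).mul (bddBy_mono L _)).mul hg').mono_le (by linarith)

section Filtration

variable [NeZero N]

lemma psum_zero_single (i : Fin N) : psum 0 (Pi.single i 1) = if i = 0 then 1 else 0 := by
  rw [psum_zero_apply, Pi.single_apply]
  simp only [eq_comm]

/-- States all of whose exponents have first entry at most `b`. -/
def vFilt (N k : ℕ) [NeZero N] (m b : ℤ) : Submodule ℂ (vSpace N k m) where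
  carrier := {f | BddBy (psum 0) (f : Laurent N) b}
  add_mem' hf hg := hf.add hg
  zero_mem' := BddBy.zero _ _
  smul_mem' r _ hf := hf.smul r

variable {k : ℕ} {m : ℤ}

lemma mem_vFilt {b : ℤ} {f : vSpace N k m} :
    f ∈ vFilt N k m b ↔ BddBy (psum 0) (f : Laurent N) b := Iff.rfl

lemma vFilt_mono {a b : ℤ} (h : a ≤ b) : vFilt N k m a ≤ vFilt N k m b :=
  fun _ hf => BddBy.mono_le hf h

lemma bddBy_lambertCoeff (i j : Fin N) (n : ℕ) : BddBy (psum 0) (lambertCoeff i j n) n := by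
  refine BddBy.sum _ fun d hd => BddBy.smul (BddBy.add ?_ ?_) _
  all_goals
    refine (bddBy_mono _ _).mono_le ?_
    have hd' : (d : ℤ) ≤ n := Nat.cast_le.2 (Nat.divisor_le hd)
    have h0 : (0 : ℤ) ≤ d := Nat.cast_nonneg d
    rw [map_zsmul, map_sub, psum_zero_single, psum_zero_single, smul_eq_mul]
    split_ifs <;> (simp; try linarith)

lemma hamOp_mem_vFilt (hN : N = 2 ∨ N = 3) (c : ℂ) (hk : 2 ≤ k) {b : ℤ} (n : ℕ)
    {f : vSpace N k m} (hf : f ∈ vFilt N k m b) : hamOp hN c k m n f ∈ vFilt N k m (b + n) := by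
  rw [mem_vFilt] at hf ⊢
  by_cases hn : n = 0
  · subst hn
    choose u hu using fun p => exists_quot_sq hk f.2 p
    rw [hamOp_zero_coe hN c f (g := u) hu, Nat.cast_zero, add_zero, sub_eq_add_neg, ← neg_smul]
    refine BddBy.add (BddBy.sum _ fun i _ => (hf.shiftDel _ _).shiftDel _ _)
      (BddBy.smul (BddBy.sum _ fun p hp => ?_) _)
    have h1 := hf
    rw [hu p hp] at h1
    obtain ⟨b', h2, h3⟩ := bddBy_X_mul_X_mul (domFun_psum 0) (mem_pairs.1 hp) h1
    exact h3 _ h2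
  · rw [hamOp_pos_coe hN c hn, add_comm]
    exact ((BddBy.sum _ fun p _ => bddBy_lambertCoeff p.1 p.2 n).mul hf).smul _

lemma cubOp_mem_vFilt (c : ℂ) (hk : 2 ≤ k) {b : ℤ} (n : ℕ)
    {f : vSpace 3 k m} (hf : f ∈ vFilt 3 k m b) : cubOp c k m n f ∈ vFilt 3 k m (b + n) := by
  rw [mem_vFilt] at hf ⊢
  by_cases hn : n = 0
  · subst hn
    choose u hu using fun p => exists_quot_sq hk f.2 p
    have key : ∀ i j l : Fin 3, i < j → BddBy (psum 0) (X i * X j * shiftDel c l (u ⟨i, j⟩)) b := by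
      intro i j l hij
      have h1 := hf
      rw [hu ⟨i, j⟩ (mem_pairs.2 hij)] at h1
      obtain ⟨b', h2, h3⟩ := bddBy_X_mul_X_mul (domFun_psum 0) hij h1
      exact h3 _ (h2.shiftDel _ _)
    rw [cubOp_zero_coe c f (g := u) hu, Nat.cast_zero, add_zero]
    have k1 := key 0 1 2 (by decide)
    have k2 := key 0 2 1 (by decide)
    have k3 := key 1 2 0 (by decide)
    exact BddBy.add (((hf.shiftDel c 2).shiftDel c 1).shiftDel c 0) (BddBy.smul ((k1.add k2).add k3) _)
  · rw [cubOp_pos_coe c hn, add_comm b]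
    have key : ∀ i j l : Fin 3, BddBy (psum 0) (lambertCoeff i j n * shiftDel c l (f : Laurent 3))
        (n + b) := fun i j l => (bddBy_lambertCoeff i j n).mul (hf.shiftDel c l)
    have k1 := key 0 1 2
    have k2 := key 0 2 1
    have k3 := key 1 2 0
    exact BddBy.smul ((k1.add k2).add k3) _

/-- The orthogonal basis of joint eigenstates. -/
def eigVec (k : ℕ) {m : ℤ} (z : Dom N m) : vSpace N k m :=
  gramVec (stateVec k) Dom.lt Dom.finite_lt z

lemma stateVec_mem_vFilt (z : Dom N m) :
    stateVec k z ∈ vFilt N k m (psum 0 (k • (rho : Fin N → ℤ)) + z.1 0) := by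
  rw [← psum_zero_apply z.1]
  exact ((hasTop_vdm_pow k).1 _ (domFun_psum 0)).mul ((hasTop_msymm z).1 _ (domFun_psum 0))

lemma eigVec_mem_vFilt (z : Dom N m) :
    eigVec k z ∈ vFilt N k m (psum 0 (k • (rho : Fin N → ℤ)) + z.1 0) := by
  have h1 : lowerSpan (stateVec k) Dom.lt z ≤
      vFilt N k m (psum 0 (k • (rho : Fin N → ℤ)) + z.1 0) := by
    refine Submodule.span_le.2 ?_
    rintro _ ⟨w, hw, rfl⟩
    exact vFilt_mono (by have := Dom.lt_zero_le hw; linarith) (stateVec_mem_vFilt w)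
  have h2 := gramVec_sub_mem (b := stateVec k) (r := Dom.lt) Dom.finite_lt z
  have := add_mem (h1 h2) (stateVec_mem_vFilt z)
  rwa [sub_add_cancel] at this

/-- The coefficient at `k • rho + z` is `1` for the state of `z` and vanishes for every strictly
lower state. -/
lemma eigVec_ne_zero (z : Dom N m) : eigVec k z ≠ 0 := by
  intro h0
  have h2 := gramVec_sub_mem (b := stateVec k) (r := Dom.lt) Dom.finite_lt z
  change eigVec k z - _ ∈ _ at h2
  rw [h0, zero_sub] at h2
  have h3 : ∀ u ∈ lowerSpan (stateVec k) Dom.lt z, (u : Laurent N).coeff (k • rho + z.1) = 0 := by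
    intro u hu
    induction hu using Submodule.span_induction with
    | zero => rfl
    | add u v _ _ hu hv =>
      rw [Submodule.coe_add, AddMonoidAlgebra.coeff_add, Finsupp.add_apply, hu, hv, add_zero]
    | smul c u _ hu =>
      rw [Submodule.coe_smul, AddMonoidAlgebra.coeff_smul_apply, hu, smul_zero]
    | mem u hu =>
      obtain ⟨w, hw, rfl⟩ := hu
      by_contra hne
      refine hw.1 (psum_injective fun i => le_antisymm (hw.2 i) ?_)
      have h4 := (((hasTop_vdm_pow k).mul (hasTop_msymm w)).1 _ (domFun_psum i)) _ hne
      rw [map_add, map_add] at h4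
      linarith
  have h4 := h3 _ h2
  have h5 := ((hasTop_vdm_pow k).mul (hasTop_msymm z)).2
  simp only [NegMemClass.coe_neg, AddMonoidAlgebra.coeff_neg, Finsupp.neg_apply, neg_eq_zero] at h4
  change (vdm ^ k * msymm z.1 : Laurent N).coeff _ = 0 at h4
  rw [h4] at h5
  simp at h5

/-- A bound on the first exponent of `vdm ^ k * G` is a bound on that of `G`, and passing down in
the dominance order cannot raise the first entry. So each level of the filtration is spanned by the
eigenvectors it contains, and operators acting diagonally on them preserve it. -/
lemma mem_span_eigVec {b : ℤ} {f : vSpace N k m} (hf : f ∈ vFilt N k m b) :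
    f ∈ Submodule.span ℂ (eigVec k '' {z : Dom N m | eigVec k z ∈ vFilt N k m b}) := by
  obtain ⟨_, G, hG, rfl⟩ := f
  set d := b - psum 0 (k • (rho : Fin N → ℤ)) with hd
  have h1 : BddBy (psum 0) G d := by
    refine bddBy_of_vdm_pow_mul (domFun_psum 0) k ?_
    rw [hd, add_sub_cancel]
    exact hf
  have h2 : ∀ z : Dom N m, z.1 0 ≤ d → stateVec k z ∈
      Submodule.span ℂ (eigVec k '' {z : Dom N m | eigVec k z ∈ vFilt N k m b}) := by
    intro z hz
    have h3 := mem_span_gramVec (b := stateVec k) (r := Dom.lt) Dom.finite_lt (Dom.lt_wf m)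
      (D := {z : Dom N m | z.1 0 ≤ d}) (fun x hx y hy => (Dom.lt_zero_le hy).trans hx) hz
    refine Submodule.span_mono (Set.image_mono fun w hw => ?_) h3
    exact vFilt_mono (by have : w.1 0 ≤ d := hw; linarith) (eigVec_mem_vFilt w)
  have h3 := mem_span_msymm hG
  have h4 : vdm ^ k * G ∈ Submodule.map (vSpace N k m).subtype
      (Submodule.span ℂ (eigVec k '' {z : Dom N m | eigVec k z ∈ vFilt N k m b})) := by
    have h5 := Submodule.mem_map_of_mem (f := LinearMap.mulLeft ℂ (vdm ^ k : Laurent N)) h3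
    rw [Submodule.map_span, Set.image_image] at h5
    refine Submodule.span_le.2 ?_ h5
    rintro _ ⟨z, hz, rfl⟩
    refine ⟨stateVec k z, h2 z ?_, rfl⟩
    have := h1 z.1 hz
    rwa [psum_zero_apply] at this
  obtain ⟨u, hu, h5⟩ := h4
  have h6 : u = ⟨vdm ^ k * G, G, hG, rfl⟩ := Subtype.ext h5
  rw [h6] at hu
  exact hu

lemma hamOp_eigVec (hN : N = 2 ∨ N = 3) (c : ℝ) (hk : 2 ≤ k) (z : Dom N m) :
    hamOp hN c k m 0 (eigVec k z) = ((∑ i, quasiMom c k z i ^ 2 : ℝ) : ℂ) • eigVec k z :=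
  gramVec_eigen (b := stateVec k) Dom.finite_lt Dom.lt_trans (hamOp_isSymmetric hN c hk m)
    (e := fun z => ((∑ i, quasiMom c k z i ^ 2 : ℝ) : ℂ)) (hamOp_triangular hN c k) z

end Filtration

lemma cubOp_eigVec {k : ℕ} {m : ℤ} (c : ℝ) (hk : 2 ≤ k) (z : Dom 3 m) :
    cubOp c k m 0 (eigVec k z) = ((∏ i, quasiMom c k z i : ℝ) : ℂ) • eigVec k z :=
  gramVec_eigen (b := stateVec k) Dom.finite_lt Dom.lt_trans (cubOp_isSymmetric c hk m)
    (e := fun z => ((∏ i, quasiMom c k z i : ℝ) : ℂ)) (cubOp_triangular c k) z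

/-! ### Joint eigenvalues -/

lemma sum_quasiMom (c : ℝ) (k : ℕ) {m : ℤ} (z : Dom N m) :
    ∑ i, quasiMom c k z i = m + ∑ i : Fin N, (c + k * (N - 1 - (i : ℕ))) := by
  simp only [quasiMom, add_assoc]
  rw [Finset.sum_add_distrib, ← Int.cast_sum, z.sum_eq]

lemma quasiMom_antitone (c : ℝ) (k : ℕ) {m : ℤ} (z : Dom N m) : Antitone (quasiMom c k z) := by
  intro i j h
  have h1 : (z.1 j : ℝ) ≤ z.1 i := Int.cast_le.2 (z.anti h)
  have h2 : ((i : ℕ) : ℝ) ≤ (j : ℕ) := Nat.cast_le.2 h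
  have h3 : (0 : ℝ) ≤ k := Nat.cast_nonneg k
  simp only [quasiMom]
  nlinarith

lemma quasiMom_injective (c : ℝ) (k : ℕ) {m : ℤ} :
    Function.Injective fun z : Dom N m => quasiMom c k z := by
  intro z w h
  refine Dom.ext (funext fun i => ?_)
  have := congrFun h i
  simp only [quasiMom] at this
  exact_mod_cast (by linarith : (z.1 i : ℝ) = w.1 i)

lemma finite_energy_le (c : ℝ) (k : ℕ) (m : ℤ) (B : ℝ) :
    {z : Dom N m | ∑ i, quasiMom c k z i ^ 2 ≤ B}.Finite := by
  refine (finite_dom_of_le m ⌈B + 1 + |c| + k * N⌉).subset fun z hz i => ?_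
  have h1 : quasiMom c k z i ^ 2 ≤ B :=
    (Finset.single_le_sum (f := fun i => quasiMom c k z i ^ 2) (fun _ _ => sq_nonneg _)
      (Finset.mem_univ i)).trans hz
  have h2 : quasiMom c k z i ≤ B + 1 := by nlinarith [sq_nonneg (quasiMom c k z i - 1)]
  have h3 : (0 : ℝ) ≤ N - 1 - (i : ℕ) := by
    have : ((i : ℕ) : ℝ) + 1 ≤ N := by exact_mod_cast i.2
    linarith
  have h4 : (0 : ℝ) ≤ k * (N - 1 - (i : ℕ)) := mul_nonneg (Nat.cast_nonneg k) h3
  have h5 : (0 : ℝ) ≤ k * N := by positivity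
  have h6 : (z.1 i : ℝ) ≤ B + 1 + |c| + k * N := by
    have := neg_abs_le c
    simp only [quasiMom] at h2
    linarith
  exact_mod_cast h6.trans (Int.le_ceil _)

/-- Sum and sum of squares determine the square of the difference, and the order of the two entries
fixes its sign. -/
lemma energy_separates_two (c : ℝ) (k : ℕ) {m : ℤ} {z w : Dom 2 m}
    (h : ∑ i, quasiMom c k z i ^ 2 = ∑ i, quasiMom c k w i ^ 2) : z = w := by
  have hs := (sum_quasiMom c k z).trans (sum_quasiMom c k w).symm
  have hz : quasiMom c k z 1 ≤ quasiMom c k z 0 := quasiMom_antitone c k z (by decide)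
  have hw : quasiMom c k w 1 ≤ quasiMom c k w 0 := quasiMom_antitone c k w (by decide)
  rw [Fin.sum_univ_two, Fin.sum_univ_two] at hs h
  refine quasiMom_injective c k (funext ?_)
  have h2 : (quasiMom c k z 0 - quasiMom c k z 1) = (quasiMom c k w 0 - quasiMom c k w 1) := by
    rw [← sq_eq_sq₀ (by linarith) (by linarith)]
    have := congrArg (· ^ 2) hs
    nlinarith
  simp only [Fin.forall_fin_two]
  constructor <;> linarith

/-- Degree, energy and cubic eigenvalue give the three elementary symmetric functions of the shifted
exponents, and the exponents are ordered. -/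
lemma energies_separate_three (c : ℝ) (k : ℕ) {m : ℤ} {z w : Dom 3 m}
    (h : ∑ i, quasiMom c k z i ^ 2 = ∑ i, quasiMom c k w i ^ 2)
    (h' : ∏ i, quasiMom c k z i = ∏ i, quasiMom c k w i) : z = w := by
  have hs := (sum_quasiMom c k z).trans (sum_quasiMom c k w).symm
  have hz1 : quasiMom c k z 1 ≤ quasiMom c k z 0 := quasiMom_antitone c k z (by decide)
  have hw1 : quasiMom c k w 1 ≤ quasiMom c k w 0 := quasiMom_antitone c k w (by decide)
  have hz2 : quasiMom c k z 2 ≤ quasiMom c k z 1 := quasiMom_antitone c k z (by decide)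
  have hw2 : quasiMom c k w 2 ≤ quasiMom c k w 1 := quasiMom_antitone c k w (by decide)
  rw [Fin.sum_univ_three, Fin.sum_univ_three] at hs h
  rw [Fin.prod_univ_three, Fin.prod_univ_three] at h'
  refine quasiMom_injective c k (funext ?_)
  simp only [Fin.forall_fin_succ, Fin.forall_fin_zero, and_true]
  generalize quasiMom c k z = a at *
  generalize quasiMom c k w = b at *
  change a 0 = b 0 ∧ a 1 = b 1 ∧ a 2 = b 2
  have he2 : a 0 * a 1 + a 0 * a 2 + a 1 * a 2 = b 0 * b 1 + b 0 * b 2 + b 1 * b 2 := by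
    have := congrArg (· ^ 2) hs
    nlinarith
  -- Both triples are the roots of one cubic polynomial. Comparing signs beyond the largest and the
  -- smallest root identifies those two, and the sum identifies the middle one.
  have hroot : ∀ t, (t - a 0) * (t - a 1) * (t - a 2) = (t - b 0) * (t - b 1) * (t - b 2) := by
    intro t
    linear_combination (-t ^ 2) * hs + t * he2 - h'
  have r0 := hroot (a 0)
  have r2 := hroot (a 2)
  have s0 := hroot (b 0)
  have s2 := hroot (b 2)
  have e0 : a 0 = b 0 := by
    refine le_antisymm ?_ ?_
    · by_contra! hlt
      have : 0 < (a 0 - b 0) * (a 0 - b 1) * (a 0 - b 2) :=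
        mul_pos (mul_pos (by linarith) (by linarith)) (by linarith)
      rw [← r0] at this; simp at this
    · by_contra! hlt
      have : 0 < (b 0 - a 0) * (b 0 - a 1) * (b 0 - a 2) :=
        mul_pos (mul_pos (by linarith) (by linarith)) (by linarith)
      rw [s0] at this; simp at this
  have e2 : a 2 = b 2 := by
    refine le_antisymm ?_ ?_
    · by_contra! hlt
      have : 0 < (a 0 - b 2) * (a 1 - b 2) * (a 2 - b 2) :=
        mul_pos (mul_pos (by linarith) (by linarith)) (by linarith)
      have : (b 2 - a 0) * (b 2 - a 1) * (b 2 - a 2) < 0 := by nlinarith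
      rw [s2] at this; simp at this
    · by_contra! hlt
      have : 0 < (b 0 - a 2) * (b 1 - a 2) * (b 2 - a 2) :=
        mul_pos (mul_pos (by linarith) (by linarith)) (by linarith)
      have : (a 2 - b 0) * (a 2 - b 1) * (a 2 - b 2) < 0 := by nlinarith
      rw [← r2] at this; simp at this
  exact ⟨e0, by linarith, e2⟩

end CalogeroMoser

end

noncomputable section

namespace CalogeroMoser

/-! ### Majorants for quadratic recursions -/

/-- Since `u 0 = 0`, the last term `v M` never occurs among the pairs with sum at most `M`. The
shorter range for `v` is what lets partial sums be bounded by induction. -/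
lemma sum_antidiagonal_le_mul {u v : ℕ → ℝ} (hu : ∀ n, 0 ≤ u n) (hv : ∀ n, 0 ≤ v n) (hu0 : u 0 = 0)
    (M : ℕ) : ∑ n ∈ Finset.range (M + 1), ∑ q ∈ Finset.HasAntidiagonal.antidiagonal n, u q.1 * v q.2 ≤
      (∑ i ∈ Finset.range (M + 1), u i) * ∑ j ∈ Finset.range M, v j := by
  rw [Finset.sum_mul_sum, ← Finset.sum_product']
  set T := Finset.range (M + 1) ×ˢ Finset.range M
  have h1 : ∑ q ∈ T with q.1 + q.2 < M + 1, u q.1 * v q.2 ≤ ∑ q ∈ T, u q.1 * v q.2 :=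
    Finset.sum_le_sum_of_subset_of_nonneg (Finset.filter_subset _ _)
      fun q _ _ => mul_nonneg (hu _) (hv _)
  refine le_trans (le_of_eq ?_) h1
  rw [← Finset.sum_fiberwise_of_maps_to (s := T.filter fun q => q.1 + q.2 < M + 1)
    (t := Finset.range (M + 1)) (g := fun q => q.1 + q.2)
    (fun q hq => Finset.mem_range.2 (Finset.mem_filter.1 hq).2)]
  refine Finset.sum_congr rfl fun n hn => ?_
  rw [Finset.mem_range] at hn
  refine (Finset.sum_subset ?_ ?_).symm
  · intro q hq
    simp only [Finset.mem_filter] at hq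
    exact Finset.HasAntidiagonal.mem_antidiagonal.2 hq.2
  · intro q hq hq'
    rw [Finset.HasAntidiagonal.mem_antidiagonal] at hq
    have : q.1 = 0 := by
      by_contra h0
      refine hq' ?_
      simp only [T, Finset.mem_filter, Finset.mem_product, Finset.mem_range]
      omega
    rw [this, hu0, zero_mul]

/-- Majorant method: the partial sums of `f n * t ^ n` are kept below `R = 2 f 0 + 1` by induction.
The inductive bound controls the sums of `β`, these control the next partial sum, and every such
contribution carries a factor `t` that can be made small. -/
lemma exists_summable_of_quadratic_recursion {f β : ℕ → ℝ} {C w : ℝ} (hf : ∀ n, 0 ≤ f n)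
    (hβ : ∀ n, 0 ≤ β n) (hβ0 : β 0 = 0) (hC : 0 ≤ C) (hw : 0 ≤ w)
    (h1 : ∀ n, n ≠ 0 → f n ≤ C * ∑ q ∈ Finset.HasAntidiagonal.antidiagonal n, (β q.1 + w * q.1 ^ 2) * f q.2)
    (h2 : ∀ n, β n ≤ C * ∑ q ∈ Finset.HasAntidiagonal.antidiagonal n, (w * q.1 ^ 2) * f q.2) :
    ∃ t : ℝ, 0 < t ∧ t < 1 ∧ Summable fun n => f n * t ^ n := by
  have hs : Summable fun n : ℕ => w * (n : ℝ) ^ 2 * (1 / 2) ^ n := by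
    have := (summable_pow_mul_geometric_of_norm_lt_one 2
      (show ‖(1 / 2 : ℝ)‖ < 1 by norm_num)).mul_left w
    simpa only [mul_assoc] using this
  set Ω := ∑' n : ℕ, w * (n : ℝ) ^ 2 * (1 / 2) ^ n with hΩ
  have hΩ0 : 0 ≤ Ω := tsum_nonneg fun n => by positivity
  set R := 2 * f 0 + 1 with hR
  have hR1 : 1 ≤ R := by have := hf 0; linarith
  -- The third condition says precisely that the terms of positive index add up to at most `1`,
  -- which closes the induction since `f 0 + 1 ≤ R`.
  obtain ⟨t, ht0, ht1, ht2⟩ : ∃ t : ℝ, 0 < t ∧ t ≤ 1 / 2 ∧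
      2 * t * Ω * C * (C * R + 1) * R ≤ 1 := by
    set Q := 2 * Ω * C * (C * R + 1) * R + 2 with hQ
    have : 0 ≤ 2 * Ω * C * (C * R + 1) * R := by positivity
    have hQ2 : 2 ≤ Q := by linarith
    refine ⟨1 / Q, by positivity, one_div_le_one_div_of_le (by norm_num) hQ2, ?_⟩
    rw [show 2 * (1 / Q) * Ω * C * (C * R + 1) * R = (2 * Ω * C * (C * R + 1) * R) / Q by ring,
      div_le_one (by linarith)]
    linarith
  -- The term of index `0` vanishes, so one factor `t` can be extracted, and the remaining powers
  -- are compared with those of `1 / 2`.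
  have hω : ∀ M, ∑ n ∈ Finset.range M, w * (n : ℝ) ^ 2 * t ^ n ≤ 2 * t * Ω := by
    intro M
    have : ∀ n : ℕ, w * (n : ℝ) ^ 2 * t ^ n ≤ 2 * t * (w * (n : ℝ) ^ 2 * (1 / 2) ^ n) := by
      intro n
      rcases n with _ | n
      · simp
      · have h3 : t ^ n ≤ (1 / 2) ^ n := pow_le_pow_left₀ ht0.le ht1 n
        have h4 : 0 ≤ w * ((n + 1 : ℕ) : ℝ) ^ 2 * t := by positivity
        calc w * ((n + 1 : ℕ) : ℝ) ^ 2 * t ^ (n + 1) = w * ((n + 1 : ℕ) : ℝ) ^ 2 * t * t ^ n := by ring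
          _ ≤ w * ((n + 1 : ℕ) : ℝ) ^ 2 * t * (1 / 2) ^ n := mul_le_mul_of_nonneg_left h3 h4
          _ = _ := by ring
    calc _ ≤ ∑ n ∈ Finset.range M, 2 * t * (w * (n : ℝ) ^ 2 * (1 / 2) ^ n) :=
          Finset.sum_le_sum fun n _ => this n
      _ = 2 * t * ∑ n ∈ Finset.range M, w * (n : ℝ) ^ 2 * (1 / 2) ^ n := by rw [Finset.mul_sum]
      _ ≤ _ := mul_le_mul_of_nonneg_left (hs.sum_le_tsum _ fun n _ => by positivity)
          (by linarith)
  have hmul : ∀ (u v : ℕ → ℝ) (n : ℕ), (∑ q ∈ Finset.HasAntidiagonal.antidiagonal n, u q.1 * v q.2) * t ^ n =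
      ∑ q ∈ Finset.HasAntidiagonal.antidiagonal n, (u q.1 * t ^ q.1) * (v q.2 * t ^ q.2) := by
    intro u v n
    rw [Finset.sum_mul]
    refine Finset.sum_congr rfl fun q hq => ?_
    rw [← Finset.HasAntidiagonal.mem_antidiagonal.1 hq, pow_add]
    ring
  have hS : ∀ M, ∑ n ∈ Finset.range (M + 1), f n * t ^ n ≤ R := by
    intro M
    induction M with
    | zero => simp; linarith [hf 0]
    | succ M ih =>
      set S := ∑ n ∈ Finset.range (M + 1), f n * t ^ n with hS
      have hS0 : 0 ≤ S := Finset.sum_nonneg fun n _ => mul_nonneg (hf n) (pow_nonneg ht0.le n)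
      have hB : ∑ n ∈ Finset.range (M + 2), β n * t ^ n ≤ C * (2 * t * Ω * R) := by
        calc ∑ n ∈ Finset.range (M + 2), β n * t ^ n
            ≤ ∑ n ∈ Finset.range (M + 2), C * ∑ q ∈ Finset.HasAntidiagonal.antidiagonal n,
              (w * (q.1 : ℝ) ^ 2 * t ^ q.1) * (f q.2 * t ^ q.2) := by
              refine Finset.sum_le_sum fun n _ => ?_
              rw [← hmul (fun i => w * (i : ℝ) ^ 2) f, ← mul_assoc]
              exact mul_le_mul_of_nonneg_right (h2 n) (pow_nonneg ht0.le n)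
          _ ≤ C * ((∑ n ∈ Finset.range (M + 2), w * (n : ℝ) ^ 2 * t ^ n) * S) := by
              rw [← Finset.mul_sum]
              exact mul_le_mul_of_nonneg_left (sum_antidiagonal_le_mul
                (u := fun i => w * (i : ℝ) ^ 2 * t ^ i) (v := fun i => f i * t ^ i)
                (fun n => by positivity) (fun n => mul_nonneg (hf n) (pow_nonneg ht0.le n))
                (by simp) (M + 1)) hC
          _ ≤ C * (2 * t * Ω * R) :=
              mul_le_mul_of_nonneg_left (mul_le_mul (hω _) ih hS0 (by positivity)) hC
      rw [Finset.sum_range_succ' _ (M + 1)]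
      have h5 : ∑ n ∈ Finset.range (M + 1), f (n + 1) * t ^ (n + 1) ≤
          C * ((C * (2 * t * Ω * R) + 2 * t * Ω) * R) := by
        calc ∑ n ∈ Finset.range (M + 1), f (n + 1) * t ^ (n + 1)
            ≤ ∑ n ∈ Finset.range (M + 1), C * ∑ q ∈ Finset.HasAntidiagonal.antidiagonal (n + 1),
              ((β q.1 + w * (q.1 : ℝ) ^ 2) * t ^ q.1) * (f q.2 * t ^ q.2) := by
              refine Finset.sum_le_sum fun n _ => ?_
              rw [← hmul (fun i => β i + w * (i : ℝ) ^ 2) f, ← mul_assoc]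
              exact mul_le_mul_of_nonneg_right (h1 _ (Nat.succ_ne_zero n)) (pow_nonneg ht0.le _)
          _ ≤ ∑ n ∈ Finset.range (M + 2), C * ∑ q ∈ Finset.HasAntidiagonal.antidiagonal n,
              ((β q.1 + w * (q.1 : ℝ) ^ 2) * t ^ q.1) * (f q.2 * t ^ q.2) := by
              rw [Finset.sum_range_succ' _ (M + 1)]
              simp [hβ0]
          _ ≤ C * ((∑ n ∈ Finset.range (M + 2), (β n + w * (n : ℝ) ^ 2) * t ^ n) * S) := by
              rw [← Finset.mul_sum]
              exact mul_le_mul_of_nonneg_left (sum_antidiagonal_le_mul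
                (u := fun i => (β i + w * (i : ℝ) ^ 2) * t ^ i) (v := fun i => f i * t ^ i)
                (fun n => by have := hβ n; positivity)
                (fun n => mul_nonneg (hf n) (pow_nonneg ht0.le n))
                (by simp [hβ0]) (M + 1)) hC
          _ ≤ _ := by
              refine mul_le_mul_of_nonneg_left (mul_le_mul ?_ ih hS0 (by positivity)) hC
              simp only [add_mul, Finset.sum_add_distrib]
              exact add_le_add hB (hω _)
      have h6 : C * ((C * (2 * t * Ω * R) + 2 * t * Ω) * R) ≤ 1 := by
        refine le_trans (le_of_eq ?_) ht2; ring
      have := hf 0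
      simp only [pow_zero, mul_one]
      linarith
  refine ⟨t, ht0, by linarith, summable_of_sum_range_le (c := R)
    (fun n => mul_nonneg (hf n) (pow_nonneg ht0.le n)) fun n => ?_⟩
  refine le_trans ?_ (hS n)
  rw [Finset.sum_range_succ]
  have := mul_nonneg (hf n) (pow_nonneg ht0.le n)
  linarith

lemma exists_recursion {E : Type*} [Zero E] (Φ : ℕ → (ℕ → E) → E)
    (hΦ : ∀ n F G, (∀ j < n, F j = G j) → Φ n F = Φ n G) : ∃ F : ℕ → E, ∀ n, F n = Φ n F := by
  classical
  -- The default `0` for indices `j ≥ n` is harmless, because `Φ n` only depends on earlier values.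
  let F : ℕ → E := fun n => WellFounded.fix Nat.lt_wfRel.wf
    (fun n (ih : ∀ j, j < n → E) => Φ n fun j => if h : j < n then ih j h else 0) n
  refine ⟨F, fun n => ?_⟩
  have h1 : F n = Φ n fun j => if j < n then F j else 0 := by
    simp only [F]
    rw [WellFounded.fix_eq]
    rfl
  rw [h1]
  exact hΦ n _ _ fun j hj => if_pos hj

/-! ### Formal perturbation theory -/

/-- Two formal power series of operators, with leading coefficients symmetric and jointly
diagonalised with simple spectrum, the higher coefficients being bounded relative to an energy
seminorm and compatible with a filtration. -/
structure PertData (E ι : Type*) [NormedAddCommGroup E] [InnerProductSpace ℂ E] where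
  /-- The Hamiltonian. -/
  H : ℕ → E →ₗ[ℂ] E
  /-- The additional integral. -/
  I : ℕ → E →ₗ[ℂ] E
  /-- The joint eigenvectors. -/
  g : ι → E
  /-- The eigenvalues of the Hamiltonian. -/
  e : ι → ℝ
  /-- The eigenvalues of the integral. -/
  f : ι → ℝ
  /-- The filtration. -/
  V : ℤ → Submodule ℂ E
  /-- The energy seminorm. -/
  K : Seminorm ℂ E
  /-- The growth constant of the perturbation. -/
  w : ℝ
  symmH : (H 0).IsSymmetric
  symmI : (I 0).IsSymmetric
  eigH : ∀ z, H 0 (g z) = (e z : ℂ) • g z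
  eigI : ∀ z, I 0 (g z) = (f z : ℂ) • g z
  g_ne_zero : ∀ z, g z ≠ 0
  separates : ∀ z w, e z = e w → f z = f w → z = w
  finite_le : ∀ B : ℝ, {z | e z ≤ B}.Finite
  mem_span : ∀ b, ∀ v ∈ V b, v ∈ Submodule.span ℂ (g '' {z | g z ∈ V b})
  memH : ∀ b (n : ℕ), ∀ v ∈ V b, H n v ∈ V (b + n)
  memI : ∀ b (n : ℕ), ∀ v ∈ V b, I n v ∈ V (b + n)
  w_nonneg : 0 ≤ w
  energy_le : ∀ v, K v ^ 2 ≤ 3 * (inner ℂ v (H 0 v)).re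
  boundH : ∀ n, n ≠ 0 → ∀ v, ‖H n v‖ ≤ w * n ^ 2 * (‖v‖ + K v)
  boundI : ∀ n, n ≠ 0 → ∀ v, ‖I n v‖ ≤ w * n ^ 2 * (‖v‖ + K v)
  mono : Monotone V

namespace PertData

variable {E ι : Type*} [NormedAddCommGroup E] [InnerProductSpace ℂ E] (P : PertData E ι)

/-- The combination `H + i I`. -/
def A (n : ℕ) : E →ₗ[ℂ] E := P.H n + Complex.I • P.I n

/-- The eigenvalues of `H + i I`. -/
def a (z : ι) : ℂ := P.e z + Complex.I * P.f z

lemma A_apply (n : ℕ) (v : E) : P.A n v = P.H n v + Complex.I • P.I n v := rfl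

lemma A_g (z : ι) : P.A 0 (P.g z) = P.a z • P.g z := by
  rw [A_apply, P.eigH, P.eigI, smul_smul, ← add_smul, a]

lemma a_injective : Function.Injective P.a := by
  intro z w h
  have h1 := congrArg Complex.re h
  have h2 := congrArg Complex.im h
  simp [a] at h1 h2
  exact P.separates z w h1 h2

lemma inner_g {z w : ι} (h : z ≠ w) : inner ℂ (P.g z) (P.g w) = 0 := by
  by_contra hne
  refine h (P.separates z w ?_ ?_)
  · have := P.symmH (P.g z) (P.g w)
    rw [P.eigH, P.eigH, inner_smul_left, inner_smul_right, Complex.conj_ofReal] at this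
    exact_mod_cast mul_right_cancel₀ hne this
  · have := P.symmI (P.g z) (P.g w)
    rw [P.eigI, P.eigI, inner_smul_left, inner_smul_right, Complex.conj_ofReal] at this
    exact_mod_cast mul_right_cancel₀ hne this

lemma inner_sum_g (s : Finset ι) (c d : ι → ℂ) :
    inner ℂ (∑ z ∈ s, c z • P.g z) (∑ z ∈ s, d z • P.g z) =
      ∑ z ∈ s, starRingEnd ℂ (c z) * d z * ((‖P.g z‖ ^ 2 : ℝ) : ℂ) := by
  rw [sum_inner]
  refine Finset.sum_congr rfl fun z hz => ?_
  rw [inner_sum, Finset.sum_eq_single z]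
  · rw [inner_smul_left, inner_smul_right, inner_self_eq_norm_sq_to_K, mul_assoc]
    norm_cast
  · intro w _ hw
    rw [inner_smul_left, inner_smul_right, P.inner_g hw.symm, mul_zero, mul_zero]
  · intro h; exact absurd hz h

lemma norm_sq_sum_g (s : Finset ι) (c : ι → ℂ) :
    ‖∑ z ∈ s, c z • P.g z‖ ^ 2 = ∑ z ∈ s, ‖c z‖ ^ 2 * ‖P.g z‖ ^ 2 := by
  have h := P.inner_sum_g s c c
  rw [inner_self_eq_norm_sq_to_K] at h
  have h2 : ∀ z, starRingEnd ℂ (c z) * c z * ((‖P.g z‖ ^ 2 : ℝ) : ℂ) =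
      ((‖c z‖ ^ 2 * ‖P.g z‖ ^ 2 : ℝ) : ℂ) := by
    intro z
    rw [Complex.conj_mul']
    push_cast
    ring
  simp only [h2] at h
  rw [← Complex.ofReal_sum] at h
  refine Complex.ofReal_injective (Eq.trans ?_ h)
  simp

/-- Beyond an energy threshold the gap is at least `e z - e z₀`, hence at least `e z / 2` and at
least `1`. Below it only finitely many eigenvalues occur, all distinct from that of `z₀`. The second
bound is what makes the resolvent gain a derivative. -/
lemma exists_gap (z₀ : ι) : ∃ C : ℝ, 0 ≤ C ∧ ∀ z, z ≠ z₀ →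
    1 ≤ C * ‖P.a z - P.a z₀‖ ^ 2 ∧ P.e z ≤ C * ‖P.a z - P.a z₀‖ ^ 2 := by
  classical
  set B := 2 * |P.e z₀| + 2 with hB
  set s := (P.finite_le B).toFinset.erase z₀
  have hpos : ∀ z, z ≠ z₀ → 0 < ‖P.a z - P.a z₀‖ ^ 2 := fun z hz => by
    have : P.a z - P.a z₀ ≠ 0 := sub_ne_zero.2 fun h => hz (P.a_injective h)
    positivity
  set C := 2 + ∑ z ∈ s, (1 + |P.e z|) / ‖P.a z - P.a z₀‖ ^ 2 with hC
  have hC2 : 2 ≤ C := le_add_of_nonneg_right (Finset.sum_nonneg fun z _ => by positivity)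
  refine ⟨C, by linarith, fun z hz => ?_⟩
  by_cases hz2 : P.e z ≤ B
  · have h1 : (1 + |P.e z|) / ‖P.a z - P.a z₀‖ ^ 2 ≤ C := by
      have : (1 + |P.e z|) / ‖P.a z - P.a z₀‖ ^ 2 ≤ ∑ z ∈ s, (1 + |P.e z|) / ‖P.a z - P.a z₀‖ ^ 2 :=
        Finset.single_le_sum (f := fun z => (1 + |P.e z|) / ‖P.a z - P.a z₀‖ ^ 2)
          (fun z _ => by positivity)
          (Finset.mem_erase.2 ⟨hz, (P.finite_le B).mem_toFinset.2 hz2⟩)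
      linarith
    rw [div_le_iff₀ (hpos z hz)] at h1
    have h2 := le_abs_self (P.e z)
    have h3 := abs_nonneg (P.e z)
    constructor <;> linarith
  · push Not at hz2
    have h1 : P.e z - P.e z₀ ≤ ‖P.a z - P.a z₀‖ := by
      refine le_trans (le_of_eq ?_) (Complex.re_le_norm _)
      simp [a]
    have h2 := le_abs_self (P.e z₀)
    have h3 : P.e z / 2 ≤ ‖P.a z - P.a z₀‖ := by linarith
    have h4 : 1 ≤ ‖P.a z - P.a z₀‖ := by linarith [abs_nonneg (P.e z₀)]
    constructor <;> nlinarith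

/-- This is the reduced resolvent: coefficients in the orthogonal eigenbasis are divided by the
eigenvalue gaps. The two bounds of `exists_gap` give the constants `√C` for the norm and `√(3C)` for
the energy seminorm. Only finite sums occur, and the filtration level is kept. -/
lemma exists_inverse (z₀ : ι) : ∃ C : ℝ, 0 ≤ C ∧ ∀ b, ∀ v ∈ P.V b, inner ℂ (P.g z₀) v = 0 →
    ∃ F ∈ P.V b, inner ℂ (P.g z₀) F = 0 ∧ P.A 0 F - P.a z₀ • F = v ∧ ‖F‖ + P.K F ≤ C * ‖v‖ := by
  classical
  obtain ⟨C, hC, hgap⟩ := P.exists_gap z₀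
  refine ⟨√C + √(3 * C), by positivity, fun b v hv hv0 => ?_⟩
  obtain ⟨l, hl, rfl⟩ := (Finsupp.mem_span_image_iff_linearCombination ℂ).1 (P.mem_span b v hv)
  rw [Finsupp.linearCombination_apply, Finsupp.sum] at *
  have hl0 : l z₀ = 0 := by
    by_contra hne
    rw [inner_sum, Finset.sum_eq_single z₀ (fun w _ hw => by
      rw [inner_smul_right, P.inner_g hw.symm, mul_zero])
      (fun h => absurd (Finsupp.mem_support_iff.2 hne) h), inner_smul_right] at hv0
    rcases mul_eq_zero.1 hv0 with h | h
    · exact hne h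
    · exact P.g_ne_zero z₀ (inner_self_eq_zero.1 h)
  have hsup : ∀ z ∈ l.support, z ≠ z₀ := by
    rintro z hz rfl
    exact Finsupp.mem_support_iff.1 hz hl0
  have ha : ∀ z ∈ l.support, P.a z - P.a z₀ ≠ 0 := fun z hz =>
    sub_ne_zero.2 fun h => hsup z hz (P.a_injective h)
  set c : ι → ℂ := fun z => l z / (P.a z - P.a z₀) with hc
  refine ⟨∑ z ∈ l.support, c z • P.g z, ?_, ?_, ?_, ?_⟩
  · exact sum_mem fun z hz => Submodule.smul_mem _ _ ((Finsupp.mem_supported _ _).1 hl hz)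
  · rw [inner_sum]
    exact Finset.sum_eq_zero fun z hz => by
      rw [inner_smul_right, P.inner_g (hsup z hz).symm, mul_zero]
  · rw [map_sum, Finset.smul_sum, ← Finset.sum_sub_distrib]
    refine Finset.sum_congr rfl fun z hz => ?_
    rw [map_smul, A_g, smul_comm (P.a z₀), ← smul_sub, ← sub_smul, smul_smul, hc,
      div_mul_cancel₀ _ (ha z hz)]
  · have hn := P.norm_sq_sum_g l.support c
    have hv := P.norm_sq_sum_g l.support l
    set F := ∑ z ∈ l.support, c z • P.g z with hF
    set v := ∑ z ∈ l.support, l z • P.g z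
    have hcz : ∀ z ∈ l.support, ‖c z‖ ^ 2 * ‖P.a z - P.a z₀‖ ^ 2 = ‖l z‖ ^ 2 := by
      intro z hz
      rw [← mul_pow, ← norm_mul, hc, div_mul_cancel₀ _ (ha z hz)]
    have h1 : ‖F‖ ^ 2 ≤ C * ‖v‖ ^ 2 := by
      rw [hn, hv, Finset.mul_sum]
      refine Finset.sum_le_sum fun z hz => ?_
      rw [← hcz z hz]
      have := (hgap z (hsup z hz)).1
      have h0 : 0 ≤ ‖c z‖ ^ 2 * ‖P.g z‖ ^ 2 := by positivity
      nlinarith [mul_le_mul_of_nonneg_left this h0]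
    have h2 : P.K F ^ 2 ≤ 3 * C * ‖v‖ ^ 2 := by
      refine (P.energy_le F).trans ?_
      have h3 : P.H 0 F = ∑ z ∈ l.support, (c z * P.e z) • P.g z := by
        rw [hF, map_sum]
        exact Finset.sum_congr rfl fun z _ => by rw [map_smul, P.eigH, smul_smul]
      have h4 : ∀ z, starRingEnd ℂ (c z) * (c z * P.e z) * ((‖P.g z‖ ^ 2 : ℝ) : ℂ) =
          ((‖c z‖ ^ 2 * P.e z * ‖P.g z‖ ^ 2 : ℝ) : ℂ) := by
        intro z
        rw [← mul_assoc, Complex.conj_mul']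
        push_cast
        ring
      rw [h3, hF, P.inner_sum_g, Finset.sum_congr rfl fun z _ => h4 z, ← Complex.ofReal_sum,
        Complex.ofReal_re, hv, Finset.mul_sum, Finset.mul_sum]
      refine Finset.sum_le_sum fun z hz => ?_
      rw [← hcz z hz]
      have := (hgap z (hsup z hz)).2
      have h0 : 0 ≤ ‖c z‖ ^ 2 * ‖P.g z‖ ^ 2 := by positivity
      nlinarith [mul_le_mul_of_nonneg_left this h0]
    have h5 : ‖F‖ ≤ √C * ‖v‖ := by
      rw [← Real.sqrt_sq (norm_nonneg v), ← Real.sqrt_mul hC]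
      exact Real.le_sqrt_of_sq_le h1
    have h6 : P.K F ≤ √(3 * C) * ‖v‖ := by
      rw [← Real.sqrt_sq (norm_nonneg v), ← Real.sqrt_mul (show 0 ≤ 3 * C by positivity)]
      exact Real.le_sqrt_of_sq_le h2
    rw [add_mul]
    exact add_le_add h5 h6

/-- The state is recovered, up to its component along `g z₀`, from the resolvent equation. -/
lemma eq_zero_of_eigen {z₀ : ι} {b : ℤ} {v : E} (hv : v ∈ P.V b) (h0 : inner ℂ (P.g z₀) v = 0)
    (h : P.A 0 v = P.a z₀ • v) : v = 0 := by
  classical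
  obtain ⟨l, hl, rfl⟩ := (Finsupp.mem_span_image_iff_linearCombination ℂ).1 (P.mem_span b v hv)
  rw [Finsupp.linearCombination_apply, Finsupp.sum] at *
  have h1 : ∑ z ∈ l.support, (l z * (P.a z - P.a z₀)) • P.g z = 0 := by
    rw [map_sum, Finset.smul_sum, ← sub_eq_zero, ← Finset.sum_sub_distrib] at h
    rw [← h]
    refine Finset.sum_congr rfl fun z _ => ?_
    rw [map_smul, A_g, smul_smul, smul_smul, ← sub_smul]
    congr 1
    ring
  have h2 := P.norm_sq_sum_g l.support fun z => l z * (P.a z - P.a z₀)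
  rw [h1, norm_zero, zero_pow two_ne_zero, eq_comm,
    Finset.sum_eq_zero_iff_of_nonneg fun z _ => by positivity] at h2
  have h3 : ∀ z ∈ l.support, z = z₀ := by
    intro z hz
    by_contra hne
    have h4 := h2 z hz
    have h5 : l z * (P.a z - P.a z₀) ≠ 0 := mul_ne_zero (Finsupp.mem_support_iff.1 hz)
      (sub_ne_zero.2 fun h => hne (P.a_injective h))
    have h6 := P.g_ne_zero z
    have : 0 < ‖l z * (P.a z - P.a z₀)‖ ^ 2 * ‖P.g z‖ ^ 2 := by positivity
    exact this.ne' h4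
  refine Finset.sum_eq_zero fun z hz => ?_
  have hz0 := h3 z hz
  subst hz0
  rw [inner_sum, Finset.sum_eq_single z (fun w hw hne => absurd (h3 w hw) hne)
    (fun h => absurd hz h), inner_smul_right] at h0
  rcases mul_eq_zero.1 h0 with h | h
  · rw [h, zero_smul]
  · exact absurd (inner_self_eq_zero.1 h) (P.g_ne_zero z)

end PertData

end CalogeroMoser

end

/-! ### Formal eigenvectors, their convergence, and descent from `H + iI` to `H`. -/

noncomputable section

namespace CalogeroMoser

lemma antidiagonal_erase_snd_lt {n : ℕ} {q : ℕ × ℕ}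
    (hq : q ∈ (Finset.HasAntidiagonal.antidiagonal n).erase (0, n)) :
    q.2 < n ∧ q.1 ≤ n ∧ q.1 ≠ 0 ∧ q.1 + q.2 = n := by
  obtain ⟨h1, h2⟩ := Finset.mem_erase.1 hq
  rw [Finset.HasAntidiagonal.mem_antidiagonal] at h2
  have : q.1 ≠ 0 := fun h => h1 (Prod.ext h (by simp only; omega))
  omega

lemma sum_antidiagonal_eq_add_erase {M : Type*} [AddCommMonoid M] (n : ℕ) (f : ℕ × ℕ → M) :
    ∑ q ∈ Finset.HasAntidiagonal.antidiagonal n, f q =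
      f (0, n) + ∑ q ∈ (Finset.HasAntidiagonal.antidiagonal n).erase (0, n), f q :=
  (Finset.add_sum_erase _ f (Finset.HasAntidiagonal.mem_antidiagonal.2 (zero_add n))).symm

namespace PertData

variable {E ι : Type*} [NormedAddCommGroup E] [InnerProductSpace ℂ E] (P : PertData E ι)

lemma norm_A_le {n : ℕ} (hn : n ≠ 0) (v : E) : ‖P.A n v‖ ≤ 2 * P.w * n ^ 2 * (‖v‖ + P.K v) := by
  have h1 := P.boundH n hn v
  have h2 := P.boundI n hn v
  rw [A_apply]
  refine (norm_add_le _ _).trans ?_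
  rw [norm_smul, Complex.norm_I, one_mul]
  linarith

lemma A_mem {b : ℤ} (n : ℕ) {v : E} (hv : v ∈ P.V b) : P.A n v ∈ P.V (b + n) :=
  add_mem (P.memH b n v hv) (Submodule.smul_mem _ _ (P.memI b n v hv))

/-- The normalised functional dual to an eigenvector. -/
def dual (z₀ : ι) : E →ₗ[ℂ] ℂ := (inner ℂ (P.g z₀) (P.g z₀))⁻¹ • (innerₛₗ ℂ (P.g z₀))

lemma dual_apply (z₀ : ι) (v : E) :
    P.dual z₀ v = (inner ℂ (P.g z₀) (P.g z₀))⁻¹ * inner ℂ (P.g z₀) v := rfl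

lemma dual_self (z₀ : ι) : P.dual z₀ (P.g z₀) = 1 :=
  inv_mul_cancel₀ fun h => P.g_ne_zero z₀ (inner_self_eq_zero.1 h)

lemma dual_eq_zero_iff (z₀ : ι) (v : E) : P.dual z₀ v = 0 ↔ inner ℂ (P.g z₀) v = 0 := by
  rw [dual_apply, mul_eq_zero, or_iff_right]
  exact inv_ne_zero fun h => P.g_ne_zero z₀ (inner_self_eq_zero.1 h)

lemma norm_dual_le (z₀ : ι) (v : E) : ‖P.dual z₀ v‖ ≤ ‖P.g z₀‖⁻¹ * ‖v‖ := by
  have h0 : ‖P.g z₀‖ ≠ 0 := norm_ne_zero_iff.2 (P.g_ne_zero z₀)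
  rw [dual_apply, norm_mul, norm_inv, inner_self_eq_norm_sq_to_K]
  have h1 : ‖((‖P.g z₀‖ : ℂ)) ^ 2‖ = ‖P.g z₀‖ ^ 2 := by simp
  refine (mul_le_mul_of_nonneg_left (norm_inner_le_norm _ _) (by positivity)).trans (le_of_eq ?_)
  refine (congrArg (fun u => u⁻¹ * (‖P.g z₀‖ * ‖v‖)) h1).trans ?_
  field_simp

/-- Formal eigenvectors of `H + i I` together with their convergence. -/
lemma exists_formal_eigenvector (z₀ : ι) {b₀ : ℤ} (hb : P.g z₀ ∈ P.V b₀) :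
    ∃ (F : ℕ → E) (α : ℕ → ℂ) (t : ℝ), 0 < t ∧ t < 1 ∧ F 0 = P.g z₀ ∧ α 0 = P.a z₀ ∧
      (∀ n : ℕ, F n ∈ P.V (b₀ + n)) ∧ (∀ n, n ≠ 0 → P.dual z₀ (F n) = 0) ∧
      (∀ n, ∑ q ∈ Finset.HasAntidiagonal.antidiagonal n, P.A q.1 (F q.2) =
        ∑ q ∈ Finset.HasAntidiagonal.antidiagonal n, α q.1 • F q.2) ∧
      Summable fun n => (‖F n‖ + P.K (F n)) * t ^ n := by
  obtain ⟨C, hC, hinv⟩ := P.exists_inverse z₀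
  choose! S hS using hinv
  set T : ℕ → Finset (ℕ × ℕ) := fun n => (Finset.HasAntidiagonal.antidiagonal n).erase (0, n) with hT
  -- With the normalisation that all `F n`, `n ≥ 1`, are orthogonal to `g z₀`, pairing the equation
  -- of order `n` with `g z₀` forces this value for the eigenvalue coefficient. It only involves
  -- earlier terms.
  set al : (ℕ → E) → ℕ → ℂ := fun F i => P.dual z₀ (∑ q ∈ T i, P.A q.1 (F q.2)) with hal
  obtain ⟨F, hF⟩ := exists_recursion (fun n (F : ℕ → E) => if n = 0 then P.g z₀ else
    S (b₀ + n) (∑ q ∈ T n, (al F q.1 • F q.2 - P.A q.1 (F q.2)))) (by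
      intro n F G h
      split_ifs with hn
      · rfl
      · congr 1
        refine Finset.sum_congr rfl fun q hq => ?_
        obtain ⟨h1, h2, -, -⟩ := antidiagonal_erase_snd_lt hq
        have h3 : al F q.1 = al G q.1 := by
          simp only [hal]
          congr 1
          refine Finset.sum_congr rfl fun r hr => ?_
          obtain ⟨h4, -, -, -⟩ := antidiagonal_erase_snd_lt hr
          rw [h r.2 (by omega)]
        rw [h q.2 h1, h3])
  have hF0 : F 0 = P.g z₀ := by rw [hF]; simp
  have hFn : ∀ n, n ≠ 0 → F n = S (b₀ + n) (∑ q ∈ T n, (al F q.1 • F q.2 - P.A q.1 (F q.2))) :=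
    fun n hn => by rw [hF n, if_neg hn]
  have key : ∀ n : ℕ, (F n ∈ P.V (b₀ + n)) ∧ (n ≠ 0 → P.dual z₀ (F n) = 0) ∧
      (n ≠ 0 → P.A 0 (F n) - P.a z₀ • F n = ∑ q ∈ T n, (al F q.1 • F q.2 - P.A q.1 (F q.2))) ∧
      (n ≠ 0 → ‖F n‖ + P.K (F n) ≤ C * ‖∑ q ∈ T n, (al F q.1 • F q.2 - P.A q.1 (F q.2))‖) := by
    intro n
    induction n using Nat.strong_induction_on with
    | _ n ih =>
      by_cases hn : n = 0
      · subst hn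
        rw [hF0]
        simpa using hb
      · have hmem : ∑ q ∈ T n, (al F q.1 • F q.2 - P.A q.1 (F q.2)) ∈ P.V (b₀ + n) := by
          refine sum_mem fun q hq => ?_
          obtain ⟨h1, h2, h3, h4⟩ := antidiagonal_erase_snd_lt hq
          have h5 := (ih q.2 h1).1
          refine sub_mem (Submodule.smul_mem _ _ (P.mono (by omega) h5)) ?_
          exact P.mono (by omega) (P.A_mem q.1 h5)
        -- Solvability: the dual functional kills every `F q.2` except `F 0`, so only the pair `(n,
        -- 0)` contributes, and `al F n` was chosen to cancel the rest.
        have hz : inner ℂ (P.g z₀) (∑ q ∈ T n, (al F q.1 • F q.2 - P.A q.1 (F q.2))) = 0 := by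
          rw [← dual_eq_zero_iff, Finset.sum_sub_distrib, map_sub, map_sum, sub_eq_zero]
          change _ = al F n
          have hmem : (n, 0) ∈ T n := by
            rw [hT, Finset.mem_erase, Finset.HasAntidiagonal.mem_antidiagonal]
            refine ⟨fun h => hn (congrArg Prod.fst h), rfl⟩
          rw [Finset.sum_eq_single (n, 0)]
          · rw [map_smul, hF0, dual_self, smul_eq_mul, mul_one]
          · intro q hq hne
            obtain ⟨h1, h2, h3, h4⟩ := antidiagonal_erase_snd_lt hq
            have : q.2 ≠ 0 := fun h => hne (Prod.ext (by simp only; omega) h)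
            rw [map_smul, (ih q.2 h1).2.1 this, smul_zero]
          · intro h; exact absurd hmem h
        obtain ⟨h1, h2, h3, h4⟩ := hS _ _ hmem hz
        rw [← hFn n hn] at h1 h2 h3 h4
        exact ⟨h1, fun _ => (P.dual_eq_zero_iff z₀ _).2 h2, fun _ => h3, fun _ => h4⟩
  -- The sum defining `al F 0` is empty, so the unperturbed eigenvalue has to be inserted at index
  -- `0`.
  set α : ℕ → ℂ := fun n => if n = 0 then P.a z₀ else al F n with hα
  set f : ℕ → ℝ := fun n => ‖F n‖ + P.K (F n) with hf
  have hf0 : ∀ n, 0 ≤ f n := fun n => add_nonneg (norm_nonneg _) (apply_nonneg _ _)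
  have hAb : ∀ n, ∀ q ∈ T n, ‖P.A q.1 (F q.2)‖ ≤ 2 * P.w * q.1 ^ 2 * f q.2 := fun n q hq =>
    P.norm_A_le (antidiagonal_erase_snd_lt hq).2.2.1 _
  have hw := P.w_nonneg
  have hψ : 0 ≤ ‖P.g z₀‖⁻¹ := by positivity
  have halb : ∀ n, ‖al F n‖ ≤ ‖P.g z₀‖⁻¹ *
      ∑ q ∈ Finset.HasAntidiagonal.antidiagonal n, 2 * P.w * (q.1 : ℝ) ^ 2 * f q.2 := by
    intro n
    refine (P.norm_dual_le z₀ _).trans (mul_le_mul_of_nonneg_left ?_ hψ)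
    refine (norm_sum_le_of_le _ (hAb n)).trans ?_
    exact Finset.sum_le_sum_of_subset_of_nonneg (Finset.erase_subset _ _)
      fun q _ _ => by have := hf0 q.2; positivity
  -- The resolvent bound and the bound for the eigenvalue coefficients are merged into one constant,
  -- as the majorant lemma requires; `2 * P.w` accounts for the two summands of `A`.
  obtain ⟨t, ht0, ht1, hs⟩ := exists_summable_of_quadratic_recursion (f := f)
    (β := fun n => if n = 0 then 0 else ‖al F n‖) (C := C + ‖P.g z₀‖⁻¹) (w := 2 * P.w) hf0
    (fun n => by split_ifs <;> positivity) (if_pos rfl) (by positivity) (by positivity)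
    (by
      intro n hn
      refine ((key n).2.2.2 hn).trans ?_
      have h1 : ‖∑ q ∈ T n, (al F q.1 • F q.2 - P.A q.1 (F q.2))‖ ≤
          ∑ q ∈ T n, ((if q.1 = 0 then 0 else ‖al F q.1‖) + 2 * P.w * (q.1 : ℝ) ^ 2) * f q.2 := by
        refine norm_sum_le_of_le _ fun q hq => (norm_sub_le _ _).trans ?_
        rw [add_mul, norm_smul, if_neg (antidiagonal_erase_snd_lt hq).2.2.1]
        refine add_le_add (mul_le_mul_of_nonneg_left ?_ (norm_nonneg _)) (hAb n q hq)
        exact le_add_of_nonneg_right (apply_nonneg _ _)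
      have hnn : ∀ q : ℕ × ℕ, 0 ≤
          ((if q.1 = 0 then 0 else ‖al F q.1‖) + 2 * P.w * (q.1 : ℝ) ^ 2) * f q.2 := by
        intro q
        have := hf0 q.2
        split_ifs <;> positivity
      have h2 := h1.trans (Finset.sum_le_sum_of_subset_of_nonneg
        (Finset.erase_subset (0, n) (Finset.HasAntidiagonal.antidiagonal n)) fun q _ _ => hnn q)
      refine (mul_le_mul_of_nonneg_left h2 hC).trans
        (mul_le_mul_of_nonneg_right (le_add_of_nonneg_right hψ) ?_)
      exact Finset.sum_nonneg fun q _ => hnn q)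
    (by
      intro n
      have h3 : 0 ≤ ∑ q ∈ Finset.HasAntidiagonal.antidiagonal n, 2 * P.w * (q.1 : ℝ) ^ 2 * f q.2 :=
        Finset.sum_nonneg fun q _ => by have := hf0 q.2; positivity
      split_ifs
      · positivity
      · exact (halb n).trans (mul_le_mul_of_nonneg_right (le_add_of_nonneg_left hC) h3))
  refine ⟨F, α, t, ht0, ht1, hF0, if_pos rfl, fun n => (key n).1, fun n => (key n).2.1, ?_, hs⟩
  intro n
  rw [sum_antidiagonal_eq_add_erase, sum_antidiagonal_eq_add_erase]
  have h1 : ∑ q ∈ T n, α q.1 • F q.2 = ∑ q ∈ T n, al F q.1 • F q.2 :=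
    Finset.sum_congr rfl fun q hq => by
      exact congrArg (· • F q.2) (if_neg (antidiagonal_erase_snd_lt hq).2.2.1)
  change P.A 0 (F n) + ∑ q ∈ T n, P.A q.1 (F q.2) = α 0 • F n + ∑ q ∈ T n, α q.1 • F q.2
  rw [h1, show α 0 = P.a z₀ from if_pos rfl]
  by_cases hn : n = 0
  · subst hn
    have : T 0 = ∅ := by rw [hT]; rfl
    rw [this, hF0, A_g]
    simp
  · have h2 := (key n).2.2.1 hn
    rw [Finset.sum_sub_distrib] at h2
    rw [sub_eq_sub_iff_add_eq_add] at h2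
    rw [h2, add_comm]

open PowerSeries in
/-- A formal eigenvector of `H + i I` is a formal eigenvector of `H` if `H` and `I` commute
formally. -/
lemma formal_eigenvector_of_commute {z₀ : ι} {b₀ : ℤ}
    (hcomm : ∀ n v, ∑ q ∈ Finset.HasAntidiagonal.antidiagonal n, P.H q.1 (P.I q.2 v) =
      ∑ q ∈ Finset.HasAntidiagonal.antidiagonal n, P.I q.1 (P.H q.2 v))
    {F : ℕ → E} {α : ℕ → ℂ} (hF0 : F 0 = P.g z₀) (hα : α 0 = P.a z₀)
    (hV : ∀ n : ℕ, F n ∈ P.V (b₀ + n)) (hd : ∀ n, n ≠ 0 → P.dual z₀ (F n) = 0)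
    (hA : ∀ n, ∑ q ∈ Finset.HasAntidiagonal.antidiagonal n, P.A q.1 (F q.2) =
        ∑ q ∈ Finset.HasAntidiagonal.antidiagonal n, α q.1 • F q.2) (n : ℕ) :
    ∑ q ∈ Finset.HasAntidiagonal.antidiagonal n, P.H q.1 (F q.2) =
      ∑ q ∈ Finset.HasAntidiagonal.antidiagonal n,
        P.dual z₀ (∑ r ∈ Finset.HasAntidiagonal.antidiagonal q.1, P.H r.1 (F r.2)) • F q.2 := by
  set G : ℕ → E := fun n => ∑ q ∈ Finset.HasAntidiagonal.antidiagonal n, P.H q.1 (F q.2) with hG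
  set ε : ℕ → ℂ := fun n => P.dual z₀ (G n) with hε
  set R : ℕ → E := fun n => G n - ∑ q ∈ Finset.HasAntidiagonal.antidiagonal n, ε q.1 • F q.2 with hR
  -- Vectors are encoded as rank-one operators through the dual functional and scalars as multiples
  -- of the identity. All Cauchy products then take place in the associative ring of power series
  -- over the endomorphisms.
  let em : (ℕ → E) → (Module.End ℂ E)⟦X⟧ := fun u => PowerSeries.mk fun n => (P.dual z₀).smulRight (u n)
  let sc : (ℕ → ℂ) → (Module.End ℂ E)⟦X⟧ := fun u => PowerSeries.mk fun n => u n • 1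
  let op : (ℕ → E →ₗ[ℂ] E) → (Module.End ℂ E)⟦X⟧ := fun u => PowerSeries.mk u
  have hsc : ∀ (u : ℕ → ℂ) (T : (Module.End ℂ E)⟦X⟧), T * sc u = sc u * T := by
    intro u T
    ext1 n
    rw [coeff_mul, coeff_mul, ← Finset.Nat.sum_antidiagonal_swap]
    refine Finset.sum_congr rfl fun q _ => ?_
    simp [sc, coeff_mk]
  have hop : ∀ (u : ℕ → E →ₗ[ℂ] E) (v : ℕ → E), op u * em v =
      em fun n => ∑ q ∈ Finset.HasAntidiagonal.antidiagonal n, u q.1 (v q.2) := by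
    intro u v
    ext1 n
    rw [coeff_mul]
    ext x
    simp [op, em, coeff_mk, LinearMap.sum_apply, Finset.smul_sum]
  have hse : ∀ (u : ℕ → ℂ) (v : ℕ → E), sc u * em v =
      em fun n => ∑ q ∈ Finset.HasAntidiagonal.antidiagonal n, u q.1 • v q.2 := by
    intro u v
    ext1 n
    rw [coeff_mul]
    ext x
    simp only [sc, em, coeff_mk, LinearMap.sum_apply, Finset.smul_sum, LinearMap.smulRight_apply,
      smul_mul_assoc, one_mul, LinearMap.smul_apply]
    exact Finset.sum_congr rfl fun q _ => smul_comm _ _ _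
  have hem : ∀ u v : ℕ → E, em u = em v → u = v := by
    intro u v h
    funext n
    have h1 := congrArg (fun T : (Module.End ℂ E)⟦X⟧ => (coeff n T) (P.g z₀)) h
    simpa [em, coeff_mk, dual_self] using h1
  have hsub : ∀ u v : ℕ → E, em (fun n => u n - v n) = em u - em v := by
    intro u v
    ext1 n
    ext x
    simp [em, coeff_mk, smul_sub]
  have hHI : op P.H * op P.I = op P.I * op P.H := by
    ext1 n
    rw [coeff_mul, coeff_mul]
    ext x
    simpa [op, coeff_mk, LinearMap.sum_apply] using hcomm n x
  have hAop : op P.A = op P.H + sc (fun n => if n = 0 then Complex.I else 0) * op P.I := by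
    ext1 n
    rw [map_add, coeff_mul, sum_antidiagonal_eq_add_erase, Finset.sum_eq_zero]
    · simp only [op, sc, coeff_mk, if_true, add_zero, smul_mul_assoc, one_mul]
      rfl
    · intro q hq
      simp [sc, coeff_mk, (antidiagonal_erase_snd_lt hq).2.2.1]
  have hHA : op P.H * op P.A = op P.A * op P.H := by
    rw [hAop, mul_add, add_mul, ← mul_assoc, hsc, mul_assoc, hHI, mul_assoc]
  have hAF : op P.A * em F = sc α * em F := by
    rw [hop, hse]; congr 1; funext n; exact hA n
  have hRem : em R = op P.H * em F - sc ε * em F := by rw [hop, hse, ← hsub]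
  -- The defect `R = H F - ε F` again solves the eigenvalue equation of `A`, because `H` commutes
  -- with `A` and scalar series are central.
  have hAR : op P.A * em R = sc α * em R := by
    rw [hRem, mul_sub, mul_sub, ← mul_assoc, ← hHA, mul_assoc, hAF, ← mul_assoc, hsc, mul_assoc,
      ← mul_assoc (op P.A), hsc, mul_assoc, hAF, ← mul_assoc (sc ε), hsc α, mul_assoc]
  rw [hop, hse] at hAR
  have hAR' := fun n => congrFun (hem _ _ hAR) n
  have hRV : ∀ n : ℕ, R n ∈ P.V (b₀ + n) := by
    intro n
    refine sub_mem (sum_mem fun q hq => ?_) (sum_mem fun q hq => Submodule.smul_mem _ _ ?_)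
    · rw [Finset.HasAntidiagonal.mem_antidiagonal] at hq
      exact P.mono (by omega) (P.memH _ q.1 _ (hV q.2))
    · rw [Finset.HasAntidiagonal.mem_antidiagonal] at hq
      exact P.mono (by omega) (hV q.2)
  -- By the normalisation of `F` only the pair `(n, 0)` survives, and `ε n` is defined as the
  -- component of `H F` that it must cancel.
  have hRd : ∀ n, P.dual z₀ (R n) = 0 := by
    intro n
    change P.dual z₀ (G n - ∑ q ∈ Finset.HasAntidiagonal.antidiagonal n, ε q.1 • F q.2) = 0
    rw [map_sub, map_sum (P.dual z₀) (fun q : ℕ × ℕ => ε q.1 • F q.2), Finset.sum_eq_single (n, 0)]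
    · rw [map_smul, hF0, dual_self]; simp [hε]
    · intro q hq hne
      rw [Finset.HasAntidiagonal.mem_antidiagonal] at hq
      have : q.2 ≠ 0 := fun h => hne (Prod.ext (by simp only; omega) h)
      rw [map_smul, hd _ this, smul_zero]
    · intro h
      exact absurd (Finset.HasAntidiagonal.mem_antidiagonal.2 (add_zero n)) h
  -- Once the lower orders vanish, the equation of order `n` says that `R n` lies in the unperturbed
  -- eigenspace. This eigenspace is spanned by `g z₀`, to which `R n` is orthogonal.
  have hR0 : ∀ n, R n = 0 := by
    intro n
    induction n using Nat.strong_induction_on with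
    | _ n ih =>
      refine P.eq_zero_of_eigen (hRV n) ((P.dual_eq_zero_iff z₀ _).1 (hRd n)) ?_
      have h1 := hAR' n
      rw [sum_antidiagonal_eq_add_erase, sum_antidiagonal_eq_add_erase, Finset.sum_eq_zero,
        Finset.sum_eq_zero, add_zero, add_zero, hα] at h1
      · exact h1
      · intro q hq
        rw [ih q.2 (antidiagonal_erase_snd_lt hq).1, smul_zero]
      · intro q hq
        rw [ih q.2 (antidiagonal_erase_snd_lt hq).1, map_zero]
  exact sub_eq_zero.1 (hR0 n)

/-- Convergent formal eigenvectors of `H`. -/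
theorem exists_convergent_eigenvector {z₀ : ι} {b₀ : ℤ} (hb : P.g z₀ ∈ P.V b₀)
    (hcomm : ∀ n v, ∑ q ∈ Finset.HasAntidiagonal.antidiagonal n, P.H q.1 (P.I q.2 v) =
      ∑ q ∈ Finset.HasAntidiagonal.antidiagonal n, P.I q.1 (P.H q.2 v)) :
    ∃ (F : ℕ → E) (ε : ℕ → ℂ) (t : ℝ), 0 < t ∧ t < 1 ∧ F 0 = P.g z₀ ∧ ε 0 = P.e z₀ ∧
      (∀ n : ℕ, F n ∈ P.V (b₀ + n)) ∧
      (∀ n, ∑ q ∈ Finset.HasAntidiagonal.antidiagonal n, P.H q.1 (F q.2) =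
        ∑ q ∈ Finset.HasAntidiagonal.antidiagonal n, ε q.1 • F q.2) ∧
      (Summable fun n => ‖F n‖ * t ^ n) ∧ Summable fun n => ‖ε n‖ * t ^ n := by
  obtain ⟨F, α, t, ht0, ht1, hF0, hα, hV, hd, hA, hs⟩ := P.exists_formal_eigenvector z₀ hb
  have hE := P.formal_eigenvector_of_commute hcomm hF0 hα hV hd hA
  have hf0 : ∀ n, 0 ≤ ‖F n‖ + P.K (F n) := fun n => add_nonneg (norm_nonneg _) (apply_nonneg _ _)
  refine ⟨F, fun n => P.dual z₀ (∑ r ∈ Finset.HasAntidiagonal.antidiagonal n, P.H r.1 (F r.2)), t,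
    ht0, ht1, hF0, ?_, hV, hE, ?_, ?_⟩
  · beta_reduce
    rw [Finset.Nat.antidiagonal_zero, Finset.sum_singleton, hF0, P.eigH, map_smul, dual_self,
      smul_eq_mul, mul_one]
  · refine hs.of_nonneg_of_le (fun n => by positivity) fun n =>
      mul_le_mul_of_nonneg_right ?_ (by positivity)
    exact le_add_of_nonneg_right (apply_nonneg _ _)
  · have hw : Summable fun n : ℕ => P.w * (n : ℝ) ^ 2 * t ^ n := by
      have := (summable_pow_mul_geometric_of_norm_lt_one 2
        (show ‖t‖ < 1 by rwa [Real.norm_of_nonneg ht0.le])).mul_left P.w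
      simpa only [mul_assoc] using this
    have hw0 := P.w_nonneg
    have h1 : Summable fun n : ℕ => ∑ q ∈ Finset.HasAntidiagonal.antidiagonal n,
        (P.w * (q.1 : ℝ) ^ 2 * t ^ q.1) * ((‖F q.2‖ + P.K (F q.2)) * t ^ q.2) := by
      refine summable_sum_mul_antidiagonal_of_summable_mul (f := fun n : ℕ => P.w * (n : ℝ) ^ 2 * t ^ n)
        (g := fun n => (‖F n‖ + P.K (F n)) * t ^ n) ?_
      exact hw.mul_of_nonneg hs (fun n => by positivity)
        fun n => mul_nonneg (hf0 n) (by positivity)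
    rw [← summable_nat_add_iff 1]
    refine ((summable_nat_add_iff 1).2 (h1.mul_left ‖P.g z₀‖⁻¹)).of_nonneg_of_le
      (fun n => by positivity) fun n => ?_
    set m := n + 1 with hm
    have hm0 : m ≠ 0 := Nat.succ_ne_zero n
    -- The contribution of `H 0` drops out: `H 0` is symmetric, `g z₀` is its eigenvector, and `F m`
    -- is orthogonal to `g z₀`. What remains only involves bounded coefficients.
    have h2 : P.dual z₀ (∑ r ∈ Finset.HasAntidiagonal.antidiagonal m, P.H r.1 (F r.2)) =
        P.dual z₀ (∑ r ∈ (Finset.HasAntidiagonal.antidiagonal m).erase (0, m), P.H r.1 (F r.2)) := by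
      rw [sum_antidiagonal_eq_add_erase, map_add, add_eq_right, dual_eq_zero_iff]
      simp only
      rw [← P.symmH, P.eigH, inner_smul_left, (P.dual_eq_zero_iff z₀ _).1 (hd m hm0), mul_zero]
    beta_reduce
    rw [h2]
    have h3 : ‖∑ r ∈ (Finset.HasAntidiagonal.antidiagonal m).erase (0, m), P.H r.1 (F r.2)‖ ≤
        ∑ q ∈ Finset.HasAntidiagonal.antidiagonal m,
          P.w * (q.1 : ℝ) ^ 2 * (‖F q.2‖ + P.K (F q.2)) := by
      refine (norm_sum_le_of_le _ fun q hq =>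
        P.boundH q.1 (antidiagonal_erase_snd_lt hq).2.2.1 (F q.2)).trans ?_
      exact Finset.sum_le_sum_of_subset_of_nonneg (Finset.erase_subset _ _)
        fun q _ _ => by have := hf0 q.2; positivity
    have h4 : (∑ q ∈ Finset.HasAntidiagonal.antidiagonal m,
          P.w * (q.1 : ℝ) ^ 2 * (‖F q.2‖ + P.K (F q.2))) * t ^ m =
        ∑ q ∈ Finset.HasAntidiagonal.antidiagonal m,
        (P.w * (q.1 : ℝ) ^ 2 * t ^ q.1) * ((‖F q.2‖ + P.K (F q.2)) * t ^ q.2) := by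
      rw [Finset.sum_mul]
      refine Finset.sum_congr rfl fun q hq => ?_
      rw [← Finset.HasAntidiagonal.mem_antidiagonal.1 hq, pow_add]
      ring
    rw [← h4, ← mul_assoc]
    refine mul_le_mul_of_nonneg_right ((P.norm_dual_le z₀ _).trans ?_) (by positivity)
    exact mul_le_mul_of_nonneg_left h3 (by positivity)

end PertData

end CalogeroMoser

end

/-! ### Trigonometric functional equation for the rows of the lattice. -/

noncomputable section

namespace CalogeroMoser

/-- The power series `∑ s d p^(m d)`. -/
def lacunary {K : Type*} [Field K] (m : ℕ) (s : ℕ → K) : PowerSeries K :=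
  PowerSeries.mk fun n => if m ∣ n then s (n / m) else 0

section Rows

variable {K : Type*} [Field K]

lemma coeff_monomial_mul_ite (m : ℕ) (y : K) (g : PowerSeries K) (n : ℕ) :
    PowerSeries.coeff n (PowerSeries.monomial m y * g) =
      if m ≤ n then y * PowerSeries.coeff (n - m) g else 0 := by
  have : (PowerSeries.monomial m y : PowerSeries K) = PowerSeries.C y * PowerSeries.X ^ m := by
    ext j
    rw [PowerSeries.coeff_monomial, PowerSeries.coeff_C_mul_X_pow]
  rw [this, mul_assoc, PowerSeries.coeff_C_mul, PowerSeries.coeff_X_pow_mul']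
  split_ifs <;> simp

/-- Multiplication by `1 - y p^m` acts on the coefficient sequence as a twisted difference, so
closed forms of row series reduce to differencing `d y^d` and `d² y^d`. -/
lemma one_sub_monomial_mul_lacunary {m : ℕ} (hm : m ≠ 0) (y : K) {s s' : ℕ → K}
    (h0 : s' 0 = s 0) (h : ∀ d, s' (d + 1) = s (d + 1) - y * s d) :
    (1 - PowerSeries.monomial m y) * lacunary m s = lacunary m s' := by
  ext n
  rw [sub_mul, one_mul, map_sub, coeff_monomial_mul_ite]
  simp only [lacunary, PowerSeries.coeff_mk]
  by_cases hn : m ∣ n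
  · obtain ⟨d, rfl⟩ := hn
    rw [if_pos (dvd_mul_right m d), if_pos (dvd_mul_right m d),
      Nat.mul_div_cancel_left d (Nat.pos_of_ne_zero hm)]
    cases d with
    | zero =>
      have : ¬ m ≤ m * 0 := by simpa using hm
      rw [if_neg this, h0, sub_zero]
    | succ d =>
      have h1 : m * (d + 1) - m = m * d := by rw [Nat.mul_succ, Nat.add_sub_cancel]
      rw [if_pos (Nat.le_mul_of_pos_right m d.succ_pos), h1, if_pos (dvd_mul_right m d),
        Nat.mul_div_cancel_left d (Nat.pos_of_ne_zero hm), h]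
  · rw [if_neg hn, if_neg hn, zero_sub, neg_eq_zero]
    split_ifs with h1 h2
    · exact absurd ((Nat.dvd_sub_iff_left h1 dvd_rfl).1 h2) hn
    · rw [mul_zero]
    · rfl

lemma lacunary_single_one {m : ℕ} (hm : m ≠ 0) (y : K) :
    lacunary m (fun d => if d = 1 then y else 0) = PowerSeries.monomial m y := by
  ext n
  rw [lacunary, PowerSeries.coeff_mk, PowerSeries.coeff_monomial]
  by_cases hn : m ∣ n
  · obtain ⟨d, rfl⟩ := hn
    rw [if_pos (dvd_mul_right m d), Nat.mul_div_cancel_left d (Nat.pos_of_ne_zero hm)]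
    have : m * d = m ↔ d = 1 := by
      rw [Nat.mul_eq_left hm]
    simp only [this]
  · rw [if_neg hn, if_neg fun h => hn (dvd_of_eq h.symm)]

/-- The expansion in `p` of `p^m y / (1 - p^m y)^2`. -/
def rowPot (y : K) (m : ℤ) : PowerSeries K :=
  if m = 0 then PowerSeries.C (y / (1 - y) ^ 2) else
    lacunary m.natAbs fun d => (d : K) * y ^ (m.sign * d)

/-- The expansion in `p` of `p^m y (1 + p^m y) / (1 - p^m y)^3`. -/
def rowDer (y : K) (m : ℤ) : PowerSeries K :=
  if m = 0 then PowerSeries.C (y * (1 + y) / (1 - y) ^ 3) else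
    lacunary m.natAbs fun d => (m.sign : K) * ((d : K) ^ 2 * y ^ (m.sign * d))

/-- The potential is even under `y ↦ y⁻¹` together with reversal of the row; its derivative, treated
next, is odd. -/
lemma rowPot_neg {y : K} (h0 : y ≠ 0) (h1 : y ≠ 1) (m : ℤ) : rowPot y (-m) = rowPot y⁻¹ m := by
  simp only [rowPot, neg_eq_zero, Int.natAbs_neg, Int.sign_neg, inv_zpow', neg_mul]
  split_ifs
  · congr 1
    have h2 : (1 - y) ≠ 0 := sub_ne_zero.2 h1.symm
    have h3 : (1 - y⁻¹) ≠ 0 := sub_ne_zero.2 fun h => h1 (by rw [← inv_inv y, ← h, inv_one])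
    rw [div_eq_div_iff (pow_ne_zero _ h2) (pow_ne_zero _ h3)]
    field_simp
    ring
  · rfl

lemma rowDer_neg {y : K} (h0 : y ≠ 0) (h1 : y ≠ 1) (m : ℤ) : rowDer y (-m) = -rowDer y⁻¹ m := by
  simp only [rowDer, neg_eq_zero, Int.natAbs_neg, Int.sign_neg, inv_zpow', neg_mul]
  split_ifs
  · rw [← map_neg]
    congr 1
    have h2 : (1 - y) ≠ 0 := sub_ne_zero.2 h1.symm
    have h3 : (1 - y⁻¹) ≠ 0 := sub_ne_zero.2 fun h => h1 (by rw [← inv_inv y, ← h, inv_one])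
    rw [← neg_div, div_eq_div_iff (pow_ne_zero _ h2) (pow_ne_zero _ h3)]
    field_simp
    ring
  · ext n
    simp only [lacunary, PowerSeries.coeff_mk, map_neg]
    split_ifs
    · push_cast; ring
    · rw [neg_zero]

/-- For `m > 0` two differences take `d y^d` first to `y^d` for `d ≥ 1`, then to the single term `y`
at `d = 1`. -/
lemma rowPot_mul {y : K} (h1 : y ≠ 1) (m : ℕ) :
    rowPot y m * (1 - PowerSeries.monomial m y) ^ 2 = PowerSeries.monomial m y := by
  rcases Nat.eq_zero_or_pos m with rfl | hm
  · have h2 : (1 - y) ≠ 0 := sub_ne_zero.2 h1.symm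
    rw [rowPot, Nat.cast_zero, if_pos rfl]
    have : (1 : PowerSeries K) - PowerSeries.monomial 0 y = PowerSeries.C (1 - y) := by
      rw [map_sub, map_one, PowerSeries.monomial_zero_eq_C_apply]
    rw [this, ← map_pow, ← map_mul, div_mul_cancel₀ _ (pow_ne_zero _ h2),
      PowerSeries.monomial_zero_eq_C_apply]
  · have hs : (m : ℤ).sign = 1 := Int.sign_eq_one_of_pos (by exact_mod_cast hm)
    rw [rowPot, if_neg (by exact_mod_cast hm.ne'), hs, Int.natAbs_natCast, mul_comm, pow_two,
      mul_assoc, one_sub_monomial_mul_lacunary hm.ne' y (s' := fun d => if d = 0 then 0 else y ^ d),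
      one_sub_monomial_mul_lacunary hm.ne' y (s' := fun d => if d = 1 then y else 0),
      lacunary_single_one hm.ne']
    · simp
    · intro d
      cases d with
      | zero => simp
      | succ d => simp [pow_succ]; ring
    · simp
    · intro d
      simp only [one_mul, zpow_natCast, Nat.succ_ne_zero, if_false]
      rw [pow_succ]
      push_cast
      ring

lemma rowDer_mul {y : K} (h1 : y ≠ 1) (m : ℕ) :
    rowDer y m * (1 - PowerSeries.monomial m y) ^ 3 =
      PowerSeries.monomial m y * (1 + PowerSeries.monomial m y) := by
  rcases Nat.eq_zero_or_pos m with rfl | hm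
  · have h2 : (1 - y) ≠ 0 := sub_ne_zero.2 h1.symm
    rw [rowDer, Nat.cast_zero, if_pos rfl]
    have : (1 : PowerSeries K) - PowerSeries.monomial 0 y = PowerSeries.C (1 - y) := by
      rw [map_sub, map_one, PowerSeries.monomial_zero_eq_C_apply]
    rw [this, ← map_pow, ← map_mul, div_mul_cancel₀ _ (pow_ne_zero _ h2), map_mul, map_add, map_one,
      PowerSeries.monomial_zero_eq_C_apply]
  · have hs : (m : ℤ).sign = 1 := Int.sign_eq_one_of_pos (by exact_mod_cast hm)
    -- Both products have the coefficients `(2d - 1) y^d`, which expresses the derivative row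
    -- through the potential row and avoids a threefold difference.
    have e : rowDer y m * (1 - PowerSeries.monomial m y) =
        rowPot y m * (1 + PowerSeries.monomial m y) := by
      have h3 : (1 - PowerSeries.monomial m y) * rowDer y m =
          lacunary m (fun d => ((2 * d - 1 : ℤ) : K) * if d = 0 then 0 else y ^ d) := by
        rw [rowDer, if_neg (by exact_mod_cast hm.ne'), hs, Int.natAbs_natCast,
          one_sub_monomial_mul_lacunary hm.ne' y]
        · simp
        · intro d
          simp only [one_mul, zpow_natCast, Int.cast_one, Nat.succ_ne_zero, if_false]
          rw [pow_succ]
          push_cast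
          ring
      have h4 : (1 - PowerSeries.monomial m (-y)) * rowPot y m =
          lacunary m (fun d => ((2 * d - 1 : ℤ) : K) * if d = 0 then 0 else y ^ d) := by
        rw [rowPot, if_neg (by exact_mod_cast hm.ne'), hs, Int.natAbs_natCast,
          one_sub_monomial_mul_lacunary hm.ne' (-y)]
        · simp
        · intro d
          simp only [one_mul, zpow_natCast, Nat.succ_ne_zero, if_false]
          rw [pow_succ]
          push_cast
          ring
      rw [mul_comm, h3, ← h4, map_neg]
      ring
    have h5 := rowPot_mul h1 m
    linear_combination (1 - PowerSeries.monomial m y) ^ 2 * e +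
      (1 + PowerSeries.monomial m y) * h5

lemma one_sub_monomial_ne_zero {y : K} (h1 : y ≠ 1) (m : ℕ) :
    (1 - PowerSeries.monomial m y : PowerSeries K) ≠ 0 := by
  intro h
  have h2 := congrArg (PowerSeries.coeff 0) h
  rw [map_sub, PowerSeries.coeff_zero_one, PowerSeries.coeff_monomial, map_zero] at h2
  split_ifs at h2 with h3
  · exact h1 (sub_eq_zero.1 h2).symm
  · simp at h2

/-- Degenerate form of the addition theorem `det (1, ℘, ℘') = 0` at three points with sum zero. The
third point is `(xy)⁻¹`; evenness and oddness express its values at `xy`. -/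
lemma trig_functional_eq {L : Type*} [Field L] {x y : L} (hx : 1 - x ≠ 0) (hy : 1 - y ≠ 0)
    (hz : 1 - x * y ≠ 0) :
    x / (1 - x) ^ 2 * (y * (1 + y) / (1 - y) ^ 3 + x * y * (1 + x * y) / (1 - x * y) ^ 3) +
    y / (1 - y) ^ 2 * (-(x * y * (1 + x * y) / (1 - x * y) ^ 3) - x * (1 + x) / (1 - x) ^ 3) +
    x * y / (1 - x * y) ^ 2 * (x * (1 + x) / (1 - x) ^ 3 - y * (1 + y) / (1 - y) ^ 3) = 0 := by
  field_simp
  ring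

/-- The trigonometric functional equation for the rows `m`, `n`, `-m-n`. -/
def rowCyc (a b c : K) (m n r : ℤ) : PowerSeries K :=
  rowPot a m * (rowDer b n - rowDer c r) + rowPot b n * (rowDer c r - rowDer a m) +
    rowPot c r * (rowDer a m - rowDer b n)

lemma rowCyc_rotate (a b c : K) (m n r : ℤ) : rowCyc a b c m n r = rowCyc b c a n r m := by
  rw [rowCyc, rowCyc]; ring

lemma rowCyc_inv {a b c : K} (ha : a ≠ 0) (hb : b ≠ 0) (hc : c ≠ 0) (ha1 : a ≠ 1) (hb1 : b ≠ 1)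
    (hc1 : c ≠ 1) (m n r : ℤ) :
    rowCyc a⁻¹ b⁻¹ c⁻¹ m n r = -rowCyc a b c (-m) (-n) (-r) := by
  rw [rowCyc, rowCyc, rowPot_neg ha ha1, rowPot_neg hb hb1, rowPot_neg hc hc1, rowDer_neg ha ha1,
    rowDer_neg hb hb1, rowDer_neg hc hc1]
  ring

/-- Reflecting the third row turns its index into `m + n` and its argument into `a * b`, and the
monomial of that row is the product of the other two. The rows are thus rational functions of two
elements of the fraction field of power series, where the trigonometric identity applies. -/
lemma rowCyc_of_nonneg {a b c : K} (ha1 : a ≠ 1) (hb1 : b ≠ 1)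
    (hc1 : c ≠ 1) (habc : a * b * c = 1) (m n : ℕ) :
    rowCyc a b c m n (-(m + n : ℕ)) = 0 := by
  have hab0 : a * b ≠ 0 := left_ne_zero_of_mul (habc.symm ▸ one_ne_zero)
  have ha := left_ne_zero_of_mul hab0
  have hb := right_ne_zero_of_mul hab0
  have hc : c ≠ 0 := right_ne_zero_of_mul (habc.symm ▸ one_ne_zero)
  have hci : c⁻¹ = a * b := (eq_inv_of_mul_eq_one_left habc).symm
  have hab1 : a * b ≠ 1 := fun h => hc1 (by rwa [h, one_mul] at habc)
  rw [rowCyc, rowPot_neg hc hc1, rowDer_neg hc hc1, hci]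
  have hT : (PowerSeries.monomial (m + n) (a * b) : PowerSeries K) =
      PowerSeries.monomial m a * PowerSeries.monomial n b :=
    (PowerSeries.monomial_mul_monomial _ _ _ _).symm
  have e1 := rowPot_mul ha1 m
  have e2 := rowPot_mul hb1 n
  have e3 := rowPot_mul hab1 (m + n)
  have d1 := rowDer_mul ha1 m
  have d2 := rowDer_mul hb1 n
  have d3 := rowDer_mul hab1 (m + n)
  have n1 := one_sub_monomial_ne_zero ha1 m
  have n2 := one_sub_monomial_ne_zero hb1 n
  have n3 := one_sub_monomial_ne_zero hab1 (m + n)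
  rw [hT] at e3 d3 n3
  generalize (PowerSeries.monomial m a : PowerSeries K) = x at *
  generalize (PowerSeries.monomial n b : PowerSeries K) = y at *
  have hj := IsFractionRing.injective (PowerSeries K) (FractionRing (PowerSeries K))
  set j := algebraMap (PowerSeries K) (FractionRing (PowerSeries K)) with hjdef
  have hj0 : ∀ t, t ≠ 0 → j t ≠ 0 := fun t ht h => ht (hj (by rw [h, map_zero]))
  have q : ∀ s t r : PowerSeries K, ∀ l : ℕ, t ≠ 0 → s * t ^ l = r → j s = j r / j t ^ l := by
    intro s t r l ht h
    rw [eq_div_iff (pow_ne_zero _ (hj0 t ht)), ← h, map_mul, map_pow]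
  apply hj
  have key := trig_functional_eq (x := j x) (y := j y) (by simpa using hj0 _ n1)
    (by simpa using hj0 _ n2) (by simpa using hj0 _ n3)
  rw [map_zero, ← key]
  simp only [map_add, map_mul, map_sub, map_neg, q _ _ _ _ n1 e1, q _ _ _ _ n2 e2, q _ _ _ _ n3 e3,
    q _ _ _ _ n1 d1, q _ _ _ _ n2 d2, q _ _ _ _ n3 d3, map_one]
  ring

/-- Among three integers with sum zero two have the same weak sign. Rotation brings them to the
first two places, and inversion of the arguments turns negative indices into nonnegative ones. -/
lemma rowCyc_eq_zero {a b c : K} (ha1 : a ≠ 1) (hb1 : b ≠ 1) (hc1 : c ≠ 1) (habc : a * b * c = 1)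
    {m n r : ℤ} (h : m + n + r = 0) : rowCyc a b c m n r = 0 := by
  have hab0 : a * b ≠ 0 := left_ne_zero_of_mul (habc.symm ▸ one_ne_zero)
  have ha := left_ne_zero_of_mul hab0
  have hb := right_ne_zero_of_mul hab0
  have hc : c ≠ 0 := right_ne_zero_of_mul (habc.symm ▸ one_ne_zero)
  have pos : ∀ {a b c : K}, a ≠ 1 → b ≠ 1 → c ≠ 1 → a * b * c = 1 → ∀ {m n r : ℤ},
      m + n + r = 0 → 0 ≤ m → 0 ≤ n → rowCyc a b c m n r = 0 := by
    intro a b c ha hb hc habc m n r h hm hn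
    lift m to ℕ using hm
    lift n to ℕ using hn
    have : r = -((m + n : ℕ) : ℤ) := by push_cast; linarith
    rw [this]
    exact rowCyc_of_nonneg ha hb hc habc m n
  have inv1 : ∀ {t : K}, t ≠ 1 → t⁻¹ ≠ 1 := fun ht h => ht (inv_eq_one.1 h)
  have neg : ∀ {a b c : K}, a ≠ 0 → b ≠ 0 → c ≠ 0 → a ≠ 1 → b ≠ 1 → c ≠ 1 → a * b * c = 1 →
      ∀ {m n r : ℤ}, m + n + r = 0 → m ≤ 0 → n ≤ 0 → rowCyc a b c m n r = 0 := by
    intro a b c ha hb hc ha1 hb1 hc1 habc m n r h hm hn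
    have h1 := rowCyc_inv ha hb hc ha1 hb1 hc1 (-m) (-n) (-r)
    rw [pos (inv1 ha1) (inv1 hb1) (inv1 hc1) (by rw [← mul_inv, ← mul_inv, habc, inv_one])
      (by linarith) (by linarith) (by linarith), neg_neg, neg_neg, neg_neg] at h1
    exact neg_eq_zero.1 h1.symm
  have habc2 : b * c * a = 1 := by rw [← habc]; ring
  have habc3 : c * a * b = 1 := by rw [← habc]; ring
  rcases le_total 0 m with hm | hm <;> rcases le_total 0 n with hn | hn
  · exact pos ha1 hb1 hc1 habc h hm hn
  · rcases le_total 0 r with hr | hr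
    · rw [rowCyc_rotate, rowCyc_rotate]
      exact pos hc1 ha1 hb1 habc3 (by linarith) hr hm
    · rw [rowCyc_rotate]
      exact neg hb hc ha hb1 hc1 ha1 habc2 (by linarith) hn hr
  · rcases le_total 0 r with hr | hr
    · rw [rowCyc_rotate]
      exact pos hb1 hc1 ha1 habc2 (by linarith) hn hr
    · rw [rowCyc_rotate, rowCyc_rotate]
      exact neg hc ha hb hc1 ha1 hb1 habc3 (by linarith) hr hm
  · exact neg ha hb hc ha1 hb1 hc1 habc h hm hn

end Rows

end CalogeroMoser

end

/-! ### Elliptic functional equation by summation over rows. -/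

noncomputable section

namespace CalogeroMoser

section Elliptic

variable {K : Type*} [Field K]

lemma coeff_rowPot_of_lt (y : K) {m : ℤ} {n : ℕ} (h : n < m.natAbs) :
    PowerSeries.coeff n (rowPot y m) = 0 := by
  have hm : m ≠ 0 := by rintro rfl; simp at h
  rw [rowPot, if_neg hm, lacunary, PowerSeries.coeff_mk]
  split_ifs with h1
  · rw [Nat.div_eq_of_lt h]; simp
  · rfl

lemma coeff_rowDer_of_lt (y : K) {m : ℤ} {n : ℕ} (h : n < m.natAbs) :
    PowerSeries.coeff n (rowDer y m) = 0 := by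
  have hm : m ≠ 0 := by rintro rfl; simp at h
  rw [rowDer, if_neg hm, lacunary, PowerSeries.coeff_mk]
  split_ifs with h1
  · rw [Nat.div_eq_of_lt h]; simp
  · rfl

lemma X_pow_dvd_rowPot (y : K) (m : ℤ) : PowerSeries.X ^ m.natAbs ∣ rowPot y m :=
  PowerSeries.X_pow_dvd_iff.2 fun _ h => coeff_rowPot_of_lt y h

lemma X_pow_dvd_rowDer (y : K) (m : ℤ) : PowerSeries.X ^ m.natAbs ∣ rowDer y m :=
  PowerSeries.X_pow_dvd_iff.2 fun _ h => coeff_rowDer_of_lt y h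

/-- The elliptic potential as a power series in `p`. -/
def ellPot (y : K) : PowerSeries K := PowerSeries.mk fun n =>
  if n = 0 then y / (1 - y) ^ 2 else ∑ d ∈ n.divisors, (d : K) * (y ^ (d : ℤ) + y ^ (-d : ℤ))

/-- The logarithmic derivative in `y` of the elliptic potential. -/
def ellDer (y : K) : PowerSeries K := PowerSeries.mk fun n =>
  if n = 0 then y * (1 + y) / (1 - y) ^ 3 else
    ∑ d ∈ n.divisors, (d : K) ^ 2 * (y ^ (d : ℤ) - y ^ (-d : ℤ))

lemma sum_Icc_neg {A : Type*} [AddCommMonoid A] (φ : ℤ → A) (M : ℕ) :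
    ∑ m ∈ Finset.Icc (-(M : ℤ)) M, φ m =
      φ 0 + ∑ m ∈ Finset.Icc 1 M, (φ m + φ (-m)) := by
  induction M with
  | zero => simp
  | succ M ih =>
    have h1 : Finset.Icc (-((M + 1 : ℕ) : ℤ)) ((M + 1 : ℕ) : ℤ) =
        insert ((M + 1 : ℕ) : ℤ) (insert (-((M + 1 : ℕ) : ℤ)) (Finset.Icc (-(M : ℤ)) M)) := by
      ext x
      simp only [Finset.mem_Icc, Finset.mem_insert]
      push_cast
      omega
    rw [h1, Finset.sum_insert, Finset.sum_insert, ih, Finset.sum_Icc_succ_top (by omega)]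
    · rw [← add_assoc, add_comm, add_assoc]
    · simp
    · simp only [Finset.mem_Icc, Finset.mem_insert]
      push_cast
      omega

lemma sum_Icc_dvd {A : Type*} [AddCommMonoid A] (g : ℕ → A) {n M : ℕ} (hn : n ≠ 0) (hM : n ≤ M) :
    ∑ m ∈ Finset.Icc 1 M, (if m ∣ n then g (n / m) else 0) = ∑ d ∈ n.divisors, g d := by
  rw [← Nat.sum_div_divisors n g, ← Finset.sum_filter]
  refine Finset.sum_congr ?_ fun _ _ => rfl
  ext m
  simp only [Finset.mem_filter, Finset.mem_Icc, Nat.mem_divisors]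
  constructor
  · exact fun h => ⟨h.2, hn⟩
  · exact fun h => ⟨⟨Nat.pos_of_dvd_of_pos h.1 (Nat.pos_of_ne_zero hn),
      (Nat.le_of_dvd (Nat.pos_of_ne_zero hn) h.1).trans hM⟩, h.1⟩

/-- The elliptic potential is the sum of all its rows. Row `±m` starts at `p^m` and contributes to
`p^n` only when `m` divides `n`, with `d = n / m`. Working modulo a power of `p` keeps the sums
finite. -/
lemma X_pow_dvd_ellPot_sub (y : K) (M : ℕ) :
    PowerSeries.X ^ (M + 1) ∣ ellPot y - ∑ m ∈ Finset.Icc (-(M : ℤ)) M, rowPot y m := by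
  refine PowerSeries.X_pow_dvd_iff.2 fun n hn => ?_
  rw [map_sub, sub_eq_zero, map_sum, sum_Icc_neg, ellPot, PowerSeries.coeff_mk]
  rcases eq_or_ne n 0 with rfl | h0
  · rw [if_pos rfl, Finset.sum_eq_zero, add_zero, rowPot, if_pos rfl, PowerSeries.coeff_zero_C]
    intro m hm
    rw [Finset.mem_Icc] at hm
    rw [coeff_rowPot_of_lt y (by simp; omega), coeff_rowPot_of_lt y (by simp; omega), add_zero]
  · rw [if_neg h0, ← sum_Icc_dvd (fun d => (d : K) * (y ^ (d : ℤ) + y ^ (-d : ℤ))) h0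
      (Nat.le_of_lt_succ hn), rowPot, if_pos rfl, PowerSeries.coeff_C, if_neg h0, zero_add]
    refine Finset.sum_congr rfl fun m hm => ?_
    rw [Finset.mem_Icc] at hm
    have hm0 : (m : ℤ) ≠ 0 := by omega
    have hs : (m : ℤ).sign = 1 := Int.sign_eq_one_of_pos (by omega)
    rw [rowPot, rowPot, if_neg hm0, if_neg (neg_ne_zero.2 hm0), Int.sign_neg, hs, lacunary,
      lacunary, PowerSeries.coeff_mk, PowerSeries.coeff_mk, Int.natAbs_neg, Int.natAbs_natCast]
    split_ifs
    · rw [one_mul, neg_one_mul, mul_add]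
    · rw [add_zero]

lemma X_pow_dvd_ellDer_sub (y : K) (M : ℕ) :
    PowerSeries.X ^ (M + 1) ∣ ellDer y - ∑ m ∈ Finset.Icc (-(M : ℤ)) M, rowDer y m := by
  refine PowerSeries.X_pow_dvd_iff.2 fun n hn => ?_
  rw [map_sub, sub_eq_zero, map_sum, sum_Icc_neg, ellDer, PowerSeries.coeff_mk]
  rcases eq_or_ne n 0 with rfl | h0
  · rw [if_pos rfl, Finset.sum_eq_zero, add_zero, rowDer, if_pos rfl, PowerSeries.coeff_zero_C]
    intro m hm
    rw [Finset.mem_Icc] at hm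
    rw [coeff_rowDer_of_lt y (by simp; omega), coeff_rowDer_of_lt y (by simp; omega), add_zero]
  · rw [if_neg h0, ← sum_Icc_dvd (fun d => (d : K) ^ 2 * (y ^ (d : ℤ) - y ^ (-d : ℤ))) h0
      (Nat.le_of_lt_succ hn), rowDer, if_pos rfl, PowerSeries.coeff_C, if_neg h0, zero_add]
    refine Finset.sum_congr rfl fun m hm => ?_
    rw [Finset.mem_Icc] at hm
    have hm0 : (m : ℤ) ≠ 0 := by omega
    have hs : (m : ℤ).sign = 1 := Int.sign_eq_one_of_pos (by omega)
    rw [rowDer, rowDer, if_neg hm0, if_neg (neg_ne_zero.2 hm0), Int.sign_neg, hs, lacunary,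
      lacunary, PowerSeries.coeff_mk, PowerSeries.coeff_mk, Int.natAbs_neg, Int.natAbs_natCast]
    split_ifs
    · simp only [Int.cast_one, Int.cast_neg, one_mul, neg_one_mul]
      ring
    · rw [add_zero]

/-- Pairs of row indices such that they and their sum are at most `M` in absolute value. -/
def hexagon (M : ℕ) : Finset (ℤ × ℤ) :=
  (Finset.Icc (-(M : ℤ)) M ×ˢ Finset.Icc (-(M : ℤ)) M).filter
    fun q => q.1 + q.2 ∈ Finset.Icc (-(M : ℤ)) M

lemma sum_hexagon_fst {A : Type*} [AddCommMonoid A] (M : ℕ) (g : ℤ → ℤ → A) :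
    ∑ q ∈ hexagon M, g q.1 q.2 = ∑ q ∈ hexagon M, g q.1 (-q.1 - q.2) := by
  refine Finset.sum_nbij' (fun q => (q.1, -q.1 - q.2)) (fun q => (q.1, -q.1 - q.2)) ?_ ?_ ?_ ?_ ?_
  · intro q; simp only [hexagon, Finset.mem_filter, Finset.mem_product, Finset.mem_Icc]; omega
  · intro q; simp only [hexagon, Finset.mem_filter, Finset.mem_product, Finset.mem_Icc]; omega
  · intro q _; ext <;> simp
  · intro q _; ext <;> simp
  · intro q _; simp

lemma sum_hexagon_swap {A : Type*} [AddCommMonoid A] (M : ℕ) (g : ℤ → ℤ → A) :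
    ∑ q ∈ hexagon M, g q.1 q.2 = ∑ q ∈ hexagon M, g q.2 q.1 := by
  refine Finset.sum_nbij' Prod.swap Prod.swap ?_ ?_ ?_ ?_ ?_
  · intro q; simp only [hexagon, Finset.mem_filter, Finset.mem_product, Finset.mem_Icc]
    simp only [Prod.fst_swap, Prod.snd_swap]; omega
  · intro q; simp only [hexagon, Finset.mem_filter, Finset.mem_product, Finset.mem_Icc]
    simp only [Prod.fst_swap, Prod.snd_swap]; omega
  · intro q _; simp
  · intro q _; simp
  · intro q _; simp

/-- Outside the hexagon `|i + j| > M`, so `|i| + |j| > M` and the product of the two rows is already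
divisible by `p^(M+1)`. -/
lemma X_pow_dvd_mul_sub_hexagon {f g : PowerSeries K} {P Q : ℤ → PowerSeries K} {M : ℕ}
    (hf : PowerSeries.X ^ (M + 1) ∣ f - ∑ m ∈ Finset.Icc (-(M : ℤ)) M, P m)
    (hg : PowerSeries.X ^ (M + 1) ∣ g - ∑ m ∈ Finset.Icc (-(M : ℤ)) M, Q m)
    (hP : ∀ m, PowerSeries.X ^ m.natAbs ∣ P m) (hQ : ∀ m, PowerSeries.X ^ m.natAbs ∣ Q m) :
    PowerSeries.X ^ (M + 1) ∣ f * g - ∑ q ∈ hexagon M, P q.1 * Q q.2 := by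
  have h1 : PowerSeries.X ^ (M + 1) ∣ (∑ m ∈ Finset.Icc (-(M : ℤ)) M, P m) *
      (∑ m ∈ Finset.Icc (-(M : ℤ)) M, Q m) - ∑ q ∈ hexagon M, P q.1 * Q q.2 := by
    rw [Finset.sum_mul_sum, ← Finset.sum_product', hexagon, sub_eq_iff_eq_add.2
      ((Finset.sum_filter_not_add_sum_filter _
        (fun q : ℤ × ℤ => q.1 + q.2 ∈ Finset.Icc (-(M : ℤ)) M) _).symm)]
    refine Finset.dvd_sum fun q hq => ?_
    refine dvd_trans (pow_dvd_pow _ (?_ : M + 1 ≤ q.1.natAbs + q.2.natAbs)) ?_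
    · rw [Finset.mem_filter, Finset.mem_Icc] at hq
      omega
    · rw [pow_add]; exact mul_dvd_mul (hP _) (hQ _)
  have h2 := (hf.mul_right g).add ((hg.mul_left (∑ m ∈ Finset.Icc (-(M : ℤ)) M, P m)).add h1)
  convert h2 using 1
  ring

/-- The hexagon is symmetric in the three indices `i`, `j`, `-i - j`. All six products can therefore
be summed over the same triples of rows with sum zero, where the trigonometric identity makes each
term vanish. -/
theorem ell_functional_eq {a b c : K} (ha1 : a ≠ 1) (hb1 : b ≠ 1) (hc1 : c ≠ 1)
    (habc : a * b * c = 1) :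
    ellPot a * (ellDer b - ellDer c) + ellPot b * (ellDer c - ellDer a) +
      ellPot c * (ellDer a - ellDer b) = 0 := by
  ext n
  rw [map_zero]
  suffices h : PowerSeries.X ^ (n + 1) ∣ ellPot a * (ellDer b - ellDer c) +
      ellPot b * (ellDer c - ellDer a) + ellPot c * (ellDer a - ellDer b) from
    PowerSeries.X_pow_dvd_iff.1 h n n.lt_succ_self
  have key := fun x y : K => X_pow_dvd_mul_sub_hexagon (X_pow_dvd_ellPot_sub x n)
    (X_pow_dvd_ellDer_sub y n) (X_pow_dvd_rowPot x) (X_pow_dvd_rowDer y)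
  have h1 := key a b
  have h2 := key a c
  have h3 := key b c
  have h4 := key b a
  have h5 := key c a
  have h6 := key c b
  -- Reindexing so that `a`, `b`, `c` carry the row indices `q.1`, `q.2` and `-q.1 - q.2` in every
  -- sum.
  rw [sum_hexagon_fst n fun i j => rowPot a i * rowDer c j] at h2
  rw [sum_hexagon_fst n fun i j => rowPot b i * rowDer c j,
    sum_hexagon_swap n fun i j => rowPot b i * rowDer c (-i - j)] at h3
  rw [sum_hexagon_swap n fun i j => rowPot b i * rowDer a j] at h4
  rw [sum_hexagon_swap n fun i j => rowPot c i * rowDer a j,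
    sum_hexagon_fst n fun i j => rowPot c j * rowDer a i] at h5
  rw [sum_hexagon_swap n fun i j => rowPot c i * rowDer b j,
    sum_hexagon_fst n fun i j => rowPot c j * rowDer b i,
    sum_hexagon_swap n fun i j => rowPot c (-i - j) * rowDer b i] at h6
  have h := ((h1.sub h2).add (h3.sub h4)).add (h5.sub h6)
  have hz : ∑ q ∈ hexagon n, (rowPot a q.1 * rowDer b q.2 - rowPot a q.1 * rowDer c (-q.1 - q.2) +
      (rowPot b q.2 * rowDer c (-q.2 - q.1) - rowPot b q.2 * rowDer a q.1) +
      (rowPot c (-q.1 - q.2) * rowDer a q.1 - rowPot c (-q.2 - q.1) * rowDer b q.2)) = 0 := by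
    refine Finset.sum_eq_zero fun q _ => ?_
    have := rowCyc_eq_zero ha1 hb1 hc1 habc (m := q.1) (n := q.2) (r := -q.1 - q.2) (by ring)
    rw [← this, rowCyc, show -q.2 - q.1 = -q.1 - q.2 by ring]
    ring
  simp only [Finset.sum_add_distrib, Finset.sum_sub_distrib] at hz
  convert h using 1
  linear_combination hz

end Elliptic

end CalogeroMoser

end

/-! ### The Hamiltonian commutes with the cubic integral to all orders in `p`. -/

noncomputable section

namespace CalogeroMoser

variable {N : ℕ}

/-- The ratio `X i / X j`. -/
def ratioR (i j : Fin N) : Ratl N := toRatl (X i) / toRatl (X j)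

lemma toRatl_X_ne_zero (i : Fin N) : (toRatl (X i) : Ratl N) ≠ 0 := by
  intro h
  have := congrArg (fun f => f * toRatl (Xinv i)) h
  simp only [← map_mul toRatl, X_mul_Xinv, map_one, zero_mul] at this
  exact one_ne_zero this

lemma ratioR_ne_one {i j : Fin N} (h : i ≠ j) : (ratioR i j : Ratl N) ≠ 1 := by
  intro h1
  rw [ratioR, div_eq_one_iff_eq (toRatl_X_ne_zero j)] at h1
  exact toRatl_X_sub_ne_zero' h (sub_eq_zero.2 h1)

lemma delR_ratioR (l i j : Fin N) :
    delR l (ratioR i j : Ratl N) = ((if l = i then 1 else 0) - if l = j then 1 else 0) * ratioR i j := by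
  have h0 := toRatl_X_ne_zero j
  have h : ratioR i j * toRatl (X j) = (toRatl (X i) : Ratl N) := div_mul_cancel₀ _ h0
  have h1 := congrArg (delR l) h
  rw [Derivation.leibniz, delR_X, delR_X, smul_eq_mul, smul_eq_mul] at h1
  refine mul_right_cancel₀ h0 ?_
  split_ifs at h1 ⊢
  · linear_combination h1 - h
  · linear_combination h1 - h
  · linear_combination h1
  · linear_combination h1

lemma toRatl_mono_smul (i j : Fin N) (d : ℤ) :
    toRatl (mono (d • (Pi.single i 1 - Pi.single j 1))) = (ratioR i j : Ratl N) ^ d := by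
  have h1 : ∀ d : ℕ, toRatl (mono ((d : ℤ) • (Pi.single i 1 - Pi.single j 1))) =
      (ratioR i j : Ratl N) ^ d := by
    intro d
    induction d with
    | zero => simp [mono_zero]
    | succ d ih =>
      have : ((d + 1 : ℕ) : ℤ) • (Pi.single i 1 - Pi.single j 1 : Fin N → ℤ) + Pi.single j 1 =
          (d : ℤ) • (Pi.single i 1 - Pi.single j 1) + Pi.single i 1 := by
        push_cast
        rw [add_smul, one_smul]
        abel
      have h2 := congrArg (fun u => toRatl (mono u)) this
      simp only [← mono_mul, map_mul toRatl] at h2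
      refine mul_right_cancel₀ (toRatl_X_ne_zero j) (h2.trans ?_)
      rw [ih, pow_succ, mul_assoc]
      exact congrArg _ (div_mul_cancel₀ _ (toRatl_X_ne_zero j)).symm
  obtain ⟨n, rfl | rfl⟩ := d.eq_nat_or_neg
  · rw [h1, zpow_natCast]
  · rw [zpow_neg, zpow_natCast, ← h1]
    refine eq_inv_of_mul_eq_one_left ?_
    rw [← map_mul toRatl, mono_mul, neg_smul, neg_add_cancel, mono_zero, map_one]

lemma potR_eq_coeff {i j : Fin N} (h : i ≠ j) (n : ℕ) :
    potR i j n = PowerSeries.coeff n (ellPot (ratioR i j)) := by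
  rw [potR, ellPot, PowerSeries.coeff_mk]
  split_ifs with hn
  · have h0 := toRatl_X_sub_ne_zero' h
    have h0' : (toRatl (X j) - toRatl (X i) : Ratl N) ≠ 0 := toRatl_X_sub_ne_zero' h.symm
    have hj := toRatl_X_ne_zero j
    have h1 : 1 - ratioR i j ≠ (0 : Ratl N) := sub_ne_zero.2 (ratioR_ne_one h).symm
    have h2 : 1 - ratioR i j = ((toRatl (X j) - toRatl (X i)) / toRatl (X j) : Ratl N) := by
      rw [sub_div, div_self hj]; rfl
    rw [h2, ratioR, map_sub, map_mul]
    field_simp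
    ring
  · rw [lambertCoeff, map_sum]
    refine Finset.sum_congr rfl fun d _ => ?_
    rw [map_smul, map_add, toRatl_mono_smul, ← neg_sub (Pi.single i 1) (Pi.single j 1), smul_neg,
      ← neg_smul, toRatl_mono_smul, Algebra.smul_def, map_natCast]

lemma delR_zpow (l i j : Fin N) (d : ℤ) :
    delR l ((ratioR i j : Ratl N) ^ d) =
      d * ((if l = i then 1 else 0) - if l = j then 1 else 0) * ratioR i j ^ d := by
  rw [← toRatl_mono_smul, delR_toRatl, del_mono, map_smul, Algebra.smul_def]
  congr 1
  simp only [Pi.smul_apply, Pi.sub_apply, Pi.single_apply]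
  split_ifs <;> simp

lemma delR_coeff_ellPot (l : Fin N) {i j : Fin N} (h : i ≠ j) (n : ℕ) :
    delR l (PowerSeries.coeff n (ellPot (ratioR i j : Ratl N))) =
      ((if l = i then 1 else 0) - if l = j then 1 else 0) *
        PowerSeries.coeff n (ellDer (ratioR i j)) := by
  have hd := delR_ratioR l i j
  have hz := delR_zpow l i j
  generalize ((if l = i then 1 else 0) - if l = j then 1 else 0 : Ratl N) = t at *
  rw [ellPot, ellDer, PowerSeries.coeff_mk, PowerSeries.coeff_mk]
  split_ifs with hn
  · have h1 : 1 - ratioR i j ≠ (0 : Ratl N) := sub_ne_zero.2 (ratioR_ne_one h).symm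
    have e : ratioR i j / (1 - ratioR i j) ^ 2 * (1 - ratioR i j) ^ 2 = (ratioR i j : Ratl N) :=
      div_mul_cancel₀ _ (pow_ne_zero _ h1)
    have e2 := congrArg (delR l) e
    rw [Derivation.leibniz, Derivation.leibniz_pow, map_sub, Derivation.map_one_eq_zero, hd,
      zero_sub] at e2
    simp only [smul_eq_mul, nsmul_eq_mul] at e2
    refine mul_right_cancel₀ (pow_ne_zero 2 h1) ?_
    have e3 : ratioR i j * (1 + ratioR i j) / (1 - ratioR i j) ^ 3 * (1 - ratioR i j) ^ 2 =
        ratioR i j + 2 * (ratioR i j / (1 - ratioR i j) ^ 2 * (1 - ratioR i j)) *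
          (ratioR i j : Ratl N) := by
      field_simp
      ring
    push_cast at e2
    rw [mul_assoc, e3]
    linear_combination e2
  · rw [map_sum, Finset.mul_sum]
    refine Finset.sum_congr rfl fun d _ => ?_
    rw [Derivation.leibniz, map_add, hz, hz, Derivation.map_natCast]
    simp only [smul_eq_mul]
    push_cast
    ring

lemma sum_antidiagonal_potR_functional (n : ℕ) (A : Fin 3 → Fin 3 → ℕ → Ratl 3)
    (hA : ∀ i j n, A i j n = PowerSeries.coeff n (ellDer (ratioR i j))) :
    ∑ q ∈ Finset.HasAntidiagonal.antidiagonal n,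
      (potR 0 1 q.1 * (A 1 2 q.2 - A 2 0 q.2) + potR 1 2 q.1 * (A 2 0 q.2 - A 0 1 q.2) +
        potR 2 0 q.1 * (A 0 1 q.2 - A 1 2 q.2)) = 0 := by
  have habc : ratioR 0 1 * ratioR 1 2 * ratioR 2 0 = (1 : Ratl 3) := by
    have h0 := toRatl_X_ne_zero (0 : Fin 3)
    have h1 := toRatl_X_ne_zero (1 : Fin 3)
    have h2 := toRatl_X_ne_zero (2 : Fin 3)
    rw [ratioR, ratioR, ratioR]
    field_simp
  have key := congrArg (PowerSeries.coeff n) (ell_functional_eq (ratioR_ne_one (by decide))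
    (ratioR_ne_one (by decide)) (ratioR_ne_one (by decide)) habc)
  rw [map_add, map_add, PowerSeries.coeff_mul, PowerSeries.coeff_mul, PowerSeries.coeff_mul,
    ← Finset.sum_add_distrib, ← Finset.sum_add_distrib, map_zero] at key
  rw [← key]
  refine Finset.sum_congr rfl fun q _ => ?_
  rw [potR_eq_coeff (by decide), potR_eq_coeff (by decide), potR_eq_coeff (by decide)]
  simp only [hA, map_sub]

lemma shiftR_mul (c : ℂ) (i : Fin N) (f F : Ratl N) :
    shiftR c i (f * F) = f * shiftR c i F + delR i f * F := by
  rw [shiftR_apply, shiftR_apply, Derivation.leibniz, smul_eq_mul, smul_eq_mul]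
  ring

lemma shiftR_comm (c : ℂ) (i j : Fin N) (F : Ratl N) :
    shiftR c i (shiftR c j F) = shiftR c j (shiftR c i F) := by
  simp only [shiftR_apply, map_add, Derivation.leibniz, smul_eq_mul, delR_algebraMap, delR_comm i j]
  ring

/-- The part of the commutator linear in the potential vanishes for arbitrary pair potentials: the
hypotheses only say that `A`, `B`, `C` depend on `x_0 - x_1`, `x_1 - x_2`, `x_2 - x_0`. -/
lemma shiftR_laplace_commutator (c : ℂ) (F A B C A' B' C' A'' B'' C'' : Ratl 3)
    (a0 : delR 0 A = A') (a1 : delR 1 A = -A') (a2 : delR 2 A = 0)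
    (b0 : delR 0 B = 0) (b1 : delR 1 B = B') (b2 : delR 2 B = -B')
    (c0 : delR 0 C = -C') (c1 : delR 1 C = 0) (c2 : delR 2 C = C')
    (a0' : delR 0 A' = A'') (b1' : delR 1 B' = B'') (c2' : delR 2 C' = C'') :
    (shiftR c 0 (shiftR c 0 (A * shiftR c 2 F + C * shiftR c 1 F + B * shiftR c 0 F)) +
      shiftR c 1 (shiftR c 1 (A * shiftR c 2 F + C * shiftR c 1 F + B * shiftR c 0 F)) +
      shiftR c 2 (shiftR c 2 (A * shiftR c 2 F + C * shiftR c 1 F + B * shiftR c 0 F))) +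
      2 * shiftR c 0 (shiftR c 1 (shiftR c 2 ((A + B + C) * F))) =
    A * shiftR c 2 (shiftR c 0 (shiftR c 0 F) + shiftR c 1 (shiftR c 1 F) +
        shiftR c 2 (shiftR c 2 F)) +
      C * shiftR c 1 (shiftR c 0 (shiftR c 0 F) + shiftR c 1 (shiftR c 1 F) +
        shiftR c 2 (shiftR c 2 F)) +
      B * shiftR c 0 (shiftR c 0 (shiftR c 0 F) + shiftR c 1 (shiftR c 1 F) +
        shiftR c 2 (shiftR c 2 F)) +
      2 * ((A + B + C) * shiftR c 0 (shiftR c 1 (shiftR c 2 F))) := by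
  have a1' : delR 1 A' = -A'' := by rw [← a0, delR_comm, a1, map_neg, a0']
  have b0' : delR 0 B' = 0 := by rw [← b1, delR_comm, b0, map_zero]
  have b2' : delR 2 B' = -B'' := by rw [← b1, delR_comm, b2, map_neg, b1']
  have c0' : delR 0 C' = -C'' := by rw [← c2, delR_comm, c0, map_neg, c2']
  have c1' : delR 1 C' = 0 := by rw [← c2, delR_comm, c1, map_zero]
  have b0'' : delR 0 B'' = 0 := by rw [← b1', delR_comm, b0', map_zero]
  have s10 := shiftR_comm c (1 : Fin 3) 0
  have s20 := shiftR_comm c (2 : Fin 3) 0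
  have s21 := shiftR_comm c (2 : Fin 3) 1
  simp only [shiftR_mul, map_add, map_neg, a0, a1, a2, b0, b1, b2, c0, c1, c2, a0', b1',
    c2', a1', b0', b2', c0', c1', b0'', neg_mul, zero_mul, s10, s20, s21, neg_zero,
    add_zero, zero_add]
  ring

/-- The commutator is sorted by powers of the coupling `g = k(k-1)`. Order zero is the commutation
of constant-coefficient operators, order one is `shiftR_laplace_commutator`, and order two, where
different powers of `p` mix, is the elliptic functional equation. -/
theorem hamR_cubR_comm (c : ℂ) (k n : ℕ) (F : Ratl 3) :
    ∑ q ∈ Finset.HasAntidiagonal.antidiagonal n, hamR c k q.1 (cubR c k q.2 F) =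
      ∑ q ∈ Finset.HasAntidiagonal.antidiagonal n, cubR c k q.1 (hamR c k q.2 F) := by
  set g : Ratl 3 := algebraMap ℂ (Ratl 3) (k * (k - 1)) with hg
  have h2g : algebraMap ℂ (Ratl 3) (2 * k * (k - 1)) = 2 * g := by
    rw [hg, mul_assoc, map_mul, map_ofNat]
  set V : Fin 3 → Fin 3 → ℕ → Ratl 3 := fun i j n => PowerSeries.coeff n (ellDer (ratioR i j))
    with hV
  have hsym : ∀ n, potR 2 0 n = (potR 0 2 n : Ratl 3) := by
    intro n
    rw [potR, potR, lambertCoeff_symm, mul_comm]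
    congr 2
    rw [map_sub, map_sub]
    ring
  have hdel : ∀ l : Fin 3, ∀ {i j : Fin 3}, i ≠ j → ∀ n, delR l (potR i j n) =
      ((if l = i then 1 else 0) - if l = j then 1 else 0) * V i j n := by
    intro l i j h n
    rw [potR_eq_coeff h, delR_coeff_ellPot l h]
  have a0 : ∀ n, delR 0 (potR 0 1 n) = V 0 1 n := fun n => by
    rw [hdel _ (i := 0) (j := 1) (by decide)]; simp
  have a1 : ∀ n, delR 1 (potR 0 1 n) = -V 0 1 n := fun n => by
    rw [hdel _ (i := 0) (j := 1) (by decide)]; simp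
  have a2 : ∀ n, delR 2 (potR 0 1 n) = 0 := fun n => by
    rw [hdel _ (i := 0) (j := 1) (by decide)]; simp
  have b0 : ∀ n, delR 0 (potR 1 2 n) = 0 := fun n => by
    rw [hdel _ (i := 1) (j := 2) (by decide)]; simp
  have b1 : ∀ n, delR 1 (potR 1 2 n) = V 1 2 n := fun n => by
    rw [hdel _ (i := 1) (j := 2) (by decide)]; simp
  have b2 : ∀ n, delR 2 (potR 1 2 n) = -V 1 2 n := fun n => by
    rw [hdel _ (i := 1) (j := 2) (by decide)]; simp
  have c0 : ∀ n, delR 0 (potR 0 2 n) = -V 2 0 n := fun n => by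
    rw [← hsym, hdel _ (i := 2) (j := 0) (by decide)]; simp
  have c1 : ∀ n, delR 1 (potR 0 2 n) = 0 := fun n => by rw [← hsym, hdel _ (i := 2) (j := 0) (by decide)]; simp
  have c2 : ∀ n, delR 2 (potR 0 2 n) = V 2 0 n := fun n => by
    rw [← hsym, hdel _ (i := 2) (j := 0) (by decide)]; simp
  set L : Ratl 3 → Ratl 3 := fun F => shiftR c 0 (shiftR c 0 F) + shiftR c 1 (shiftR c 1 F) +
        shiftR c 2 (shiftR c 2 F) with hL
  set M : Ratl 3 → Ratl 3 := fun F => shiftR c 0 (shiftR c 1 (shiftR c 2 F)) with hM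
  set u : ℕ → Ratl 3 := fun n => potR 0 1 n + potR 1 2 n + potR 0 2 n with hu
  set J : ℕ → Ratl 3 → Ratl 3 := fun n F => potR 0 1 n * shiftR c 2 F + potR 0 2 n * shiftR c 1 F +
    potR 1 2 n * shiftR c 0 F with hJ
  have hH : ∀ a F, hamR c k a F = (if a = 0 then L F else 0) - 2 * g * (u a * F) := by
    intro a F
    rw [hamR, LinearMap.sub_apply, LinearMap.smul_apply, Algebra.smul_def, h2g,
      LinearMap.mulLeft_apply, sum_pairs_three, hu]
    congr 1
    · split_ifs
      · rw [Fin.sum_univ_three]; rfl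
      · rfl
    · ring
  have hI : ∀ b F, cubR c k b F = (if b = 0 then M F else 0) + g * J b F := by
    intro b F
    rw [cubR, LinearMap.add_apply, LinearMap.smul_apply, Algebra.smul_def]
    congr 1
    split_ifs <;> rfl
  have hLadd : ∀ x y, L (x + y) = L x + L y := fun x y => by simp only [hL, map_add]; ring
  have hMsub : ∀ x y, M (x - y) = M x - M y := fun x y => by simp only [hM, map_sub]
  have hsg : ∀ i x, shiftR c i (g * x) = g * shiftR c i x := fun i x => by
    rw [hg, ← Algebra.smul_def, map_smul, Algebra.smul_def]
  have hLg : ∀ x, L (g * x) = g * L x := fun x => by simp only [hL, hsg]; ring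
  have hMg : ∀ x, M (2 * g * x) = 2 * g * M x := fun x => by
    rw [two_mul, add_mul]; simp only [hM, map_add, hsg]; ring
  have hJg : ∀ b x, J b (2 * g * x) = 2 * g * J b x := fun b x => by
    rw [two_mul, add_mul]; simp only [hJ, map_add, hsg]; ring
  have hJsub : ∀ b x y, J b (x - y) = J b x - J b y := fun b x y => by
    simp only [hJ, map_sub]; ring
  have hJ0 : ∀ b, J b 0 = 0 := fun b => by simp [hJ]
  have hL0 : L 0 = 0 := by simp [hL]
  have hM0 : M 0 = 0 := by simp [hM]
  have hLM : L (M F) = M (L F) := by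
    have s10 := shiftR_comm c (1 : Fin 3) 0
    have s20 := shiftR_comm c (2 : Fin 3) 0
    have s21 := shiftR_comm c (2 : Fin 3) 1
    simp only [hL, hM, map_add, s10, s20, s21]
  have hC1 : ∀ n, L (J n F) + 2 * M (u n * F) = J n (L F) + 2 * (u n * M F) := by
    intro n
    exact shiftR_laplace_commutator c F _ _ _ _ _ _ _ _ _ (a0 n) (a1 n) (a2 n) (b0 n) (b1 n) (b2 n)
      (c0 n) (c1 n) (c2 n) rfl rfl rfl
  -- The quadratic part is a multiplication operator: the first-order operator `J` only
  -- differentiates the potential.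
  have hC2 : ∀ a b, J b (u a * F) - u a * J b F =
      -(potR 0 1 b * (V 1 2 a - V 2 0 a) + potR 1 2 b * (V 2 0 a - V 0 1 a) +
        potR 2 0 b * (V 0 1 a - V 1 2 a)) * F := by
    intro a b
    simp only [hJ, hu, shiftR_mul, map_add, a0, a1, a2, b0, b1, b2, c0, c1, c2, hsym]
    ring
  have hswap : ∑ q ∈ Finset.HasAntidiagonal.antidiagonal n, cubR c k q.1 (hamR c k q.2 F) =
      ∑ q ∈ Finset.HasAntidiagonal.antidiagonal n, cubR c k q.2 (hamR c k q.1 F) :=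
    (Finset.Nat.sum_antidiagonal_swap (f := fun q : ℕ × ℕ => cubR c k q.2 (hamR c k q.1 F)))
  have hswap2 : ∑ q ∈ Finset.HasAntidiagonal.antidiagonal n, (J q.2 (u q.1 * F) - u q.1 * J q.2 F) =
      0 := by
    have h1 := congrArg (fun t => -t * F) (sum_antidiagonal_potR_functional n V fun _ _ _ => rfl)
    beta_reduce at h1
    rw [neg_zero, zero_mul, ← Finset.sum_neg_distrib, Finset.sum_mul] at h1
    rw [← h1, ← Finset.Nat.sum_antidiagonal_swap]
    exact Finset.sum_congr rfl fun q _ => hC2 _ _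
  rw [← sub_eq_zero, hswap, ← Finset.sum_sub_distrib]
  have hterm : ∀ q : ℕ × ℕ, hamR c k q.1 (cubR c k q.2 F) - cubR c k q.2 (hamR c k q.1 F) =
      (if q.1 = 0 then g * (L (J q.2 F) - J q.2 (L F)) else 0) +
      (if q.2 = 0 then 2 * g * (M (u q.1 * F) - u q.1 * M F) else 0) +
      2 * g ^ 2 * (J q.2 (u q.1 * F) - u q.1 * J q.2 F) := by
    intro q
    rw [hH, hI, hI, hH, hJsub, hJg]
    split_ifs
    · rw [hLadd, hMsub, hMg, hLg, hLM]; ring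
    · rw [zero_add, hLg]; ring
    · rw [zero_sub, ← zero_sub, hMsub, hM0, hMg, hJ0]; ring
    · rw [hJ0]; ring
  rw [Finset.sum_congr rfl fun q _ => hterm q, Finset.sum_add_distrib, Finset.sum_add_distrib,
    ← Finset.mul_sum, hswap2, mul_zero, add_zero, Finset.sum_ite, Finset.sum_ite]
  rw [Finset.sum_const_zero, Finset.sum_const_zero, add_zero, add_zero]
  have f1 : (Finset.HasAntidiagonal.antidiagonal n).filter (fun q : ℕ × ℕ => q.1 = 0) = {(0, n)} := by
    ext q
    simp only [Finset.mem_filter, Finset.HasAntidiagonal.mem_antidiagonal, Finset.mem_singleton,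
      Prod.ext_iff]
    omega
  have f2 : (Finset.HasAntidiagonal.antidiagonal n).filter (fun q : ℕ × ℕ => q.2 = 0) = {(n, 0)} := by
    ext q
    simp only [Finset.mem_filter, Finset.HasAntidiagonal.mem_antidiagonal, Finset.mem_singleton,
      Prod.ext_iff]
    omega
  rw [f1, f2, Finset.sum_singleton, Finset.sum_singleton]
  linear_combination g * hC1 n

end CalogeroMoser

end

/-! ### Perturbation data for two and three particles. -/

noncomputable section

namespace CalogeroMoser

variable {N k : ℕ} {m : ℤ}

/-- The first-order Sobolev seminorm. -/
def gradSeminorm (c : ℝ) (N k : ℕ) (m : ℤ) : Seminorm ℂ (vSpace N k m) :=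
  Seminorm.of (gradNorm c)
    (fun f g => by
      rw [gradNorm, gradNorm, gradNorm, ← Finset.sum_add_distrib]
      refine Finset.sum_le_sum fun i _ => ?_
      rw [Submodule.coe_add, map_add]
      exact norm_add_le _ _)
    (fun a f => by
      rw [gradNorm, gradNorm, Finset.mul_sum]
      refine Finset.sum_congr rfl fun i _ => ?_
      rw [Submodule.coe_smul, map_smul, norm_smul])

lemma gradNorm_sq_le (hN : N = 2 ∨ N = 3) (c : ℝ) (hk : 2 ≤ k) (f : vSpace N k m) :
    gradNorm c f ^ 2 ≤ 3 * (inner ℂ f (hamOp hN c k m 0 f)).re := by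
  have h1 := sum_norm_shiftDel_sq_le hN c hk f
  have h2 := sq_sum_le_card_mul_sum_sq (s := Finset.univ)
    (f := fun i => ‖shiftDel (c : ℂ) i (f : Laurent N)‖)
  have h3 : (((Finset.univ : Finset (Fin N)).card : ℕ) : ℝ) ≤ 3 := by
    rw [Finset.card_univ, Fintype.card_fin]
    rcases hN with rfl | rfl <;> norm_num
  have h4 : 0 ≤ ∑ i, ‖shiftDel (c : ℂ) i (f : Laurent N)‖ ^ 2 :=
    Finset.sum_nonneg fun _ _ => sq_nonneg _
  exact h2.trans ((mul_le_mul_of_nonneg_right h3 h4).trans (by linarith))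

/-- The perturbation problem defined by the Hamiltonian and a commuting integral. -/
def pertData [NeZero N] (hN : N = 2 ∨ N = 3) (c : ℝ) (hk : 2 ≤ k) (m : ℤ)
    (I : ℕ → vSpace N k m →ₗ[ℂ] vSpace N k m) (f : Dom N m → ℝ) (symmI : (I 0).IsSymmetric)
    (eigI : ∀ z, I 0 (eigVec k z) = (f z : ℂ) • eigVec k z)
    (separates : ∀ z w : Dom N m, ∑ i, quasiMom c k z i ^ 2 = ∑ i, quasiMom c k w i ^ 2 →
      f z = f w → z = w)
    (memI : ∀ b (n : ℕ), ∀ v ∈ vFilt N k m b, I n v ∈ vFilt N k m (b + n))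
    (boundI : ∀ n : ℕ, n ≠ 0 → ∀ v, ‖I n v‖ ≤ 4 * k ^ 2 * n ^ 2 * gradNorm c v) :
    PertData (vSpace N k m) (Dom N m) where
  H := hamOp hN c k m
  I := I
  g := eigVec k
  e z := ∑ i, quasiMom c k z i ^ 2
  f := f
  V := vFilt N k m
  K := gradSeminorm c N k m
  w := 12 * k ^ 2
  symmH := hamOp_isSymmetric hN c hk m
  symmI := symmI
  eigH := hamOp_eigVec hN c hk
  eigI := eigI
  g_ne_zero := eigVec_ne_zero
  separates := separates
  finite_le := finite_energy_le c k m
  mem_span _ _ := mem_span_eigVec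
  memH _ n _ := hamOp_mem_vFilt hN c hk n
  memI := memI
  w_nonneg := by positivity
  energy_le := gradNorm_sq_le hN c hk
  boundH n hn v := (norm_hamOp_pos_le hN c hn v).trans (mul_le_mul_of_nonneg_left
    (le_add_of_nonneg_right (apply_nonneg (gradSeminorm c N k m) v)) (by positivity))
  boundI n hn v := by
    have h0 : 0 ≤ gradNorm c v := apply_nonneg (gradSeminorm c N k m) v
    refine (boundI n hn v).trans ?_
    have h1 : (4 : ℝ) * k ^ 2 * n ^ 2 ≤ 12 * k ^ 2 * n ^ 2 := by
      have : (0 : ℝ) ≤ k ^ 2 * n ^ 2 := by positivity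
      nlinarith
    exact mul_le_mul h1 (le_add_of_nonneg_left (norm_nonneg v)) h0 (by positivity)
  mono _ _ := vFilt_mono

lemma hamOp_cubOp_comm (c : ℝ) (k : ℕ) (m : ℤ) (n : ℕ) (v : vSpace 3 k m) :
    ∑ q ∈ Finset.HasAntidiagonal.antidiagonal n, hamOp (Or.inr rfl) c k m q.1 (cubOp c k m q.2 v) =
      ∑ q ∈ Finset.HasAntidiagonal.antidiagonal n,
        cubOp c k m q.1 (hamOp (Or.inr rfl) c k m q.2 v) := by
  refine Subtype.ext (toRatl_injective ?_)
  rw [Submodule.coe_sum, Submodule.coe_sum, map_sum, map_sum]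
  simp only [hamOp, cubOp, toRatl_opOfRatl]
  exact hamR_cubR_comm c k n _

/-- For two particles the energy alone separates the states of a given degree, so the zero operator
serves as additional integral. For three particles the cubic integral is used. -/
theorem exists_formal_eigenstate [NeZero N] (hN : N = 2 ∨ N = 3) (c : ℝ) (hk : 2 ≤ k)
    (z : Dom N m) :
    ∃ (F : ℕ → vSpace N k m) (ε : ℕ → ℂ) (t : ℝ), 0 < t ∧ t < 1 ∧ F 0 = eigVec k z ∧
      ε 0 = ((∑ i, quasiMom c k z i ^ 2 : ℝ) : ℂ) ∧
      (∀ n : ℕ, F n ∈ vFilt N k m (psum 0 (k • (rho : Fin N → ℤ)) + z.1 0 + n)) ∧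
      (∀ n, ∑ q ∈ Finset.HasAntidiagonal.antidiagonal n, hamOp hN c k m q.1 (F q.2) =
        ∑ q ∈ Finset.HasAntidiagonal.antidiagonal n, ε q.1 • F q.2) ∧
      (Summable fun n => ‖F n‖ * t ^ n) ∧ Summable fun n => ‖ε n‖ * t ^ n := by
  rcases hN with rfl | rfl
  · refine (pertData (Or.inl rfl) c hk m (fun _ => 0) (fun _ => 0) ?_ ?_ ?_ ?_
      ?_).exists_convergent_eigenvector (eigVec_mem_vFilt z) ?_
    · intro u v; simp
    · intro w; simp
    · exact fun u w h _ => energy_separates_two c k h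
    · exact fun _ _ _ _ => Submodule.zero_mem _
    · intro n _ v
      have : 0 ≤ gradNorm c v := apply_nonneg (gradSeminorm c 2 k m) v
      simp only [LinearMap.zero_apply, norm_zero]
      positivity
    · intro n v
      simp [pertData]
  · refine (pertData (Or.inr rfl) c hk m (cubOp c k m) (fun z => ∏ i, quasiMom c k z i) ?_ ?_ ?_ ?_
      ?_).exists_convergent_eigenvector (eigVec_mem_vFilt z) ?_
    · exact cubOp_isSymmetric c hk m
    · exact cubOp_eigVec c hk
    · exact fun u w => energies_separate_three c k
    · exact fun _ n _ => cubOp_mem_vFilt c hk n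
    · exact fun n hn v => norm_cubOp_pos_le c hn v
    · exact hamOp_cubOp_comm c k m

end CalogeroMoser

end

noncomputable section

namespace CalogeroMoser

/-! ### Double geometric sums -/

lemma summable_lambert_prod {g : ℕ → ℂ} {C : ℝ} (hg : ∀ n, ‖g n‖ ≤ C * n) {p : ℂ} (hp : ‖p‖ < 1) :
    Summable fun c : ℕ+ × ℕ+ => g c.2 * p ^ (c.1 * c.2 : ℕ) := by
  have h1 := ((summable_prod_mul_pow 1 hp).norm.mul_left C)
  refine Summable.of_norm_bounded h1 fun c => ?_
  rw [norm_mul, norm_mul, pow_one, Complex.norm_natCast, ← mul_assoc]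
  exact mul_le_mul_of_nonneg_right (hg _) (norm_nonneg _)

/-- The pairs are grouped by their product `n`; the second factor then runs through the divisors of
`n`. -/
lemma tsum_lambert {g : ℕ → ℂ} {C : ℝ} (hg : ∀ n, ‖g n‖ ≤ C * n) {p : ℂ} (hp : ‖p‖ < 1) :
    ∑' c : ℕ+ × ℕ+, g c.2 * p ^ (c.1 * c.2 : ℕ) = ∑' n : ℕ, p ^ n * ∑ d ∈ n.divisors, g d := by
  have hs := summable_lambert_prod hg hp
  have h1 : ∑' n : ℕ, p ^ n * ∑ d ∈ n.divisors, g d =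
      ∑' n : ℕ+, p ^ (n : ℕ) * ∑ d ∈ (n : ℕ).divisors, g d := by
    refine (PNat.coe_injective.tsum_eq fun n hn => ?_).symm
    rcases Nat.eq_zero_or_pos n with rfl | h
    · simp at hn
    · exact ⟨⟨n, h⟩, rfl⟩
  rw [h1, ← sigmaAntidiagonalEquivProd.tsum_eq]
  refine (Summable.tsum_sigma (sigmaAntidiagonalEquivProd.summable_iff.2 hs)).trans ?_
  refine tsum_congr fun n => ?_
  rw [tsum_fintype, Finset.univ_eq_attach]
  simp only [Function.comp_apply]
  have h2 : ∀ x : (n : ℕ).divisorsAntidiagonal,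
      g ((sigmaAntidiagonalEquivProd ⟨n, x⟩).2 : ℕ) *
        p ^ ((sigmaAntidiagonalEquivProd ⟨n, x⟩).1 * (sigmaAntidiagonalEquivProd ⟨n, x⟩).2 : ℕ) =
      p ^ (n : ℕ) * g x.1.2 := by
    intro x
    have := (Nat.mem_divisorsAntidiagonal.1 x.2).1
    rw [mul_comm]
    congr 2
  rw [Finset.sum_congr rfl fun x _ => h2 x, (n : ℕ).divisorsAntidiagonal.sum_attach
    (fun x : ℕ × ℕ => p ^ (n : ℕ) * g x.2), ← Finset.mul_sum,
    Nat.sum_divisorsAntidiagonal (f := fun _ y => g y), Nat.sum_div_divisors n g]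

lemma norm_sum_divisors_le {g : ℕ → ℂ} {C : ℝ} (hg : ∀ n, ‖g n‖ ≤ C * n) (n : ℕ) :
    ‖∑ d ∈ n.divisors, g d‖ ≤ C * n ^ 2 := by
  have hC : 0 ≤ C := by simpa using (norm_nonneg _).trans (hg 1)
  refine (norm_sum_le_of_le _ fun d hd => (hg d).trans (mul_le_mul_of_nonneg_left
    (Nat.cast_le.2 (Nat.divisor_le hd)) hC)).trans ?_
  rw [Finset.sum_const, nsmul_eq_mul]
  have h1 : ((n.divisors.card : ℕ) : ℝ) ≤ n := by exact_mod_cast Nat.card_divisors_le_self n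
  have h2 : 0 ≤ C * n := by positivity
  nlinarith

lemma summable_of_norm_le_sq {a : ℕ → ℂ} {C : ℝ} (ha : ∀ n, ‖a n‖ ≤ C * n ^ 2) {p : ℂ}
    (hp : ‖p‖ < 1) : Summable fun n => p ^ n * a n := by
  have h1 := (summable_pow_mul_geometric_of_norm_lt_one 2
    (show ‖(‖p‖ : ℝ)‖ < 1 by simpa using hp)).mul_left C
  refine Summable.of_norm_bounded h1 fun n => ?_
  rw [norm_mul, norm_pow, ← mul_assoc, mul_comm]
  exact mul_le_mul_of_nonneg_right (ha n) (by positivity)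

/-! ### Rows of the lattice sum -/

lemma summable_inv_add_int_sq (z : ℂ) : Summable fun a : ℤ => 1 / (z + a) ^ 2 := by
  have := EisensteinSeries.linear_right_summable z 1 (k := 2) le_rfl
  refine this.congr fun a => ?_
  rw [Int.cast_one, one_mul, one_div]
  norm_cast

lemma tsum_inv_add_int_sq (z : UpperHalfPlane) :
    ∑' a : ℤ, 1 / ((z : ℂ) + a) ^ 2 =
      -4 * Real.pi ^ 2 * ∑' n : ℕ+, (n : ℂ) * Complex.exp (2 * Real.pi * Complex.I * z) ^ (n : ℕ) := by
  have := EisensteinSeries.qExpansion_identity_pnat (k := 1) le_rfl z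
  rw [show (1 : ℕ) + 1 = 2 from rfl] at this
  rw [this]
  congr 1
  · rw [Nat.factorial_one, Nat.cast_one, div_one]
    linear_combination (4 * (Real.pi : ℂ) ^ 2) * Complex.I_sq
  · simp only [pow_one]

lemma tsum_inv_neg_add_int_sq (z : ℂ) :
    ∑' a : ℤ, 1 / (-z + a) ^ 2 = ∑' a : ℤ, 1 / (z + a) ^ 2 := by
  rw [← (Equiv.neg ℤ).tsum_eq]
  refine tsum_congr fun a => ?_
  rw [Equiv.neg_apply, Int.cast_neg, ← neg_add, neg_sq]

/-- The exponential `exp (2πix)`. -/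
def expI (x : ℝ) : ℂ := Complex.exp (2 * Real.pi * Complex.I * x)

lemma norm_expI (x : ℝ) : ‖expI x‖ = 1 := by
  rw [expI, Complex.norm_exp]
  simp

lemma expI_ne_zero (x : ℝ) : expI x ≠ 0 := Complex.exp_ne_zero _

lemma expI_eq_one_iff (x : ℝ) : expI x = 1 ↔ ∃ n : ℤ, x = n := by
  rw [expI, Complex.exp_eq_one_iff]
  have h : (2 * Real.pi * Complex.I : ℂ) ≠ 0 := Complex.two_pi_I_ne_zero
  constructor
  · rintro ⟨n, hn⟩
    refine ⟨n, ?_⟩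
    rw [mul_comm (n : ℂ)] at hn
    exact_mod_cast mul_left_cancel₀ h hn
  · rintro ⟨n, rfl⟩
    exact ⟨n, by push_cast; ring⟩

/-- The Lipschitz formula is available in the open upper half plane. The real case is its limit
along `x + iy`, `y → 0`, where the terms are dominated by their values at `y = 0`, and the
exponential series is summed in closed form. -/
lemma tsum_inv_real_add_int_sq {x : ℝ} (hx : ∀ n : ℤ, x ≠ n) :
    ∑' a : ℤ, 1 / ((x : ℂ) + a) ^ 2 = -4 * Real.pi ^ 2 * (expI x / (1 - expI x) ^ 2) := by
  have hX : 1 - expI x ≠ 0 := fun h => by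
    obtain ⟨n, hn⟩ := (expI_eq_one_iff x).1 (sub_eq_zero.1 h).symm
    exact hx n hn
  set w : ℝ → ℂ := fun y => (x : ℂ) + y * Complex.I with hw
  have h1 : Filter.Tendsto (fun y : ℝ => ∑' a : ℤ, 1 / (w y + a) ^ 2) (nhdsWithin 0 (Set.Ioi 0))
      (nhds (∑' a : ℤ, 1 / ((x : ℂ) + a) ^ 2)) := by
    refine tendsto_tsum_of_dominated_convergence (bound := fun a : ℤ => ‖1 / ((x : ℂ) + a) ^ 2‖)
      (summable_inv_add_int_sq x).norm ?_ ?_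
    · intro a
      have hne : (x : ℂ) + a ≠ 0 := by
        intro h
        refine hx (-a) ?_
        have : ((x + a : ℝ) : ℂ) = 0 := by push_cast; exact h
        have := Complex.ofReal_eq_zero.1 this
        push_cast
        linarith
      have hc : ContinuousAt (fun y : ℝ => 1 / (w y + a) ^ 2) 0 := by
        refine ContinuousAt.div continuousAt_const ?_ (by simpa [hw] using hne)
        exact ((by fun_prop : Continuous fun y : ℝ => ((x : ℂ) + y * Complex.I + a) ^ 2)).continuousAt
      have := hc.tendsto
      simp only [hw, Complex.ofReal_zero, zero_mul, add_zero] at this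
      exact this.mono_left nhdsWithin_le_nhds
    · refine Filter.Eventually.of_forall fun y a => ?_
      have hre : ‖(x : ℂ) + a‖ ≤ ‖w y + a‖ := by
        have h2 : (x : ℂ) + a = ((x + a : ℝ) : ℂ) := by push_cast; rfl
        rw [h2, Complex.norm_real, Real.norm_eq_abs]
        refine le_trans (le_of_eq ?_) (Complex.abs_re_le_norm _)
        simp [hw]
      have hpos : 0 < ‖(x : ℂ) + a‖ := by
        rw [norm_pos_iff]
        intro h
        refine hx (-a) ?_
        have : ((x + a : ℝ) : ℂ) = 0 := by push_cast; exact h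
        have := Complex.ofReal_eq_zero.1 this
        push_cast
        linarith
      rw [norm_div, norm_div, norm_pow, norm_pow]
      gcongr
  have h2 : Filter.Tendsto (fun y : ℝ => -4 * (Real.pi : ℂ) ^ 2 *
      (Complex.exp (2 * Real.pi * Complex.I * w y) / (1 - Complex.exp (2 * Real.pi * Complex.I * w y)) ^ 2))
      (nhdsWithin 0 (Set.Ioi 0)) (nhds (-4 * Real.pi ^ 2 * (expI x / (1 - expI x) ^ 2))) := by
    have he : Continuous fun y : ℝ => Complex.exp (2 * Real.pi * Complex.I * w y) := by
      simp only [hw]; fun_prop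
    have h0 : Complex.exp (2 * Real.pi * Complex.I * w 0) = expI x := by simp [hw, expI]
    have hc : ContinuousAt (fun y : ℝ => -4 * (Real.pi : ℂ) ^ 2 *
      (Complex.exp (2 * Real.pi * Complex.I * w y) /
        (1 - Complex.exp (2 * Real.pi * Complex.I * w y)) ^ 2)) 0 := by
      refine continuousAt_const.mul (he.continuousAt.div
        ((continuousAt_const.sub he.continuousAt).pow 2) ?_)
      rw [h0]; exact pow_ne_zero 2 hX
    have := hc.tendsto
    beta_reduce at this
    rw [h0] at this
    exact this.mono_left nhdsWithin_le_nhds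
  refine tendsto_nhds_unique h1 (h2.congr' ?_)
  filter_upwards [self_mem_nhdsWithin] with y hy
  have him : 0 < (w y).im := by simpa [hw] using hy
  have h3 := tsum_inv_add_int_sq ⟨w y, him⟩
  have hq : ‖Complex.exp (2 * Real.pi * Complex.I * w y)‖ < 1 :=
    UpperHalfPlane.norm_exp_two_pi_I_lt_one ⟨w y, him⟩
  have h4 := tsum_coe_mul_geometric_of_norm_lt_one hq
  refine Eq.trans ?_ h3.symm
  rw [← h4]
  congr 1
  have h5 := tsum_zero_pnat_eq_tsum_nat (hasSum_coe_mul_geometric_of_norm_lt_one hq).summable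
  simp only [Nat.cast_zero, zero_mul, zero_add] at h5
  exact h5.symm

lemma tsum_inv_int_sq : ∑' a : ℤ, 1 / (a : ℂ) ^ 2 = (Real.pi : ℂ) ^ 2 / 3 := by
  have hs : Summable fun a : ℤ => 1 / (a : ℂ) ^ 2 := by
    simpa using summable_inv_add_int_sq 0
  have he : Function.Even (fun a : ℤ => 1 / (a : ℂ) ^ 2) := fun a => by simp
  rw [tsum_int_eq_zero_add_two_mul_tsum_pnat he hs]
  have h1 : HasSum (fun n : ℕ => 1 / ((n : ℕ) : ℂ) ^ 2) ((Real.pi : ℂ) ^ 2 / 6) := by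
    have := Complex.hasSum_ofReal.2 hasSum_zeta_two
    push_cast at this
    exact this
  have h2 := tsum_zero_pnat_eq_tsum_nat h1.summable
  rw [h1.tsum_eq] at h2
  simp only [Int.cast_zero, Int.cast_natCast, nsmul_eq_mul] at h2 ⊢
  simp only [Nat.cast_zero] at h2
  push_cast at h2 ⊢
  linear_combination 2 * h2

/-! ### Expansion of the Weierstrass function -/

lemma norm_pParam_lt_one (τ : UpperHalfPlane) : ‖pParam τ‖ < 1 :=
  UpperHalfPlane.norm_exp_two_pi_I_lt_one τ

lemma summable_row (z w : ℂ) :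
    Summable fun a : ℤ => 1 / (z + a) ^ 2 - 1 / (w + a) ^ 2 :=
  (summable_inv_add_int_sq z).sub (summable_inv_add_int_sq w)

/-- The coefficients of the expansion of the pair potential in powers of `p`. -/
def potCoeff (x : ℝ) (n : ℕ) : ℂ :=
  if n = 0 then expI x / (1 - expI x) ^ 2 else
    ∑ d ∈ n.divisors, (d : ℂ) * (expI x ^ (d : ℤ) + expI x ^ (-d : ℤ))

/-- The additive constant relating the Weierstrass function to its expansion. -/
def potConst (p : ℂ) : ℂ :=
  8 * Real.pi ^ 2 * ∑' n : ℕ, p ^ n * ∑ d ∈ n.divisors, ((d : ℂ) - 1)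

/-- Each half is the Lipschitz formula for the row at height `s b τ`; the subtracted half is the
case `x = 0`. For `s = -1` the row is first reflected into the upper half plane, which inverts the
exponential of `x`. -/
lemma tsum_row (τ : UpperHalfPlane) (x : ℝ) (b : ℕ+) (s : ℤ) (hs : s = 1 ∨ s = -1) :
    ∑' a : ℤ, (1 / ((x : ℂ) + s * b * τ + a) ^ 2 - 1 / ((s * b * τ : ℂ) + a) ^ 2) =
      -4 * Real.pi ^ 2 * ∑' n : ℕ+, ((n : ℕ) : ℂ) * (expI x ^ (s * n) - 1) *
        pParam τ ^ (b * n : ℕ) := by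
  have hs2 : (s : ℂ) * s = 1 := by rcases hs with rfl | rfl <;> simp
  have key : ∀ y : ℝ, ∑' a : ℤ, 1 / ((y : ℂ) + s * b * τ + a) ^ 2 =
      -4 * Real.pi ^ 2 * ∑' n : ℕ+, ((n : ℕ) : ℂ) * expI y ^ (s * n) * pParam τ ^ (b * n : ℕ) ∧
      Summable fun n : ℕ+ => ((n : ℕ) : ℂ) * expI y ^ (s * n) * pParam τ ^ (b * n : ℕ) := by
    intro y
    have him : 0 < ((s * y : ℂ) + b * τ).im := by
      have h1 : ((s * y : ℂ) + b * τ).im = b * (τ : ℂ).im := by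
        have : ((s * y : ℂ)) = ((s * y : ℝ) : ℂ) := by push_cast; rfl
        rw [this, Complex.add_im, Complex.ofReal_im, zero_add, Complex.mul_im]
        simp
      rw [h1]
      exact mul_pos (by exact_mod_cast b.pos) τ.im_pos
    have h2 := tsum_inv_add_int_sq ⟨_, him⟩
    have h3 : ∑' a : ℤ, 1 / ((y : ℂ) + s * b * τ + a) ^ 2 =
        ∑' a : ℤ, 1 / (((s * y : ℂ) + b * τ) + a) ^ 2 := by
      rcases hs with rfl | rfl
      · simp
      · rw [← tsum_inv_neg_add_int_sq]
        refine tsum_congr fun a => ?_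
        push_cast
        congr 2
        ring
    have he : ∀ n : ℕ, Complex.exp (2 * Real.pi * Complex.I * ((s * y : ℂ) + b * τ)) ^ n =
        expI y ^ (s * n) * pParam τ ^ (b * n : ℕ) := by
      intro n
      rw [expI, pParam, ← Complex.exp_int_mul, ← Complex.exp_nat_mul, ← Complex.exp_nat_mul,
        ← Complex.exp_add]
      congr 1
      push_cast
      ring
    have h4 : ∀ n : ℕ, (n : ℂ) * Complex.exp (2 * Real.pi * Complex.I * ((s * y : ℂ) + b * τ)) ^ n =
        (n : ℂ) * expI y ^ (s * n) * pParam τ ^ (b * n : ℕ) := fun n => by rw [he, mul_assoc]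
    refine ⟨h3.trans (h2.trans ?_), ?_⟩
    · congr 1
      exact tsum_congr fun n => h4 n
    · have hq : ‖Complex.exp (2 * Real.pi * Complex.I * ((s * y : ℂ) + b * τ))‖ < 1 :=
        UpperHalfPlane.norm_exp_two_pi_I_lt_one ⟨_, him⟩
      have := (hasSum_coe_mul_geometric_of_norm_lt_one hq).summable
      exact (this.comp_injective PNat.coe_injective).congr fun n => (h4 n)
  have k0 := key 0
  have e0 : expI 0 = 1 := by simp [expI]
  simp only [Complex.ofReal_zero, zero_add, e0, one_zpow, mul_one] at k0
  rw [Summable.tsum_sub (summable_inv_add_int_sq _) (summable_inv_add_int_sq _), (key x).1, k0.1,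
    ← mul_sub, ← Summable.tsum_sub (key x).2 k0.2]
  congr 1
  exact tsum_congr fun n => by ring

/-- The lattice sum is taken row by row. Row zero gives the trigonometric term and `-π²/3`, which
`2η` cancels. The rows `±b` give Lambert series; their part independent of `x` combines with the
series in `η` to `potConst`, which has no constant term in `p`. -/
theorem weierstrassP_add_eta (τ : UpperHalfPlane) {x : ℝ} (hx : ∀ n : ℤ, x ≠ n) :
    (periods τ).weierstrassP x + 2 * etaConst τ =
      -4 * Real.pi ^ 2 * ∑' n : ℕ, pParam τ ^ n * potCoeff x n + potConst (pParam τ) := by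
  have hp := norm_pParam_lt_one τ
  have hX := norm_expI x
  set p := pParam τ with hpdef
  have h1 : HasSum (fun c : ℤ × ℤ => 1 / ((x : ℂ) + c.1 * τ + c.2) ^ 2 - 1 / ((c.1 * τ : ℂ) + c.2) ^ 2)
      ((periods τ).weierstrassP x) := by
    -- The lattice is reindexed by `-(bτ + a)`, so that the summand contains `x + bτ + a` and the
    -- inner sum runs along a row.
    have h := (periods τ).hasSum_weierstrassP x
    have e := (((Equiv.prodComm ℤ ℤ).trans ((Equiv.neg ℤ).prodCongr (Equiv.neg ℤ))).trans
      (periods τ).latticeEquivProd.symm.toEquiv).hasSum_iff.2 h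
    convert e using 1
    funext c
    have hl : ((periods τ).latticeEquivProd.symm (-c.2, -c.1)).1 = -(c.1 * τ : ℂ) - c.2 := by
      rw [PeriodPair.latticeEquiv_symm_apply]
      simp only [periods]
      push_cast
      ring
    change _ = 1 / ((x : ℂ) - ((periods τ).latticeEquivProd.symm (-c.2, -c.1)).1) ^ 2 -
      1 / (((periods τ).latticeEquivProd.symm (-c.2, -c.1)).1) ^ 2
    rw [hl]
    congr 2 <;> ring
  have h2 := h1.prod_fiberwise fun b => (summable_row ((x : ℂ) + b * τ) (b * τ)).hasSum
  have h3 := tsum_int_eq_zero_add_tsum_pnat h2.summable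
  rw [h2.tsum_eq] at h3
  have hrow : ∀ s : ℤ, s = 1 ∨ s = -1 → ∀ b : ℕ+,
      ∑' a : ℤ, (1 / ((x : ℂ) + ((s * b : ℤ) : ℂ) * τ + a) ^ 2 - 1 / ((((s * b : ℤ) : ℂ) * τ) + a) ^ 2) =
      -4 * Real.pi ^ 2 * ∑' n : ℕ+, ((n : ℕ) : ℂ) * (expI x ^ (s * n) - 1) * p ^ (b * n : ℕ) := by
    intro s hs b
    rw [← tsum_row τ x b s hs]
    push_cast
    rfl
  have hbd : ∀ s : ℤ, ∀ n : ℕ, ‖(n : ℂ) * (expI x ^ (s * n) - 1)‖ ≤ 2 * n := by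
    intro s n
    rw [norm_mul, Complex.norm_natCast, mul_comm]
    refine mul_le_mul_of_nonneg_right ((norm_sub_le _ _).trans ?_) (Nat.cast_nonneg n)
    rw [norm_zpow, hX, one_zpow, norm_one]
    norm_num
  have hsum : ∀ s : ℤ, s = 1 ∨ s = -1 →
      ∑' b : ℕ+, ∑' a : ℤ, (1 / ((x : ℂ) + ((s * b : ℤ) : ℂ) * τ + a) ^ 2 -
        1 / ((((s * b : ℤ) : ℂ) * τ) + a) ^ 2) =
      -4 * Real.pi ^ 2 * ∑' n : ℕ, p ^ n * ∑ d ∈ n.divisors, (d : ℂ) * (expI x ^ (s * d) - 1) := by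
    intro s hs
    rw [tsum_congr (hrow s hs), tsum_mul_left, ← tsum_lambert (hbd s) hp,
      (summable_lambert_prod (hbd s) hp).tsum_prod]
  have g1 := hsum 1 (Or.inl rfl)
  have g2 := hsum (-1) (Or.inr rfl)
  have g0 : ∑' a : ℤ, (1 / ((x : ℂ) + ((0 : ℤ) : ℂ) * τ + a) ^ 2 - 1 / ((((0 : ℤ) : ℂ) * τ) + a) ^ 2) =
      -4 * Real.pi ^ 2 * (expI x / (1 - expI x) ^ 2) - (Real.pi : ℂ) ^ 2 / 3 := by
    rw [Summable.tsum_sub (summable_inv_add_int_sq _) (summable_inv_add_int_sq _),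
      ← tsum_inv_real_add_int_sq hx, ← tsum_inv_int_sq]
    simp only [Int.cast_zero, zero_mul, add_zero, zero_add]
  simp only [one_mul, neg_one_mul] at g1 g2
  rw [g0, g1, g2] at h3
  have hη : 2 * etaConst τ = (Real.pi : ℂ) ^ 2 / 3 -
      8 * Real.pi ^ 2 * ∑' n : ℕ, p ^ n * ∑ d ∈ n.divisors, (1 : ℂ) := by
    -- The value at `0` is set to `0` to meet the linear bound; divisors are never `0`, so the sums
    -- are unaffected.
    have hb1 : ∀ n : ℕ, ‖(if n = 0 then 0 else 1 : ℂ)‖ ≤ 1 * n := by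
      intro n
      rcases n with _ | n
      · simp
      · simp
    have e1 : ∀ n : ℕ, ∑ d ∈ n.divisors, (1 : ℂ) = ∑ d ∈ n.divisors, if d = 0 then 0 else 1 := by
      intro n
      refine Finset.sum_congr rfl fun d hd => ?_
      rw [if_neg (Nat.pos_of_mem_divisors hd).ne']
    have e2 : ∑' n : ℕ, p ^ (n + 1) / (1 - p ^ (n + 1)) =
        ∑' n : ℕ, p ^ n * ∑ d ∈ n.divisors, (1 : ℂ) := by
      simp only [e1]
      rw [← tsum_lambert hb1 hp, (summable_lambert_prod hb1 hp).tsum_prod,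
        ← tsum_pnat_eq_tsum_succ (f := fun n => p ^ n / (1 - p ^ n))]
      refine tsum_congr fun b => ?_
      have hpb : ‖p ^ (b : ℕ)‖ < 1 := by
        rw [norm_pow]; exact pow_lt_one₀ (norm_nonneg p) hp b.ne_zero
      have := tsum_geometric_of_norm_lt_one hpb
      have e3 : ∀ n : ℕ+, (if ((n : ℕ) : ℕ) = 0 then (0 : ℂ) else 1) * p ^ (b * n : ℕ) =
          (fun m : ℕ => (p ^ (b : ℕ)) ^ m) n := by
        intro n
        rw [if_neg n.ne_zero, one_mul, pow_mul]
      rw [tsum_congr e3, tsum_pnat_eq_tsum_succ (f := fun m : ℕ => (p ^ (b : ℕ)) ^ m)]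
      simp only [pow_succ _ (_ : ℕ)]
      rw [tsum_mul_right, this, div_eq_mul_inv, mul_comm]
    rw [etaConst, ← hpdef, e2]
    ring
  have sG : ∀ s : ℤ, Summable fun n : ℕ => p ^ n * ∑ d ∈ n.divisors, (d : ℂ) * (expI x ^ (s * d) - 1) :=
    fun s => summable_of_norm_le_sq (norm_sum_divisors_le (hbd s)) hp
  have sd : Summable fun n : ℕ => p ^ n * ∑ d ∈ n.divisors, (d : ℂ) :=
    summable_of_norm_le_sq (norm_sum_divisors_le (C := 1) fun n => by simp) hp
  have s1 : Summable fun n : ℕ => p ^ n * ∑ d ∈ n.divisors, (1 : ℂ) := by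
    refine summable_of_norm_le_sq (C := 1) (fun n => ?_) hp
    have : ((n.divisors.card : ℕ) : ℝ) ≤ n := by exact_mod_cast Nat.card_divisors_le_self n
    simp only [Finset.sum_const, nsmul_eq_mul, mul_one, Complex.norm_natCast, one_mul]
    rcases n with _ | n
    · simp
    · refine this.trans (le_self_pow₀ ?_ two_ne_zero)
      exact_mod_cast n.succ_pos
  have hC : potConst p = 8 * Real.pi ^ 2 * (∑' n : ℕ, p ^ n * ∑ d ∈ n.divisors, (d : ℂ) -
      ∑' n : ℕ, p ^ n * ∑ d ∈ n.divisors, (1 : ℂ)) := by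
    rw [potConst, ← Summable.tsum_sub sd s1]
    congr 1
    refine tsum_congr fun n => ?_
    rw [Finset.sum_sub_distrib, mul_sub]
  have hP : ∑' n : ℕ, p ^ n * potCoeff x n = expI x / (1 - expI x) ^ 2 +
      (∑' n : ℕ, p ^ n * ∑ d ∈ n.divisors, (d : ℂ) * (expI x ^ ((1 : ℤ) * d) - 1) +
        ∑' n : ℕ, p ^ n * ∑ d ∈ n.divisors, (d : ℂ) * (expI x ^ ((-1 : ℤ) * d) - 1)) +
      2 * ∑' n : ℕ, p ^ n * ∑ d ∈ n.divisors, (d : ℂ) := by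
    have e : ∀ n : ℕ, p ^ n * potCoeff x n = (if n = 0 then expI x / (1 - expI x) ^ 2 else 0) +
        ((p ^ n * ∑ d ∈ n.divisors, (d : ℂ) * (expI x ^ ((1 : ℤ) * d) - 1) +
          p ^ n * ∑ d ∈ n.divisors, (d : ℂ) * (expI x ^ ((-1 : ℤ) * d) - 1)) +
        2 * (p ^ n * ∑ d ∈ n.divisors, (d : ℂ))) := by
      intro n
      rcases eq_or_ne n 0 with rfl | hn
      · simp [potCoeff]
      · rw [potCoeff, if_neg hn, if_neg hn, zero_add, ← mul_add, mul_left_comm, ← mul_add,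
          ← Finset.sum_add_distrib, Finset.mul_sum _ _ (2 : ℂ), ← Finset.sum_add_distrib]
        congr 1
        refine Finset.sum_congr rfl fun d _ => ?_
        rw [one_mul, neg_one_mul]
        ring
    rw [tsum_congr e, Summable.tsum_add ?_ (((sG 1).add (sG (-1))).add (sd.mul_left 2)),
      tsum_ite_eq, Summable.tsum_add ((sG 1).add (sG (-1))) (sd.mul_left 2),
      Summable.tsum_add (sG 1) (sG (-1)), tsum_mul_left, ← add_assoc]
    exact (hasSum_ite_eq 0 _).summable
  rw [h3, hη, hC, hP]
  simp only [one_mul, neg_one_mul]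
  ring

lemma norm_potCoeff_le (x : ℝ) {n : ℕ} (hn : n ≠ 0) : ‖potCoeff x n‖ ≤ 2 * n ^ 2 := by
  rw [potCoeff, if_neg hn]
  refine norm_sum_divisors_le (g := fun d => (d : ℂ) * (expI x ^ (d : ℤ) + expI x ^ (-d : ℤ)))
    (fun d => ?_) n
  rw [norm_mul, Complex.norm_natCast, mul_comm]
  refine mul_le_mul_of_nonneg_right ((norm_add_le _ _).trans ?_) (Nat.cast_nonneg d)
  rw [norm_zpow, norm_zpow, norm_expI, one_zpow, one_zpow]
  norm_num

end CalogeroMoser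

end

noncomputable section

namespace CalogeroMoser

variable {N : ℕ}

/-! ### Plane waves -/

/-- The linear form `x ↦ ∑ μᵢ xᵢ`. -/
def linForm (mu : Fin N → ℝ) : (Fin N → ℝ) →L[ℝ] ℝ :=
  ∑ i, mu i • ContinuousLinearMap.proj (R := ℝ) (φ := fun _ : Fin N => ℝ) i

lemma linForm_apply (mu x : Fin N → ℝ) : linForm mu x = ∑ i, mu i * x i := by
  simp [linForm]

lemma norm_linForm_le (mu : Fin N → ℝ) : ‖linForm mu‖ ≤ ∑ i, |mu i| := by
  refine ContinuousLinearMap.opNorm_le_bound _ (Finset.sum_nonneg fun _ _ => abs_nonneg _)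
    fun x => ?_
  rw [linForm_apply, Finset.sum_mul]
  refine norm_sum_le_of_le _ fun i _ => ?_
  rw [norm_mul]
  exact mul_le_mul_of_nonneg_left (norm_le_pi_norm x i) (abs_nonneg _)

lemma expI_add (x y : ℝ) : expI (x + y) = expI x * expI y := by
  rw [expI, expI, expI, ← Complex.exp_add]
  congr 1
  push_cast
  ring

lemma hasDerivAt_expI (x : ℝ) : HasDerivAt expI (2 * Real.pi * Complex.I * expI x) x := by
  have h1 : HasDerivAt (fun t : ℝ => 2 * Real.pi * Complex.I * (t : ℂ)) (2 * Real.pi * Complex.I) x := by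
    simpa using (Complex.ofRealCLM.hasDerivAt (x := x)).const_mul (2 * Real.pi * Complex.I)
  exact h1.cexp.congr_deriv (mul_comm _ _)

lemma contDiff_expI {n : WithTop ℕ∞} : ContDiff ℝ n expI := by
  have h : ContDiff ℝ n fun t : ℝ => 2 * Real.pi * Complex.I * (t : ℂ) :=
    contDiff_const.mul Complex.ofRealCLM.contDiff
  exact h.cexp

lemma iteratedDeriv_expI (k : ℕ) :
    iteratedDeriv k expI = fun x => (2 * Real.pi * Complex.I) ^ k * expI x := by
  induction k with
  | zero => simp
  | succ k ih =>
    rw [iteratedDeriv_succ, ih]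
    funext x
    rw [((hasDerivAt_expI x).const_mul _).deriv, pow_succ]
    ring

lemma norm_iteratedFDeriv_expI_linForm_le (mu : Fin N → ℝ) (k : ℕ) (x : Fin N → ℝ) :
    ‖iteratedFDeriv ℝ k (fun x => expI (linForm mu x)) x‖ ≤ (2 * Real.pi * ∑ i, |mu i|) ^ k := by
  have h := (linForm mu).iteratedFDeriv_comp_right (contDiff_expI (n := k)) x le_rfl
  change ‖iteratedFDeriv ℝ k (expI ∘ linForm mu) x‖ ≤ _
  rw [h]
  refine (ContinuousMultilinearMap.norm_compContinuousLinearMap_le _ _).trans ?_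
  rw [norm_iteratedFDeriv_eq_norm_iteratedDeriv, iteratedDeriv_expI, norm_mul, norm_expI, mul_one,
    norm_pow, Finset.prod_const, Finset.card_univ, Fintype.card_fin, ← mul_pow]
  refine pow_le_pow_left₀ (by positivity) ?_ k
  have : ‖(2 * Real.pi * Complex.I : ℂ)‖ = 2 * Real.pi := by
    simp [abs_of_pos Real.pi_pos]
  rw [this]
  exact mul_le_mul_of_nonneg_left (norm_linForm_le mu) (by positivity)

/-! ### States as functions -/

/-- The function attached to a Laurent polynomial, with all exponents shifted by `c`. -/
def wave (c : ℝ) (f : Laurent N) (x : Fin N → ℝ) : ℂ := expI (c * ∑ i, x i) * evalAt x f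

lemma wave_add (c : ℝ) (f g : Laurent N) (x : Fin N → ℝ) :
    wave c (f + g) x = wave c f x + wave c g x := by
  rw [wave, map_add, mul_add]; rfl

lemma wave_smul (c : ℝ) (r : ℂ) (f : Laurent N) (x : Fin N → ℝ) :
    wave c (r • f) x = r * wave c f x := by
  rw [wave, map_smul, smul_eq_mul, wave]; ring

/-- `wave` as a linear map. -/
def waveLin (c : ℝ) : Laurent N →ₗ[ℂ] (Fin N → ℝ) → ℂ where
  toFun f := wave c f
  map_add' f g := funext fun x => wave_add c f g x
  map_smul' r f := funext fun x => wave_smul c r f x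

lemma wave_sum {ι : Type*} (c : ℝ) (s : Finset ι) (f : ι → Laurent N) (x : Fin N → ℝ) :
    wave c (∑ j ∈ s, f j) x = ∑ j ∈ s, wave c (f j) x := by
  have := congrFun (map_sum (waveLin c) f s) x
  rw [Finset.sum_apply] at this
  exact this

lemma wave_mono (c : ℝ) (nu : Fin N → ℤ) (x : Fin N → ℝ) :
    wave c (mono nu) x = expI (linForm (fun i => nu i + c) x) := by
  have : evalAt x (mono nu) = expI (∑ i, (nu i : ℝ) * x i) := evalAt_mono x nu
  rw [wave, this, ← expI_add, linForm_apply, Finset.mul_sum, ← Finset.sum_add_distrib]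
  congr 1
  exact Finset.sum_congr rfl fun i _ => by ring

lemma laurent_eq_sum (f : Laurent N) : f = ∑ nu ∈ f.coeff.support, f.coeff nu • mono nu := by
  ext mu
  rw [AddMonoidAlgebra.coeff_sum, Finset.sum_apply']
  simp only [AddMonoidAlgebra.coeff_smul_apply, coeff_mono, smul_eq_mul]
  rw [Finset.sum_eq_single mu]
  · simp
  · intro b _ hb
    rw [if_neg hb, mul_zero]
  · intro h
    simp only [Finsupp.mem_support_iff, not_not] at h
    rw [h, zero_mul]

/-- The sum of the absolute values of the coefficients. -/
def coeffSum (f : Laurent N) : ℝ := ∑ nu ∈ f.coeff.support, ‖f.coeff nu‖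

lemma coeffSum_nonneg (f : Laurent N) : 0 ≤ coeffSum f := Finset.sum_nonneg fun _ _ => norm_nonneg _

lemma wave_eq_sum (c : ℝ) (f : Laurent N) : wave c f =
    fun x => ∑ nu ∈ f.coeff.support, f.coeff nu • expI (linForm (fun i => nu i + c) x) := by
  funext x
  conv_lhs => rw [laurent_eq_sum f]
  rw [wave_sum]
  refine Finset.sum_congr rfl fun nu _ => ?_
  rw [wave_smul, wave_mono, smul_eq_mul]

lemma norm_wave_le (c : ℝ) (f : Laurent N) (x : Fin N → ℝ) : ‖wave c f x‖ ≤ coeffSum f := by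
  rw [wave_eq_sum]
  refine norm_sum_le_of_le _ fun nu _ => ?_
  rw [norm_smul, norm_expI, mul_one]

lemma contDiff_expI_linForm {n : WithTop ℕ∞} (mu : Fin N → ℝ) :
    ContDiff ℝ n fun x => expI (linForm mu x) :=
  contDiff_expI.comp (linForm mu).contDiff

lemma contDiff_wave {n : WithTop ℕ∞} (c : ℝ) (f : Laurent N) : ContDiff ℝ n (wave c f) := by
  rw [wave_eq_sum]
  exact ContDiff.sum fun nu _ => (contDiff_expI_linForm _).const_smul _

lemma norm_iteratedFDeriv_wave_le {c R : ℝ} {f : Laurent N}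
    (hR : ∀ nu, f.coeff nu ≠ 0 → ∑ i, |(nu i : ℝ) + c| ≤ R) (k : ℕ) (x : Fin N → ℝ) :
    ‖iteratedFDeriv ℝ k (wave c f) x‖ ≤ (2 * Real.pi * R) ^ k * coeffSum f := by
  rw [wave_eq_sum, iteratedFDeriv_fun_sum_apply fun nu _ =>
    ((contDiff_expI_linForm _).const_smul _).contDiffAt, coeffSum, Finset.mul_sum]
  refine norm_sum_le_of_le _ fun nu hnu => ?_
  rw [iteratedFDeriv_const_smul_apply' (contDiff_expI_linForm _).contDiffAt, norm_smul, mul_comm]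
  refine mul_le_mul_of_nonneg_right ((norm_iteratedFDeriv_expI_linForm_le _ k x).trans ?_)
    (norm_nonneg _)
  refine pow_le_pow_left₀ ?_ (mul_le_mul_of_nonneg_left (hR nu (Finsupp.mem_support_iff.1 hnu))
    (by positivity)) k
  exact mul_nonneg (by positivity) (Finset.sum_nonneg fun _ _ => abs_nonneg _)

lemma hasDerivAt_wave_update (c : ℝ) (f : Laurent N) (x : Fin N → ℝ) (i : Fin N) (t : ℝ) :
    HasDerivAt (fun t => wave c f (Function.update x i t))
      (2 * Real.pi * Complex.I * wave c (shiftDel c i f) (Function.update x i t)) t := by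
  induction f using laurent_induction with
  | hadd f g hf hg =>
    simp only [map_add, wave_add, mul_add]
    exact hf.add hg
  | hsmul r f hf =>
    simp only [map_smul, wave_smul]
    exact (hf.const_mul r).congr_deriv (by ring)
  | hm nu =>
    have h1 : shiftDel c i (mono nu) = ((nu i : ℂ) + c) • mono nu := by
      rw [shiftDel_apply, del_mono, add_smul]
    have h2 : ∀ t, linForm (fun i => nu i + c) (Function.update x i t) =
        (nu i + c) * t + ∑ j ∈ Finset.univ.erase i, (nu j + c) * x j := by
      intro t
      rw [linForm_apply, ← Finset.add_sum_erase _ _ (Finset.mem_univ i), Function.update_self]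
      congr 1
      refine Finset.sum_congr rfl fun j hj => ?_
      rw [Function.update_of_ne (Finset.ne_of_mem_erase hj)]
    rw [h1, wave_smul]
    simp only [wave_mono, h2]
    have h3 : HasDerivAt (fun t : ℝ => ((nu i : ℝ) + c) * t +
        ∑ j ∈ Finset.univ.erase i, ((nu j : ℝ) + c) * x j) (nu i + c) t := by
      simpa using ((hasDerivAt_id t).const_mul ((nu i : ℝ) + c)).add_const
        (∑ j ∈ Finset.univ.erase i, ((nu j : ℝ) + c) * x j)
    refine ((hasDerivAt_expI _).scomp t h3).congr_deriv ?_
    rw [Complex.real_smul]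
    push_cast
    ring

lemma coeffSum_shiftDel_le {c R : ℝ} {f : Laurent N}
    (hR : ∀ nu, f.coeff nu ≠ 0 → ∑ i, |(nu i : ℝ) + c| ≤ R) (i : Fin N) :
    coeffSum (shiftDel c i f) ≤ R * coeffSum f := by
  have hsub : (shiftDel c i f).coeff.support ⊆ f.coeff.support := by
    intro nu h
    rw [Finsupp.mem_support_iff, coeff_shiftDel] at h
    exact Finsupp.mem_support_iff.2 (right_ne_zero_of_mul h)
  rw [coeffSum, coeffSum, Finset.mul_sum]
  refine (Finset.sum_le_sum_of_subset_of_nonneg hsub fun _ _ _ => norm_nonneg _).trans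
    (Finset.sum_le_sum fun nu hnu => ?_)
  rw [coeff_shiftDel, norm_mul]
  refine mul_le_mul_of_nonneg_right ?_ (norm_nonneg _)
  have h1 : ((nu i : ℂ) + c) = ((nu i + c : ℝ) : ℂ) := by push_cast; rfl
  rw [h1, Complex.norm_real, Real.norm_eq_abs]
  exact (Finset.single_le_sum (f := fun i => |(nu i : ℝ) + c|) (fun _ _ => abs_nonneg _)
    (Finset.mem_univ i)).trans (hR nu (Finsupp.mem_support_iff.1 hnu))

lemma coeff_shiftDel_ne_zero {c : ℂ} {i : Fin N} {f : Laurent N} {nu : Fin N → ℤ}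
    (h : (shiftDel c i f).coeff nu ≠ 0) : f.coeff nu ≠ 0 := by
  rw [coeff_shiftDel] at h
  exact right_ne_zero_of_mul h

/-! ### Exponents and coefficients of states -/

variable {k : ℕ} {m : ℤ}

lemma permAct_coe_vSpace (f : vSpace N k m) (s : Equiv.Perm (Fin N)) :
    permAct s (f : Laurent N) = ((Equiv.Perm.sign s : ℤ) : ℂ) ^ k • (f : Laurent N) := by
  obtain ⟨G, hG, hf⟩ := f.2
  change vdm ^ k * G = _ at hf
  rw [← hf, map_mul, map_pow, permAct_vdm, hG.1 s, mul_pow, Algebra.smul_def, map_pow, map_intCast,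
    mul_assoc]

lemma isHomog_coe_vSpace (f : vSpace N k m) :
    IsHomog (f : Laurent N) (k * totDeg (rho : Fin N → ℤ) + m) := by
  obtain ⟨G, hG, hf⟩ := f.2
  change vdm ^ k * G = _ at hf
  rw [← hf]
  refine IsHomog.mul ?_ hG.2
  have h2 : ∀ j : ℕ, IsHomog (vdm ^ j : Laurent N) (j * totDeg (rho : Fin N → ℤ)) := by
    intro j
    induction j with
    | zero =>
      rw [pow_zero, Nat.cast_zero, zero_mul, ← mono_zero]
      simpa using isHomog_mono (0 : Fin N → ℤ)
    | succ j ih =>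
      rw [pow_succ]
      push_cast
      rw [add_mul, one_mul]
      exact ih.mul isHomog_vdm
  exact h2 k

/-- The support of a state is stable under permutations, so the bound on the first entry holds for
every entry. The fixed total degree then bounds entries from below. -/
lemma abs_exponent_le [NeZero N] {b : ℤ} {f : vSpace N k m} (hf : f ∈ vFilt N k m b)
    {nu : Fin N → ℤ} (h : (f : Laurent N).coeff nu ≠ 0) (i : Fin N) :
    |nu i| ≤ |k * totDeg (rho : Fin N → ℤ) + m| + N * |b| := by
  have hup : ∀ j, nu j ≤ b := by
    intro j
    have h1 := congrArg (fun g : Laurent N => g.coeff nu) (permAct_coe_vSpace f (Equiv.swap 0 j))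
    simp only [coeff_permAct, AddMonoidAlgebra.coeff_smul_apply, smul_eq_mul] at h1
    have h2 : (f : Laurent N).coeff (nu ∘ Equiv.swap 0 j) ≠ 0 := by
      rw [h1]
      refine mul_ne_zero (pow_ne_zero _ ?_) h
      exact_mod_cast (Equiv.Perm.sign (Equiv.swap 0 j)).ne_zero
    have := hf _ h2
    rwa [psum_zero_apply, Function.comp_apply, Equiv.swap_apply_left] at this
  have hs := isHomog_coe_vSpace f nu h
  rw [← Finset.add_sum_erase _ _ (Finset.mem_univ i)] at hs
  have h3 : ∑ j ∈ Finset.univ.erase i, nu j ≤ ∑ j ∈ Finset.univ.erase i, |b| :=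
    Finset.sum_le_sum fun j _ => (hup j).trans (le_abs_self b)
  rw [Finset.sum_const, Finset.card_erase_of_mem (Finset.mem_univ i), Finset.card_univ,
    Fintype.card_fin, nsmul_eq_mul, Nat.cast_sub (Nat.one_le_iff_ne_zero.2 (NeZero.ne N))] at h3
  have hN : (1 : ℤ) ≤ N := by exact_mod_cast Nat.one_le_iff_ne_zero.2 (NeZero.ne N)
  have hb := abs_nonneg b
  have h4 := neg_abs_le (k * totDeg (rho : Fin N → ℤ) + m)
  have h5 := hup i
  have h6 := le_abs_self b
  have h7 : |b| ≤ N * |b| := le_mul_of_one_le_left hb hN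
  have h8 := abs_nonneg (k * totDeg (rho : Fin N → ℤ) + m)
  push_cast at h3
  rw [abs_le]
  constructor
  · nlinarith
  · linarith

/-- The exponents lie in a box with `(2r + 1)^N` points, and every coefficient is at most the norm.
-/
lemma coeffSum_le_of_abs_le {f : Laurent N} {r : ℕ}
    (h : ∀ nu, f.coeff nu ≠ 0 → ∀ i, |nu i| ≤ r) : coeffSum f ≤ (2 * r + 1) ^ N * ‖f‖ := by
  have hsub : f.coeff.support ⊆ Fintype.piFinset fun _ : Fin N => Finset.Icc (-(r : ℤ)) r := by
    intro nu hnu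
    rw [Fintype.mem_piFinset]
    intro i
    rw [Finset.mem_Icc]
    exact abs_le.1 (h nu (Finsupp.mem_support_iff.1 hnu) i)
  have hcard := Finset.card_le_card hsub
  rw [Fintype.card_piFinset, Finset.prod_const, Finset.card_univ, Fintype.card_fin, Int.card_Icc]
    at hcard
  have h2 : ((r : ℤ) + 1 - -(r : ℤ)).toNat = 2 * r + 1 := by omega
  rw [h2] at hcard
  have h3 : (f.coeff.support.card : ℝ) ≤ (2 * r + 1) ^ N := by exact_mod_cast hcard
  refine (Finset.sum_le_card_nsmul _ _ ‖f‖ fun nu _ => norm_coeff_le f nu).trans ?_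
  rw [nsmul_eq_mul]
  exact mul_le_mul_of_nonneg_right h3 (norm_nonneg _)

end CalogeroMoser

end

/-! ### Majorants for values and derivatives; the Hamiltonian on functions. -/

noncomputable section

namespace CalogeroMoser

variable {N k : ℕ} {m : ℤ}

lemma exists_polynomial_bound (d : ℕ) :
    ∃ C : ℝ, 0 ≤ C ∧ ∀ n : ℕ, ((n : ℝ) + 1) ^ d * (1 / 2) ^ n ≤ C := by
  have h1 := summable_pow_mul_geometric_of_norm_lt_one d
    (show ‖(1 / 2 : ℝ)‖ < 1 by norm_num)
  have h0 : ∀ n : ℕ, 0 ≤ (n : ℝ) ^ d * (1 / 2) ^ n := fun n => by positivity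
  refine ⟨2 * ∑' n : ℕ, (n : ℝ) ^ d * (1 / 2) ^ n,
    mul_nonneg (by norm_num) (tsum_nonneg h0), fun n => ?_⟩
  have h2 := h1.le_tsum (n + 1) fun j _ => h0 j
  push_cast at h2
  rw [pow_succ] at h2
  linarith

/-- A sequence of states with convergent generating function has a common majorant for the values
and the first two derivatives. -/
lemma exists_majorant [NeZero N] (c : ℝ) {b : ℤ} {F : ℕ → vSpace N k m}
    (hF : ∀ n : ℕ, F n ∈ vFilt N k m (b + n)) {t : ℝ} (ht : 0 < t)
    (hs : Summable fun n => ‖F n‖ * t ^ n) :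
    ∃ (M : ℕ → ℝ) (s : ℝ), 0 < s ∧ s ≤ t ∧ Summable (fun n => M n * s ^ n) ∧
      (∀ n x, ‖wave c (F n : Laurent N) x‖ ≤ M n) ∧
      (∀ n j x, j ≤ 2 → ‖iteratedFDeriv ℝ j (wave c (F n : Laurent N)) x‖ ≤ M n) ∧
      (∀ n i x, ‖2 * Real.pi * Complex.I * wave c (shiftDel c i (F n : Laurent N)) x‖ ≤ M n) ∧
      (∀ n i x, ‖(2 * Real.pi * Complex.I) ^ 2 *
        wave c (shiftDel c i (shiftDel c i (F n : Laurent N))) x‖ ≤ M n) := by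
  -- Exponents at order `n` are bounded by `r n`, which is linear in `n`, and `R n` bounds the sum
  -- of the absolute values of the shifted exponents, hence the cost of one derivative.
  set A : ℕ := (|k * totDeg (rho : Fin N → ℤ) + m| + N * |b|).toNat with hA
  set r : ℕ → ℕ := fun n => A + N * n with hr
  set R : ℕ → ℝ := fun n => N * (r n + |c|) with hRdef
  have hR0 : ∀ n, 0 ≤ R n := fun n => by positivity
  have hexp : ∀ n nu, (F n : Laurent N).coeff nu ≠ 0 → ∀ i, |nu i| ≤ (r n : ℤ) := by
    intro n nu h i
    have h1 := abs_exponent_le (hF n) h i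
    have h2 : |b + (n : ℤ)| ≤ |b| + n := (abs_add_le _ _).trans (by simp)
    have h3 : (N : ℤ) * |b + (n : ℤ)| ≤ N * (|b| + n) :=
      mul_le_mul_of_nonneg_left h2 (Int.natCast_nonneg N)
    have h4 : (A : ℤ) = |k * totDeg (rho : Fin N → ℤ) + m| + N * |b| :=
      Int.toNat_of_nonneg (by positivity)
    simp only [hr]
    push_cast
    rw [h4]
    linarith
  have hR : ∀ n nu, (F n : Laurent N).coeff nu ≠ 0 → ∑ i, |(nu i : ℝ) + c| ≤ R n := by
    intro n nu h
    refine (Finset.sum_le_card_nsmul _ _ ((r n : ℝ) + |c|) fun i _ => ?_).trans ?_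
    · have h1 : ((|nu i| : ℤ) : ℝ) ≤ ((r n : ℤ) : ℝ) := Int.cast_le.2 (hexp n nu h i)
      push_cast at h1
      exact (abs_add_le _ _).trans (by linarith)
    · rw [Finset.card_univ, Fintype.card_fin, nsmul_eq_mul]
  set T : ℕ → ℝ := fun n => coeffSum (F n : Laurent N) with hT
  have hT0 : ∀ n, 0 ≤ T n := fun n => coeffSum_nonneg _
  have h2pi : ‖(2 * Real.pi * Complex.I : ℂ)‖ = 2 * Real.pi := by
    simp [abs_of_pos Real.pi_pos]
  have hpi := Real.pi_pos
  have hone : ∀ n, 1 ≤ 1 + 2 * Real.pi * R n := fun n => by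
    have := hR0 n
    have : 0 ≤ 2 * Real.pi * R n := by positivity
    linarith
  have hpow : ∀ n j, j ≤ 2 → (2 * Real.pi * R n) ^ j * T n ≤ (1 + 2 * Real.pi * R n) ^ 2 * T n := by
    intro n j hj
    refine mul_le_mul_of_nonneg_right ?_ (hT0 n)
    refine (pow_le_pow_left₀ (by have := hR0 n; positivity) (by linarith) j).trans
      (pow_le_pow_right₀ (hone n) hj)
  have hsh : ∀ n i, coeffSum (shiftDel c i (F n : Laurent N)) ≤ R n * T n := fun n i =>
    coeffSum_shiftDel_le (hR n) i
  have hsh2 : ∀ n i, coeffSum (shiftDel c i (shiftDel c i (F n : Laurent N))) ≤ R n * (R n * T n) :=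
    fun n i => (coeffSum_shiftDel_le (fun nu h => hR n nu (coeff_shiftDel_ne_zero h)) i).trans
      (mul_le_mul_of_nonneg_left (hsh n i) (hR0 n))
  refine ⟨fun n => (1 + 2 * Real.pi * R n) ^ 2 * T n, t / 2, by positivity, by linarith, ?_, ?_, ?_,
    ?_, ?_⟩
  -- The passage from the norm of the coefficients to the majorant costs a polynomial of degree `N +
  -- 2` in `n`: `N` from counting exponents and `2` from two derivatives. Halving the radius absorbs
  -- it.
  · obtain ⟨C, hC0, hC⟩ := exists_polynomial_bound (N + 2)
    set K₁ : ℝ := 1 + 2 * Real.pi * (N * (A + N + |c|)) with hK₁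
    set K₂ : ℝ := 2 * A + 2 * N + 1 with hK₂
    refine Summable.of_nonneg_of_le (fun n => mul_nonneg (mul_nonneg (sq_nonneg _) (hT0 n))
      (by positivity)) (fun n => ?_) (hs.mul_left (K₁ ^ 2 * K₂ ^ N * C))
    have h1 : 1 + 2 * Real.pi * R n ≤ K₁ * (n + 1) := by
      simp only [hRdef, hr, hK₁]
      push_cast
      have e : (1 + 2 * Real.pi * (N * ((A : ℝ) + N + |c|))) * (n + 1) -
          (1 + 2 * Real.pi * (N * (((A : ℝ) + N * n) + |c|))) =
          n + 2 * Real.pi * N * (A * n + N + |c| * n) := by ring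
      have : (0 : ℝ) ≤ n + 2 * Real.pi * N * (A * n + N + |c| * n) := by positivity
      linarith
    have h2 : T n ≤ (K₂ * (n + 1)) ^ N * ‖F n‖ := by
      refine (coeffSum_le_of_abs_le (hexp n)).trans ?_
      rw [Submodule.coe_norm]
      refine mul_le_mul_of_nonneg_right (pow_le_pow_left₀ (by positivity) ?_ N) (norm_nonneg _)
      simp only [hr, hK₂]
      push_cast
      have e : (2 * (A : ℝ) + 2 * N + 1) * (n + 1) - (2 * (A + N * n) + 1) = 2 * A * n + 2 * N + n := by
        ring
      have : (0 : ℝ) ≤ 2 * A * n + 2 * N + n := by positivity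
      linarith
    have h3 : (1 + 2 * Real.pi * R n) ^ 2 * T n ≤
        (K₁ * (n + 1)) ^ 2 * ((K₂ * (n + 1)) ^ N * ‖F n‖) :=
      mul_le_mul (pow_le_pow_left₀ (by linarith [hone n]) h1 2) h2 (hT0 n) (by positivity)
    refine (mul_le_mul_of_nonneg_right h3 (by positivity)).trans ?_
    have e : (K₁ * ((n : ℝ) + 1)) ^ 2 * ((K₂ * (n + 1)) ^ N * ‖F n‖) * (t / 2) ^ n =
        K₁ ^ 2 * K₂ ^ N * (((n : ℝ) + 1) ^ (N + 2) * (1 / 2) ^ n) * (‖F n‖ * t ^ n) := by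
      rw [mul_pow, mul_pow, div_pow, one_div, inv_pow, pow_add]
      ring
    rw [e]
    exact mul_le_mul_of_nonneg_right (mul_le_mul_of_nonneg_left (hC n) (by positivity))
      (by positivity)
  · intro n x
    refine (norm_wave_le c _ x).trans ?_
    simpa using hpow n 0 (by norm_num)
  · intro n j x hj
    exact (norm_iteratedFDeriv_wave_le (hR n) j x).trans (hpow n j hj)
  · intro n i x
    rw [norm_mul, h2pi]
    refine (mul_le_mul_of_nonneg_left ((norm_wave_le c _ x).trans (hsh n i)) (by positivity)).trans ?_
    rw [← mul_assoc]
    simpa using hpow n 1 (by norm_num)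
  · intro n i x
    rw [norm_mul, norm_pow, h2pi]
    refine (mul_le_mul_of_nonneg_left ((norm_wave_le c _ x).trans (hsh2 n i))
      (by positivity)).trans ?_
    have := hpow n 2 le_rfl
    calc _ = (2 * Real.pi * R n) ^ 2 * T n := by ring
      _ ≤ _ := this

/-! ### Evaluation of the Hamiltonian -/

lemma evalAt_X_eq (x : Fin N → ℝ) (i : Fin N) : evalAt x (X i) = expI (x i) := evalAt_X x i

lemma expI_sub (a b : ℝ) : expI (a - b) = expI a / expI b := by
  rw [eq_div_iff (expI_ne_zero b), ← expI_add, sub_add_cancel]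

lemma expI_zsmul (d : ℤ) (a : ℝ) : expI (d * a) = expI a ^ d := by
  rw [expI, expI, ← Complex.exp_int_mul]
  congr 1
  push_cast
  ring

lemma evalAt_X_sub_ne_zero {x : Fin N → ℝ} (hx : x ∈ regularSet N) {i j : Fin N} (h : i ≠ j) :
    evalAt x (X i - X j) ≠ 0 := by
  rw [map_sub, evalAt_X_eq, evalAt_X_eq, sub_ne_zero]
  intro he
  have h1 : expI (x i - x j) = 1 := by rw [expI_sub, he, div_self (expI_ne_zero _)]
  obtain ⟨n, hn⟩ := (expI_eq_one_iff _).1 h1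
  exact hx i j h n hn

lemma evalAt_lambertCoeff (x : Fin N → ℝ) (i j : Fin N) {n : ℕ} (hn : n ≠ 0) :
    evalAt x (lambertCoeff i j n) = potCoeff (x i - x j) n := by
  have h : ∀ (d : ℤ) (a b : Fin N), evalAt x (mono (d • (Pi.single a 1 - Pi.single b 1))) =
      expI (d * (x a - x b)) := by
    intro d a b
    rw [evalAt_mono, expI]
    congr 3
    simp only [Pi.smul_apply, Pi.sub_apply, Pi.single_apply, smul_eq_mul]
    push_cast
    simp only [mul_sub, sub_mul, Finset.sum_sub_distrib, mul_ite, ite_mul, mul_one, mul_zero,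
      zero_mul, Finset.sum_ite_eq', Finset.mem_univ, if_true]
  rw [lambertCoeff, potCoeff, if_neg hn, map_sum]
  refine Finset.sum_congr rfl fun d _ => ?_
  rw [map_smul, map_add, h, h, smul_eq_mul, expI_zsmul, ← expI_zsmul (-(d : ℤ))]
  congr 3
  push_cast
  ring

/-- Off the collisions the factor `(X i - X j)²` is invertible, so the algebraic quotient in the
operator becomes multiplication by the value of the pair potential. -/
lemma wave_hamOp (hN : N = 2 ∨ N = 3) (c : ℝ) (hk : 2 ≤ k) {x : Fin N → ℝ}
    (hx : x ∈ regularSet N) (n : ℕ) (f : vSpace N k m) :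
    wave c (hamOp hN c k m n f : Laurent N) x =
      (if n = 0 then ∑ i, wave c (shiftDel c i (shiftDel c i (f : Laurent N))) x else 0) -
        2 * k * (k - 1) * (∑ p ∈ pairs N, potCoeff (x p.1 - x p.2) n) * wave c (f : Laurent N) x := by
  split_ifs with hn
  · subst hn
    choose g hg using fun p => exists_quot_sq hk f.2 p
    have key : ∑ p ∈ pairs N, wave c (X p.1 * X p.2 * g p) x =
        (∑ p ∈ pairs N, potCoeff (x p.1 - x p.2) 0) * wave c (f : Laurent N) x := by
      rw [Finset.sum_mul]
      refine Finset.sum_congr rfl fun p hp => ?_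
      have h1 := (mem_pairs.1 hp).ne
      have h2 := evalAt_X_sub_ne_zero hx h1
      rw [hg p hp, wave, wave, map_mul, map_mul, map_mul, map_pow, potCoeff, if_pos rfl, expI_sub]
      rw [map_sub] at h2 ⊢
      rw [evalAt_X_eq, evalAt_X_eq] at *
      have h3 := expI_ne_zero (x p.2)
      have h4 : 1 - expI (x p.1) / expI (x p.2) ≠ 0 := by
        intro h
        apply h2
        rw [sub_eq_zero, eq_div_iff h3] at h
        rw [← h]; ring
      have h5 : (1 - expI (x p.1) / expI (x p.2)) = -(expI (x p.1) - expI (x p.2)) / expI (x p.2) := by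
        field_simp; ring
      rw [h5]
      field_simp
    rw [hamOp_zero_coe hN c f (g := g) hg, sub_eq_add_neg, ← neg_smul, wave_add, wave_smul, wave_sum,
      wave_sum, key]
    ring
  · rw [hamOp_pos_coe hN c hn, wave_smul, wave, wave, map_mul, map_sum,
      Finset.sum_congr rfl fun (p : Σ _ : Fin N, Fin N) (_ : p ∈ pairs N) =>
        evalAt_lambertCoeff x p.1 p.2 hn]
    ring

end CalogeroMoser

end

/-! ### The generating function and its eigenvalue equation. -/

noncomputable section

namespace CalogeroMoser

variable {N k : ℕ} {m : ℤ}

lemma norm_tsum_pow_sub_le {a : ℕ → ℂ} {M : ℕ → ℝ} {s : ℝ} (hs : 0 < s) (ha : ∀ n, ‖a n‖ ≤ M n)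
    (hM : Summable fun n => M n * s ^ n) {p : ℂ} (hp : ‖p‖ ≤ s) :
    ‖∑' n, p ^ n * a n - a 0‖ ≤ ‖p‖ * (s⁻¹ * ∑' n, M n * s ^ n) := by
  have hM0 : ∀ n, 0 ≤ M n := fun n => (norm_nonneg _).trans (ha n)
  have hb : ∀ n, ‖p ^ n * a n‖ ≤ M n * s ^ n := fun n => by
    rw [norm_mul, norm_pow, mul_comm]
    exact mul_le_mul (ha n) (pow_le_pow_left₀ (norm_nonneg p) hp n) (by positivity) (hM0 n)
  have h1 : Summable fun n => p ^ n * a n := Summable.of_norm_bounded hM hb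
  have h2 := h1.sum_add_tsum_nat_add 1
  rw [Finset.sum_range_one, pow_zero, one_mul] at h2
  rw [← h2, add_sub_cancel_left]
  have h3 : ∀ n, ‖p ^ (n + 1) * a (n + 1)‖ ≤ ‖p‖ * (s⁻¹ * (M (n + 1) * s ^ (n + 1))) := by
    intro n
    have e : s⁻¹ * (M (n + 1) * s ^ (n + 1)) = M (n + 1) * s ^ n := by
      rw [pow_succ]; field_simp
    rw [e, norm_mul, norm_pow, pow_succ]
    calc _ = ‖p‖ * (‖a (n + 1)‖ * ‖p‖ ^ n) := by ring
      _ ≤ _ := mul_le_mul_of_nonneg_left (mul_le_mul (ha _)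
        (pow_le_pow_left₀ (norm_nonneg p) hp n) (by positivity) (hM0 _)) (norm_nonneg p)
  have h4 : Summable fun n => M (n + 1) * s ^ (n + 1) := (summable_nat_add_iff 1).2 hM
  refine (tsum_of_norm_bounded ((h4.mul_left s⁻¹).mul_left ‖p‖).hasSum h3).trans ?_
  rw [tsum_mul_left, tsum_mul_left]
  refine mul_le_mul_of_nonneg_left (mul_le_mul_of_nonneg_left ?_ (by positivity)) (norm_nonneg p)
  have h5 := hM.sum_add_tsum_nat_add 1
  rw [Finset.sum_range_one, pow_zero, mul_one] at h5
  linarith [hM0 0]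

lemma tendsto_tsum_pow {a : ℕ → ℂ} {M : ℕ → ℝ} {s : ℝ} (hs : 0 < s) (ha : ∀ n, ‖a n‖ ≤ M n)
    (hM : Summable fun n => M n * s ^ n) :
    Filter.Tendsto (fun p : ℂ => ∑' n, p ^ n * a n) (nhds 0) (nhds (a 0)) := by
  rw [tendsto_iff_norm_sub_tendsto_zero]
  have h1 : Filter.Tendsto (fun p : ℂ => ‖p‖ * (s⁻¹ * ∑' n, M n * s ^ n)) (nhds 0) (nhds 0) := by
    have : Filter.Tendsto (fun p : ℂ => ‖p‖) (nhds 0) (nhds 0) := tendsto_norm_zero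
    simpa using this.mul_const (s⁻¹ * ∑' n, M n * s ^ n)
  refine squeeze_zero' (Filter.Eventually.of_forall fun _ => norm_nonneg _) ?_ h1
  filter_upwards [Metric.closedBall_mem_nhds (0 : ℂ) hs] with p hp
  exact norm_tsum_pow_sub_le hs ha hM (by simpa using hp)

lemma tendsto_potConst : Filter.Tendsto potConst (nhds 0) (nhds 0) := by
  -- At `d = 0` the expression `d - 1` would violate the linear bound; it is replaced by `0`, which
  -- no divisor sum sees.
  have hg : ∀ d : ℕ, ‖(if d = 0 then 0 else (d : ℂ) - 1)‖ ≤ 1 * d := by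
    intro d
    rcases d with _ | d
    · simp
    · rw [if_neg d.succ_ne_zero, Nat.cast_succ, add_sub_cancel_right, Complex.norm_natCast]
      push_cast
      linarith
  have he : ∀ n : ℕ, ∑ d ∈ n.divisors, ((d : ℂ) - 1) =
      ∑ d ∈ n.divisors, if d = 0 then 0 else (d : ℂ) - 1 := fun n =>
    Finset.sum_congr rfl fun d hd => by rw [if_neg (Nat.pos_of_mem_divisors hd).ne']
  have hM : Summable fun n : ℕ => 1 * (n : ℝ) ^ 2 * (1 / 2 : ℝ) ^ n := by
    simpa using summable_pow_mul_geometric_of_norm_lt_one 2 (show ‖(1 / 2 : ℝ)‖ < 1 by norm_num)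
  have h1 := (tendsto_tsum_pow (by norm_num : (0 : ℝ) < 1 / 2) (fun n => norm_sum_divisors_le hg n)
    hM).const_mul (8 * (Real.pi : ℂ) ^ 2)
  simp only [← he] at h1
  have e : potConst = fun p => 8 * (Real.pi : ℂ) ^ 2 *
      ∑' n : ℕ, p ^ n * ∑ d ∈ n.divisors, ((d : ℂ) - 1) := rfl
  rw [e]
  simpa only [Nat.divisors_zero, Finset.sum_empty, mul_zero] using h1

lemma summable_potCoeff (x : ℝ) {p : ℂ} (hp : ‖p‖ < 1) : Summable fun n => p ^ n * potCoeff x n := by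
  have h1 : Summable fun n => p ^ n * (if n = 0 then 0 else potCoeff x n) := by
    refine summable_of_norm_le_sq (C := 2) (fun n => ?_) hp
    split_ifs with hn
    · rw [norm_zero]; positivity
    · exact norm_potCoeff_le x hn
  refine (h1.add (hasSum_ite_eq 0 (potCoeff x 0)).summable).congr fun n => ?_
  split_ifs with hn
  · subst hn; simp
  · simp

/-- The data of a convergent family of states with a common majorant. -/
structure ConvergentFamily (c : ℝ) (F : ℕ → vSpace N k m) (M : ℕ → ℝ) (s : ℝ) : Prop where
  pos : 0 < s
  summable : Summable fun n => M n * s ^ n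
  le : ∀ n x, ‖wave c (F n : Laurent N) x‖ ≤ M n
  fderiv_le : ∀ n j x, j ≤ 2 → ‖iteratedFDeriv ℝ j (wave c (F n : Laurent N)) x‖ ≤ M n
  deriv_le : ∀ n i x,
    ‖2 * Real.pi * Complex.I * wave c (shiftDel c i (F n : Laurent N)) x‖ ≤ M n
  deriv2_le : ∀ n i x, ‖(2 * Real.pi * Complex.I) ^ 2 *
    wave c (shiftDel c i (shiftDel c i (F n : Laurent N))) x‖ ≤ M n

/-- The generating function of a family of states. -/
def genFun (c : ℝ) (F : ℕ → vSpace N k m) (p : ℂ) (x : Fin N → ℝ) : ℂ :=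
  ∑' n, p ^ n * wave c (F n : Laurent N) x

namespace ConvergentFamily

variable {c : ℝ} {F : ℕ → vSpace N k m} {M : ℕ → ℝ} {s : ℝ}

lemma norm_pow_mul_le {p : ℂ} (hp : ‖p‖ ≤ s) {a : ℂ} {n : ℕ} (ha : ‖a‖ ≤ M n) :
    ‖p ^ n * a‖ ≤ M n * s ^ n := by
  rw [norm_mul, norm_pow, mul_comm]
  exact mul_le_mul ha (pow_le_pow_left₀ (norm_nonneg p) hp n) (by positivity)
    ((norm_nonneg _).trans ha)

lemma contDiff_genFun (h : ConvergentFamily c F M s) {p : ℂ} (hp : ‖p‖ ≤ s) :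
    ContDiff ℝ 2 (genFun c F p) := by
  refine contDiff_tsum (𝕜 := ℝ) (N := 2) (v := fun _ n => M n * s ^ n)
    (fun n => contDiff_const.mul (contDiff_wave c _)) (fun _ _ => h.summable) fun j n x hj => ?_
  have e : (fun x => p ^ n * wave c (F n : Laurent N) x) =
      fun x => p ^ n • wave c (F n : Laurent N) x := rfl
  rw [e, iteratedFDeriv_const_smul_apply' (contDiff_wave c _).contDiffAt, norm_smul, norm_pow, mul_comm]
  exact mul_le_mul (h.fderiv_le n j x (by exact_mod_cast hj))
    (pow_le_pow_left₀ (norm_nonneg p) hp n) (by positivity) ((norm_nonneg _).trans (h.le n x))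

lemma hasDerivAt_genFun (h : ConvergentFamily c F M s) {p : ℂ} (hp : ‖p‖ ≤ s) (x : Fin N → ℝ)
    (i : Fin N) (t : ℝ) :
    HasDerivAt (fun t => genFun c F p (Function.update x i t))
      (∑' n, p ^ n * (2 * Real.pi * Complex.I *
        wave c (shiftDel c i (F n : Laurent N)) (Function.update x i t))) t :=
  hasDerivAt_tsum h.summable (fun n t => (hasDerivAt_wave_update c _ x i t).const_mul (p ^ n))
    (fun n _ => norm_pow_mul_le hp (h.deriv_le n i _))
    (Summable.of_norm_bounded h.summable fun n => norm_pow_mul_le (a := wave c (F n : Laurent N)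
      (Function.update x i 0)) hp (h.le n _)) t

lemma iteratedDeriv_two_genFun (h : ConvergentFamily c F M s) {p : ℂ} (hp : ‖p‖ ≤ s)
    (x : Fin N → ℝ) (i : Fin N) :
    iteratedDeriv 2 (fun t => genFun c F p (Function.update x i t)) (x i) =
      ∑' n, p ^ n * ((2 * Real.pi * Complex.I) ^ 2 *
        wave c (shiftDel c i (shiftDel c i (F n : Laurent N))) x) := by
  have h1 : deriv (fun t => genFun c F p (Function.update x i t)) = fun t =>
      ∑' n, p ^ n * (2 * Real.pi * Complex.I *
        wave c (shiftDel c i (F n : Laurent N)) (Function.update x i t)) :=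
    funext fun t => (h.hasDerivAt_genFun hp x i t).deriv
  have h2 : ∀ n t, HasDerivAt (fun t => p ^ n * (2 * Real.pi * Complex.I *
      wave c (shiftDel c i (F n : Laurent N)) (Function.update x i t)))
      (p ^ n * ((2 * Real.pi * Complex.I) ^ 2 *
        wave c (shiftDel c i (shiftDel c i (F n : Laurent N))) (Function.update x i t))) t := by
    intro n t
    refine (((hasDerivAt_wave_update c _ x i t).const_mul _).const_mul (p ^ n)).congr_deriv ?_
    ring
  have h3 := hasDerivAt_tsum h.summable h2 (fun n _ => norm_pow_mul_le hp (h.deriv2_le n i _))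
    (Summable.of_norm_bounded h.summable fun n => norm_pow_mul_le
      (a := 2 * Real.pi * Complex.I * wave c (shiftDel c i (F n : Laurent N))
        (Function.update x i 0)) hp (h.deriv_le n i _)) (x i)
  rw [iteratedDeriv_succ, iteratedDeriv_one, h1, h3.deriv, Function.update_eq_self]

lemma summable_wave (h : ConvergentFamily c F M s) {p : ℂ} (hp : ‖p‖ ≤ s) (x : Fin N → ℝ) :
    Summable fun n => p ^ n * wave c (F n : Laurent N) x :=
  Summable.of_norm_bounded h.summable fun n => norm_pow_mul_le hp (h.le n x)

lemma summable_deriv2 (h : ConvergentFamily c F M s) {p : ℂ} (hp : ‖p‖ ≤ s) (i : Fin N)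
    (x : Fin N → ℝ) : Summable fun n => p ^ n * ((2 * Real.pi * Complex.I) ^ 2 *
        wave c (shiftDel c i (shiftDel c i (F n : Laurent N))) x) :=
  Summable.of_norm_bounded h.summable fun n => norm_pow_mul_le hp (h.deriv2_le n i x)

lemma laplacian_genFun (h : ConvergentFamily c F M s) {p : ℂ} (hp : ‖p‖ ≤ s) (x : Fin N → ℝ) :
    -(1 / 2) * laplacian (genFun c F p) x = 2 * Real.pi ^ 2 * ∑' n, p ^ n *
      ∑ i, wave c (shiftDel c i (shiftDel c i (F n : Laurent N))) x := by
  rw [laplacian, Finset.sum_congr rfl fun i _ => h.iteratedDeriv_two_genFun hp x i,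
    ← Summable.tsum_finsetSum fun i _ => h.summable_deriv2 hp i x, ← tsum_mul_left, ← tsum_mul_left]
  refine tsum_congr fun n => ?_
  rw [Finset.mul_sum, Finset.mul_sum, Finset.mul_sum]
  refine Finset.sum_congr rfl fun i _ => ?_
  linear_combination (-2 * Real.pi ^ 2 * p ^ n *
    wave c (shiftDel c i (shiftDel c i (F n : Laurent N))) x) * Complex.I_sq

end ConvergentFamily

/-- The eigenvalue attached to a formal eigenvalue. -/
def eigenvalue (N k : ℕ) (ε : ℕ → ℂ) (p : ℂ) : ℂ :=
  2 * Real.pi ^ 2 * ∑' n, p ^ n * ε n + k * (k - 1) * (pairs N).card * potConst p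

/-- At a regular point the formal identity becomes a family of scalar identities, one per power of
`p`. Absolute convergence turns the convolutions into products of the potential, the eigenvalue
series and the generating function. The scalar `potConst` of each pair goes into the eigenvalue. -/
theorem ConvergentFamily.ellipticH_genFun {c : ℝ} {F : ℕ → vSpace N k m} {M : ℕ → ℝ} {s : ℝ}
    (h : ConvergentFamily c F M s) (hN : N = 2 ∨ N = 3) {l : ℕ} (hl : k = l + 1) (hk : 2 ≤ k)
    {ε : ℕ → ℂ} (hε : Summable fun n => ‖ε n‖ * s ^ n)
    (heq : ∀ n, ∑ q ∈ Finset.HasAntidiagonal.antidiagonal n, hamOp hN c k m q.1 (F q.2) =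
        ∑ q ∈ Finset.HasAntidiagonal.antidiagonal n, ε q.1 • F q.2)
    (τ : UpperHalfPlane) (hp : ‖pParam τ‖ ≤ s) {x : Fin N → ℝ} (hx : x ∈ regularSet N) :
    ellipticH l τ (genFun c F (pParam τ)) x =
      eigenvalue N k ε (pParam τ) * genFun c F (pParam τ) x := by
  have hp1 := norm_pParam_lt_one τ
  set p := pParam τ with hpdef
  set W : ℕ → ℂ := fun n => wave c (F n : Laurent N) x with hW
  set D : ℕ → ℂ := fun n => ∑ i, wave c (shiftDel c i (shiftDel c i (F n : Laurent N))) x with hD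
  set U : ℕ → ℂ := fun n => ∑ q ∈ pairs N, potCoeff (x q.1 - x q.2) n with hU
  have hformal : ∀ n, D n - 2 * k * (k - 1) *
      ∑ q ∈ Finset.HasAntidiagonal.antidiagonal n, U q.1 * W q.2 =
      ∑ q ∈ Finset.HasAntidiagonal.antidiagonal n, ε q.1 * W q.2 := by
    intro n
    have h1 := congrArg (fun f : vSpace N k m => wave c (f : Laurent N) x) (heq n)
    simp only [Submodule.coe_sum, wave_sum, Submodule.coe_smul, wave_smul,
      wave_hamOp hN c hk hx] at h1
    have h2 : ∑ q ∈ Finset.HasAntidiagonal.antidiagonal n, (if q.1 = 0 then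
        ∑ i, wave c (shiftDel c i (shiftDel c i (F q.2 : Laurent N))) x else 0) = D n := by
      rw [Finset.sum_eq_single (0, n)]
      · rw [if_pos rfl]
      · intro q hq hq2
        rw [Finset.HasAntidiagonal.mem_antidiagonal] at hq
        refine if_neg fun h0 => hq2 (Prod.ext h0 ?_)
        rw [h0, zero_add] at hq
        exact hq
      · intro h0
        exact absurd (Finset.HasAntidiagonal.mem_antidiagonal.2 (zero_add n)) h0
    rw [← h1, Finset.sum_sub_distrib, h2, Finset.mul_sum]
    congr 1
    exact Finset.sum_congr rfl fun q _ => by ring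
  have hsW := h.summable_wave hp x
  have hsε : Summable fun n => p ^ n * ε n := Summable.of_norm_bounded hε fun n => by
    rw [norm_mul, norm_pow, mul_comm]
    exact mul_le_mul_of_nonneg_left (pow_le_pow_left₀ (norm_nonneg p) hp n) (norm_nonneg _)
  have hsU : Summable fun n => p ^ n * U n := by
    simp only [hU, Finset.mul_sum]
    exact summable_sum fun q _ => summable_potCoeff _ hp1
  have hcauchy : ∀ a : ℕ → ℂ, (Summable fun n => p ^ n * a n) →
      (∑' n, p ^ n * a n) * (∑' n, p ^ n * W n) =
        ∑' n, p ^ n * ∑ q ∈ Finset.HasAntidiagonal.antidiagonal n, a q.1 * W q.2 := by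
    intro a ha
    rw [tsum_mul_tsum_eq_tsum_sum_antidiagonal_of_summable_norm ha.norm hsW.norm]
    refine tsum_congr fun n => ?_
    rw [Finset.mul_sum]
    refine Finset.sum_congr rfl fun q hq => ?_
    rw [← Finset.HasAntidiagonal.mem_antidiagonal.1 hq, pow_add]
    ring
  have hsAW : ∀ a : ℕ → ℂ, (Summable fun n => p ^ n * a n) →
      Summable fun n => p ^ n * ∑ q ∈ Finset.HasAntidiagonal.antidiagonal n, a q.1 * W q.2 := by
    intro a ha
    refine (summable_norm_sum_mul_antidiagonal_of_summable_norm ha.norm hsW.norm).of_norm.congr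
      fun n => ?_
    rw [Finset.mul_sum]
    refine Finset.sum_congr rfl fun q hq => ?_
    rw [← Finset.HasAntidiagonal.mem_antidiagonal.1 hq, pow_add]
    ring
  have hpot : ∑ i, ∑ j ∈ Finset.Ioi i,
      ((periods τ).weierstrassP ((x i - x j : ℝ) : ℂ) + 2 * etaConst τ) =
      -4 * Real.pi ^ 2 * ∑' n, p ^ n * U n + (pairs N).card * potConst p := by
    rw [Finset.sum_sigma' Finset.univ (fun i => Finset.Ioi i) fun i j =>
      ((periods τ).weierstrassP ((x i - x j : ℝ) : ℂ) + 2 * etaConst τ)]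
    have e1 : ∑' n, p ^ n * U n =
        ∑ q ∈ pairs N, ∑' n, p ^ n * potCoeff (x q.1 - x q.2) n := by
      rw [← Summable.tsum_finsetSum fun q _ => summable_potCoeff _ hp1]
      exact tsum_congr fun n => Finset.mul_sum _ _ _
    rw [e1, Finset.mul_sum, ← nsmul_eq_mul, ← Finset.sum_const, ← Finset.sum_add_distrib]
    refine Finset.sum_congr rfl fun q hq => ?_
    exact weierstrassP_add_eta τ (hx _ _ (mem_pairs.1 hq).ne)
  rw [ellipticH, h.laplacian_genFun hp, hpot, eigenvalue, genFun]
  change 2 * (Real.pi : ℂ) ^ 2 * ∑' n, p ^ n * D n + _ * (∑' n, p ^ n * W n) = _ * ∑' n, p ^ n * W n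
  have h2 : ∑' n, p ^ n * D n = 2 * k * (k - 1) * ((∑' n, p ^ n * U n) * ∑' n, p ^ n * W n) +
      (∑' n, p ^ n * ε n) * ∑' n, p ^ n * W n := by
    rw [hcauchy U hsU, hcauchy ε hsε, ← tsum_mul_left, ← Summable.tsum_add
      ((hsAW U hsU).mul_left _) (hsAW ε hsε)]
    refine tsum_congr fun n => ?_
    rw [← hformal]
    ring
  rw [h2, hl]
  push_cast
  ring

end CalogeroMoser

end

/-! ### Fourier orthogonality on the torus and the factor `Δ`. -/

noncomputable section

namespace CalogeroMoser

variable {N k : ℕ} {m : ℤ}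

lemma expI_sum {ι : Type*} (s : Finset ι) (a : ι → ℝ) : expI (∑ i ∈ s, a i) = ∏ i ∈ s, expI (a i) := by
  simp only [expI]
  rw [← Complex.exp_sum]
  push_cast
  rw [Finset.mul_sum]

lemma conj_mul_expI (x : ℝ) : starRingEnd ℂ (expI x) * expI x = 1 := by
  rw [← Complex.normSq_eq_conj_mul_self, Complex.normSq_eq_norm_sq, norm_expI]
  simp

lemma integral_expI (n : ℤ) :
    ∫ x in Set.Icc (0 : ℝ) 1, expI (n * x) = if n = 0 then 1 else 0 := by
  rw [MeasureTheory.integral_Icc_eq_integral_Ioc, ← intervalIntegral.integral_of_le zero_le_one]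
  split_ifs with hn
  · subst hn
    simp [expI]
  · have hc : (2 * Real.pi * Complex.I * n : ℂ) ≠ 0 :=
      mul_ne_zero Complex.two_pi_I_ne_zero (Int.cast_ne_zero.2 hn)
    have h1 := integral_exp_mul_complex (a := 0) (b := 1) hc
    have h2 : Complex.exp (2 * Real.pi * Complex.I * n) = 1 :=
      Complex.exp_eq_one_iff.2 ⟨n, by ring⟩
    rw [Complex.ofReal_one, mul_one, h2, Complex.ofReal_zero, mul_zero, Complex.exp_zero, sub_self,
      zero_div] at h1
    rw [← h1]
    refine intervalIntegral.integral_congr fun x _ => ?_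
    simp only [expI]
    congr 1
    push_cast
    ring

lemma evalAt_mono_eq_prod (x : Fin N → ℝ) (nu : Fin N → ℤ) :
    evalAt x (mono nu) = ∏ i, expI (nu i * x i) := by
  rw [evalAt_mono, ← expI_sum]
  rfl

lemma integral_evalAt_mono (nu : Fin N → ℤ) :
    ∫ x in Set.Icc (0 : Fin N → ℝ) 1, evalAt x (mono nu) = if nu = 0 then 1 else 0 := by
  have e : Set.Icc (0 : Fin N → ℝ) 1 = Set.univ.pi fun _ => Set.Icc (0 : ℝ) 1 :=
    (Set.pi_univ_Icc _ _).symm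
  rw [e, MeasureTheory.volume_pi, MeasureTheory.Measure.restrict_pi_pi]
  simp only [evalAt_mono_eq_prod]
  rw [MeasureTheory.integral_fintype_prod_eq_prod (fun i t => expI (nu i * t))]
  simp only [integral_expI]
  rw [Finset.prod_ite_zero]
  simp only [Finset.prod_const_one, Finset.mem_univ, true_imp_iff, funext_iff, Pi.zero_apply]

lemma conj_evalAt_mono (x : Fin N → ℝ) (nu : Fin N → ℤ) :
    starRingEnd ℂ (evalAt x (mono nu)) = evalAt x (mono (-nu)) := by
  rw [evalAt_mono, evalAt_mono, ← Complex.exp_conj]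
  congr 1
  simp only [map_mul, Complex.conj_ofReal, Complex.conj_I, map_ofNat, Pi.neg_apply, Int.cast_neg,
    neg_mul, Finset.sum_neg_distrib, Complex.ofReal_neg, mul_neg]

lemma continuous_wave (c : ℝ) (f : Laurent N) : Continuous (wave c f) :=
  (contDiff_wave (n := 0) c f).continuous

lemma wave_zero_eq (f : Laurent N) (x : Fin N → ℝ) : wave 0 f x = evalAt x f := by
  simp [wave, expI]

lemma continuous_evalAt (f : Laurent N) : Continuous fun x => evalAt x f :=
  (continuous_wave 0 f).congr fun x => wave_zero_eq f x

/-- Waves on the torus are orthogonal: the integral over the unit cube is the inner product of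
coefficients. -/
lemma integral_conj_wave_mul (c : ℝ) (f g : Laurent N) :
    ∫ x in Set.Icc (0 : Fin N → ℝ) 1, starRingEnd ℂ (wave c f x) * wave c g x = inner ℂ f g := by
  have e : ∀ x, starRingEnd ℂ (wave c f x) * wave c g x =
      ∑ nu ∈ g.coeff.support, ∑ mu ∈ f.coeff.support,
        (starRingEnd ℂ (f.coeff mu) * g.coeff nu) * evalAt x (mono (nu - mu)) := by
    intro x
    have h1 : starRingEnd ℂ (wave c f x) * wave c g x =
        starRingEnd ℂ (evalAt x f) * evalAt x g := by
      rw [wave, wave, map_mul]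
      linear_combination (starRingEnd ℂ (evalAt x f) * evalAt x g) * conj_mul_expI (c * ∑ i, x i)
    rw [h1]
    conv_lhs => rw [laurent_eq_sum f, laurent_eq_sum g]
    rw [map_sum, map_sum, map_sum, Finset.mul_sum]
    refine Finset.sum_congr rfl fun nu _ => ?_
    rw [Finset.sum_mul]
    refine Finset.sum_congr rfl fun mu _ => ?_
    rw [map_smul (evalAt x), map_smul (evalAt x), smul_eq_mul, smul_eq_mul, map_mul (starRingEnd ℂ),
      conj_evalAt_mono, sub_eq_add_neg,
      ← mono_mul, map_mul]
    ring
  have hint : ∀ (a : ℂ) (nu : Fin N → ℤ), MeasureTheory.Integrable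
      (fun x => a * evalAt x (mono nu))
      (MeasureTheory.volume.restrict (Set.Icc (0 : Fin N → ℝ) 1)) := fun a nu =>
    ((continuous_const.mul (continuous_evalAt _)).continuousOn).integrableOn_compact isCompact_Icc
  simp only [e]
  rw [MeasureTheory.integral_finsetSum _ fun nu _ =>
    MeasureTheory.integrable_finsetSum _ fun mu _ => hint _ _, inner_eq,
    coeffInner_eq_sum f g subset_rfl]
  refine Finset.sum_congr rfl fun nu _ => ?_
  rw [MeasureTheory.integral_finsetSum _ fun mu _ => hint _ _]
  simp only [MeasureTheory.integral_const_mul, integral_evalAt_mono, sub_eq_zero]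
  rw [Finset.sum_eq_single nu]
  · rw [if_pos rfl, mul_one]
  · intro mu _ h
    rw [if_neg (Ne.symm h), mul_zero]
  · intro h
    rw [Finsupp.notMem_support_iff.1 h]
    simp

lemma exists_evalAt_ne_zero {f : Laurent N} (hf : f ≠ 0) : ∃ x, evalAt x f ≠ 0 := by
  by_contra! h
  have h1 := integral_conj_wave_mul 0 f f
  simp only [wave_zero_eq, h, mul_zero, MeasureTheory.integral_zero] at h1
  exact hf (inner_self_eq_zero.1 h1.symm)

lemma evalAt_vdm (x : Fin N → ℝ) :
    evalAt x vdm = ∏ i, ∏ j ∈ Finset.Ioi i, (expI (x i) - expI (x j)) := by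
  simp only [vdm_eq, map_prod, map_sub, evalAt_X_eq]

lemma mem_regularSet_of_evalAt_vdm_ne_zero {x : Fin N → ℝ} (h : evalAt x vdm ≠ 0) :
    x ∈ regularSet N := by
  have key : ∀ i j : Fin N, i < j → ∀ n : ℤ, x i - x j ≠ n := by
    intro i j hij n hn
    apply h
    rw [evalAt_vdm, Finset.prod_eq_zero (Finset.mem_univ i)]
    rw [Finset.prod_eq_zero (Finset.mem_Ioi.2 hij)]
    rw [sub_eq_iff_eq_add.1 hn, expI_add, (expI_eq_one_iff _).2 ⟨n, rfl⟩, one_mul, sub_self]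
  intro i j hij n hn
  rcases lt_or_gt_of_ne hij with h1 | h1
  · exact key i j h1 n hn
  · refine key j i h1 (-n) ?_
    push_cast
    linarith

/-- A point where `vdm * f` does not vanish is automatically free of collisions; such a point exists
because Laurent polynomials form a domain and are determined by their values on the torus. -/
lemma exists_mem_regularSet_wave_ne_zero (c : ℝ) {f : Laurent N} (hf : f ≠ 0) :
    ∃ x ∈ regularSet N, wave c f x ≠ 0 := by
  obtain ⟨x, hx⟩ := exists_evalAt_ne_zero (mul_ne_zero (vdm_ne_zero (N := N)) hf)
  rw [map_mul] at hx
  exact ⟨x, mem_regularSet_of_evalAt_vdm_ne_zero (left_ne_zero_of_mul hx),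
    mul_ne_zero (expI_ne_zero _) (right_ne_zero_of_mul hx)⟩

lemma delta_eq (x : Fin N → ℝ) : delta x = expI ((1 - N) / 2 * ∑ i, x i) * evalAt x vdm := by
  rw [delta, evalAt_vdm, expI]
  congr 2
  push_cast
  ring

/-- The monomial prefactor of `Δ ^ k` is a common shift of all exponents by `k(1 - N)/2`. -/
lemma delta_pow_mul_wave (k : ℕ) (a : ℝ) (f : Laurent N) (x : Fin N → ℝ) :
    delta x ^ k * wave a f x = wave (a + k * ((1 - N) / 2)) (vdm ^ k * f) x := by
  have h : expI ((a + k * ((1 - N) / 2)) * ∑ i, x i) =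
      expI ((1 - N) / 2 * ∑ i, x i) ^ k * expI (a * ∑ i, x i) := by
    have h2 := expI_zsmul k ((1 - N) / 2 * ∑ i, x i)
    rw [zpow_natCast] at h2
    rw [← h2, ← expI_add]
    congr 1
    push_cast
    ring
  rw [wave, wave, h, delta_eq, map_mul, map_pow]
  ring

lemma jackInner_wave (k : ℕ) (a : ℝ) (f g : Laurent N) :
    jackInner k (wave a f) (wave a g) =
      1 / (N.factorial : ℂ) * inner ℂ (vdm ^ k * f) (vdm ^ k * g) := by
  simp only [jackInner, delta_pow_mul_wave]
  rw [integral_conj_wave_mul]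

end CalogeroMoser

end

/-! ### Dominant weights, Jack polynomials, exchange symmetry and quasi-periodicity. -/

noncomputable section

namespace CalogeroMoser

variable {N k : ℕ} {m : ℤ}

/-- The real exponent `nu + a (1, …, 1)`. -/
def realExp (a : ℝ) (nu : Fin N → ℤ) (i : Fin N) : ℝ := nu i + a

lemma realExp_injective (a : ℝ) : Function.Injective (realExp a : (Fin N → ℤ) → Fin N → ℝ) := by
  intro u v h
  funext i
  have := congrFun h i
  simpa [realExp] using this

lemma expMonomial_realExp (a : ℝ) (nu : Fin N → ℤ) (x : Fin N → ℝ) :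
    expMonomial (realExp a nu) x = wave a (mono nu) x := by
  rw [wave_mono, linForm_apply]
  rfl

lemma monomialSymm_realExp (a : ℝ) (w : Fin N → ℤ) :
    monomialSymm (realExp a w) = wave a (msymm w) := by
  classical
  funext x
  rw [monomialSymm, msymm, wave_sum]
  have e : (Finset.univ.image fun s : Equiv.Perm (Fin N) => fun i => realExp a w (s i)) =
      (Finset.univ.image fun s : Equiv.Perm (Fin N) => w ∘ s).image (realExp a) := by
    rw [Finset.image_image]
    rfl
  convert_to ∑ nu ∈ (Finset.univ.image fun s : Equiv.Perm (Fin N) => fun i => realExp a w (s i)),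
    expMonomial nu x = ∑ nu ∈ (Finset.univ.image fun s : Equiv.Perm (Fin N) => w ∘ s),
    wave a (mono nu) x
  rw [e, Finset.sum_image fun u _ v _ h => realExp_injective a h]
  exact Finset.sum_congr rfl fun nu _ => expMonomial_realExp a nu x

lemma sum_realExp (a : ℝ) (nu : Fin N → ℤ) :
    ∑ i, realExp a nu i = ((∑ i, nu i : ℤ) : ℝ) + N * a := by
  simp [realExp, Finset.sum_add_distrib]

lemma sum_Iic_realExp (a : ℝ) (nu : Fin N → ℤ) (j : Fin N) :
    ∑ i ∈ Finset.Iic j, realExp a nu i = (psum j nu : ℝ) + (Finset.Iic j).card * a := by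
  simp [realExp, Finset.sum_add_distrib, psum_apply]

/-- Subtracting the first entry `a` from all entries makes a dominant weight integral; the vanishing
of the coordinate sum becomes `m + N a = 0`. -/
lemma IsDominantWeight.exists_dom [NeZero N] {lam : Fin N → ℝ} (h : IsDominantWeight lam) :
    ∃ (a : ℝ) (m : ℤ) (z : Dom N m), lam = realExp a z.1 ∧ (m : ℝ) + N * a = 0 := by
  choose n hn using fun i => h.2 0 i (Fin.zero_le i)
  have h1 : lam = realExp (lam 0) fun i => -(n i : ℤ) := by
    funext i
    simp only [realExp]
    push_cast
    linarith [hn i]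
  refine ⟨lam 0, ∑ i, -(n i : ℤ), ⟨fun i => -(n i : ℤ), ?_, rfl⟩, h1, ?_⟩
  · intro i j hij
    obtain ⟨d, hd⟩ := h.2 i j hij
    have h2 : (n j : ℝ) = n i + d := by linarith [hn i, hn j]
    have h3 : n j = n i + d := by exact_mod_cast h2
    simp only
    omega
  · rw [← sum_realExp, ← h1, h.1]

lemma isDominantWeight_realExp {a : ℝ} (ha : (m : ℝ) + N * a = 0) (w : Dom N m) :
    IsDominantWeight (realExp a w.1) := by
  refine ⟨by rw [sum_realExp, w.sum_eq, ha], fun i j hij => ⟨(w.1 i - w.1 j).toNat, ?_⟩⟩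
  have h1 : ((w.1 i - w.1 j).toNat : ℤ) = w.1 i - w.1 j :=
    Int.toNat_of_nonneg (sub_nonneg.2 (w.anti hij))
  have h2 : (((w.1 i - w.1 j).toNat : ℤ) : ℝ) = ((w.1 i - w.1 j : ℤ) : ℝ) := congrArg _ h1
  simp only [realExp]
  push_cast at h2 ⊢
  linarith

lemma dominanceLT_realExp {a : ℝ} (ha : (m : ℝ) + N * a = 0) {w z : Dom N m} (h : w.lt z) :
    DominanceLT (realExp a w.1) (realExp a z.1) := by
  refine ⟨isDominantWeight_realExp ha w, isDominantWeight_realExp ha z,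
    fun e => h.1 (realExp_injective a e), fun i => ⟨z.1 i - w.1 i, ?_⟩, fun j => ?_⟩
  · simp only [realExp]
    push_cast
    ring
  · rw [sum_Iic_realExp, sum_Iic_realExp]
    have := h.2 j
    have h2 : (psum j w.1 : ℝ) ≤ psum j z.1 := by exact_mod_cast this
    linarith

lemma DominanceLT.exists_dom {a : ℝ} {z : Dom N m} {mu : Fin N → ℝ}
    (h : DominanceLT mu (realExp a z.1)) : ∃ w : Dom N m, w.lt z ∧ mu = realExp a w.1 := by
  obtain ⟨h1, h2, h3, h4, h5⟩ := h
  choose n hn using h4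
  have e : mu = realExp a fun i => z.1 i - n i := by
    funext i
    have := hn i
    simp only [realExp] at this ⊢
    push_cast
    linarith
  have hs : ∑ i, (z.1 i - n i) = m := by
    have e1 := h1.1
    have e2 := h2.1
    rw [e, sum_realExp] at e1
    rw [sum_realExp, z.sum_eq] at e2
    have e3 : ((∑ i, (z.1 i - n i) : ℤ) : ℝ) = m := by linarith
    exact_mod_cast e3
  refine ⟨⟨fun i => z.1 i - n i, fun i j hij => ?_, hs⟩, ⟨fun h => h3 ?_, fun j => ?_⟩, e⟩
  · obtain ⟨d, hd⟩ := h1.2 i j hij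
    rw [e] at hd
    simp only [realExp] at hd
    have hd' : ((z.1 i - n i : ℤ) : ℝ) - ((z.1 j - n j : ℤ) : ℝ) = d := by linarith
    have hd2 : (z.1 i - n i) - (z.1 j - n j) = (d : ℤ) := by exact_mod_cast hd'
    simp only
    omega
  · rw [e]
    exact congrArg _ h
  · have := h5 j
    rw [e, sum_Iic_realExp, sum_Iic_realExp] at this
    have h6 : (psum j (fun i => z.1 i - n i) : ℝ) ≤ psum j z.1 := by linarith
    exact_mod_cast h6

/-- The Jack polynomial, with the wave it gives rise to. -/
theorem exists_isJackPolynomial [NeZero N] (k : ℕ) {a : ℝ} (ha : (m : ℝ) + N * a = 0) (z : Dom N m) :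
    ∃ J, IsJackPolynomial k (realExp a z.1) J ∧
      ∀ x, delta x ^ k * J x = wave (a + k * ((1 - N) / 2)) (eigVec k z : Laurent N) x := by
  let L : Laurent N →ₗ[ℂ] Laurent N := LinearMap.mulLeft ℂ (vdm ^ k)
  have h1 : (eigVec k z : Laurent N) - vdm ^ k * msymm z.1 ∈
      (Submodule.span ℂ ((fun w : Dom N m => msymm w.1) '' {w | w.lt z})).map L := by
    have h2 := Submodule.mem_map_of_mem (f := (vSpace N k m).subtype)
      (gramVec_sub_mem (b := stateVec k) (r := Dom.lt) Dom.finite_lt z)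
    rw [lowerSpan, Submodule.map_span, Set.image_image] at h2
    rw [Submodule.map_span, Set.image_image]
    exact h2
  -- The Gram-Schmidt vector is `vdm ^ k` times `msymm z + Q`, with `Q` in the span of the lower
  -- monomial symmetric polynomials. Its orthogonality is that of the Jack polynomial, because the
  -- weight `Δ ^ k` is built into the states.
  obtain ⟨Q, hQ, hQ2⟩ := h1
  have hQ3 : vdm ^ k * (msymm z.1 + Q) = (eigVec k z : Laurent N) := by
    have : vdm ^ k * Q = (eigVec k z : Laurent N) - vdm ^ k * msymm z.1 := hQ2
    rw [mul_add, this]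
    ring
  refine ⟨wave a (msymm z.1 + Q), ⟨?_, ?_⟩, fun x => by rw [delta_pow_mul_wave, hQ3]⟩
  · have h3 : wave a (msymm z.1 + Q) - monomialSymm (realExp a z.1) = waveLin a Q := by
      funext x
      rw [monomialSymm_realExp, Pi.sub_apply, wave_add, add_sub_cancel_left]
      rfl
    rw [h3]
    have h4 := Submodule.mem_map_of_mem (f := waveLin a) hQ
    rw [Submodule.map_span, Set.image_image] at h4
    refine Submodule.span_mono ?_ h4
    rintro _ ⟨w, hw, rfl⟩
    exact ⟨realExp a w.1, dominanceLT_realExp ha hw, monomialSymm_realExp a w.1⟩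
  · intro mu hmu
    obtain ⟨w, hw, rfl⟩ := hmu.exists_dom
    rw [monomialSymm_realExp, jackInner_wave, hQ3]
    have h5 : stateVec k w ∈ lowerSpan (stateVec k) Dom.lt z :=
      Submodule.subset_span ⟨w, hw, rfl⟩
    have h6 : inner ℂ (vdm ^ k * msymm w.1) (eigVec k z : Laurent N) = 0 :=
      inner_gramVec Dom.finite_lt h5
    rw [h6, mul_zero]

lemma wave_perm (c : ℝ) (f : vSpace N k m) (s : Equiv.Perm (Fin N)) (x : Fin N → ℝ) :
    wave c (f : Laurent N) (fun i => x (s i)) =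
      ((Equiv.Perm.sign s : ℤ) : ℂ) ^ k * wave c (f : Laurent N) x := by
  rw [wave, Equiv.sum_comp s x, ← evalAt_permAct, permAct_coe_vSpace, map_smul, smul_eq_mul, wave]
  ring

lemma evalAt_add_single (x : Fin N → ℝ) (i : Fin N) (f : Laurent N) :
    evalAt (x + Pi.single i 1) f = evalAt x f := by
  induction f using laurent_induction with
  | hadd f g hf hg => rw [map_add, map_add, hf, hg]
  | hsmul r f hf => rw [map_smul, map_smul, hf]
  | hm nu =>
    have e : ∑ j, (nu j : ℝ) * (x + Pi.single i (1 : ℝ) : Fin N → ℝ) j = ∑ j, (nu j : ℝ) * x j + nu i := by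
      simp [mul_add, Finset.sum_add_distrib, Pi.single_apply]
    rw [evalAt_mono, evalAt_mono, e]
    change expI _ = expI _
    rw [expI_add, (expI_eq_one_iff (nu i)).2 ⟨_, rfl⟩, mul_one]

lemma wave_add_single (c : ℝ) (f : Laurent N) (x : Fin N → ℝ) (i : Fin N) :
    wave c f (x + Pi.single i 1) = expI c * wave c f x := by
  have e : c * ∑ j, (x + Pi.single i (1 : ℝ) : Fin N → ℝ) j = c + c * ∑ j, x j := by
    simp [Finset.sum_add_distrib]
    ring
  rw [wave, evalAt_add_single, e, expI_add, wave, mul_assoc]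

lemma expI_half : expI (1 / 2) = -1 := by
  rw [expI, ← Complex.exp_pi_mul_I]
  congr 1
  push_cast
  ring

/-- Integral parts of the exponent do not affect the phase, and `k(N - 1)` halves give the sign. -/
lemma expI_shift [NeZero N] (k : ℕ) (a : ℝ) (nu : Fin N → ℤ) (i : Fin N) :
    expI (a + k * ((1 - N) / 2)) = (-1) ^ ((N - 1) * k) * expI (realExp a nu i) := by
  have h1 : a + k * ((1 - N) / 2) =
      ((-((N - 1 : ℕ) * k : ℕ) : ℤ) : ℝ) * (1 / 2) + (realExp a nu i + ((-nu i : ℤ) : ℝ)) := by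
    rw [realExp]
    push_cast [Nat.cast_sub (NeZero.one_le : 1 ≤ N)]
    ring
  rw [h1, expI_add, expI_add, expI_zsmul, expI_half, (expI_eq_one_iff ((-nu i : ℤ) : ℝ)).2 ⟨_, rfl⟩,
    mul_one, zpow_neg, zpow_natCast]
  congr 1
  rw [← inv_pow]
  norm_num

lemma inSector_genFun [NeZero N] {l : ℕ} (hl : k = l + 1) (a : ℝ) (nu : Fin N → ℤ)
    (F : ℕ → vSpace N k m) (p : ℂ) :
    InSector l (realExp a nu) (genFun (a + k * ((1 - N) / 2)) F p) where
  perm s x := by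
    rw [genFun, genFun, ← tsum_mul_left, ← hl]
    refine tsum_congr fun n => ?_
    rw [wave_perm]
    ring
  translate i x := by
    rw [genFun, genFun, ← tsum_mul_left, ← hl]
    refine tsum_congr fun n => ?_
    rw [wave_add_single, expI_shift k a nu i, expI]
    ring

/-- With this shift the quasi-momenta are `λ_i + k (N + 1 - 2i) / 2` for `i = 1, …, N`. The cross
terms give the linear part of the Jack energy, and the sum of `((N + 1 - 2i) / 2)²`, equal to `N(N²
- 1)/12`, gives the ground state energy. -/
lemma sum_quasiMom_sq (hN : N = 2 ∨ N = 3) {l : ℕ} (hl : k = l + 1) {a : ℝ}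
    (ha : (m : ℝ) + N * a = 0) (z : Dom N m) :
    2 * Real.pi ^ 2 * ∑ i, quasiMom (a + k * ((1 - N) / 2)) k z i ^ 2 =
      2 * Real.pi ^ 2 * jackEnergy k (realExp a z.1) + groundEnergy N l := by
  have hs := (isDominantWeight_realExp ha z).1
  subst hl
  rcases hN with rfl | rfl
  · simp only [jackEnergy, groundEnergy, quasiMom, Fin.sum_univ_two, realExp] at hs ⊢
    push_cast
    simp only [Fin.val_zero, Fin.val_one, Nat.cast_zero, Nat.cast_one]
    ring
  · simp only [jackEnergy, groundEnergy, quasiMom, Fin.sum_univ_three, realExp] at hs ⊢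
    push_cast
    simp only [Fin.val_zero, Fin.val_one, Fin.val_two, Nat.cast_zero, Nat.cast_one, Nat.cast_ofNat]
    ring

end CalogeroMoser

end

/-! ### Limits as `p → 0` and the eigenstates. -/

noncomputable section

namespace CalogeroMoser

variable {N k : ℕ} {m : ℤ}

namespace ConvergentFamily

variable {c : ℝ} {F : ℕ → vSpace N k m} {M : ℕ → ℝ} {s : ℝ}

lemma norm_genFun_sub_le (h : ConvergentFamily c F M s) {p : ℂ} (hp : ‖p‖ ≤ s) (x : Fin N → ℝ) :
    ‖genFun c F p x - wave c (F 0 : Laurent N) x‖ ≤ ‖p‖ * (s⁻¹ * ∑' n, M n * s ^ n) :=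
  norm_tsum_pow_sub_le h.pos (fun n => h.le n x) h.summable hp

lemma norm_genFun_le (h : ConvergentFamily c F M s) {p : ℂ} (hp : ‖p‖ ≤ s) (x : Fin N → ℝ) :
    ‖genFun c F p x‖ ≤ ∑' n, M n * s ^ n :=
  tsum_of_norm_bounded h.summable.hasSum fun n => norm_pow_mul_le hp (h.le n x)

lemma tendstoUniformly_genFun (h : ConvergentFamily c F M s) :
    TendstoUniformly (genFun c F) (wave c (F 0 : Laurent N)) (nhds 0) := by
  rw [Metric.tendstoUniformly_iff]
  intro e he
  have h1 : Filter.Tendsto (fun p : ℂ => ‖p‖ * (s⁻¹ * ∑' n, M n * s ^ n)) (nhds 0) (nhds 0) := by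
    have : Filter.Tendsto (fun p : ℂ => ‖p‖) (nhds 0) (nhds 0) := tendsto_norm_zero
    simpa using this.mul_const (s⁻¹ * ∑' n, M n * s ^ n)
  filter_upwards [h1.eventually (gt_mem_nhds he), Metric.closedBall_mem_nhds (0 : ℂ) h.pos]
    with p hp hp2 x
  rw [dist_comm, dist_eq_norm]
  exact (h.norm_genFun_sub_le (by simpa using hp2) x).trans_lt hp

lemma memLp_genFun (h : ConvergentFamily c F M s) {p : ℂ} (hp : ‖p‖ ≤ s) :
    MeasureTheory.MemLp (genFun c F p) 2
      (MeasureTheory.volume.restrict (Set.Icc (0 : Fin N → ℝ) 1)) := by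
  have : MeasureTheory.IsFiniteMeasure
      (MeasureTheory.volume.restrict (Set.Icc (0 : Fin N → ℝ) 1)) :=
    ⟨by rw [MeasureTheory.Measure.restrict_apply_univ]; exact isCompact_Icc.measure_lt_top⟩
  exact MeasureTheory.MemLp.of_bound (h.contDiff_genFun hp).continuous.aestronglyMeasurable _
    (Filter.Eventually.of_forall fun x => h.norm_genFun_le hp x)

end ConvergentFamily

lemma tendsto_eigenvalue {ε : ℕ → ℂ} {s : ℝ} (hs : 0 < s)
    (hε : Summable fun n => ‖ε n‖ * s ^ n) :
    Filter.Tendsto (eigenvalue N k ε) (nhds 0) (nhds (2 * Real.pi ^ 2 * ε 0)) := by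
  have h1 := ((tendsto_tsum_pow hs (fun n => le_rfl) hε).const_mul (2 * (Real.pi : ℂ) ^ 2)).add
    (tendsto_potConst.const_mul ((k : ℂ) * (k - 1) * (pairs N).card))
  rw [mul_zero, add_zero] at h1
  exact h1

/-- The perturbative construction of eigenstates of the elliptic Hamiltonian out of the
trigonometric ones. -/
theorem exists_eigenstates [NeZero N] (hN : N = 2 ∨ N = 3) {l : ℕ} (hl : k = l + 1) (hk : 2 ≤ k)
    (c : ℝ) (z : Dom N m) :
    ∃ (F : ℕ → vSpace N k m) (ε : ℕ → ℂ) (r : ℝ), 0 < r ∧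
      (∀ τ : UpperHalfPlane, ‖pParam τ‖ < r →
        IsEigenstate l τ (eigenvalue N k ε (pParam τ)) (genFun c F (pParam τ))) ∧
      Filter.Tendsto (eigenvalue N k ε) (nhds 0)
        (nhds (2 * Real.pi ^ 2 * ((∑ i, quasiMom c k z i ^ 2 : ℝ) : ℂ))) ∧
      TendstoUniformly (genFun c F) (wave c (eigVec k z : Laurent N)) (nhds 0) := by
  obtain ⟨F, ε, t, ht, -, hF0, hε0, hF, heq, hsF, hsε⟩ := exists_formal_eigenstate hN c hk z
  obtain ⟨M, s, hs, hst, h1, h2, h3, h4, h5⟩ := exists_majorant c hF ht hsF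
  have h : ConvergentFamily c F M s := ⟨hs, h1, h2, h3, h4, h5⟩
  have hsε' : Summable fun n => ‖ε n‖ * s ^ n :=
    Summable.of_nonneg_of_le (fun n => by positivity)
      (fun n => mul_le_mul_of_nonneg_left (pow_le_pow_left₀ hs.le hst n) (norm_nonneg _)) hsε
  have hU := h.tendstoUniformly_genFun
  -- The limit function is nonzero at some regular point, so by convergence there the perturbed
  -- function is nonzero at the same point for small `p`.
  obtain ⟨x, hx, hx0⟩ := exists_mem_regularSet_wave_ne_zero c
    (f := (eigVec k z : Laurent N)) fun h0 => eigVec_ne_zero z (Subtype.ext h0)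
  rw [hF0] at hU
  obtain ⟨r, hr, hr2⟩ := Metric.eventually_nhds_iff.1
    ((hU.tendsto_at x).eventually_ne hx0)
  refine ⟨F, ε, min r s, lt_min hr hs, fun τ hτ => ?_, hε0 ▸ tendsto_eigenvalue hs hsε', hU⟩
  have hp : ‖pParam τ‖ ≤ s := (hτ.trans_le (min_le_right _ _)).le
  exact ⟨(h.contDiff_genFun hp).contDiffOn,
    fun y hy => h.ellipticH_genFun hN hl hk hsε' heq τ hp hy,
    ⟨x, hx, hr2 (by simpa using hτ.trans_le (min_le_left _ _))⟩, h.memLp_genFun hp⟩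

end CalogeroMoser

end

theorem corollary3p8 (N l : ℕ) (hNl : (N = 2 ∧ 1 ≤ l) ∨ (N = 3 ∧ l = 1))
    (lam : Fin N → ℝ) (hlam : CalogeroMoser.IsDominantWeight lam) :
    ∃ J : (Fin N → ℝ) → ℂ, CalogeroMoser.IsJackPolynomial (l + 1) lam J ∧
      ∃ ε : ℝ, 0 < ε ∧
      ∃ (E : ℂ → ℂ) (F : ℂ → (Fin N → ℝ) → ℂ),
        (∀ τ : UpperHalfPlane, ‖CalogeroMoser.pParam τ‖ < ε →
          CalogeroMoser.IsEigenstate l τ (E (CalogeroMoser.pParam τ)) (F (CalogeroMoser.pParam τ)) ∧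
          CalogeroMoser.InSector l lam (F (CalogeroMoser.pParam τ))) ∧
        Filter.Tendsto E (nhdsWithin 0 {0}ᶜ)
          (nhds ((2 * Real.pi ^ 2 * CalogeroMoser.jackEnergy (l + 1) lam +
            CalogeroMoser.groundEnergy N l : ℝ) : ℂ)) ∧
        TendstoUniformly F (fun x => CalogeroMoser.delta x ^ (l + 1) * J x)
          (nhdsWithin 0 {0}ᶜ) := by
  have hN : N = 2 ∨ N = 3 := hNl.imp And.left And.left
  have hk : 2 ≤ l + 1 := by omega
  have : NeZero N := ⟨by omega⟩
  obtain ⟨a, m, z, rfl, ha⟩ := hlam.exists_dom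
  obtain ⟨J, hJ, hJ2⟩ := CalogeroMoser.exists_isJackPolynomial (l + 1) ha z
  -- The common shift of the exponents combines `a`, which makes `λ` integral, with the shift coming
  -- from the prefactor of `Δ ^ (l + 1)`.
  obtain ⟨F, ε, r, hr, h1, h2, h3⟩ := CalogeroMoser.exists_eigenstates hN rfl hk
    (a + ((l + 1 : ℕ) : ℝ) * ((1 - N) / 2)) z
  refine ⟨J, hJ, r, hr, CalogeroMoser.eigenvalue N (l + 1) ε, CalogeroMoser.genFun _ F,
    fun τ hτ => ⟨h1 τ hτ, CalogeroMoser.inSector_genFun rfl a z.1 F _⟩, ?_, ?_⟩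
  · rw [← CalogeroMoser.sum_quasiMom_sq hN rfl ha z]
    push_cast at h2 ⊢
    exact h2.mono_left nhdsWithin_le_nhds
  · rw [funext hJ2]
    exact fun u hu => (h3 u hu).filter_mono nhdsWithin_le_nhds
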